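/- Setting. Let $\Gamma=\Gamma_1\cup\dots\cup\Gamma_\ell\subset\mathbb C$ be a bounded oriented contour, where $\Gamma_i=M_i([-1,1])$ for a Möbius transformation $M_i$ without pole on $[-1,1]$, $\Gamma_i$ is oriented from $M_i(-1)$ to $M_i(1)$, and distinct $\Gamma_i,\Gamma_j$ meet at most at endpoints. Functions on $\Gamma$ are $\mathbb C^{2\times2}$-valued (Frobenius norm) and are given by their restrictions to the components, with a separate value on each component at common endpoints; $C(\Gamma)$ is the space of functions that are continuous on each closed component, with the uniform norm. $L^2(\Gamma)$ is taken with respect to arc length, $D$ is the distributional derivative on the open components, $\|f\|_{H^k(\Gamma)}^2=\sum_{j\le k}\|D^jf\|_{L^2(\Gamma)}^2$ for integers $k\ge0$, and $W^{1,\infty}(\Gamma)$ is defined likewise with $L^\infty$. $H^1_z(\Gamma)\subset H^1(\Gamma)$ consists of the $f$ such that, at each point $a$ that is an endpoint of some component, the sum of the values $f|_{\Gamma_i}(a)$ over components ending at $a$ equals the sum over components starting at $a$. Let $\mathcal C_\Gamma^-u$ be the non-tangential boundary value from the right of $\frac1{2\pi i}\int_\Gamma\frac{u(s)}{s-z}\,ds$,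 and $$\mathcal T[G;\Gamma]u=(\mathcal C_\Gamma^-u)(G-I),\qquad \mathcal C[G;\Gamma]u=u-\mathcal T[G;\Gamma]u .$$ For $n\ge2$ let $\mathcal I_n$ replace a function that is continuous on each component (for $u\in H^1(\Gamma)$, its continuous representative) on each $\Gamma_i$ by $p_i\circ M_i^{-1}$, where $p_i$ is the polynomial of degree less than $n$ interpolating $f\circ M_i$ at the Chebyshev points $\cos\bigl(\pi(1-\tfrac j{n-1})\bigr)$, $0\le j\le n-1$. Put $\mathcal C_n[G;\Gamma]=\mathcal I_n\mathcal C[G;\Gamma]$, $\mathcal T_n[G;\Gamma]=\mathcal I_n\mathcal T[G;\Gamma]$, $X_n=\mathcal I_n(H^1_z(\Gamma))$ and $Y_n=\mathcal I_n\bigl(\mathcal C[G;\Gamma]H^1_z(\Gamma)\bigr)$; elements of $X_n$ and $Y_n$ and all values of $\mathcal I_n$ are measured in $L^2(\Gamma)$, unless another norm is indicated. Statement. $\mathcal C_\Gamma^-$ is bounded on $L^2(\Gamma)$, $X_n\subset H^1_z(\Gamma)$ for $n\ge 2$, and for $G\in W^{1,\infty}(\Gamma)$ both $\mathcal T[G;\Gamma]$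 and $\mathcal C[G;\Gamma]$ map $H^1_z(\Gamma)$ into $H^1(\Gamma)$. Moreover there are a constant $C$ depending only on $\Gamma$, and for each integer $s\ge1$ a constant $C_s$ depending only on $s$ and $\Gamma$, such that for all $n\ge2$ and all $G\in W^{1,\infty}(\Gamma)$: 1. $\|\mathcal I_n\|_{\mathcal L(C(\Gamma),L^2(\Gamma))}\le C$. 2. $\|\mathcal C_n[G;\Gamma]\|_{\mathcal L(H^1_z(\Gamma),Y_n)}\le C\bigl(1+\|G-I\|_{L^\infty(\Gamma)}\|\mathcal C_\Gamma^-\|_{\mathcal L(L^2(\Gamma))}\bigr)$, where $H^1_z(\Gamma)$ has the $H^1(\Gamma)$ norm. 3. $\|\mathcal I_n\mathcal T[G;\Gamma]u\|_{L^2(\Gamma)}\le Cn^2\|G-I\|_{L^\infty(\Gamma)}\|\mathcal C_\Gamma^-\|_{\mathcal L(L^2(\Gamma))}\|u\|_{L^2(\Gamma)}$ for all $u\in X_n$; that is, $\|\mathcal T_n[G;\Gamma]\|\le Cn^2\|G-I\|_{L^\infty(\Gamma)}\|\mathcal C_\Gamma^-\|_{\mathcal L(L^2(\Gamma))}$ on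 $X_n$. 4. $\|\mathcal I_nu-u\|_{H^1(\Gamma)}\le C_sn^{2-s}\|u\|_{H^s(\Gamma)}$ for all $u\in H^s(\Gamma)$. Finally, let $\mathcal G\subset W^{1,\infty}(\Gamma)$ be any class of jump matrices and $\beta\in\mathbb R$. Assume that there is a constant $C'$ such that for each $G\in\mathcal G$ for which $\mathcal C[G;\Gamma]$ has a bounded inverse on $L^2(\Gamma)$ there is an $N$ such that for all $n>N$ the operator $\mathcal C_n[G;\Gamma]:X_n\to Y_n$ is invertible and $$\|\mathcal C_n[G;\Gamma]^{-1}\|_{\mathcal L(Y_n,X_n)}\le C'n^\beta\|\mathcal C[G;\Gamma]^{-1}\|_{\mathcal L(L^2(\Gamma))}.$$ Then the method $(\mathcal I_n,\mathcal I_n)$ is of type $(0,\beta,2)$ on $\mathcal G$: there are constants $C_1,C_2,C_3$ such that for each $G\in\mathcal G$ for which $\mathcal C[G;\Gamma]$ has a bounded inverse on $L^2(\Gamma)$ there is an $N$ such that for all $n>N$ the operator $\mathcal C_n[G;\Gamma]:X_n\to Y_n$ is invertible and - $\|\mathcal C_n[G;\Gamma]\|_{\mathcal L(H^1_z(\Gamma),Y_n)}\le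 C_1\bigl(1+\|G-I\|_{L^\infty(\Gamma)}\|\mathcal C_\Gamma^-\|_{\mathcal L(L^2(\Gamma))}\bigr)$, - $\|\mathcal C_n[G;\Gamma]^{-1}\|_{\mathcal L(Y_n,X_n)}\le C_2n^{\beta}\|\mathcal C[G;\Gamma]^{-1}\|_{\mathcal L(L^2(\Gamma))}$, - $\|\mathcal I_n\mathcal T[G;\Gamma]u\|_{L^2(\Gamma)}\le C_3n^{2}\|G-I\|_{L^\infty(\Gamma)}\|\mathcal C_\Gamma^-\|_{\mathcal L(L^2(\Gamma))}\|u\|_{L^2(\Gamma)}$ for all $u\in X_n$. -/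

import Mathlib

open Set Filter Topology MeasureTheory
open scoped ENNReal NNReal ContDiff Matrix.Norms.Frobenius

noncomputable section

/-- A Möbius transformation `z ↦ (a z + b) / (c z + d)`. -/
structure Mobius where
  a : ℂ
  b : ℂ
  c : ℂ
  d : ℂ
  det_ne_zero : a * d - b * c ≠ 0

namespace Mobius

/-- The value of the transformation at a finite point that is not its pole. -/
def map (M : Mobius) (z : ℂ) : ℂ := (M.a * z + M.b) / (M.c * z + M.d)

/-- The complex derivative of the transformation. -/
def der (M : Mobius) (z : ℂ) : ℂ := (M.a * M.d - M.b * M.c) / (M.c * z + M.d) ^ 2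

theorem hasDerivAt_map (M : Mobius) (z : ℂ) (hz : M.c * z + M.d ≠ 0) :
    HasDerivAt M.map (M.der z) z := by
  have h1 : HasDerivAt (fun w : ℂ => M.a * w + M.b) M.a z := by
    simpa using ((hasDerivAt_id z).const_mul M.a).add_const M.b
  have h2 : HasDerivAt (fun w : ℂ => M.c * w + M.d) M.c z := by
    simpa using ((hasDerivAt_id z).const_mul M.c).add_const M.d
  have h := h1.div h2 hz
  refine h.congr_deriv ?_
  unfold der
  congr 1
  ring

end Mobius

/-- A bounded oriented contour `Γ = Γ₁ ∪ ⋯ ∪ Γ_ℓ`: each component is the image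
`Γᵢ = Mᵢ([-1,1])` of the unit interval under a Möbius transformation without pole on `[-1,1]`,
oriented from `Mᵢ(-1)` to `Mᵢ(1)`, and distinct components meet at most at endpoints. -/
structure MobiusContour (ℓ : ℕ) where
  M : Fin ℓ → Mobius
  no_pole : ∀ i, ∀ t ∈ Icc (-1 : ℝ) 1, (M i).c * (t : ℂ) + (M i).d ≠ 0
  meet_at_endpoints : ∀ i j, i ≠ j → ∀ s ∈ Icc (-1 : ℝ) 1, ∀ t ∈ Icc (-1 : ℝ) 1,
    (M i).map s = (M j).map t → (s = -1 ∨ s = 1) ∧ (t = -1 ∨ t = 1)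

/-- A function on the contour with values in the complex `2 × 2` matrices (normed by the Frobenius
norm), given by its restrictions to the components in the coordinate `t ∈ [-1,1]`: `f i t` is the
value of `f|_{Γᵢ}` at `Mᵢ(t)`.  At a point where several components meet, every component carries
its own value.  Only the values for `t ∈ [-1,1]` are relevant. -/
abbrev ArcFun (ℓ : ℕ) : Type := Fin ℓ → ℝ → Matrix (Fin 2) (Fin 2) ℂ

/-- Lebesgue measure on the parameter interval `[-1,1]`. -/
abbrev paramMeasure : Measure ℝ := volume.restrict (Icc (-1 : ℝ) 1)

/-- Equality almost everywhere on the contour. -/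
def AEEqArc {ℓ : ℕ} (f g : ArcFun ℓ) : Prop := ∀ i, f i =ᵐ[paramMeasure] g i

/-- Continuity on each (closed) component. -/
def IsContArc {ℓ : ℕ} (f : ArcFun ℓ) : Prop := ∀ i, ContinuousOn (f i) (Icc (-1 : ℝ) 1)

/-- The uniform norm. -/
def supNorm {ℓ : ℕ} (f : ArcFun ℓ) : ℝ≥0∞ := ⨆ i, ⨆ t ∈ Icc (-1 : ℝ) 1, ‖f i t‖ₑ

/-- The norm of `L^∞(Γ)`. -/
def linfNorm {ℓ : ℕ} (f : ArcFun ℓ) : ℝ≥0∞ := ⨆ i, eLpNorm (f i) ⊤ paramMeasure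

/-- Membership in `L^∞(Γ)`. -/
def MemLinf {ℓ : ℕ} (f : ArcFun ℓ) : Prop := ∀ i, MemLp (f i) ⊤ paramMeasure

open Classical in
/-- The continuous representative, on each component on which there is one. -/
def contRep {ℓ : ℕ} (f : ArcFun ℓ) : ArcFun ℓ := fun i =>
  if h : ∃ g : ℝ → Matrix (Fin 2) (Fin 2) ℂ,
      ContinuousOn g (Icc (-1 : ℝ) 1) ∧ f i =ᵐ[paramMeasure] g
  then h.choose else f i

/-- Continuous functions on `[-1,1]` that agree almost everywhere agree everywhere. -/
theorem eqOn_of_ae_eq {g h : ℝ → Matrix (Fin 2) (Fin 2) ℂ}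
    (hg : ContinuousOn g (Icc (-1 : ℝ) 1)) (hh : ContinuousOn h (Icc (-1 : ℝ) 1))
    (hgh : g =ᵐ[paramMeasure] h) : EqOn g h (Icc (-1 : ℝ) 1) :=
  Measure.eqOn_Icc_of_ae_eq volume (by norm_num) hgh hg hh

/-- The continuous representative is determined on `[-1,1]`. -/
theorem contRep_eqOn {ℓ : ℕ} {f g : ArcFun ℓ} (hg : IsContArc g) (hfg : AEEqArc f g) (i : Fin ℓ) :
    EqOn (contRep f i) (g i) (Icc (-1 : ℝ) 1) := by
  have h : ∃ g : ℝ → Matrix (Fin 2) (Fin 2) ℂ,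
      ContinuousOn g (Icc (-1 : ℝ) 1) ∧ f i =ᵐ[paramMeasure] g := ⟨g i, hg i, hfg i⟩
  have e : contRep f i = h.choose := dif_pos h
  rw [e]
  exact eqOn_of_ae_eq h.choose_spec.1 (hg i) (h.choose_spec.2.symm.trans (hfg i))

/-- The Chebyshev points of the second kind, `x_j = cos (π (1 - j / (n - 1)))` for
`j = 0, …, n - 1` (meaningful for `n ≥ 2`). -/
def chebPoint (n : ℕ) (j : Fin n) : ℝ :=
  Real.cos (Real.pi * (1 - (j : ℝ) / ((n : ℝ) - 1)))

/-- The interpolation operator `𝓘ₙ`: on each component the (continuous) function is replaced by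
its interpolant at the mapped Chebyshev points `Mᵢ(x_j)` by a polynomial of degree less than `n` in
the coordinate `t = Mᵢ⁻¹(z)`, that is, by a combination of the mapped Chebyshev polynomials
`T_k(Mᵢ⁻¹(z))`, `k < n`. -/
def chebInterp {ℓ : ℕ} (n : ℕ) (f : ArcFun ℓ) : ArcFun ℓ := fun i t =>
  ∑ j : Fin n, (Lagrange.basis Finset.univ (chebPoint n) j).eval t • contRep f i (chebPoint n j)

/-- The norm of a linear map `T` on the domain `dom`: the least `K` such that
`‖T u‖ ≤ K ‖u‖` for all `u` in the domain. -/
def opNorm {ℓ : ℕ} (dom : Set (ArcFun ℓ)) (normDom normCod : ArcFun ℓ → ℝ≥0∞)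
    (T : ArcFun ℓ → ArcFun ℓ) : ℝ≥0∞ :=
  sInf {K : ℝ≥0∞ | ∀ u ∈ dom, normCod (T u) ≤ K * normDom u}

/-- The norm of the inverse of a linear bijection `T` from `dom` onto its image: the least `K`
such that `‖u‖ ≤ K ‖T u‖` for all `u` in the domain. -/
def invNorm {ℓ : ℕ} (dom : Set (ArcFun ℓ)) (nrm : ArcFun ℓ → ℝ≥0∞)
    (T : ArcFun ℓ → ArcFun ℓ) : ℝ≥0∞ :=
  sInf {K : ℝ≥0∞ | ∀ u ∈ dom, nrm u ≤ K * nrm (T u)}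

namespace MobiusContour

variable {ℓ : ℕ} (Γ : MobiusContour ℓ)

/-- The norm of `L²(Γ)` with respect to arc length `|dk| = |Mᵢ'(t)| dt`. -/
def l2Norm (f : ArcFun ℓ) : ℝ≥0∞ :=
  (∑ i, ∫⁻ t in Icc (-1 : ℝ) 1, ‖f i t‖ₑ ^ 2 * ‖(Γ.M i).der t‖ₑ) ^ (1 / 2 : ℝ)

/-- Membership in `L²(Γ)`. -/
def MemL2 (f : ArcFun ℓ) : Prop :=
  (∀ i, AEStronglyMeasurable (f i) paramMeasure) ∧ Γ.l2Norm f < ⊤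

/-- `g = D f`, the distributional derivative `d/dk` on the components.  In the coordinate `t` one
has `dk = Mᵢ'(t) dt`, and a test function `φ` on `Γᵢ`, with `ψ = φ ∘ Mᵢ`, has `φ' dk = ψ' dt`. -/
def IsWeakDeriv (f g : ArcFun ℓ) : Prop :=
  ∀ i, ∀ ψ : ℝ → ℝ, ContDiff ℝ ∞ ψ → HasCompactSupport ψ → tsupport ψ ⊆ Ioo (-1 : ℝ) 1 →
    ∫ t in Icc (-1 : ℝ) 1, deriv ψ t • f i t
      = -∫ t in Icc (-1 : ℝ) 1, ψ t • ((Γ.M i).der t • g i t)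

/-- `g j = D^j f ∈ L²(Γ)` for `j = 0, …, k`. -/
def IsDerivChain (k : ℕ) (f : ArcFun ℓ) (g : ℕ → ArcFun ℓ) : Prop :=
  g 0 = f ∧ (∀ j ≤ k, Γ.MemL2 (g j)) ∧ ∀ j < k, Γ.IsWeakDeriv (g j) (g (j + 1))

/-- Membership in `H^k(Γ)`. -/
def MemH (k : ℕ) (f : ArcFun ℓ) : Prop := ∃ g, Γ.IsDerivChain k f g

/-- The norm of `H^k(Γ)`: `(∑_{j ≤ k} ‖D^j f‖²)^{1/2}`.  The derivatives are unique up to null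
sets, so the infimum runs over equal numbers; it is `∞` outside `H^k(Γ)`. -/
def hNorm (k : ℕ) (f : ArcFun ℓ) : ℝ≥0∞ :=
  ⨅ (g : ℕ → ArcFun ℓ) (_ : Γ.IsDerivChain k f g),
    (∑ j ∈ Finset.range (k + 1), Γ.l2Norm (g j) ^ 2) ^ (1 / 2 : ℝ)

/-- Membership in `W^{1,∞}(Γ)`. -/
def MemW1inf (f : ArcFun ℓ) : Prop :=
  MemLinf f ∧ ∃ g, MemLinf g ∧ Γ.IsWeakDeriv f g

/-- The zeroth-order zero-sum condition: at each point `a`, the values at `a` along the components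
that end in `a` minus the values along the components that start in `a` sum to zero.  At an
endpoint of only one component this says that `f` vanishes there. -/
def ZeroSum (f : ArcFun ℓ) : Prop :=
  ∀ a : ℂ, ∑ i, ((if (Γ.M i).map 1 = a then contRep f i 1 else 0)
    - (if (Γ.M i).map (-1) = a then contRep f i (-1) else 0)) = 0

/-- The space `H¹_z(Γ)`. -/
def Hz : Set (ArcFun ℓ) := {u | Γ.MemH 1 u ∧ Γ.ZeroSum u}

/-- The Cauchy integral `(1 / 2πi) ∫_Γ u(s) / (s - z) ds`. -/
def cauchy (u : ArcFun ℓ) (z : ℂ) : Matrix (Fin 2) (Fin 2) ℂ :=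
  (1 / (2 * (Real.pi : ℂ) * Complex.I)) •
    ∑ i, ∫ t in Icc (-1 : ℝ) 1, ((Γ.M i).der t / ((Γ.M i).map t - z)) • u i t

/-- Non-tangential approach to the point `Mᵢ(t)` from the right of `Γᵢ`: a limit along this filter
is a common limit in all the sectors `|z - Mᵢ(t)| ≤ K · dist`, where `dist > 0` is the distance of
`z` from the tangent line, on its right side. -/
def rightApproach (i : Fin ℓ) (t : ℝ) : Filter ℂ :=
  ⨆ K : ℕ, 𝓝[{z : ℂ | z ≠ (Γ.M i).map t ∧ ‖z - (Γ.M i).map t‖ ≤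
    K * -((z - (Γ.M i).map t) / ((Γ.M i).der t / (‖(Γ.M i).der t‖ : ℂ))).im}] ((Γ.M i).map t)

/-- The boundary value `𝓒⁻_Γ u` of the Cauchy integral from the right. -/
def cauchyMinus (u : ArcFun ℓ) : ArcFun ℓ := fun i t =>
  limUnder (Γ.rightApproach i t) (Γ.cauchy u)

/-- The operator norm of `𝓒⁻_Γ` on `L²(Γ)`. -/
def cauchyMinusNorm : ℝ≥0∞ := opNorm {u | Γ.MemL2 u} Γ.l2Norm Γ.l2Norm Γ.cauchyMinus

/-- `𝓣[G;Γ] u = 𝓒⁻_Γ u · (G - I)`. -/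
def opT (G u : ArcFun ℓ) : ArcFun ℓ := fun i t => Γ.cauchyMinus u i t * (G i t - 1)

/-- `𝓒[G;Γ] u = u - 𝓒⁻_Γ u · (G - I)`. -/
def opC (G u : ArcFun ℓ) : ArcFun ℓ := u - Γ.opT G u

/-- `‖G - I‖_{L^∞(Γ)} ‖𝓒⁻_Γ‖_{𝓛(L²(Γ))}`. -/
def gc (G : ArcFun ℓ) : ℝ≥0∞ := linfNorm (fun i t => G i t - 1) * Γ.cauchyMinusNorm

/-- `𝓒[G;Γ]` is invertible on `L²(Γ)` with bounded inverse. -/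
def InvertibleL2 (G : ArcFun ℓ) : Prop :=
  (∀ u, Γ.MemL2 u → Γ.MemL2 (Γ.opC G u)) ∧
  (∀ f, Γ.MemL2 f → ∃ u, Γ.MemL2 u ∧ AEEqArc (Γ.opC G u) f) ∧
  invNorm {u | Γ.MemL2 u} Γ.l2Norm (Γ.opC G) < ⊤

/-- A sequence of projections on functions on the contour. -/
abbrev Proj (ℓ : ℕ) : Type := ℕ → ArcFun ℓ → ArcFun ℓ

/-- `𝓒ₙ[G;Γ] = 𝓘ₙ 𝓒[G;Γ]`. -/
def opCn (I : Proj ℓ) (G : ArcFun ℓ) (n : ℕ) (u : ArcFun ℓ) : ArcFun ℓ := I n (Γ.opC G u)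

/-- `𝓣ₙ[G;Γ] = 𝓘ₙ 𝓣[G;Γ]`. -/
def opTn (I : Proj ℓ) (G : ArcFun ℓ) (n : ℕ) (u : ArcFun ℓ) : ArcFun ℓ := I n (Γ.opT G u)

/-- `Xₙ`, the range of `𝓟ₙ` on `H¹_z(Γ)`. -/
def Xn (P : Proj ℓ) (n : ℕ) : Set (ArcFun ℓ) := P n '' Γ.Hz

/-- `Yₙ`, the range of `𝓘ₙ` on the image of `H¹_z(Γ)` under `𝓒[G;Γ]`. -/
def Yn (I : Proj ℓ) (G : ArcFun ℓ) (n : ℕ) : Set (ArcFun ℓ) := I n '' (Γ.opC G '' Γ.Hz)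

/-- `𝓒ₙ[G;Γ] : Xₙ → Yₙ` is invertible, with
`‖𝓒ₙ[G;Γ]⁻¹‖_{𝓛(Yₙ,Xₙ)} ≤ C n^β ‖𝓒[G;Γ]⁻¹‖_{𝓛(L²(Γ))}`. -/
def InverseBoundAt (I P : Proj ℓ) (β : ℝ) (C : ℝ≥0) (G : ArcFun ℓ) (n : ℕ) : Prop :=
  BijOn (Γ.opCn I G n) (Γ.Xn P n) (Γ.Yn I G n) ∧
  invNorm (Γ.Xn P n) Γ.l2Norm (Γ.opCn I G n)
    ≤ C * ENNReal.ofReal ((n : ℝ) ^ β) * invNorm {u | Γ.MemL2 u} Γ.l2Norm (Γ.opC G)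

/-- The assumption on the inverses, for the jump matrices in the class `𝒢`: the constant does not
depend on the jump matrix, the threshold `N` may. -/
def HasInverseBound (I P : Proj ℓ) (𝒢 : Set (ArcFun ℓ)) (β : ℝ) : Prop :=
  ∃ C : ℝ≥0, ∀ G ∈ 𝒢, Γ.InvertibleL2 G → ∃ N : ℕ, ∀ n > N, Γ.InverseBoundAt I P β C G n

/-- The method `(𝓘ₙ, 𝓟ₙ)` is of type `(α, β, γ)` for the jump matrices in the class `𝒢`; the
constants do not depend on the jump matrix. -/
def IsOfType (I P : Proj ℓ) (𝒢 : Set (ArcFun ℓ)) (α β γ : ℝ) : Prop :=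
  ∃ C₁ C₂ C₃ : ℝ≥0, ∀ G ∈ 𝒢, Γ.InvertibleL2 G → ∃ N : ℕ, ∀ n > N,
    opNorm Γ.Hz (Γ.hNorm 1) Γ.l2Norm (Γ.opCn I G n)
      ≤ C₁ * ENNReal.ofReal ((n : ℝ) ^ α) * (1 + Γ.gc G) ∧
    Γ.InverseBoundAt I P β C₂ G n ∧
    opNorm (Γ.Xn P n) Γ.l2Norm Γ.l2Norm (Γ.opTn I G n)
      ≤ C₃ * ENNReal.ofReal ((n : ℝ) ^ γ) * Γ.gc G

end MobiusContour

end

noncomputable section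

/-! ### Improper integrals of products of two simple fractions -/

/-! Boundedness of `𝓒⁻` on `L²`. In the coordinates of the arcs the difference `M(s) - M'(t)` is a
bilinear polynomial in `s` and `t` divided by two nonvanishing linear factors. An arc therefore acts
on itself through the Cauchy kernel of the real line, and on another arc through a kernel `1 / (A x
y + B x + C y + D)` that is singular at most at corners of the square. On the line no Fourier
transform is needed. The residue formula shows that the pairing of the Cauchy integrals at depths
`ε` and `δ` depends only on `ε + δ`. Hence their squared norm satisfies `A(δ)² ≤ 4π² ‖f‖² A(2δ)`;
iterating this against a crude bound gives `A(δ) ≤ 4π² ‖f‖²` (`lineCauchySq_le`), and midpoint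
convexity of `A` gives the limit in `L²`. Non-tangential limits exist almost everywhere because the
Cauchy integral is the Poisson integral of this limit (`ae_tendsto_lineCauchy`). The corners are
settled by Hilbert's inequality, or, for tangent arcs, by an inversion that turns the kernel into a
Cauchy kernel at a fixed depth (`isL2Kernel_bilinear`).

The bounds for `𝓒ₙ` and `𝓣ₙ`. On `H¹_z` the endpoint terms of an integration by parts cancel, so `D`
commutes with `𝓒⁻` (`exists_hasPrim_boundary`). The Sobolev inequality `|f|² ≤ (1 + c) ‖f‖² + c⁻¹
‖f'‖²`, applied to `𝓒⁻u`, then bounds it uniformly with a single factor `‖𝓒⁻‖`. Multiplication by `G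
- I` and the stability of `𝓘ₙ` from `C(Γ)` to `L²(Γ)` finish both bounds: `c = 1` serves for `𝓒ₙ` on
`H¹_z`, while on `Xₙ` a Markov inequality controls the derivative and `c = n⁴` gives the factor
`n²`. The type `(0, β, 2)` combines the two bounds with the assumed one.

Interpolation. With `t = cos θ` polynomials become cosine sums, and the Chebyshev points become
equidistant angles. Discrete orthogonality bounds the coefficients by the nodal values, which is the
stability, and bounds `∑ k² |a_k|²` by the differences of neighbouring nodal values, hence by
`‖f'‖²`. The latter controls the interpolant and its derivative. For the rate `n^(2-s)` a polynomial
whose derivative approximates that of `u` is subtracted first; interpolation reproduces it, so only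
a small remainder is interpolated. -/

theorem ofReal_sub_ne_zero {p : ℂ} (hp : p.im ≠ 0) (x : ℝ) : (x : ℂ) - p ≠ 0 := by
  intro h
  have := congrArg Complex.im h
  simp at this
  exact hp this

theorem norm_inv_ofReal_sub_sq {p : ℂ} (hp : p.im ≠ 0) (x : ℝ) :
    ‖((x : ℂ) - p)⁻¹‖ ^ 2 = (p.im ^ 2)⁻¹ * (1 + ((x - p.re) / p.im) ^ 2)⁻¹ := by
  rw [norm_inv, inv_pow, ← Complex.normSq_eq_norm_sq, Complex.normSq_apply, ← mul_inv]
  simp only [Complex.sub_re, Complex.ofReal_re, Complex.sub_im, Complex.ofReal_im]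
  congr 1
  field_simp
  ring

theorem continuous_inv_ofReal_sub {p : ℂ} (hp : p.im ≠ 0) :
    Continuous fun x : ℝ => ((x : ℂ) - p)⁻¹ :=
  (Complex.continuous_ofReal.sub continuous_const).inv₀ (ofReal_sub_ne_zero hp)

theorem integrable_norm_inv_ofReal_sub_sq {p : ℂ} (hp : p.im ≠ 0) :
    Integrable fun x : ℝ => ‖((x : ℂ) - p)⁻¹‖ ^ 2 := by
  simp_rw [norm_inv_ofReal_sub_sq hp]
  exact ((integrable_inv_one_add_sq.comp_div hp).comp_sub_right p.re).const_mul _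

theorem integral_norm_inv_ofReal_sub_sq {p : ℂ} (hp : p.im ≠ 0) :
    ∫ x : ℝ, ‖((x : ℂ) - p)⁻¹‖ ^ 2 = Real.pi / |p.im| := by
  simp_rw [norm_inv_ofReal_sub_sq hp]
  rw [integral_const_mul, integral_sub_right_eq_self (fun x : ℝ => (1 + (x / p.im) ^ 2)⁻¹) p.re,
    Measure.integral_comp_div (fun x : ℝ => (1 + x ^ 2)⁻¹) p.im, integral_univ_inv_one_add_sq,
    smul_eq_mul, ← sq_abs]
  have : |p.im| ≠ 0 := abs_ne_zero.2 hp
  field_simp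

theorem memLp_inv_ofReal_sub {p : ℂ} (hp : p.im ≠ 0) :
    MemLp (fun x : ℝ => ((x : ℂ) - p)⁻¹) 2 volume :=
  (memLp_two_iff_integrable_sq_norm (continuous_inv_ofReal_sub hp).aestronglyMeasurable).2
    (integrable_norm_inv_ofReal_sub_sq hp)

/-- A positive real factor can be pulled out of the principal logarithm: `log (x - p) = log x + log
(1 - p / x)`. -/
theorem tendsto_clog_ofReal_sub_atTop (p : ℂ) :
    Tendsto (fun x : ℝ => Complex.log (x - p) - Real.log x) atTop (𝓝 0) := by
  have h1 : Tendsto (fun x : ℝ => Complex.log (1 - p * (x : ℂ)⁻¹)) atTop (𝓝 (Complex.log 1)) := by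
    refine (continuousAt_clog (by simp)).tendsto.comp ?_
    have : Tendsto (fun x : ℝ => (x : ℂ)⁻¹) atTop (𝓝 0) := by
      simpa [Function.comp_def] using
        (Complex.continuous_ofReal.tendsto 0).comp tendsto_inv_atTop_zero
    simpa using (this.const_mul p).const_sub 1
  rw [Complex.log_one] at h1
  refine h1.congr' ?_
  filter_upwards [eventually_gt_atTop (0 : ℝ), eventually_gt_atTop ‖p‖] with x hx hxp
  have hne : (x : ℂ) ≠ 0 := by exact_mod_cast hx.ne'
  have e : (x : ℂ) - p = (x : ℝ) * (1 - p * (x : ℂ)⁻¹) := by field_simp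
  have hne' : (1 - p * (x : ℂ)⁻¹) ≠ 0 := by
    intro h
    rw [h, mul_zero, sub_eq_zero] at e
    rw [← e, Complex.norm_real, Real.norm_of_nonneg hx.le] at hxp
    exact lt_irrefl _ hxp
  rw [e, Complex.log_ofReal_mul hx hne']
  ring

theorem tendsto_neg_one_sub_mul_inv (p : ℂ) :
    Tendsto (fun x : ℝ => -1 - p * (x : ℂ)⁻¹) atTop (𝓝 (-1)) := by
  have : Tendsto (fun x : ℝ => (x : ℂ)⁻¹) atTop (𝓝 0) := by
    simpa [Function.comp_def] using
      (Complex.continuous_ofReal.tendsto 0).comp tendsto_inv_atTop_zero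
  simpa using (this.const_mul p).const_sub (-1)

theorem clog_neg_sub_eq {p : ℂ} (hp : p.im ≠ 0) {x : ℝ} (hx : 0 < x) :
    Complex.log (((-x : ℝ) : ℂ) - p) = Real.log x + Complex.log (-1 - p * (x : ℂ)⁻¹) := by
  have hne : (x : ℂ) ≠ 0 := by exact_mod_cast hx.ne'
  have e : ((-x : ℝ) : ℂ) - p = (x : ℝ) * (-1 - p * (x : ℂ)⁻¹) := by
    push_cast; field_simp
  have hne' : (-1 - p * (x : ℂ)⁻¹) ≠ 0 := by
    intro h
    rw [h, mul_zero] at e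
    exact ofReal_sub_ne_zero hp _ e
  rw [e, Complex.log_ofReal_mul hx hne']

theorem im_neg_one_sub_mul_inv (p : ℂ) (x : ℝ) : (-1 - p * (x : ℂ)⁻¹).im = -(p.im * x⁻¹) := by
  rw [← Complex.ofReal_inv]
  simp

/-- After the modulus is factored out, the argument tends to `-1` from the side of the branch cut
opposite to `p`. The jump `2πi` between this case and the case `p.im < 0` is the residue that all
later computations use. -/
theorem tendsto_clog_ofReal_sub_atBot_of_pos {p : ℂ} (hp : 0 < p.im) :
    Tendsto (fun x : ℝ => Complex.log (x - p) - Real.log (-x)) atBot (𝓝 (-(Real.pi * Complex.I))) := by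
  have h0 := Complex.tendsto_log_nhdsWithin_im_neg_of_re_neg_of_im_zero (z := -1) (by simp) (by simp)
  have h1 : Tendsto (fun x : ℝ => -1 - p * (x : ℂ)⁻¹) atTop (𝓝[{z : ℂ | z.im < 0}] (-1)) := by
    refine tendsto_nhdsWithin_iff.2 ⟨tendsto_neg_one_sub_mul_inv p, ?_⟩
    filter_upwards [eventually_gt_atTop (0 : ℝ)] with x hx
    simp only [im_neg_one_sub_mul_inv]
    have := mul_pos hp (inv_pos.2 hx)
    linarith
  have h2 := ((h0.comp h1).comp tendsto_neg_atBot_atTop)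
  simp only [norm_neg, norm_one, Real.log_one, Complex.ofReal_zero, zero_sub] at h2
  refine h2.congr' ?_
  filter_upwards [eventually_lt_atBot (0 : ℝ)] with x hx
  have := clog_neg_sub_eq hp.ne' (neg_pos.2 hx)
  rw [neg_neg] at this
  simp only [Function.comp_apply]
  rw [this]; ring

theorem tendsto_clog_ofReal_sub_atBot_of_neg {p : ℂ} (hp : p.im < 0) :
    Tendsto (fun x : ℝ => Complex.log (x - p) - Real.log (-x)) atBot (𝓝 (Real.pi * Complex.I)) := by
  have h0 := Complex.tendsto_log_nhdsWithin_im_nonneg_of_re_neg_of_im_zero (z := -1)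
    (by simp) (by simp)
  have h1 : Tendsto (fun x : ℝ => -1 - p * (x : ℂ)⁻¹) atTop (𝓝[{z : ℂ | 0 ≤ z.im}] (-1)) := by
    refine tendsto_nhdsWithin_iff.2 ⟨tendsto_neg_one_sub_mul_inv p, ?_⟩
    filter_upwards [eventually_gt_atTop (0 : ℝ)] with x hx
    simp only [im_neg_one_sub_mul_inv]
    have := mul_neg_of_neg_of_pos hp (inv_pos.2 hx)
    linarith
  have h2 := ((h0.comp h1).comp tendsto_neg_atBot_atTop)
  simp only [norm_neg, norm_one, Real.log_one, Complex.ofReal_zero, zero_add] at h2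
  refine h2.congr' ?_
  filter_upwards [eventually_lt_atBot (0 : ℝ)] with x hx
  have := clog_neg_sub_eq hp.ne (neg_pos.2 hx)
  rw [neg_neg] at this
  simp only [Function.comp_apply]
  rw [this]; ring

theorem integrable_inv_mul_inv {p q : ℂ} (hp : p.im ≠ 0) (hq : q.im ≠ 0) :
    Integrable fun x : ℝ => ((x : ℂ) - p)⁻¹ * ((x : ℂ) - q)⁻¹ :=
  MemLp.integrable_mul (memLp_inv_ofReal_sub hp) (memLp_inv_ofReal_sub hq)

/-- By partial fractions `(log (x - p) - log (x - q)) / (p - q)` is a primitive on the whole line,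
since `x - p` and `x - q` never meet the slit. It vanishes at `+∞`, so only its limit at `-∞`
contributes. -/
theorem integral_inv_mul_inv_aux {p q l : ℂ} (hp : p.im ≠ 0) (hq : q.im ≠ 0) (hpq : p ≠ q)
    (hl : Tendsto (fun x : ℝ => Complex.log (x - p) - Complex.log (x - q)) atBot (𝓝 l)) :
    ∫ x : ℝ, ((x : ℂ) - p)⁻¹ * ((x : ℂ) - q)⁻¹ = -l / (p - q) := by
  have hne : p - q ≠ 0 := sub_ne_zero.2 hpq
  have hslit : ∀ {r : ℂ}, r.im ≠ 0 → ∀ x : ℝ, (x : ℂ) - r ∈ Complex.slitPlane := fun {r} hr x =>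
    Or.inr (by simpa using hr)
  have hd : ∀ {r : ℂ}, r.im ≠ 0 → ∀ x : ℝ,
      HasDerivAt (fun x : ℝ => Complex.log (x - r)) (((x : ℂ) - r)⁻¹) x := fun {r} hr x => by
    have h1 : HasDerivAt (fun z : ℂ => Complex.log (z - r)) (((x : ℂ) - r)⁻¹) (x : ℂ) := by
      simpa using ((hasDerivAt_id (x : ℂ)).sub_const r).clog (hslit hr x)
    exact h1.comp_ofReal
  have htop : Tendsto (fun x : ℝ => (p - q)⁻¹ * (Complex.log (x - p) - Complex.log (x - q)))
      atTop (𝓝 0) := by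
    have := ((tendsto_clog_ofReal_sub_atTop p).sub (tendsto_clog_ofReal_sub_atTop q)).const_mul
      (p - q)⁻¹
    simpa using this
  have hbot := hl.const_mul (p - q)⁻¹
  have := integral_of_hasDerivAt_of_tendsto
    (f := fun x : ℝ => (p - q)⁻¹ * (Complex.log (x - p) - Complex.log (x - q)))
    (f' := fun x : ℝ => ((x : ℂ) - p)⁻¹ * ((x : ℂ) - q)⁻¹) (fun x => ?_)
    (integrable_inv_mul_inv hp hq) hbot htop
  · rw [this]; field_simp; ring
  · refine (((hd hp x).sub (hd hq x)).const_mul (p - q)⁻¹).congr_deriv ?_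
    have h1 := ofReal_sub_ne_zero hp x
    have h2 := ofReal_sub_ne_zero hq x
    field_simp
    ring

theorem integral_inv_mul_inv {p q : ℂ} (hp : 0 < p.im) (hq : q.im < 0) :
    ∫ x : ℝ, ((x : ℂ) - p)⁻¹ * ((x : ℂ) - q)⁻¹ = 2 * Real.pi * Complex.I / (p - q) := by
  have hpq : p ≠ q := fun h => by rw [h] at hp; exact lt_asymm hp hq
  have := (tendsto_clog_ofReal_sub_atBot_of_pos hp).sub (tendsto_clog_ofReal_sub_atBot_of_neg hq)
  rw [integral_inv_mul_inv_aux hp.ne' hq.ne hpq (this.congr fun x => by ring)]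
  ring

theorem integral_inv_mul_inv_of_pos {p q : ℂ} (hp : 0 < p.im) (hq : 0 < q.im) (hpq : p ≠ q) :
    ∫ x : ℝ, ((x : ℂ) - p)⁻¹ * ((x : ℂ) - q)⁻¹ = 0 := by
  have := (tendsto_clog_ofReal_sub_atBot_of_pos hp).sub (tendsto_clog_ofReal_sub_atBot_of_pos hq)
  rw [sub_self] at this
  rw [integral_inv_mul_inv_aux hp.ne' hq.ne' hpq (this.congr fun x => by ring)]
  simp

/-! ### The Cauchy integral over the real line -/

theorem sq_integral_norm_mul_le {α : Type*} [MeasurableSpace α] {μ : Measure α} {u v : α → ℂ}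
    (hu : MemLp u 2 μ) (hv : MemLp v 2 μ) :
    ‖∫ x, u x * v x ∂μ‖ ^ 2 ≤ (∫ x, ‖u x‖ ^ 2 ∂μ) * ∫ x, ‖v x‖ ^ 2 ∂μ := by
  have hpq : Real.HolderConjugate 2 2 := Real.HolderConjugate.two_two
  have h := integral_mul_norm_le_Lp_mul_Lq hpq (f := u) (g := v) (μ := μ)
    (by simpa using hu) (by simpa using hv)
  have h1 : ‖∫ x, u x * v x ∂μ‖ ≤ ∫ x, ‖u x‖ * ‖v x‖ ∂μ := by
    simpa using norm_integral_le_integral_norm (μ := μ) fun x => u x * v x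
  have h2 : 0 ≤ ∫ x, ‖u x‖ ^ 2 ∂μ := integral_nonneg fun x => by positivity
  have h3 : 0 ≤ ∫ x, ‖v x‖ ^ 2 ∂μ := integral_nonneg fun x => by positivity
  simp only [Real.rpow_ofNat] at h
  calc ‖∫ x, u x * v x ∂μ‖ ^ 2
      ≤ ((∫ x, ‖u x‖ ^ 2 ∂μ) ^ (1 / 2 : ℝ) * (∫ x, ‖v x‖ ^ 2 ∂μ) ^ (1 / 2 : ℝ)) ^ 2 := by
        gcongr; exact h1.trans h
    _ = _ := by
        rw [mul_pow, ← Real.sqrt_eq_rpow, ← Real.sqrt_eq_rpow, Real.sq_sqrt h2, Real.sq_sqrt h3]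

theorem sq_lintegral_mul_le {α : Type*} [MeasurableSpace α] {μ : Measure α} {u v : α → ℝ≥0∞}
    (hu : AEMeasurable u μ) (hv : AEMeasurable v μ) :
    (∫⁻ x, u x * v x ∂μ) ^ 2 ≤ (∫⁻ x, u x ^ 2 ∂μ) * ∫⁻ x, v x ^ 2 ∂μ := by
  have h := ENNReal.lintegral_mul_le_Lp_mul_Lq μ Real.HolderConjugate.two_two hu hv
  simp only [Pi.mul_apply, ENNReal.rpow_ofNat] at h
  calc _ ≤ ((∫⁻ x, u x ^ 2 ∂μ) ^ (1 / 2 : ℝ) * (∫⁻ x, v x ^ 2 ∂μ) ^ (1 / 2 : ℝ)) ^ 2 := by gcongr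
    _ = _ := by
        rw [mul_pow, ← ENNReal.rpow_natCast, ← ENNReal.rpow_natCast, ← ENNReal.rpow_mul,
          ← ENNReal.rpow_mul]
        norm_num

/-- The weighted Cauchy-Schwarz inequality. -/
theorem sq_lintegral_mul_le_weighted {α : Type*} [MeasurableSpace α] {μ : Measure α}
    {w k : α → ℝ≥0∞} (hw : AEMeasurable w μ) (hk : AEMeasurable k μ) :
    (∫⁻ x, w x * k x ∂μ) ^ 2 ≤ (∫⁻ x, w x ∂μ) * ∫⁻ x, w x * k x ^ 2 ∂μ := by
  have hsq : ∀ y : ℝ≥0∞, (y ^ (1 / 2 : ℝ)) ^ 2 = y := fun y => by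
    rw [← ENNReal.rpow_natCast, ← ENNReal.rpow_mul]; norm_num
  have h := sq_lintegral_mul_le (hw.pow_const (1 / 2 : ℝ)) ((hw.pow_const (1 / 2 : ℝ)).mul hk)
  simp only [Pi.mul_apply, ← mul_assoc, ← sq, mul_pow, hsq] at h
  exact h

/-- The Cauchy integral of a function on the real line. -/
def lineCauchy (f : ℝ → ℂ) (z : ℂ) : ℂ := ∫ s : ℝ, f s * ((s : ℂ) - z)⁻¹

theorem im_add_mul_I (x δ : ℝ) : ((x : ℂ) + δ * Complex.I).im = δ := by simp

theorem inv_sub_eq_neg (s x δ : ℝ) :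
    ((s : ℂ) - (x - δ * Complex.I))⁻¹ = -((x : ℂ) - (s + δ * Complex.I))⁻¹ := by
  rw [← inv_neg]; congr 1; ring

theorem norm_inv_ofReal_sub_le {p : ℂ} (hp : p.im ≠ 0) (x : ℝ) :
    ‖((x : ℂ) - p)⁻¹‖ ≤ |p.im|⁻¹ := by
  rw [norm_inv]
  have h : |p.im| ≤ ‖(x : ℂ) - p‖ := by
    have := Complex.abs_im_le_norm ((x : ℂ) - p)
    simpa using this
  exact inv_anti₀ (abs_pos.2 hp) h

theorem norm_inv_sub_le {δ : ℝ} (hδ : 0 < δ) (s x : ℝ) :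
    ‖((s : ℂ) - (x - δ * Complex.I))⁻¹‖ ≤ δ⁻¹ := by
  have := norm_inv_ofReal_sub_le (p := (x : ℂ) - δ * Complex.I) (by simpa using hδ.ne') s
  simpa [abs_of_pos hδ] using this

theorem continuous_uncurry_inv_sub {δ : ℝ} (hδ : 0 < δ) :
    Continuous fun p : ℝ × ℝ => ((p.2 : ℂ) - (p.1 - δ * Complex.I))⁻¹ := by
  refine Continuous.inv₀ (by fun_prop) fun p => ?_
  exact ofReal_sub_ne_zero (by simpa using hδ.ne') p.2

theorem continuous_lineCauchy {f : ℝ → ℂ} (hf : Integrable f) {δ : ℝ} (hδ : 0 < δ) :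
    Continuous fun x : ℝ => lineCauchy f (x - δ * Complex.I) := by
  refine continuous_of_dominated (bound := fun s => ‖f s‖ * δ⁻¹) (fun x => ?_) (fun x => ?_)
    (hf.norm.mul_const _) ?_
  · exact hf.aestronglyMeasurable.mul
      ((continuous_uncurry_inv_sub hδ).comp (Continuous.prodMk_right x)).aestronglyMeasurable
  · refine Eventually.of_forall fun s => ?_
    rw [norm_mul]
    gcongr
    exact norm_inv_sub_le hδ s x
  · refine Eventually.of_forall fun s => continuous_const.mul ?_
    exact (continuous_uncurry_inv_sub hδ).comp (Continuous.prodMk_left s)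

theorem lintegral_enorm_inv_sub_sq {δ : ℝ} (hδ : 0 < δ) (s : ℝ) :
    ∫⁻ x : ℝ, ‖((s : ℂ) - (x - δ * Complex.I))⁻¹‖ₑ ^ 2 = ENNReal.ofReal (Real.pi / δ) := by
  have hp : ((s : ℂ) + δ * Complex.I).im ≠ 0 := by simpa using hδ.ne'
  have h := integral_norm_inv_ofReal_sub_sq hp
  rw [im_add_mul_I, abs_of_pos hδ] at h
  rw [← h, ofReal_integral_eq_lintegral_ofReal (integrable_norm_inv_ofReal_sub_sq hp)
    (Eventually.of_forall fun x => by positivity)]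
  refine lintegral_congr fun x => ?_
  rw [inv_sub_eq_neg, enorm_neg, ENNReal.ofReal_pow (norm_nonneg _), ofReal_norm]

/-- Cauchy-Schwarz with respect to the weight `‖f‖`, then Tonelli. The bound degenerates as `δ → 0`;
it serves for a priori finiteness and to stop the iteration in `lineCauchySq_le`. -/
theorem lintegral_enorm_lineCauchy_sq_le {f : ℝ → ℂ} (hf : Integrable f) {δ : ℝ} (hδ : 0 < δ) :
    ∫⁻ x : ℝ, ‖lineCauchy f (x - δ * Complex.I)‖ₑ ^ 2
      ≤ (∫⁻ s, ‖f s‖ₑ) ^ 2 * ENNReal.ofReal (Real.pi / δ) := by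
  have hm : AEMeasurable (fun s => ‖f s‖ₑ) := hf.aestronglyMeasurable.enorm
  calc _ ≤ ∫⁻ x : ℝ, (∫⁻ s, ‖f s‖ₑ) *
          ∫⁻ s : ℝ, ‖f s‖ₑ * ‖((s : ℂ) - (x - δ * Complex.I))⁻¹‖ₑ ^ 2 := by
        refine lintegral_mono fun x => ?_
        refine le_trans ?_ (sq_lintegral_mul_le_weighted hm
          ((continuous_uncurry_inv_sub hδ).comp (Continuous.prodMk_right x)).enorm.aemeasurable)
        gcongr
        refine (enorm_integral_le_lintegral_enorm _).trans_eq ?_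
        simp [enorm_mul]
    _ = (∫⁻ s, ‖f s‖ₑ) * ∫⁻ s : ℝ, ∫⁻ x : ℝ,
          ‖f s‖ₑ * ‖((s : ℂ) - (x - δ * Complex.I))⁻¹‖ₑ ^ 2 := by
        rw [lintegral_const_mul' _ _ hf.2.ne, lintegral_lintegral_swap]
        exact (hf.aestronglyMeasurable.comp_snd.enorm).mul
          ((continuous_uncurry_inv_sub hδ).enorm.measurable.pow_const 2).aemeasurable
    _ = _ := by
        have : ∀ s : ℝ, ∫⁻ x : ℝ, ‖f s‖ₑ * ‖((s : ℂ) - (x - δ * Complex.I))⁻¹‖ₑ ^ 2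
            = ‖f s‖ₑ * ENNReal.ofReal (Real.pi / δ) := fun s => by
          rw [lintegral_const_mul' _ _ enorm_ne_top, lintegral_enorm_inv_sub_sq hδ]
        simp_rw [this]
        rw [lintegral_mul_const' _ _ ENNReal.ofReal_ne_top, sq, mul_assoc]

theorem lintegral_enorm_sq_eq {α : Type*} [MeasurableSpace α] {μ : Measure α} {f : α → ℂ}
    (hf : MemLp f 2 μ) : ∫⁻ x, ‖f x‖ₑ ^ 2 ∂μ = ENNReal.ofReal (∫ x, ‖f x‖ ^ 2 ∂μ) := by
  rw [ofReal_integral_eq_lintegral_ofReal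
    ((memLp_two_iff_integrable_sq_norm hf.1).1 hf) (Eventually.of_forall fun x => by positivity)]
  refine lintegral_congr fun x => ?_
  rw [ENNReal.ofReal_pow (norm_nonneg _), ofReal_norm]

theorem memLp_two_of_lintegral_lt_top {α : Type*} [MeasurableSpace α] {μ : Measure α} {f : α → ℂ}
    (hm : AEStronglyMeasurable f μ) (hf : ∫⁻ x, ‖f x‖ₑ ^ 2 ∂μ < ⊤) : MemLp f 2 μ := by
  refine (memLp_two_iff_integrable_sq_norm hm).2 ⟨(hm.norm.pow 2), ?_⟩
  refine lt_of_eq_of_lt (lintegral_congr fun x => ?_) hf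
  simp

theorem memLp_lineCauchy {f : ℝ → ℂ} (hf : Integrable f) {δ : ℝ} (hδ : 0 < δ) :
    MemLp (fun x : ℝ => lineCauchy f (x - δ * Complex.I)) 2 volume := by
  refine memLp_two_of_lintegral_lt_top (continuous_lineCauchy hf hδ).aestronglyMeasurable ?_
  refine (lintegral_enorm_lineCauchy_sq_le hf hδ).trans_lt ?_
  exact ENNReal.mul_lt_top (ENNReal.pow_lt_top hf.2) ENNReal.ofReal_lt_top

theorem integral_norm_lineCauchy_sq_le_div {f : ℝ → ℂ} (hf : Integrable f) {δ : ℝ} (hδ : 0 < δ) :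
    ∫ x : ℝ, ‖lineCauchy f (x - δ * Complex.I)‖ ^ 2 ≤ (∫ s, ‖f s‖) ^ 2 * (Real.pi / δ) := by
  have h := lintegral_enorm_lineCauchy_sq_le hf hδ
  rw [lintegral_enorm_sq_eq (memLp_lineCauchy hf hδ), ← ofReal_integral_norm_eq_lintegral_enorm hf,
    ← ENNReal.ofReal_pow (integral_nonneg fun _ => norm_nonneg _),
    ← ENNReal.ofReal_mul (by positivity)] at h
  have := Real.pi_pos
  exact (ENNReal.ofReal_le_ofReal_iff (by positivity)).1 h

/-- Fubini. The double integral converges because the `L²` norm in `x` of the kernel does not depend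
on `s`, and `|h| |k| ≤ |h|² + |k|²`. -/
theorem integral_lineCauchy_mul {f h : ℝ → ℂ} (hf : Integrable f) (hh : MemLp h 2 volume) {δ : ℝ}
    (hδ : 0 < δ) :
    ∫ x : ℝ, lineCauchy f (x - δ * Complex.I) * h x
      = ∫ s : ℝ, f s * ∫ x : ℝ, h x * ((s : ℂ) - (x - δ * Complex.I))⁻¹ := by
  have hk : ∀ s : ℝ, MemLp (fun x : ℝ => ((s : ℂ) - (x - δ * Complex.I))⁻¹) 2 volume := fun s => by
    simp_rw [inv_sub_eq_neg]
    exact (memLp_inv_ofReal_sub (by simpa using hδ.ne')).neg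
  have hki : ∀ s : ℝ, ∫ x : ℝ, ‖((s : ℂ) - (x - δ * Complex.I))⁻¹‖ ^ 2 = Real.pi / δ := fun s => by
    simp_rw [inv_sub_eq_neg, norm_neg]
    rw [integral_norm_inv_ofReal_sub_sq (by simpa using hδ.ne'), im_add_mul_I, abs_of_pos hδ]
  have hm : AEStronglyMeasurable (fun p : ℝ × ℝ =>
      f p.2 * (h p.1 * ((p.2 : ℂ) - (p.1 - δ * Complex.I))⁻¹)) (volume.prod volume) :=
    hf.1.comp_snd.mul (hh.1.comp_fst.mul (continuous_uncurry_inv_sub hδ).aestronglyMeasurable)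
  have hint : Integrable (fun p : ℝ × ℝ =>
      f p.2 * (h p.1 * ((p.2 : ℂ) - (p.1 - δ * Complex.I))⁻¹)) (volume.prod volume) := by
    refine (integrable_prod_iff' hm).2 ⟨?_, ?_⟩
    · exact Eventually.of_forall fun s => Integrable.const_mul (MemLp.integrable_mul hh (hk s)) (f s)
    · have hb : Integrable fun s : ℝ => ‖f s‖ * ((∫ x, ‖h x‖ ^ 2) + Real.pi / δ) :=
        hf.norm.mul_const _
      refine hb.mono' hm.norm.prod_swap.integral_prod_right' (Eventually.of_forall fun s => ?_)
      have hh2 := (memLp_two_iff_integrable_sq_norm hh.1).1 hh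
      have hk2 := (memLp_two_iff_integrable_sq_norm (hk s).1).1 (hk s)
      simp only [norm_mul]
      rw [integral_const_mul, norm_mul, norm_norm, Real.norm_of_nonneg
        (integral_nonneg fun x => by positivity), ← hki s, ← integral_add hh2 hk2]
      refine mul_le_mul_of_nonneg_left ?_ (norm_nonneg _)
      refine integral_mono_of_nonneg (Eventually.of_forall fun x => by positivity) (hh2.add hk2)
        (Eventually.of_forall fun x => ?_)
      nlinarith [sq_nonneg (‖h x‖ - ‖((s : ℂ) - (x - δ * Complex.I))⁻¹‖),
        sq_nonneg ‖h x‖, sq_nonneg ‖((s : ℂ) - (x - δ * Complex.I))⁻¹‖]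
  calc _ = ∫ x : ℝ, ∫ s : ℝ, f s * (h x * ((s : ℂ) - (x - δ * Complex.I))⁻¹) := by
        refine integral_congr_ae (Eventually.of_forall fun x => ?_)
        simp only [lineCauchy]
        rw [← integral_mul_const]
        exact integral_congr_ae (Eventually.of_forall fun s => by simp only; ring)
    _ = ∫ s : ℝ, ∫ x : ℝ, f s * (h x * ((s : ℂ) - (x - δ * Complex.I))⁻¹) :=
        integral_integral_swap hint
    _ = _ := by simp_rw [integral_const_mul]

-- Two applications of Fubini leave the integral over `x` of a product of two kernels with poles on
-- opposite sides. By `integral_inv_mul_inv` it is again a Cauchy kernel, at the sum of the depths.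
open ComplexConjugate in
theorem integral_lineCauchy_mul_conj {f : ℝ → ℂ} (hf : Integrable f) {ε δ : ℝ} (hε : 0 < ε)
    (hδ : 0 < δ) :
    ∫ x : ℝ, lineCauchy f (x - ε * Complex.I) * conj (lineCauchy f (x - δ * Complex.I))
      = -(2 * Real.pi * Complex.I) *
        ∫ s : ℝ, f s * conj (lineCauchy f (s - (ε + δ : ℝ) * Complex.I)) := by
  have hm := (memLp_lineCauchy hf hδ)
  have hmc : MemLp (fun x : ℝ => conj (lineCauchy f (x - δ * Complex.I))) 2 volume := hm.star
  rw [integral_lineCauchy_mul hf hmc hε, ← integral_const_mul]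
  refine integral_congr_ae (Eventually.of_forall fun s => ?_)
  have hq : (((s : ℂ) - ε * Complex.I)).im < 0 := by simpa using hε
  have key : ∫ x : ℝ, conj (lineCauchy f (x - δ * Complex.I)) * ((s : ℂ) - (x - ε * Complex.I))⁻¹
      = conj (∫ x : ℝ, lineCauchy f (x - δ * Complex.I) * -((x : ℂ) - (s - ε * Complex.I))⁻¹) := by
    rw [← integral_conj]
    refine integral_congr_ae (Eventually.of_forall fun x => ?_)
    simp only [map_mul, map_neg, map_inv₀, map_sub, Complex.conj_ofReal, Complex.conj_I]
    rw [inv_sub_eq_neg]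
    simp [sub_neg_eq_add]
  simp only
  have hneg : MemLp (fun x : ℝ => -((x : ℂ) - (s - ε * Complex.I))⁻¹) 2 volume :=
    (memLp_inv_ofReal_sub hq.ne).neg
  rw [key, integral_lineCauchy_mul hf hneg hδ]
  have key2 : ∀ r : ℝ, ∫ x : ℝ, -((x : ℂ) - (s - ε * Complex.I))⁻¹ *
      ((r : ℂ) - (x - δ * Complex.I))⁻¹
      = 2 * Real.pi * Complex.I * ((r : ℂ) - (s - (ε + δ : ℝ) * Complex.I))⁻¹ := fun r => by
    have hp : 0 < ((r : ℂ) + δ * Complex.I).im := by simpa using hδ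
    have := integral_inv_mul_inv hp hq
    rw [div_eq_mul_inv] at this
    have e : ∀ x : ℝ, -((x : ℂ) - (s - ε * Complex.I))⁻¹ * ((r : ℂ) - (x - δ * Complex.I))⁻¹
        = ((x : ℂ) - (r + δ * Complex.I))⁻¹ * ((x : ℂ) - (s - ε * Complex.I))⁻¹ := fun x => by
      rw [inv_sub_eq_neg r x δ]; ring
    rw [integral_congr_ae (Eventually.of_forall e), this]
    congr 2; push_cast; ring
  simp_rw [key2]
  have : ∫ r : ℝ, f r * (2 * Real.pi * Complex.I * ((r : ℂ) - (s - (ε + δ : ℝ) * Complex.I))⁻¹)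
      = 2 * Real.pi * Complex.I * lineCauchy f (s - (ε + δ : ℝ) * Complex.I) := by
    rw [lineCauchy, ← integral_const_mul]
    exact integral_congr_ae (Eventually.of_forall fun r => by simp only; ring)
  rw [this]
  simp only [map_mul, Complex.conj_I, Complex.conj_ofReal, map_ofNat]
  ring

/-- The squared `L²` norm of the Cauchy integral on the line at depth `δ`. -/
def lineCauchySq (f : ℝ → ℂ) (δ : ℝ) : ℝ := ∫ x : ℝ, ‖lineCauchy f (x - δ * Complex.I)‖ ^ 2

-- The previous formula depends on `ε + δ` alone, so both depths can be replaced by their mean,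
-- where the pairing is a squared norm.
open ComplexConjugate in
theorem integral_lineCauchy_mul_conj_eq {f : ℝ → ℂ} (hf : Integrable f) {ε δ : ℝ} (hε : 0 < ε)
    (hδ : 0 < δ) :
    ∫ x : ℝ, lineCauchy f (x - ε * Complex.I) * conj (lineCauchy f (x - δ * Complex.I))
      = (lineCauchySq f ((ε + δ) / 2) : ℂ) := by
  have h0 : 0 < (ε + δ) / 2 := by positivity
  rw [integral_lineCauchy_mul_conj hf hε hδ, ← add_halves (ε + δ),
    ← integral_lineCauchy_mul_conj hf h0 h0, lineCauchySq, ← integral_complex_ofReal, add_halves]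
  refine integral_congr_ae (Eventually.of_forall fun x => ?_)
  simp only [Complex.mul_conj, Complex.normSq_eq_norm_sq]

/-- The squared norm at depth `δ` equals, up to the factor `2π`, the pairing of `f` with its Cauchy
integral at depth `2δ`; Cauchy-Schwarz then gives a self-improving inequality. -/
theorem sq_lineCauchySq_le {f : ℝ → ℂ} (hf : Integrable f) (hf2 : MemLp f 2 volume) {δ : ℝ}
    (hδ : 0 < δ) :
    lineCauchySq f δ ^ 2 ≤ (4 * Real.pi ^ 2 * ∫ s, ‖f s‖ ^ 2) * lineCauchySq f (2 * δ) := by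
  have h := integral_lineCauchy_mul_conj_eq hf hδ hδ
  rw [add_self_div_two, integral_lineCauchy_mul_conj hf hδ hδ, ← two_mul] at h
  have h2 : 0 < 2 * δ := by positivity
  have hcs := sq_integral_norm_mul_le hf2 (memLp_lineCauchy hf h2).star
  have h3 := congrArg (fun z : ℂ => ‖z‖ ^ 2) h
  simp only [norm_mul, norm_neg, Complex.norm_real, Complex.norm_I, mul_pow, Real.norm_eq_abs,
    sq_abs, mul_one, Complex.norm_ofNat] at h3
  rw [← h3]
  simp only [Pi.star_apply, norm_star] at hcs
  calc _ ≤ 2 ^ 2 * Real.pi ^ 2 * ((∫ s, ‖f s‖ ^ 2) * lineCauchySq f (2 * δ)) := by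
        gcongr; exact hcs
    _ = _ := by ring

/-- If `b 0 > 1`, then `b k ≥ (b 0) ^ (2 ^ k)` is unbounded. -/
theorem le_one_of_sq_le_succ {b : ℕ → ℝ} {C : ℝ} (hb : ∀ k, b k ^ 2 ≤ b (k + 1))
    (hC : ∀ k, b k ≤ C) : b 0 ≤ 1 := by
  by_contra! h
  have h1 : ∀ k, b 0 ^ (2 ^ k) ≤ b k := by
    intro k
    induction k with
    | zero => simp
    | succ k ih =>
      rw [pow_succ, pow_mul]
      refine le_trans ?_ (hb k)
      have : 0 ≤ b 0 ^ 2 ^ k := by positivity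
      gcongr
  obtain ⟨n, hn⟩ := pow_unbounded_of_one_lt C h
  have h2 : b 0 ^ n ≤ b 0 ^ (2 ^ n) := pow_le_pow_right₀ h.le Nat.lt_two_pow_self.le
  linarith [h1 n, hC n]

/-- The Cauchy integral is bounded on `L²`, uniformly in the depth. -/
theorem lineCauchySq_le {f : ℝ → ℂ} (hf : Integrable f) (hf2 : MemLp f 2 volume) {δ : ℝ}
    (hδ : 0 < δ) : lineCauchySq f δ ≤ 4 * Real.pi ^ 2 * ∫ s, ‖f s‖ ^ 2 := by
  set F := 4 * Real.pi ^ 2 * ∫ s, ‖f s‖ ^ 2 with hF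
  have hF0 : 0 ≤ F := mul_nonneg (by positivity) (integral_nonneg fun _ => by positivity)
  rcases hF0.eq_or_lt with h | h
  · have := sq_lineCauchySq_le hf hf2 hδ
    rw [← hF, ← h, zero_mul] at this
    rw [← h]
    exact ((sq_nonpos_iff _).1 this).le
  · have hpos : ∀ k : ℕ, 0 < 2 ^ k * δ := fun k => by positivity
    -- The sequence consists of the norms at the depths `2 ^ k * δ`, divided by the claimed bound.
    -- Its upper bound is the crude estimate at depth `δ`, which is the worst of these depths.
    have h1 := le_one_of_sq_le_succ (b := fun k => lineCauchySq f (2 ^ k * δ) / F)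
      (C := (∫ s, ‖f s‖) ^ 2 * (Real.pi / δ) / F) (fun k => ?_) (fun k => ?_)
    · simpa [div_le_one h] using h1
    · have := sq_lineCauchySq_le hf hf2 (hpos k)
      rw [div_pow, div_le_div_iff₀ (by positivity) h, pow_succ' 2 k, mul_assoc 2]
      nlinarith
    · refine div_le_div_of_nonneg_right ?_ h.le
      refine (integral_norm_lineCauchy_sq_le_div hf (hpos k)).trans ?_
      have : δ ≤ 2 ^ k * δ := le_mul_of_one_le_left hδ.le (one_le_pow₀ (by norm_num))
      have := Real.pi_pos
      gcongr

open ComplexConjugate in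
theorem integral_norm_lineCauchy_sub_sq {f : ℝ → ℂ} (hf : Integrable f) {ε δ : ℝ} (hε : 0 < ε)
    (hδ : 0 < δ) :
    ∫ x : ℝ, ‖lineCauchy f (x - ε * Complex.I) - lineCauchy f (x - δ * Complex.I)‖ ^ 2
      = lineCauchySq f ε + lineCauchySq f δ - 2 * lineCauchySq f ((ε + δ) / 2) := by
  have h1 := memLp_lineCauchy hf hε
  have h2 := memLp_lineCauchy hf hδ
  have i1 := (memLp_two_iff_integrable_sq_norm h1.1).1 h1
  have i2 := (memLp_two_iff_integrable_sq_norm h2.1).1 h2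
  have i3 : Integrable fun x : ℝ =>
      lineCauchy f (x - ε * Complex.I) * conj (lineCauchy f (x - δ * Complex.I)) :=
    MemLp.integrable_mul h1 h2.star
  have h3 : ∫ x : ℝ, (lineCauchy f (x - ε * Complex.I) *
      conj (lineCauchy f (x - δ * Complex.I))).re = lineCauchySq f ((ε + δ) / 2) := by
    have := congrArg Complex.re (integral_lineCauchy_mul_conj_eq hf hε hδ)
    rw [Complex.ofReal_re] at this
    rw [← this]
    exact integral_re i3
  have i4 : Integrable fun x : ℝ => 2 * (lineCauchy f (x - ε * Complex.I) *
      conj (lineCauchy f (x - δ * Complex.I))).re := i3.re.const_mul 2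
  rw [← h3, lineCauchySq, lineCauchySq, ← integral_const_mul, ← integral_add i1 i2,
    ← integral_sub (by exact i1.add i2) i4]
  refine integral_congr_ae (Eventually.of_forall fun x => ?_)
  simp only [← Complex.normSq_eq_norm_sq, Complex.normSq_sub]

/-- If `A` increased between two points, convexity would make every later step of the same length
increase `A` at least as much, against the upper bound. -/
theorem antitoneOn_of_midpoint_convex {A : ℝ → ℝ} {C : ℝ} (hC : ∀ t, 0 < t → A t ≤ C)
    (hA : ∀ s t, 0 < s → 0 < t → 2 * A ((s + t) / 2) ≤ A s + A t) : AntitoneOn A (Ioi 0) := by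
  intro s hs t ht hst
  by_contra! h
  rcases hst.eq_or_lt with rfl | hlt
  · exact lt_irrefl _ h
  have hs0 : 0 < s := hs
  have hd : 0 < t - s := sub_pos.2 hlt
  have hpos : ∀ k : ℕ, 0 < s + k * (t - s) := fun k => by positivity
  have hinc : ∀ k : ℕ, A t - A s ≤ A (s + (k + 1 : ℕ) * (t - s)) - A (s + k * (t - s)) := by
    intro k
    induction k with
    | zero => simp
    | succ k ih =>
      have := hA _ _ (hpos k) (hpos (k + 2))
      rw [show (s + k * (t - s) + (s + ((k + 2 : ℕ) : ℝ) * (t - s))) / 2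
        = s + ((k + 1 : ℕ) : ℝ) * (t - s) by push_cast; ring] at this
      rw [show k + 1 + 1 = k + 2 from rfl]
      linarith
  have hlin : ∀ k : ℕ, A s + k * (A t - A s) ≤ A (s + k * (t - s)) := by
    intro k
    induction k with
    | zero => simp
    | succ k ih => have := hinc k; push_cast at this ⊢; linarith
  obtain ⟨n, hn⟩ := exists_nat_gt ((C - A s) / (A t - A s))
  rw [div_lt_iff₀ (by linarith)] at hn
  linarith [hlin n, hC _ (hpos n)]

theorem eLpNorm_two_sq_eq {α : Type*} [MeasurableSpace α] {μ : Measure α} {f : α → ℂ}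
    (hf : MemLp f 2 μ) : eLpNorm f 2 μ ^ 2 = ENNReal.ofReal (∫ x, ‖f x‖ ^ 2 ∂μ) := by
  rw [← lintegral_enorm_sq_eq hf, eLpNorm_eq_lintegral_rpow_enorm_toReal (by norm_num) (by norm_num),
    ← ENNReal.rpow_natCast, ← ENNReal.rpow_mul]
  norm_num

/-- The boundary values of the Cauchy integral from below, as a limit in `L²`. -/
theorem exists_tendsto_lineCauchy {f : ℝ → ℂ} (hf : Integrable f) (hf2 : MemLp f 2 volume) :
    ∃ g : ℝ → ℂ, MemLp g 2 volume ∧ ∫ x, ‖g x‖ ^ 2 ≤ 4 * Real.pi ^ 2 * ∫ s, ‖f s‖ ^ 2 ∧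
      Tendsto (fun n : ℕ => eLpNorm (fun x : ℝ =>
        lineCauchy f (x - ((n + 1 : ℝ)⁻¹ : ℝ) * Complex.I) - g x) 2 volume) atTop (𝓝 0) := by
  set C := 4 * Real.pi ^ 2 * ∫ s, ‖f s‖ ^ 2
  have hδ : ∀ n : ℕ, 0 < ((n : ℝ) + 1)⁻¹ := fun n => by positivity
  have hanti : AntitoneOn (lineCauchySq f) (Ioi 0) := by
    refine antitoneOn_of_midpoint_convex (C := C) (fun t ht => lineCauchySq_le hf hf2 ht)
      fun s t hs ht => ?_
    have := integral_norm_lineCauchy_sub_sq hf hs ht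
    have h0 : 0 ≤ ∫ x : ℝ, ‖lineCauchy f (x - s * Complex.I) - lineCauchy f (x - t * Complex.I)‖ ^ 2 :=
      integral_nonneg fun _ => by positivity
    linarith
  have hmono : Monotone fun n : ℕ => lineCauchySq f ((n : ℝ) + 1)⁻¹ := fun m n hmn =>
    hanti (hδ n) (hδ m) (by gcongr)
  have hcauchy : CauchySeq fun n : ℕ => lineCauchySq f ((n : ℝ) + 1)⁻¹ :=
    (tendsto_atTop_ciSup hmono ⟨C, by rintro _ ⟨n, rfl⟩; exact lineCauchySq_le hf hf2 (hδ n)⟩).cauchySeq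
  set G : ℕ → Lp ℂ 2 (volume : Measure ℝ) := fun n => (memLp_lineCauchy hf (hδ n)).toLp _
  have hdist : ∀ m n : ℕ, m ≤ n →
      dist (G m) (G n) ^ 2 ≤ lineCauchySq f ((n : ℝ) + 1)⁻¹ - lineCauchySq f ((m : ℝ) + 1)⁻¹ := by
    intro m n hmn
    have hme := (memLp_lineCauchy hf (hδ m)).sub (memLp_lineCauchy hf (hδ n))
    have h1 : dist (G m) (G n) ^ 2 = ∫ x : ℝ, ‖lineCauchy f (x - ((m + 1 : ℝ)⁻¹ : ℝ) * Complex.I)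
        - lineCauchy f (x - ((n + 1 : ℝ)⁻¹ : ℝ) * Complex.I)‖ ^ 2 := by
      rw [Lp.dist_def, ← ENNReal.toReal_pow]
      have : eLpNorm (⇑(G m) - ⇑(G n)) 2 volume = eLpNorm ((fun x : ℝ =>
          lineCauchy f (x - ((m + 1 : ℝ)⁻¹ : ℝ) * Complex.I)) - fun x : ℝ =>
          lineCauchy f (x - ((n + 1 : ℝ)⁻¹ : ℝ) * Complex.I)) 2 volume :=
        eLpNorm_congr_ae ((MemLp.coeFn_toLp _).sub (MemLp.coeFn_toLp _))
      rw [this, eLpNorm_two_sq_eq hme, ENNReal.toReal_ofReal (integral_nonneg fun _ => by positivity)]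
      rfl
    rw [h1, integral_norm_lineCauchy_sub_sq hf (hδ m) (hδ n)]
    -- The mean of the two depths is at most the larger one, and the norm decreases with depth. This
    -- bounds the squared distance by an increment of a convergent sequence.
    have h2 : lineCauchySq f ((m : ℝ) + 1)⁻¹
        ≤ lineCauchySq f ((((m : ℝ) + 1)⁻¹ + ((n : ℝ) + 1)⁻¹) / 2) := by
      refine hanti (by have := hδ m; have := hδ n; simp only [mem_Ioi]; positivity) (hδ m) ?_
      have : ((n : ℝ) + 1)⁻¹ ≤ ((m : ℝ) + 1)⁻¹ := by gcongr
      linarith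
    linarith
  have hG : CauchySeq G := by
    rw [Metric.cauchySeq_iff'] at hcauchy ⊢
    intro ε hε
    obtain ⟨N, hN⟩ := hcauchy (ε ^ 2) (by positivity)
    refine ⟨N, fun n hn => ?_⟩
    have h1 := hdist N n hn
    have h2 := hN n hn
    rw [Real.dist_eq] at h2
    have h3 : dist (G N) (G n) ^ 2 < ε ^ 2 := h1.trans_lt ((le_abs_self _).trans_lt h2)
    rw [dist_comm]
    exact lt_of_pow_lt_pow_left₀ 2 hε.le h3
  obtain ⟨g, hg⟩ := cauchySeq_tendsto_of_complete hG
  refine ⟨g, Lp.memLp g, ?_, ?_⟩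
  · have hn : Tendsto (fun n => ‖G n‖ ^ 2) atTop (𝓝 (‖g‖ ^ 2)) := (hg.norm).pow 2
    have e1 : ‖g‖ ^ 2 = ∫ x, ‖g x‖ ^ 2 := by
      rw [Lp.norm_def, ← ENNReal.toReal_pow, eLpNorm_two_sq_eq (Lp.memLp g),
        ENNReal.toReal_ofReal (integral_nonneg fun _ => by positivity)]
    rw [← e1]
    refine le_of_tendsto' hn fun n => ?_
    rw [Lp.norm_toLp, ← ENNReal.toReal_pow, eLpNorm_two_sq_eq (memLp_lineCauchy hf (hδ n)),
        ENNReal.toReal_ofReal (integral_nonneg fun _ => by positivity)]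
    exact lineCauchySq_le hf hf2 (hδ n)
  · have := (tendsto_iff_edist_tendsto_0.1 hg)
    refine this.congr fun n => ?_
    rw [Lp.edist_def]
    exact eLpNorm_congr_ae ((MemLp.coeFn_toLp (memLp_lineCauchy hf (hδ n))).sub (ae_eq_refl _))

/-! ### The Poisson integral and nontangential limits -/

open ComplexConjugate in
/-- The Poisson kernel of the lower half plane, up to a factor. -/
def poissonDiff (z : ℂ) (x : ℝ) : ℂ := ((x : ℂ) - z)⁻¹ - ((x : ℂ) - conj z)⁻¹

theorem memLp_poissonDiff {z : ℂ} (hz : z.im ≠ 0) : MemLp (poissonDiff z) 2 volume :=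
  (memLp_inv_ofReal_sub hz).sub (memLp_inv_ofReal_sub (by simpa using hz))

-- Of the two poles of `poissonDiff z` only `z` lies opposite to `s + δ i`, so the term with `conj
-- z` integrates to zero. The condition `z.im < -δ` keeps `conj z` apart from `s + δ i`.
open ComplexConjugate in
theorem integral_lineCauchy_mul_poissonDiff {f : ℝ → ℂ} (hf : Integrable f) {z : ℂ} {δ : ℝ}
    (hδ : 0 < δ) (hz : z.im < -δ) :
    ∫ x : ℝ, lineCauchy f (x - δ * Complex.I) * poissonDiff z x
      = -(2 * Real.pi * Complex.I) * lineCauchy f (z - δ * Complex.I) := by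
  have hz0 : z.im < 0 := by linarith
  rw [integral_lineCauchy_mul hf (memLp_poissonDiff hz0.ne) hδ, lineCauchy, ← integral_const_mul]
  refine integral_congr_ae (Eventually.of_forall fun s => ?_)
  have hp : 0 < ((s : ℂ) + δ * Complex.I).im := by simpa using hδ
  have hzc : 0 < (conj z).im := by simpa using hz0
  have hne : (s : ℂ) + δ * Complex.I ≠ conj z := fun h => by
    have := congrArg Complex.im h
    simp at this
    linarith
  have e : ∀ x : ℝ, poissonDiff z x * ((s : ℂ) - (x - δ * Complex.I))⁻¹
      = ((x : ℂ) - (s + δ * Complex.I))⁻¹ * ((x : ℂ) - conj z)⁻¹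
        - ((x : ℂ) - (s + δ * Complex.I))⁻¹ * ((x : ℂ) - z)⁻¹ := fun x => by
    rw [inv_sub_eq_neg s x δ, poissonDiff]; ring
  simp only
  rw [integral_congr_ae (Eventually.of_forall e), integral_sub
    (integrable_inv_mul_inv hp.ne' hzc.ne') (integrable_inv_mul_inv hp.ne' hz0.ne),
    integral_inv_mul_inv hp hz0, integral_inv_mul_inv_of_pos hp hzc hne,
    show (s : ℂ) - (z - δ * Complex.I) = s + δ * Complex.I - z by ring]
  ring

theorem tendsto_lineCauchy_sub_mul_I {f : ℝ → ℂ} (hf : Integrable f) {z : ℂ} (hz : z.im < 0)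
    {δ : ℕ → ℝ} (hδ : ∀ n, 0 < δ n) (hlim : Tendsto δ atTop (𝓝 0)) :
    Tendsto (fun n => lineCauchy f (z - δ n * Complex.I)) atTop (𝓝 (lineCauchy f z)) := by
  have him : ∀ n, (z - δ n * Complex.I).im < z.im := fun n => by simpa using hδ n
  refine tendsto_integral_of_dominated_convergence (fun s => ‖f s‖ * |z.im|⁻¹) (fun n => ?_)
    (hf.norm.mul_const _) (fun n => Eventually.of_forall fun s => ?_)
    (Eventually.of_forall fun s => ?_)
  · exact hf.1.mul (continuous_inv_ofReal_sub ((him n).trans hz).ne).aestronglyMeasurable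
  · rw [norm_mul]
    refine mul_le_mul_of_nonneg_left ?_ (norm_nonneg _)
    refine (norm_inv_ofReal_sub_le ((him n).trans hz).ne s).trans ?_
    refine inv_anti₀ (abs_pos.2 hz.ne) ?_
    rw [abs_of_neg hz, abs_of_neg ((him n).trans hz)]
    linarith [him n]
  · refine (Tendsto.inv₀ ?_ (ofReal_sub_ne_zero hz.ne s)).const_mul _
    have : Tendsto (fun n => (δ n : ℂ)) atTop (𝓝 0) := by
      simpa [Function.comp_def] using (Complex.continuous_ofReal.tendsto 0).comp hlim
    simpa using ((this.mul_const Complex.I).const_sub z).const_sub (s : ℂ)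

theorem tendsto_integral_mul_of_tendsto_eLpNorm {α : Type*} [MeasurableSpace α] {μ : Measure α}
    {F : ℕ → α → ℂ} {g h : α → ℂ} (hF : ∀ n, MemLp (F n) 2 μ) (hg : MemLp g 2 μ)
    (hh : MemLp h 2 μ) (hlim : Tendsto (fun n => eLpNorm (fun x => F n x - g x) 2 μ) atTop (𝓝 0)) :
    Tendsto (fun n => ∫ x, F n x * h x ∂μ) atTop (𝓝 (∫ x, g x * h x ∂μ)) := by
  have hi : ∀ n, Integrable (fun x => F n x * h x) μ := fun n => MemLp.integrable_mul (hF n) hh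
  have hig : Integrable (fun x => g x * h x) μ := MemLp.integrable_mul hg hh
  refine tendsto_integral_of_L1 (fun x => g x * h x) hig.1 (Eventually.of_forall hi) ?_
  have hz : Tendsto (fun n => eLpNorm (fun x => F n x - g x) 2 μ * eLpNorm h 2 μ) atTop (𝓝 0) := by
    simpa using ENNReal.Tendsto.mul_const hlim (Or.inr hh.2.ne)
  refine tendsto_of_tendsto_of_tendsto_of_le_of_le tendsto_const_nhds hz (fun n => zero_le)
    fun n => ?_
  have := eLpNorm_smul_le_mul_eLpNorm (p := 2) (q := 2) (r := 1) (μ := μ) hh.1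
    ((hF n).1.sub hg.1)
  rw [eLpNorm_one_eq_lintegral_enorm] at this
  refine le_trans (le_of_eq (lintegral_congr fun x => ?_)) this
  simp [sub_mul]

/-- The limit of the preceding identity for depths tending to zero: on the left by `L²` convergence
against a fixed `L²` kernel, on the right by dominated convergence. -/
theorem lineCauchy_eq_integral_poissonDiff {f g : ℝ → ℂ} (hf : Integrable f)
    (hg : MemLp g 2 volume)
    (hlim : Tendsto (fun n : ℕ => eLpNorm (fun x : ℝ =>
        lineCauchy f (x - ((n + 1 : ℝ)⁻¹ : ℝ) * Complex.I) - g x) 2 volume) atTop (𝓝 0))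
    {z : ℂ} (hz : z.im < 0) :
    ∫ x : ℝ, g x * poissonDiff z x = -(2 * Real.pi * Complex.I) * lineCauchy f z := by
  have hδ : ∀ n : ℕ, 0 < ((n : ℝ) + 1)⁻¹ := fun n => by positivity
  have hδ0 : Tendsto (fun n : ℕ => ((n : ℝ) + 1)⁻¹) atTop (𝓝 0) := by
    simpa using tendsto_one_div_add_atTop_nhds_zero_nat (𝕜 := ℝ)
  refine tendsto_nhds_unique (tendsto_integral_mul_of_tendsto_eLpNorm
    (fun n => memLp_lineCauchy hf (hδ n)) hg (memLp_poissonDiff hz.ne) hlim) ?_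
  refine ((tendsto_lineCauchy_sub_mul_I hf hz hδ hδ0).const_mul _).congr' ?_
  filter_upwards [hδ0.eventually (gt_mem_nhds (show 0 < -z.im by linarith))] with n hn
  rw [integral_lineCauchy_mul_poissonDiff hf (hδ n) (by linarith)]

open ComplexConjugate in
theorem integral_poissonDiff {z : ℂ} (hz : z.im < 0) :
    Integrable (poissonDiff z) ∧ ∫ x : ℝ, poissonDiff z x = -(2 * Real.pi * Complex.I) := by
  have hzc : 0 < (conj z).im := by simpa using hz
  have hne : conj z - z ≠ 0 := fun h => by
    have := congrArg Complex.im h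
    simp at this
    linarith
  have e : poissonDiff z = fun x : ℝ =>
      -(conj z - z) * (((x : ℂ) - conj z)⁻¹ * ((x : ℂ) - z)⁻¹) := by
    ext x
    have h1 := ofReal_sub_ne_zero hz.ne x
    have h2 := ofReal_sub_ne_zero hzc.ne' x
    rw [poissonDiff]
    field_simp
    ring
  rw [e]
  refine ⟨(integrable_inv_mul_inv hzc.ne' hz.ne).const_mul _, ?_⟩
  rw [integral_const_mul, integral_inv_mul_inv hzc hz]
  field_simp

open ComplexConjugate in
theorem norm_poissonDiff (z : ℂ) (hz : z.im ≠ 0) (x : ℝ) :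
    ‖poissonDiff z x‖ = 2 * |z.im| / ‖(x : ℂ) - z‖ ^ 2 := by
  have h1 := ofReal_sub_ne_zero hz x
  have h2 : (x : ℂ) - conj z ≠ 0 := ofReal_sub_ne_zero (by simpa using hz) x
  have h3 : ‖(x : ℂ) - conj z‖ = ‖(x : ℂ) - z‖ := by
    rw [← Complex.norm_conj ((x : ℂ) - z)]; simp
  have e : poissonDiff z x = (z - conj z) / (((x : ℂ) - z) * ((x : ℂ) - conj z)) := by
    rw [poissonDiff]; field_simp; ring
  rw [e, norm_div, norm_mul, h3, Complex.sub_conj]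
  simp [sq]

/-- Inside a sector at `t` the Poisson kernel of `z` is dominated by the one of the point vertically
below `t` at the same depth. -/
theorem sq_add_sq_le_of_mem_sector {z : ℂ} {t x K : ℝ} (hK : 0 ≤ K)
    (hz : ‖z - t‖ ≤ K * -z.im) (hz0 : z.im < 0) :
    z.im ^ 2 + (x - t) ^ 2 ≤ (1 + (1 + K) ^ 2) * ‖(x : ℂ) - z‖ ^ 2 := by
  have h1 : -z.im ≤ ‖(x : ℂ) - z‖ := by
    have := Complex.abs_im_le_norm ((x : ℂ) - z)
    simpa [abs_of_neg hz0] using this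
  have h2 : |x - t| ≤ ‖(x : ℂ) - z‖ + ‖z - t‖ := by
    have := norm_add_le ((x : ℂ) - z) (z - t)
    rw [sub_add_sub_cancel] at this
    simpa [← Complex.ofReal_sub] using this
  have h3 : |x - t| ≤ (1 + K) * ‖(x : ℂ) - z‖ := by nlinarith
  have h4 : z.im ^ 2 ≤ ‖(x : ℂ) - z‖ ^ 2 := by nlinarith
  have h5 : (x - t) ^ 2 ≤ ((1 + K) * ‖(x : ℂ) - z‖) ^ 2 := by
    rw [← sq_abs (x - t)]; gcongr
  nlinarith

theorem ofReal_div_sq_add_sq_eq_lintegral {ε y : ℝ} (hε : 0 < ε) (hy : 0 ≤ y) :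
    ENNReal.ofReal (ε / (ε ^ 2 + y ^ 2))
      = ∫⁻ r in Ioi y, ENNReal.ofReal (2 * r * ε / (ε ^ 2 + r ^ 2) ^ 2) := by
  have hd : ∀ r : ℝ, HasDerivAt (fun r : ℝ => -(ε / (ε ^ 2 + r ^ 2)))
      (2 * r * ε / (ε ^ 2 + r ^ 2) ^ 2) r := fun r => by
    have h0 : ε ^ 2 + r ^ 2 ≠ 0 := by positivity
    have h1 : HasDerivAt (fun r : ℝ => ε ^ 2 + r ^ 2) (2 * r) r := by
      simpa using (hasDerivAt_pow 2 r).const_add (ε ^ 2)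
    refine ((hasDerivAt_const r ε).div h1 h0).neg.congr_deriv ?_
    field_simp
    ring
  have hlim : Tendsto (fun r : ℝ => -(ε / (ε ^ 2 + r ^ 2))) atTop (𝓝 0) := by
    have : Tendsto (fun r : ℝ => ε ^ 2 + r ^ 2) atTop atTop :=
      tendsto_atTop_add_const_left _ _ (tendsto_pow_atTop two_ne_zero)
    simpa using (this.const_div_atTop ε).neg
  have hpos : ∀ r ∈ Ioi y, 0 ≤ 2 * r * ε / (ε ^ 2 + r ^ 2) ^ 2 := fun r hr => by
    have : 0 < r := hy.trans_lt hr
    positivity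
  have h := integral_Ioi_of_hasDerivAt_of_nonneg' (fun r _ => hd r) hpos hlim
  rw [← ofReal_integral_eq_lintegral_ofReal
    (integrableOn_Ioi_deriv_of_nonneg' (fun r _ => hd r) hpos hlim)
    ((ae_restrict_iff' measurableSet_Ioi).2 (Eventually.of_forall hpos)), h]
  simp

/-- Layer cake: the radially decreasing kernel is a superposition of indicators of balls around `t`,
so only the integrals of `h` over such balls matter. -/
theorem lintegral_poisson_eq {h : ℝ → ℝ≥0∞} (hh : AEMeasurable h volume) {ε : ℝ} (hε : 0 < ε)
    (t : ℝ) :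
    ∫⁻ x, ENNReal.ofReal (ε / (ε ^ 2 + (x - t) ^ 2)) * h x
      = ∫⁻ r in Ioi 0, ENNReal.ofReal (2 * r * ε / (ε ^ 2 + r ^ 2) ^ 2) *
          ∫⁻ x in Metric.ball t r, h x := by
  set w : ℝ → ℝ≥0∞ := fun r => ENNReal.ofReal (2 * r * ε / (ε ^ 2 + r ^ 2) ^ 2) with hw
  have hwm : Measurable w := by
    have : Continuous fun r : ℝ => 2 * r * ε / (ε ^ 2 + r ^ 2) ^ 2 :=
      Continuous.div (by fun_prop) (by fun_prop) fun r => by positivity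
    exact this.measurable.ennreal_ofReal
  set S : Set (ℝ × ℝ) := {p | dist p.1 t < p.2} with hS
  have hSm : MeasurableSet S := (isOpen_lt (by fun_prop) (by fun_prop)).measurableSet
  have hm : AEMeasurable (fun p : ℝ × ℝ => S.indicator (fun p => w p.2 * h p.1) p)
      (volume.prod (volume.restrict (Ioi 0))) := by
    refine AEMeasurable.indicator ?_ hSm
    refine (hwm.comp measurable_snd).aemeasurable.mul ?_
    exact hh.comp_quasiMeasurePreserving Measure.quasiMeasurePreserving_fst
  calc _ = ∫⁻ x, ∫⁻ r in Ioi 0, S.indicator (fun p => w p.2 * h p.1) (x, r) := by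
        refine lintegral_congr fun x => ?_
        have hset : Ioi (dist x t) ⊆ Ioi (0 : ℝ) := Ioi_subset_Ioi dist_nonneg
        have e : (fun r => S.indicator (fun p => w p.2 * h p.1) (x, r))
            = (Ioi (dist x t)).indicator fun r => w r * h x := rfl
        rw [e, lintegral_indicator measurableSet_Ioi, Measure.restrict_restrict measurableSet_Ioi,
          inter_eq_left.2 hset, lintegral_mul_const _ hwm,
          ← ofReal_div_sq_add_sq_eq_lintegral hε dist_nonneg, Real.dist_eq, sq_abs]
    _ = ∫⁻ r in Ioi 0, ∫⁻ x, S.indicator (fun p => w p.2 * h p.1) (x, r) :=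
        lintegral_lintegral_swap hm
    _ = _ := by
        refine lintegral_congr fun r => ?_
        have e : (fun x => S.indicator (fun p => w p.2 * h p.1) (x, r))
            = (Metric.ball t r).indicator fun x => w r * h x := rfl
        rw [e, lintegral_indicator Metric.isOpen_ball.measurableSet,
          lintegral_const_mul' _ _ ENNReal.ofReal_ne_top]

theorem lintegral_ofReal_div_sq_add_sq {ε : ℝ} (hε : 0 < ε) :
    ∫⁻ r : ℝ, ENNReal.ofReal (ε / (ε ^ 2 + r ^ 2)) = ENNReal.ofReal Real.pi := by
  have e : ∀ r : ℝ, ε / (ε ^ 2 + r ^ 2) = ε⁻¹ * (1 + (r / ε) ^ 2)⁻¹ := fun r => by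
    field_simp
  simp_rw [e]
  rw [← ofReal_integral_eq_lintegral_ofReal
    ((integrable_inv_one_add_sq.comp_div hε.ne').const_mul _)
    (Eventually.of_forall fun r => by positivity), integral_const_mul,
    Measure.integral_comp_div (fun x : ℝ => (1 + x ^ 2)⁻¹), integral_univ_inv_one_add_sq,
    abs_of_pos hε, smul_eq_mul]
  congr 1
  field_simp

theorem lintegral_Ioi_ofReal_div_sq {c a : ℝ} (hc : 0 < c) (ha : 0 ≤ a) :
    ∫⁻ r in Ioi c, ENNReal.ofReal (a / r ^ 2) = ENNReal.ofReal (a / c) := by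
  have hi := integrableOn_Ioi_rpow_of_lt (a := -2) (by norm_num) hc
  have h := integral_Ioi_rpow_of_lt (a := -2) (by norm_num) hc
  have e : ∀ r ∈ Ioi c, a / r ^ 2 = a * r ^ (-2 : ℝ) := fun r hr => by
    rw [Real.rpow_neg (hc.trans hr).le, Real.rpow_ofNat]; rfl
  rw [setLIntegral_congr_fun (f := fun r => ENNReal.ofReal (a / r ^ 2))
    (g := fun r => ENNReal.ofReal (a * r ^ (-2 : ℝ))) measurableSet_Ioi
    (fun r hr => by simp only [e r hr]), ← ofReal_integral_eq_lintegral_ofReal (hi.const_mul a)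
    ((ae_restrict_iff' measurableSet_Ioi).2 (Eventually.of_forall fun r hr => by
      have : 0 < r := hc.trans hr
      positivity)), integral_const_mul, h]
  congr 1
  rw [show (-2 : ℝ) + 1 = -1 by norm_num, Real.rpow_neg_one]
  field_simp

/-- Radii up to `r₀` contribute a multiple of the small average `η`; for larger radii linear growth
suffices, because their contribution carries a factor `ε`. -/
theorem lintegral_poisson_le {h : ℝ → ℝ≥0∞} (hh : AEMeasurable h volume) {ε η C r₀ t : ℝ}
    (hε : 0 < ε) (hη : 0 ≤ η) (hC : 0 ≤ C) (hr₀ : 0 < r₀)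
    (h1 : ∀ r, 0 < r → r ≤ r₀ → ∫⁻ x in Metric.ball t r, h x ≤ ENNReal.ofReal (η * r))
    (h2 : ∀ r, r₀ < r → ∫⁻ x in Metric.ball t r, h x ≤ ENNReal.ofReal (C * r)) :
    ∫⁻ x, ENNReal.ofReal (ε / (ε ^ 2 + (x - t) ^ 2)) * h x
      ≤ ENNReal.ofReal (2 * η * Real.pi + 2 * C * ε / r₀) := by
  rw [lintegral_poisson_eq hh hε]
  have hm : Measurable fun r : ℝ => ENNReal.ofReal (2 * η) * ENNReal.ofReal (ε / (ε ^ 2 + r ^ 2)) := by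
    fun_prop
  have hb : ∀ r ∈ Ioi (0 : ℝ), ENNReal.ofReal (2 * r * ε / (ε ^ 2 + r ^ 2) ^ 2) *
      ∫⁻ x in Metric.ball t r, h x ≤ ENNReal.ofReal (2 * η) * ENNReal.ofReal (ε / (ε ^ 2 + r ^ 2))
        + (Ioi r₀).indicator (fun r => ENNReal.ofReal (2 * C * ε / r ^ 2)) r := by
    intro r hr
    have hr0 : 0 < r := hr
    rcases le_or_gt r r₀ with hle | hgt
    · refine le_trans ?_ le_self_add
      grw [h1 r hr hle]
      rw [← ENNReal.ofReal_mul (by positivity), ← ENNReal.ofReal_mul (by positivity)]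
      refine ENNReal.ofReal_le_ofReal ?_
      rw [div_mul_eq_mul_div, mul_div_assoc', div_le_div_iff₀ (by positivity) (by positivity)]
      have : 0 ≤ η * ε * ((ε ^ 2 + r ^ 2) * ε ^ 2) := by positivity
      nlinarith
    · refine le_trans ?_ le_add_self
      rw [indicator_of_mem (mem_Ioi.2 hgt)]
      grw [h2 r hgt]
      rw [← ENNReal.ofReal_mul (by positivity)]
      refine ENNReal.ofReal_le_ofReal ?_
      rw [div_mul_eq_mul_div, div_le_div_iff₀ (by positivity) (by positivity)]
      have h0 : 0 ≤ C * ε := by positivity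
      have : r ^ 4 ≤ (ε ^ 2 + r ^ 2) ^ 2 := by nlinarith [sq_nonneg ε, sq_nonneg r, sq_nonneg (ε * r)]
      nlinarith
  calc _ ≤ ∫⁻ r in Ioi (0 : ℝ), (ENNReal.ofReal (2 * η) * ENNReal.ofReal (ε / (ε ^ 2 + r ^ 2))
        + (Ioi r₀).indicator (fun r => ENNReal.ofReal (2 * C * ε / r ^ 2)) r) :=
        setLIntegral_mono' measurableSet_Ioi hb
    _ ≤ ∫⁻ r : ℝ, (ENNReal.ofReal (2 * η) * ENNReal.ofReal (ε / (ε ^ 2 + r ^ 2))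
        + (Ioi r₀).indicator (fun r => ENNReal.ofReal (2 * C * ε / r ^ 2)) r) :=
        setLIntegral_le_lintegral _ _
    _ = _ := by
        rw [lintegral_add_left hm, lintegral_const_mul' _ _ ENNReal.ofReal_ne_top,
          lintegral_ofReal_div_sq_add_sq hε, lintegral_indicator measurableSet_Ioi,
          lintegral_Ioi_ofReal_div_sq hr₀ (by positivity), ENNReal.ofReal_add
            (mul_nonneg (by positivity) Real.pi_pos.le) (by positivity),
          ENNReal.ofReal_mul (p := 2 * η) (by positivity)]

theorem tendsto_lintegral_poisson {g : ℝ → ℂ} (hg : MemLp g 2 volume) {t : ℝ}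
    (ht : Tendsto (fun r : ℝ => ⨍ y in Metric.closedBall t r, ‖g y - g t‖) (𝓝[>] 0) (𝓝 0)) :
    Tendsto (fun ε : ℝ => ∫⁻ x, ENNReal.ofReal (ε / (ε ^ 2 + (x - t) ^ 2)) * ‖g x - g t‖ₑ)
      (𝓝[>] 0) (𝓝 0) := by
  have hm : AEMeasurable (fun x => ‖g x - g t‖ₑ) volume :=
    (hg.1.sub aestronglyMeasurable_const).enorm
  have hloc' : LocallyIntegrable (fun x => g x - g t) volume :=
    (hg.locallyIntegrable (by norm_num)).sub (locallyIntegrable_const _)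
  have hloc : LocallyIntegrable (fun x => ‖g x - g t‖) volume := fun x => (hloc' x).norm
  have hball : ∀ r : ℝ, ∫⁻ x in Metric.ball t r, ‖g x - g t‖ₑ
      ≤ ENNReal.ofReal (∫ x in Metric.closedBall t r, ‖g x - g t‖) := fun r => by
    rw [ofReal_integral_eq_lintegral_ofReal
      (hloc.integrableOn_isCompact (isCompact_closedBall t r))
      (Eventually.of_forall fun x => norm_nonneg _)]
    simp_rw [ofReal_norm]
    exact lintegral_mono_set Metric.ball_subset_closedBall
  rw [ENNReal.tendsto_nhds_zero]
  intro e he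
  obtain ⟨e', he', hee⟩ : ∃ e' : ℝ, 0 < e' ∧ ENNReal.ofReal e' ≤ e := by
    rcases eq_or_ne e ⊤ with rfl | h
    · exact ⟨1, one_pos, le_top⟩
    · exact ⟨e.toReal, ENNReal.toReal_pos he.ne' h, ENNReal.ofReal_toReal_le⟩
  have hpi := Real.pi_pos
  set η : ℝ := e' / (4 * Real.pi) with hη
  have hη0 : 0 < η := by positivity
  have h1 := ht.eventually (gt_mem_nhds (show 0 < η / 2 by positivity))
  obtain ⟨r₀, hr₀, h1⟩ := mem_nhdsGT_iff_exists_Ioc_subset.1 h1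
  have hr₀' : 0 < r₀ := hr₀
  set F := ∫ x, ‖g x‖ ^ 2 with hF
  have hF0 : 0 ≤ F := integral_nonneg fun _ => by positivity
  -- Over a ball of radius `r`, `‖g x - g t‖ ≤ ‖g x‖² + 1/2 + ‖g t‖` integrates to at most `F + (1 +
  -- 2 ‖g t‖) r`, and `F ≤ (F / r₀) r` once `r > r₀`.
  set C : ℝ := 1 + F / r₀ + 2 * ‖g t‖ with hC
  have hC0 : 0 ≤ C := by positivity
  have hlim : Tendsto (fun ε : ℝ => 2 * C * ε / r₀) (𝓝[>] 0) (𝓝 0) := by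
    have : Tendsto (fun ε : ℝ => 2 * C * ε / r₀) (𝓝 0) (𝓝 (2 * C * 0 / r₀)) := by
      apply Continuous.tendsto; fun_prop
    rw [mul_zero, zero_div] at this
    exact this.mono_left nhdsWithin_le_nhds
  filter_upwards [self_mem_nhdsWithin, hlim.eventually (gt_mem_nhds (show 0 < e' / 2 by positivity))]
    with ε hε hε2
  refine le_trans (lintegral_poisson_le hm (η := η) (C := C) (r₀ := r₀) hε hη0.le hC0 hr₀'
    (fun r hr hle => ?_) (fun r hr => ?_)) (le_trans (ENNReal.ofReal_le_ofReal ?_) hee)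
  · refine (hball r).trans (ENNReal.ofReal_le_ofReal ?_)
    have h3 : ⨍ y in Metric.closedBall t r, ‖g y - g t‖ < η / 2 := h1 ⟨hr, hle⟩
    rw [setAverage_eq, smul_eq_mul, Real.volume_real_closedBall hr.le, inv_mul_lt_iff₀ (by positivity)]
      at h3
    linarith
  · refine (hball r).trans (ENNReal.ofReal_le_ofReal ?_)
    have hr0 : 0 < r := hr₀'.trans hr
    have hsq := (memLp_two_iff_integrable_sq_norm hg.1).1 hg
    have hfin : IntegrableOn (fun _ : ℝ => (1 : ℝ)) (Metric.closedBall t r) :=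
      integrableOn_const (isCompact_closedBall t r).measure_lt_top.ne
    calc ∫ x in Metric.closedBall t r, ‖g x - g t‖
        ≤ ∫ x in Metric.closedBall t r, (‖g x‖ ^ 2 + (1 / 2 + ‖g t‖) * 1) := by
          refine setIntegral_mono (hloc.integrableOn_isCompact (isCompact_closedBall t r))
            (hsq.integrableOn.add (hfin.const_mul _)) fun x => ?_
          have := norm_sub_le (g x) (g t)
          nlinarith [sq_nonneg (‖g x‖ - 1 / 2)]
      _ ≤ F + (1 / 2 + ‖g t‖) * (2 * r) := by
          rw [integral_add hsq.integrableOn (hfin.const_mul _), integral_const_mul,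
            setIntegral_const, Real.volume_real_closedBall hr0.le, smul_eq_mul, mul_one]
          gcongr
          exact setIntegral_le_integral hsq (Eventually.of_forall fun _ => by positivity)
      _ ≤ C * r := by
          have : F ≤ F / r₀ * r := by
            rw [div_mul_eq_mul_div, le_div_iff₀ hr₀']
            gcongr
          rw [hC]
          nlinarith
  · have : 2 * η * Real.pi = e' / 2 := by rw [hη]; field_simp; norm_num
    linarith

/-- Nontangential boundary values of the Cauchy integral from below. -/
theorem ae_tendsto_lineCauchy {f g : ℝ → ℂ} (hf : Integrable f) (hg : MemLp g 2 volume)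
    (hlim : Tendsto (fun n : ℕ => eLpNorm (fun x : ℝ =>
        lineCauchy f (x - ((n + 1 : ℝ)⁻¹ : ℝ) * Complex.I) - g x) 2 volume) atTop (𝓝 0)) :
    ∀ᵐ t : ℝ, ∀ K : ℝ, 0 ≤ K → Tendsto (lineCauchy f)
      (𝓝[{z : ℂ | z.im < 0 ∧ ‖z - t‖ ≤ K * -z.im}] (t : ℂ)) (𝓝 (g t)) := by
  filter_upwards [IsUnifLocDoublingMeasure.ae_tendsto_average_norm_sub volume
    (hg.locallyIntegrable (by norm_num)) 1] with t ht K hK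
  have ht' := ht (l := 𝓝[>] (0 : ℝ)) (fun _ => t) id tendsto_id (by
    filter_upwards [self_mem_nhdsWithin] with r hr
    simpa using (show (0 : ℝ) < r from hr).le)
  have hP := tendsto_lintegral_poisson hg ht'
  set l := 𝓝[{z : ℂ | z.im < 0 ∧ ‖z - t‖ ≤ K * -z.im}] (t : ℂ)
  have him : Tendsto (fun z : ℂ => -z.im) l (𝓝[>] 0) := by
    refine tendsto_nhdsWithin_iff.2 ⟨?_, ?_⟩
    · have : Tendsto (fun z : ℂ => -z.im) (𝓝 (t : ℂ)) (𝓝 (-(t : ℂ).im)) := by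
        apply Continuous.tendsto; fun_prop
      simpa using this.mono_left nhdsWithin_le_nhds
    · filter_upwards [self_mem_nhdsWithin] with z hz
      simpa using hz.1
  have hJ := hP.comp him
  have hJ' := ENNReal.Tendsto.const_mul (a := ENNReal.ofReal (1 + (1 + K) ^ 2)) hJ
    (Or.inr ENNReal.ofReal_ne_top)
  rw [mul_zero] at hJ'
  rw [tendsto_iff_edist_tendsto_0]
  refine tendsto_of_tendsto_of_tendsto_of_le_of_le' tendsto_const_nhds hJ'
    (Eventually.of_forall fun z => zero_le) ?_
  filter_upwards [self_mem_nhdsWithin] with z hz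
  have hz0 : z.im < 0 := hz.1
  have h1 := lineCauchy_eq_integral_poissonDiff hf hg hlim hz0
  obtain ⟨h2i, h2⟩ := integral_poissonDiff hz0
  -- The kernel has total mass `-2πi`, so the constant `g t` can be moved under the integral.
  have h3 : -(2 * Real.pi * Complex.I) * (lineCauchy f z - g t)
      = ∫ x, (g x - g t) * poissonDiff z x := by
    have e : ∀ x, (g x - g t) * poissonDiff z x = g x * poissonDiff z x - g t * poissonDiff z x :=
      fun x => by ring
    have hi : Integrable fun x => g x * poissonDiff z x :=
      MemLp.integrable_mul hg (memLp_poissonDiff hz0.ne)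
    simp_rw [e]
    rw [integral_sub hi (h2i.const_mul _), h1,
      integral_const_mul, h2]
    ring
  have h4 : ‖lineCauchy f z - g t‖ₑ ≤ ‖-(2 * Real.pi * Complex.I) * (lineCauchy f z - g t)‖ₑ
      * ENNReal.ofReal (1 / 2) := by
    rw [enorm_mul, mul_right_comm, ← ofReal_norm (-(2 * Real.pi * Complex.I)),
      ← ENNReal.ofReal_mul (norm_nonneg _)]
    refine le_mul_of_one_le_left zero_le ?_
    rw [ENNReal.one_le_ofReal]
    have := Real.pi_gt_three
    simp [abs_of_pos Real.pi_pos]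
    linarith
  rw [edist_eq_enorm_sub]
  refine h4.trans ?_
  rw [h3]
  grw [enorm_integral_le_lintegral_enorm]
  rw [← lintegral_mul_const' _ _ ENNReal.ofReal_ne_top]
  simp only [Function.comp_apply]
  rw [← lintegral_const_mul' _ _ ENNReal.ofReal_ne_top]
  refine lintegral_mono fun x => ?_
  rw [enorm_mul, mul_assoc, mul_comm ‖g x - g t‖ₑ, ← mul_assoc (ENNReal.ofReal (1 + (1 + K) ^ 2))]
  refine mul_le_mul' ?_ le_rfl
  rw [← ofReal_norm (poissonDiff z x), ← ENNReal.ofReal_mul (norm_nonneg _),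
    ← ENNReal.ofReal_mul (by positivity), norm_poissonDiff z hz0.ne, abs_of_neg hz0]
  refine ENNReal.ofReal_le_ofReal ?_
  have h5 := sq_add_sq_le_of_mem_sector (x := x) hK hz.2 hz0
  have h6 : 0 < ‖(x : ℂ) - z‖ := norm_pos_iff.2 (ofReal_sub_ne_zero hz0.ne x)
  have h7 : 0 < z.im ^ 2 := sq_pos_of_neg hz0
  rw [show 2 * -z.im / ‖(x : ℂ) - z‖ ^ 2 * (1 / 2) = -z.im / ‖(x : ℂ) - z‖ ^ 2 by ring,
    mul_div_assoc', neg_sq,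
    div_le_div_iff₀ (by positivity) (by positivity)]
  have h8 := mul_le_mul_of_nonneg_left h5 (show 0 ≤ -z.im by linarith)
  nlinarith

/-! ### Integral operators with the kernel `1 / (A x y + B x + C y + D)` -/

theorem lintegral_lineCauchy_sq_le_of_integrable {f : ℝ → ℂ} (hf : Integrable f)
    (hf2 : MemLp f 2 volume) {δ : ℝ} (hδ : 0 < δ) :
    ∫⁻ x : ℝ, ‖lineCauchy f (x - δ * Complex.I)‖ₑ ^ 2
      ≤ ENNReal.ofReal (4 * Real.pi ^ 2) * ∫⁻ s, ‖f s‖ₑ ^ 2 := by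
  rw [lintegral_enorm_sq_eq (memLp_lineCauchy hf hδ), lintegral_enorm_sq_eq hf2,
    ← ENNReal.ofReal_mul (by positivity)]
  exact ENNReal.ofReal_le_ofReal (lineCauchySq_le hf hf2 hδ)

/-- Truncation to bounded intervals and Fatou's lemma remove the integrability of `f`. -/
theorem lintegral_lineCauchy_sq_le {f : ℝ → ℂ} (hf : MemLp f 2 volume) {δ : ℝ} (hδ : 0 < δ) :
    ∫⁻ x : ℝ, ‖lineCauchy f (x - δ * Complex.I)‖ₑ ^ 2
      ≤ ENNReal.ofReal (4 * Real.pi ^ 2) * ∫⁻ s, ‖f s‖ₑ ^ 2 := by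
  set F : ℕ → ℝ → ℂ := fun n => (Icc (-(n : ℝ)) n).indicator f
  have hF2 : ∀ n, MemLp (F n) 2 volume := fun n => hf.indicator measurableSet_Icc
  have hF1 : ∀ n, Integrable (F n) := fun n => by
    have := (hf.restrict (Icc (-(n : ℝ)) n)).integrable (by norm_num)
    exact (integrable_indicator_iff measurableSet_Icc).2 this
  have hlim : ∀ x : ℝ, Tendsto (fun n => lineCauchy (F n) (x - δ * Complex.I)) atTop
      (𝓝 (lineCauchy f (x - δ * Complex.I))) := fun x => by
    have hk : MemLp (fun s : ℝ => ((s : ℂ) - (x - δ * Complex.I))⁻¹) 2 volume :=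
      memLp_inv_ofReal_sub (by simpa using hδ.ne')
    refine tendsto_integral_of_dominated_convergence
      (fun s => ‖f s * ((s : ℂ) - (x - δ * Complex.I))⁻¹‖) (fun n => (hF2 n).1.mul hk.1)
      (MemLp.integrable_mul hf hk).norm (fun n => Eventually.of_forall fun s => ?_)
      (Eventually.of_forall fun s => ?_)
    · rw [norm_mul, norm_mul]
      gcongr
      exact norm_indicator_le_norm_self _ _
    · refine Tendsto.mul_const _ (tendsto_const_nhds.congr' ?_)
      obtain ⟨N, hN⟩ := exists_nat_ge |s|
      filter_upwards [eventually_ge_atTop N] with n hn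
      have : |s| ≤ n := hN.trans (by exact_mod_cast hn)
      exact (indicator_of_mem (mem_Icc.2 (abs_le.1 this)) _).symm
  calc _ = ∫⁻ x : ℝ, liminf (fun n => ‖lineCauchy (F n) (x - δ * Complex.I)‖ₑ ^ 2) atTop := by
        refine lintegral_congr fun x => ?_
        exact (((ENNReal.continuous_pow 2).tendsto _).comp
          (continuous_enorm.tendsto _ |>.comp (hlim x))).liminf_eq.symm
    _ ≤ liminf (fun n => ∫⁻ x : ℝ, ‖lineCauchy (F n) (x - δ * Complex.I)‖ₑ ^ 2) atTop :=
        lintegral_liminf_le fun n => (continuous_lineCauchy (hF1 n) hδ).enorm.measurable.pow_const 2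
    _ ≤ liminf (fun _ : ℕ => ENNReal.ofReal (4 * Real.pi ^ 2) * ∫⁻ s, ‖f s‖ₑ ^ 2) atTop := by
        refine liminf_le_liminf (Eventually.of_forall fun n => ?_)
        refine (lintegral_lineCauchy_sq_le_of_integrable (hF1 n) (hF2 n) hδ).trans ?_
        gcongr with s
        exact enorm_indicator_le_enorm_self _ _
    _ = _ := liminf_const _

-- The real part of `a` is a translation; complex conjugation exchanges the two half planes.
open ComplexConjugate in
theorem lintegral_lineCauchy_add_sq_le {f : ℝ → ℂ} (hf : MemLp f 2 volume) {a : ℂ}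
    (ha : a.im ≠ 0) :
    ∫⁻ x : ℝ, ‖lineCauchy f (x + a)‖ₑ ^ 2
      ≤ ENNReal.ofReal (4 * Real.pi ^ 2) * ∫⁻ s, ‖f s‖ₑ ^ 2 := by
  have e : ∀ x : ℝ, (x : ℂ) + a = ((x + a.re : ℝ) : ℂ) + a.im * Complex.I := fun x => by
    push_cast
    rw [add_assoc, Complex.re_add_im]
  simp_rw [e]
  rw [lintegral_add_right_eq_self (fun x : ℝ => ‖lineCauchy f (x + a.im * Complex.I)‖ₑ ^ 2) a.re]
  rcases ha.lt_or_gt with h | h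
  · have := lintegral_lineCauchy_sq_le hf (neg_pos.2 h)
    simpa using this
  · have := lintegral_lineCauchy_sq_le hf.star h
    simp only [Pi.star_apply] at this
    have h1 : ∀ x : ℝ, lineCauchy (star f) (x - a.im * Complex.I)
        = conj (lineCauchy f (x + a.im * Complex.I)) := fun x => by
      rw [lineCauchy, lineCauchy, ← integral_conj]
      refine integral_congr_ae (Eventually.of_forall fun s => ?_)
      simp [sub_eq_add_neg]
    simpa [h1] using this

/-- The primitive is `(2 / √y) arctan (√x / √y)`, and the arctangent stays below `π / 2`. -/
theorem lintegral_Ioo_rpow_div_add_le {y : ℝ} (hy : 0 < y) :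
    ∫⁻ x in Ioo (0 : ℝ) 1, ENNReal.ofReal (1 / (√x * (x + y))) ≤ ENNReal.ofReal (Real.pi / √y) := by
  have hsy : 0 < √y := Real.sqrt_pos.2 hy
  have hd : ∀ x ∈ Ioo (0 : ℝ) 1, HasDerivAt (fun x => 2 / √y * Real.arctan (√x / √y))
      (1 / (√x * (x + y))) x := fun x hx => by
    have hsx : 0 < √x := Real.sqrt_pos.2 hx.1
    have h := (((Real.hasDerivAt_sqrt hx.1.ne').div_const (√y)).arctan).const_mul (2 / √y)
    refine h.congr_deriv ?_
    have h1 : (√x / √y) ^ 2 = x / y := by rw [div_pow, Real.sq_sqrt hx.1.le, Real.sq_sqrt hy.le]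
    have h2 : √y * √y = y := Real.mul_self_sqrt hy.le
    have hx0 := hx.1
    rw [h1]
    field_simp
    rw [Real.sq_sqrt hy.le]
    ring
  have hc : ContinuousOn (fun x => 2 / √y * Real.arctan (√x / √y)) (Icc 0 1) := by
    apply Continuous.continuousOn; fun_prop
  have hpos : ∀ x ∈ Ioo (0 : ℝ) 1, 0 ≤ 1 / (√x * (x + y)) := fun x hx => by
    have := hx.1; positivity
  have hi := intervalIntegral.integrableOn_deriv_of_nonneg hc hd hpos
  have hI := intervalIntegral.integral_eq_sub_of_hasDerivAt_of_le zero_le_one hc hd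
    ((intervalIntegrable_iff_integrableOn_Ioc_of_le zero_le_one).2 hi)
  rw [intervalIntegral.integral_of_le zero_le_one, integral_Ioc_eq_integral_Ioo] at hI
  rw [← ofReal_integral_eq_lintegral_ofReal (hi.mono_set Ioo_subset_Ioc_self)
    ((ae_restrict_iff' measurableSet_Ioo).2 (Eventually.of_forall hpos)), hI]
  refine ENNReal.ofReal_le_ofReal ?_
  have := Real.arctan_lt_pi_div_two (√1 / √y)
  simp only [Real.sqrt_zero, zero_div, Real.arctan_zero, mul_zero, sub_zero]
  calc 2 / √y * Real.arctan (√1 / √y) ≤ 2 / √y * (Real.pi / 2) := by gcongr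
    _ = _ := by ring

/-- Hilbert's inequality. -/
theorem lintegral_sq_lintegral_div_add_le {f : ℝ → ℝ≥0∞}
    (hf : AEMeasurable f (volume.restrict (Ioo 0 1))) :
    ∫⁻ y in Ioo (0 : ℝ) 1, (∫⁻ x in Ioo (0 : ℝ) 1, f x * ENNReal.ofReal (1 / (x + y))) ^ 2
      ≤ ENNReal.ofReal Real.pi ^ 2 * ∫⁻ x in Ioo (0 : ℝ) 1, f x ^ 2 := by
  set μ : Measure ℝ := volume.restrict (Ioo 0 1) with hμ
  have hin : ∀ᵐ x ∂μ, x ∈ Ioo (0 : ℝ) 1 := ae_restrict_mem measurableSet_Ioo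
  have hm2 : Measurable fun p : ℝ × ℝ => ENNReal.ofReal (√p.2 / (p.2 + p.1) * (1 / √p.1)) := by
    fun_prop
  have h1 : ∀ᵐ y ∂μ, (∫⁻ x, f x * ENNReal.ofReal (1 / (x + y)) ∂μ) ^ 2
      ≤ ENNReal.ofReal Real.pi * ∫⁻ x, f x ^ 2 * ENNReal.ofReal (√x / (x + y) * (1 / √y)) ∂μ := by
    filter_upwards [hin] with y hy
    -- Schur's test with the test function `x ^ (-1/2)`, which the kernel `1 / (x + y)` reproduces
    -- up to the factor `π`.
    have h := sq_lintegral_mul_le_weighted (μ := μ)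
      (w := fun x => ENNReal.ofReal (1 / (√x * (x + y))))
      (k := fun x => f x * ENNReal.ofReal (√x)) (by fun_prop)
      (hf.mul (by fun_prop))
    have e1 : ∫⁻ x, ENNReal.ofReal (1 / (√x * (x + y))) * (f x * ENNReal.ofReal (√x)) ∂μ
        = ∫⁻ x, f x * ENNReal.ofReal (1 / (x + y)) ∂μ := by
      refine lintegral_congr_ae ?_
      filter_upwards [hin] with x hx
      have hx0 := hx.1
      have hy0 := hy.1
      rw [mul_left_comm, ← ENNReal.ofReal_mul (by positivity)]
      congr 2
      have : 0 < √x := Real.sqrt_pos.2 hx0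
      field_simp
    have e2 : ∫⁻ x, ENNReal.ofReal (1 / (√x * (x + y))) * (f x * ENNReal.ofReal (√x)) ^ 2 ∂μ
        = ∫⁻ x, f x ^ 2 * ENNReal.ofReal (√x / (x + y)) ∂μ := by
      refine lintegral_congr_ae ?_
      filter_upwards [hin] with x hx
      have hx0 := hx.1
      have hy0 := hy.1
      rw [mul_pow, mul_left_comm, ← ENNReal.ofReal_pow (by positivity),
        ← ENNReal.ofReal_mul (by positivity)]
      congr 2
      have : 0 < √x := Real.sqrt_pos.2 hx0
      field_simp
    rw [e1, e2] at h
    refine h.trans ?_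
    grw [lintegral_Ioo_rpow_div_add_le hy.1]
    have e3 : ∀ x ∈ Ioo (0:ℝ) 1, f x ^ 2 * ENNReal.ofReal (√x / (x + y) * (1 / √y))
        = ENNReal.ofReal (1 / √y) * (f x ^ 2 * ENNReal.ofReal (√x / (x + y))) := fun x hx => by
      have hx0 := hx.1
      have hy0 := hy.1
      rw [ENNReal.ofReal_mul (by positivity)]
      ring
    rw [setLIntegral_congr_fun measurableSet_Ioo e3, lintegral_const_mul' _ _ ENNReal.ofReal_ne_top,
      ← mul_assoc, ← ENNReal.ofReal_mul Real.pi_pos.le, mul_one_div]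
  calc _ ≤ ∫⁻ y, ENNReal.ofReal Real.pi *
        ∫⁻ x, f x ^ 2 * ENNReal.ofReal (√x / (x + y) * (1 / √y)) ∂μ ∂μ := lintegral_mono_ae h1
    _ = ENNReal.ofReal Real.pi *
        ∫⁻ x, ∫⁻ y, f x ^ 2 * ENNReal.ofReal (√x / (x + y) * (1 / √y)) ∂μ ∂μ := by
        rw [lintegral_const_mul' _ _ ENNReal.ofReal_ne_top, lintegral_lintegral_swap]
        refine AEMeasurable.mul ?_ hm2.aemeasurable
        exact (hf.comp_quasiMeasurePreserving Measure.quasiMeasurePreserving_snd).pow_const 2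
    _ ≤ ENNReal.ofReal Real.pi * ∫⁻ x, f x ^ 2 * ENNReal.ofReal Real.pi ∂μ := by
        refine mul_le_mul' le_rfl (lintegral_mono_ae ?_)
        filter_upwards [hin] with x hx
        have hx0 := hx.1
        rw [lintegral_const_mul _ (by fun_prop)]
        gcongr
        have e : ∀ y ∈ Ioo (0 : ℝ) 1, ENNReal.ofReal (√x / (x + y) * (1 / √y))
            = ENNReal.ofReal (√x) * ENNReal.ofReal (1 / (√y * (y + x))) := fun y hy => by
          rw [← ENNReal.ofReal_mul (by positivity)]
          congr 1
          have hy0 := hy.1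
          have : 0 < √y := Real.sqrt_pos.2 hy0
          field_simp
          ring
        rw [setLIntegral_congr_fun measurableSet_Ioo e,
          lintegral_const_mul' _ _ ENNReal.ofReal_ne_top]
        grw [lintegral_Ioo_rpow_div_add_le hx.1]
        rw [← ENNReal.ofReal_mul (by positivity)]
        refine ENNReal.ofReal_le_ofReal (le_of_eq ?_)
        have : 0 < √x := Real.sqrt_pos.2 hx0
        field_simp
    _ = _ := by
        rw [lintegral_mul_const' _ _ ENNReal.ofReal_ne_top]
        ring

/-- The integral operator with the kernel `k` maps `L²(S)` into `L²(T)`. -/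
def IsL2Kernel (S T : Set ℝ) (k : ℝ → ℝ → ℂ) : Prop :=
  ∃ K : ℝ≥0, ∀ f : ℝ → ℂ, MemLp f 2 (volume.restrict S) →
    ∫⁻ y in T, ‖∫ x in S, f x * k x y‖ₑ ^ 2 ≤ K * ∫⁻ x in S, ‖f x‖ₑ ^ 2

theorem isL2Kernel_of_norm_le {k : ℝ → ℝ → ℂ} {C : ℝ} (hC : 0 ≤ C)
    (hk : ∀ x ∈ Ioo (0 : ℝ) 1, ∀ y ∈ Ioo (0 : ℝ) 1, ‖k x y‖ ≤ C * (1 / (x + y))) :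
    IsL2Kernel (Ioo 0 1) (Ioo 0 1) k := by
  refine ⟨C.toNNReal ^ 2 * Real.pi.toNNReal ^ 2, fun f hf => ?_⟩
  calc _ ≤ ∫⁻ y in Ioo (0 : ℝ) 1, ENNReal.ofReal C ^ 2 *
        (∫⁻ x in Ioo (0 : ℝ) 1, ‖f x‖ₑ * ENNReal.ofReal (1 / (x + y))) ^ 2 := by
        refine setLIntegral_mono' measurableSet_Ioo fun y hy => ?_
        rw [← mul_pow]
        gcongr
        refine (enorm_integral_le_lintegral_enorm _).trans ?_
        rw [← lintegral_const_mul' _ _ ENNReal.ofReal_ne_top]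
        refine setLIntegral_mono' measurableSet_Ioo fun x hx => ?_
        rw [enorm_mul, mul_left_comm, ← ENNReal.ofReal_mul hC, ← ofReal_norm (k x y)]
        gcongr
        exact hk x hx y hy
    _ ≤ ENNReal.ofReal C ^ 2 * (ENNReal.ofReal Real.pi ^ 2 * ∫⁻ x in Ioo (0 : ℝ) 1, ‖f x‖ₑ ^ 2) := by
        rw [lintegral_const_mul' _ _ (ENNReal.pow_ne_top ENNReal.ofReal_ne_top)]
        exact mul_le_mul' le_rfl (lintegral_sq_lintegral_div_add_le hf.1.enorm)
    _ = _ := by rw [← mul_assoc]; rfl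

theorem image_div_Ioi {a : ℝ} (ha : 0 < a) : (fun ξ : ℝ => a / ξ) '' Ioi a = Ioo 0 1 := by
  ext x
  simp only [mem_image, mem_Ioi, mem_Ioo]
  constructor
  · rintro ⟨ξ, hξ, rfl⟩
    have : 0 < ξ := ha.trans hξ
    exact ⟨by positivity, (div_lt_one this).2 hξ⟩
  · rintro ⟨h0, h1⟩
    exact ⟨a / x, by rw [lt_div_iff₀ h0]; nlinarith, by field_simp⟩

theorem hasDerivWithinAt_div {a : ℝ} (ha : 0 < a) (ξ : ℝ) (hξ : ξ ∈ Ioi a) :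
    HasDerivWithinAt (fun ξ : ℝ => a / ξ) (-(a / ξ ^ 2)) (Ioi a) ξ := by
  have h0 : ξ ≠ 0 := (ha.trans hξ).ne'
  refine (((hasDerivAt_const ξ a).div (hasDerivAt_id ξ) h0).congr_deriv ?_).hasDerivWithinAt
  simp [neg_div]

theorem injOn_div {a : ℝ} (ha : 0 < a) : InjOn (fun ξ : ℝ => a / ξ) (Ioi a) := by
  intro x hx y hy h
  have hx0 : 0 < x := ha.trans hx
  have hy0 : 0 < y := ha.trans hy
  simp only at h
  field_simp at h
  exact h.symm

/-- This is the case of arcs that touch tangentially at a corner. With `x = a / ξ` and `y = 1 / η`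
the denominator becomes a multiple of `(ξ - (η + α)) / (ξ η)`. The operator is then a Cauchy
integral over the line, evaluated on a horizontal line at height `α.im ≠ 0`. The factors `1 / ξ` and
`1 / η` are exactly absorbed by the Jacobians in the `L²` norms. -/
theorem isL2Kernel_cusp {B α : ℂ} {a : ℝ} (hB : B ≠ 0) (ha : 0 < a) (hα : α.im ≠ 0) :
    IsL2Kernel (Ioo 0 1) (Ioo 0 1)
      fun x y => (B * (x - a * y + α * x * y))⁻¹ := by
  refine ⟨‖B⁻¹‖₊ ^ 2 * (4 * Real.pi ^ 2).toNNReal * a⁻¹.toNNReal, fun f hf => ?_⟩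
  set F : ℝ → ℂ := (Ioi a).indicator fun ξ => f (a / ξ) * (ξ : ℂ)⁻¹ with hF
  have hFm : AEStronglyMeasurable F volume := by
    refine (aestronglyMeasurable_indicator_iff measurableSet_Ioi).2 (AEStronglyMeasurable.mul ?_ ?_)
    · refine AEStronglyMeasurable.comp_quasiMeasurePreserving hf.1 ⟨by fun_prop, ?_⟩
      -- Composition with `a / ξ` respects almost everywhere equality: preimages of null sets are
      -- images under the same involution, which is differentiable on `(0, 1)`.
      refine Measure.AbsolutelyContinuous.mk fun s hs h0 => ?_
      rw [Measure.map_apply (by fun_prop) hs]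
      rw [Measure.restrict_apply hs] at h0
      rw [Measure.restrict_apply' measurableSet_Ioi]
      have h1 : ∀ ξ ∈ Ioo (0 : ℝ) 1, HasDerivWithinAt (fun ξ : ℝ => a / ξ) (-(a / ξ ^ 2))
          (Ioo 0 1) ξ := fun ξ hξ => by
        refine (((hasDerivAt_const ξ a).div (hasDerivAt_id ξ) hξ.1.ne').congr_deriv ?_).hasDerivWithinAt
        simp [neg_div]
      have h2 := addHaar_image_eq_zero_of_differentiableOn_of_addHaar_eq_zero (volume : Measure ℝ)
        (f := fun ξ : ℝ => a / ξ) (s := s ∩ Ioo 0 1)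
        (fun ξ hξ => ((h1 ξ hξ.2).differentiableWithinAt.mono inter_subset_right)) h0
      refine measure_mono_null ?_ h2
      rintro ξ ⟨hξ1, hξ2⟩
      have h3 : 0 < ξ := ha.trans hξ2
      refine ⟨a / ξ, ⟨hξ1, by positivity, (div_lt_one h3).2 hξ2⟩, ?_⟩
      simp only
      field_simp
    · exact (Complex.measurable_ofReal.inv).aestronglyMeasurable
  have hFn : ∫⁻ ξ, ‖F ξ‖ₑ ^ 2 = ENNReal.ofReal a⁻¹ * ∫⁻ x in Ioo (0 : ℝ) 1, ‖f x‖ₑ ^ 2 := by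
    rw [← image_div_Ioi ha, lintegral_image_eq_lintegral_abs_deriv_mul measurableSet_Ioi
      (hasDerivWithinAt_div ha) (injOn_div ha), ← lintegral_const_mul' _ _ ENNReal.ofReal_ne_top,
      ← lintegral_indicator measurableSet_Ioi]
    refine lintegral_congr fun ξ => ?_
    rw [hF]
    by_cases hξ : ξ ∈ Ioi a
    · have h3 : 0 < ξ := ha.trans hξ
      rw [indicator_of_mem hξ, indicator_of_mem hξ, enorm_mul, mul_pow, mul_comm, ← mul_assoc,
        ← ENNReal.ofReal_mul (by positivity), ← ofReal_norm (ξ : ℂ)⁻¹,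
        ← ENNReal.ofReal_pow (norm_nonneg _)]
      congr 2
      rw [norm_inv, Complex.norm_real, Real.norm_of_nonneg h3.le, abs_neg,
        abs_of_nonneg (by positivity)]
      field_simp
    · rw [indicator_of_notMem hξ, indicator_of_notMem hξ]
      simp
  have hF2 : MemLp F 2 volume := by
    refine memLp_two_of_lintegral_lt_top hFm ?_
    rw [hFn, lintegral_enorm_sq_eq hf]
    exact ENNReal.mul_lt_top ENNReal.ofReal_lt_top ENNReal.ofReal_lt_top
  have hT : ∀ y ∈ Ioo (0 : ℝ) 1, ∫ x in Ioo (0 : ℝ) 1, f x * (B * (x - a * y + α * x * y))⁻¹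
      = -(B⁻¹ * (y : ℂ)⁻¹ * lineCauchy F (((1 / y : ℝ) : ℂ) + α)) := fun y hy => by
    have hy0 : (y : ℂ) ≠ 0 := by exact_mod_cast hy.1.ne'
    rw [← image_div_Ioi ha, integral_image_eq_integral_abs_deriv_smul measurableSet_Ioi
      (hasDerivWithinAt_div ha) (injOn_div ha), lineCauchy, ← integral_const_mul, ← integral_neg,
      ← integral_indicator measurableSet_Ioi]
    refine integral_congr_ae (Eventually.of_forall fun ξ => ?_)
    simp only [hF]
    by_cases hξ : ξ ∈ Ioi a
    · have h3 : 0 < ξ := ha.trans hξ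
      have h4 : (ξ : ℂ) ≠ 0 := by exact_mod_cast h3.ne'
      have h5 : (ξ : ℂ) - (((1 / y : ℝ) : ℂ) + α) ≠ 0 :=
        ofReal_sub_ne_zero (by simpa [← Complex.ofReal_inv] using hα) ξ
      have h6 : (a : ℂ) ≠ 0 := by exact_mod_cast ha.ne'
      rw [indicator_of_mem hξ, indicator_of_mem hξ, abs_neg, abs_of_nonneg (by positivity),
        Complex.real_smul]
      have e : B * (((a / ξ : ℝ) : ℂ) - a * y + α * ((a / ξ : ℝ) : ℂ) * y)
          = -(B * y * (a / ξ) * ((ξ : ℂ) - (((1 / y : ℝ) : ℂ) + α))) := by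
        push_cast
        field_simp
        ring
      rw [e, inv_neg, mul_inv, mul_inv, mul_inv]
      push_cast
      field_simp
    · rw [indicator_of_notMem hξ, indicator_of_notMem hξ]
      simp
  rw [setLIntegral_congr_fun measurableSet_Ioo
    (g := fun y : ℝ => ‖B⁻¹‖ₑ ^ 2 * (‖(y : ℂ)⁻¹‖ₑ ^ 2 * ‖lineCauchy F (((1 / y : ℝ) : ℂ) + α)‖ₑ ^ 2))
    (fun y hy => by simp only; rw [hT y hy, enorm_neg, enorm_mul, enorm_mul]; ring),
    lintegral_const_mul' _ _ (ENNReal.pow_ne_top enorm_ne_top)]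
  have hsub : ∫⁻ y in Ioo (0 : ℝ) 1, ‖(y : ℂ)⁻¹‖ₑ ^ 2 * ‖lineCauchy F (((1 / y : ℝ) : ℂ) + α)‖ₑ ^ 2
      = ∫⁻ η in Ioi (1 : ℝ), ‖lineCauchy F ((η : ℂ) + α)‖ₑ ^ 2 := by
    rw [← image_div_Ioi one_pos, lintegral_image_eq_lintegral_abs_deriv_mul measurableSet_Ioi
      (hasDerivWithinAt_div one_pos) (injOn_div one_pos)]
    refine setLIntegral_congr_fun measurableSet_Ioi fun η hη => ?_
    have h3 : 0 < η := one_pos.trans hη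
    simp only [one_div_one_div]
    rw [← mul_assoc, ← ofReal_norm (((1 / η : ℝ) : ℂ)⁻¹), ← ENNReal.ofReal_pow (norm_nonneg _),
      ← ENNReal.ofReal_mul (by positivity), norm_inv, Complex.norm_real, abs_neg,
      abs_of_nonneg (by positivity), Real.norm_of_nonneg (by positivity)]
    have : 1 / η ^ 2 * (1 / η)⁻¹ ^ 2 = 1 := by field_simp
    rw [this, ENNReal.ofReal_one, one_mul]
  rw [hsub]
  grw [setLIntegral_le_lintegral, lintegral_lineCauchy_add_sq_le hF2 hα, hFn]
  refine le_of_eq ?_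
  push_cast
  rw [mul_assoc, mul_assoc]
  rfl

/-- Blow-up of the corner: with `r = x + y` and `θ = x / r` the form divided by `r` is `B θ + C (1 -
θ) + A r θ (1 - θ)`. It is continuous on a compact set that includes `r = 0`. It has no zero there,
by `h0` on `r = 0` and by `h1` elsewhere, so it has a positive minimum modulus. -/
theorem exists_mul_add_le_norm {A B C : ℂ} (h0 : ∀ x y : ℝ, 0 ≤ x → 0 ≤ y → (x, y) ≠ (0, 0) →
      B * x + C * y ≠ 0)
    (h1 : ∀ x ∈ Icc (0 : ℝ) 1, ∀ y ∈ Icc (0 : ℝ) 1, (x, y) ≠ (0, 0) →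
      A * x * y + B * x + C * y ≠ 0) :
    ∃ c > 0, ∀ x ∈ Icc (0 : ℝ) 1, ∀ y ∈ Icc (0 : ℝ) 1,
      c * (x + y) ≤ ‖A * x * y + B * x + C * y‖ := by
  set S : Set (ℝ × ℝ) := {p | p.1 ∈ Icc (0 : ℝ) 2 ∧ p.2 ∈ Icc (0 : ℝ) 1 ∧ p.1 * p.2 ≤ 1 ∧
    p.1 * (1 - p.2) ≤ 1} with hS
  have hcomp : IsCompact S := by
    refine (isCompact_Icc.prod isCompact_Icc : IsCompact (Icc (0 : ℝ) 2 ×ˢ Icc (0 : ℝ) 1)).of_isClosed_subset ?_ ?_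
    · have : S = (Icc (0 : ℝ) 2 ×ˢ Icc (0 : ℝ) 1) ∩ {p | p.1 * p.2 ≤ 1} ∩
          {p | p.1 * (1 - p.2) ≤ 1} := by
        ext p
        exact ⟨fun h => ⟨⟨⟨h.1, h.2.1⟩, h.2.2.1⟩, h.2.2.2⟩, fun h => ⟨h.1.1.1, h.1.1.2, h.1.2, h.2⟩⟩
      rw [this]
      refine ((isClosed_Icc.prod isClosed_Icc).inter (isClosed_le (by fun_prop) (by fun_prop))).inter
        (isClosed_le (by fun_prop) (by fun_prop))
    · rintro p ⟨hp1, hp2, -⟩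
      exact ⟨hp1, hp2⟩
  set Q : ℝ × ℝ → ℝ := fun p => ‖B * p.2 + C * ((1 - p.2 : ℝ) : ℂ) + A * p.1 * p.2 * ((1 - p.2 : ℝ) : ℂ)‖
  have hne : S.Nonempty := ⟨(0, 0), by simp [hS]⟩
  obtain ⟨p, hp, hmin⟩ := hcomp.exists_isMinOn hne (f := Q) (by
    apply Continuous.continuousOn; fun_prop)
  have hpos : 0 < Q p := by
    refine norm_pos_iff.2 ?_
    obtain ⟨⟨hr0, -⟩, ⟨ha0, ha1⟩, hb1, hb2⟩ := hp
    rcases hr0.eq_or_lt with hr | hr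
    · rw [← hr]
      simpa using h0 p.2 (1 - p.2) ha0 (by linarith) (by
        intro h
        simp only [Prod.mk.injEq] at h
        linarith [h.1, h.2])
    · have := h1 (p.1 * p.2) ⟨by positivity, hb1⟩ (p.1 * (1 - p.2))
        ⟨mul_nonneg hr.le (by linarith), hb2⟩ (by
          intro h
          simp only [Prod.mk.injEq, mul_eq_zero, hr.ne', false_or] at h
          linarith [h.1, h.2])
      intro h
      refine this ?_
      push_cast at h ⊢
      linear_combination (p.1 : ℂ) * h
  refine ⟨Q p, hpos, fun x hx y hy => ?_⟩
  rcases eq_or_ne (x + y) 0 with h | h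
  · rw [h, mul_zero]; exact norm_nonneg _
  · have hr : 0 < x + y := lt_of_le_of_ne (add_nonneg hx.1 hy.1) h.symm
    have hy' : 1 - x / (x + y) = y / (x + y) := by field_simp; ring
    have hmem : (x + y, x / (x + y)) ∈ S := by
      refine ⟨⟨hr.le, by linarith [hx.2, hy.2]⟩, ⟨div_nonneg hx.1 hr.le, ?_⟩, ?_, ?_⟩
      · rw [div_le_one hr]; linarith [hy.1]
      · simp only; rw [mul_div_cancel₀ _ h]; exact hx.2
      · simp only; rw [hy', mul_div_cancel₀ _ h]; exact hy.2
    have h2 : Q p ≤ Q (x + y, x / (x + y)) := hmin hmem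
    have hc : (x : ℂ) + y ≠ 0 := by exact_mod_cast h
    have h3 : A * x * y + B * x + C * y = ((x + y : ℝ) : ℂ) * (B * ((x / (x + y) : ℝ) : ℂ)
        + C * ((1 - x / (x + y) : ℝ) : ℂ) + A * ((x + y : ℝ) : ℂ) * ((x / (x + y) : ℝ) : ℂ) *
          ((1 - x / (x + y) : ℝ) : ℂ)) := by
      rw [hy']
      push_cast
      field_simp
      ring
    rw [h3, norm_mul, Complex.norm_real, Real.norm_of_nonneg hr.le, mul_comm]
    gcongr

/-- Three cases. If `D ≠ 0`, the kernel is bounded. If `D = 0` and the linear part has no zero in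
the closed quadrant except the origin, the kernel is at most a multiple of `1 / (x + y)` and
Hilbert's inequality applies. Otherwise `C = -(B a)` with `a > 0`, and `A / B` cannot be real; this
is the kernel of `isL2Kernel_cusp`. -/
theorem isL2Kernel_bilinear {A B C D : ℂ} (h : ∀ x ∈ Icc (0 : ℝ) 1, ∀ y ∈ Icc (0 : ℝ) 1,
      (x, y) ≠ (0, 0) → A * x * y + B * x + C * y + D ≠ 0) :
    IsL2Kernel (Ioo 0 1) (Ioo 0 1) fun x y => (A * x * y + B * x + C * y + D)⁻¹ := by
  rcases eq_or_ne D 0 with rfl | hD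
  · simp only [add_zero] at h ⊢
    have hB : B ≠ 0 := by simpa using h 1 (by simp) 0 (by simp) (by simp)
    by_cases hcone : ∀ x y : ℝ, 0 ≤ x → 0 ≤ y → (x, y) ≠ (0, 0) → B * x + C * y ≠ 0
    · obtain ⟨c, hc, hb⟩ := exists_mul_add_le_norm hcone h
      refine isL2Kernel_of_norm_le (C := c⁻¹) (by positivity) fun x hx y hy => ?_
      have := hb x (Ioo_subset_Icc_self hx) y (Ioo_subset_Icc_self hy)
      have hxy : 0 < x + y := add_pos hx.1 hy.1
      rw [norm_inv, one_div, ← mul_inv]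
      exact inv_anti₀ (by positivity) this
    · push Not at hcone
      obtain ⟨x, y, hx, hy, hxy, h0⟩ := hcone
      have hC : C ≠ 0 := by simpa using h 0 (by simp) 1 (by simp) (by simp)
      have hx' : 0 < x := by
        refine lt_of_le_of_ne hx fun hx0 => hxy ?_
        have : y = 0 := by simpa [← hx0, hC] using h0
        rw [← hx0, this]
      have hy' : 0 < y := by
        refine lt_of_le_of_ne hy fun hy0 => hxy ?_
        have : x = 0 := by simpa [← hy0, hB] using h0
        rw [← hy0, this]
      set a := x / y with ha
      have ha0 : 0 < a := by positivity
      have hCa : C = -(B * a) := by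
        have : (y : ℂ) ≠ 0 := by exact_mod_cast hy'.ne'
        rw [ha]; push_cast
        field_simp
        linear_combination h0
      have hα : (A / B).im ≠ 0 := by
        intro him
        set r := (A / B).re with hr
        have hA : A = B * r := by
          have : A / B = r := Complex.ext rfl (by simpa using him)
          rw [← this]; field_simp
        -- If `A / B = r` were real, the zero curve `a / x = 1 / y + r` would enter the square. The
        -- number `d = 1 / y` is large enough that both `1 / d` and `a / (d + r)` lie in the unit
        -- interval.
        set d : ℝ := 1 + 2 * |r| + 2 * a with hd
        have hd0 : 0 < d := by positivity
        have hy0 : 0 < 1 / d := by positivity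
        have hy1 : 1 / d ≤ 1 := by
          rw [div_le_one hd0, hd]
          linarith [abs_nonneg r]
        have hden : d + r ≥ 2 * a := by rw [hd]; linarith [neg_abs_le r, abs_nonneg r]
        have hden0 : 0 < d + r := by linarith
        refine h (a / (d + r)) ⟨by positivity, ?_⟩ (1 / d) ⟨hy0.le, hy1⟩ (by
          intro h; simp only [Prod.mk.injEq] at h; exact hy0.ne' h.2) ?_
        · rw [div_le_one hden0]; linarith
        · rw [hA, hCa]
          have h1 : (d : ℂ) ≠ 0 := by exact_mod_cast hd0.ne'
          have h2 : (d : ℂ) + r ≠ 0 := by exact_mod_cast hden0.ne'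
          push_cast
          field_simp
          ring
      have := isL2Kernel_cusp hB ha0 hα
      convert! this using 3 with x y
      rw [hCa]
      congr 1
      field_simp
      ring
  · have hcont : ContinuousOn (fun p : ℝ × ℝ => ‖A * p.1 * p.2 + B * p.1 + C * p.2 + D‖)
        (Icc (0 : ℝ) 1 ×ˢ Icc (0 : ℝ) 1) := by
      apply Continuous.continuousOn; fun_prop
    obtain ⟨p, hp, hmin⟩ := (isCompact_Icc.prod isCompact_Icc).exists_isMinOn
      ⟨(0, 0), by simp⟩ hcont
    have hpos : 0 < ‖A * p.1 * p.2 + B * p.1 + C * p.2 + D‖ := by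
      rw [norm_pos_iff]
      by_cases h0 : p = (0, 0)
      · rw [h0]; simpa using hD
      · exact h p.1 hp.1 p.2 hp.2 h0
    set c := ‖A * p.1 * p.2 + B * p.1 + C * p.2 + D‖
    -- A bounded kernel also falls under Hilbert's inequality, since `1 / (x + y) ≥ 1 / 2` on the
    -- unit square.
    refine isL2Kernel_of_norm_le (C := 2 * c⁻¹) (by positivity) fun x hx y hy => ?_
    have h1 : c ≤ ‖A * x * y + B * x + C * y + D‖ :=
      isMinOn_iff.1 hmin (x, y) ⟨Ioo_subset_Icc_self hx, Ioo_subset_Icc_self hy⟩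
    have hxy : 0 < x + y := add_pos hx.1 hy.1
    rw [norm_inv]
    calc _ ≤ c⁻¹ := inv_anti₀ hpos h1
      _ = 2 * c⁻¹ * (1 / 2) := by ring
      _ ≤ _ := by gcongr; linarith [hx.2, hy.2]

theorem IsL2Kernel.of_comp {S T : Set ℝ} {k : ℝ → ℝ → ℂ} {e e' : ℝ → ℝ}
    (he : MeasurePreserving e) (hemb : MeasurableEmbedding e) (hS : e ⁻¹' S = Ioo 0 1)
    (hSm : MeasurableSet S)
    (he' : MeasurePreserving e') (hemb' : MeasurableEmbedding e') (hT : e' ⁻¹' T = Ioo 0 1)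
    (h : IsL2Kernel (Ioo 0 1) (Ioo 0 1) fun x y => k (e x) (e' y)) : IsL2Kernel S T k := by
  obtain ⟨K, hK⟩ := h
  refine ⟨K, fun f hf => ?_⟩
  have hfe : MemLp (f ∘ e) 2 (volume.restrict (Ioo 0 1)) := by
    rw [← hS]
    exact hf.comp_measurePreserving (he.restrict_preimage hSm)
  have := hK _ hfe
  rw [← he.setLIntegral_comp_preimage_emb hemb (fun x => ‖f x‖ₑ ^ 2),
    ← he'.setLIntegral_comp_preimage_emb hemb', hS, hT]
  refine le_trans (le_of_eq (lintegral_congr fun y => ?_)) this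
  rw [← he.setIntegral_preimage_emb hemb, hS]
  rfl

theorem IsL2Kernel.union_right {S T T' : Set ℝ} {k : ℝ → ℝ → ℂ} (h : IsL2Kernel S T k)
    (h' : IsL2Kernel S T' k) : IsL2Kernel S (T ∪ T') k := by
  obtain ⟨K, hK⟩ := h
  obtain ⟨K', hK'⟩ := h'
  refine ⟨K + K', fun f hf => ?_⟩
  grw [lintegral_union_le, hK f hf, hK' f hf]
  push_cast
  rw [add_mul]

theorem enorm_add_sq_le (a b : ℂ) : ‖a + b‖ₑ ^ 2 ≤ 2 * ‖a‖ₑ ^ 2 + 2 * ‖b‖ₑ ^ 2 := by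
  rw [← ofReal_norm, ← ofReal_norm, ← ofReal_norm, ← ENNReal.ofReal_pow (norm_nonneg _),
    ← ENNReal.ofReal_pow (norm_nonneg _), ← ENNReal.ofReal_pow (norm_nonneg _),
    ← ENNReal.ofReal_ofNat 2, ← ENNReal.ofReal_mul (by norm_num),
    ← ENNReal.ofReal_mul (by norm_num), ← ENNReal.ofReal_add (by positivity) (by positivity)]
  refine ENNReal.ofReal_le_ofReal ?_
  nlinarith [norm_add_le a b, norm_nonneg (a + b), sq_nonneg (‖a‖ - ‖b‖)]

theorem IsL2Kernel.union_left {S S' T : Set ℝ} {k : ℝ → ℝ → ℂ} (hS' : MeasurableSet S')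
    (hd : Disjoint S S') (hT : MeasurableSet T) (hkm : Measurable (Function.uncurry k))
    (hk : ∀ y ∈ T, MemLp (fun x => k x y) 2 (volume.restrict (S ∪ S')))
    (h : IsL2Kernel S T k) (h' : IsL2Kernel S' T k) : IsL2Kernel (S ∪ S') T k := by
  obtain ⟨K, hK⟩ := h
  obtain ⟨K', hK'⟩ := h'
  refine ⟨2 * K + 2 * K', fun f hf => ?_⟩
  have h1 := hK f (hf.mono_measure (Measure.restrict_mono subset_union_left le_rfl))
  have h2 := hK' f (hf.mono_measure (Measure.restrict_mono subset_union_right le_rfl))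
  have hm : AEMeasurable (fun y => 2 * ‖∫ x in S, f x * k x y‖ₑ ^ 2) (volume.restrict T) := by
    refine AEMeasurable.const_mul (AEMeasurable.pow_const (AEStronglyMeasurable.enorm ?_) 2) _
    have : AEStronglyMeasurable (fun p : ℝ × ℝ => f p.2 * k p.2 p.1)
        ((volume.restrict T).prod (volume.restrict S)) := by
      refine AEStronglyMeasurable.mul ?_ (hkm.comp measurable_swap).aestronglyMeasurable
      exact (hf.mono_measure (Measure.restrict_mono subset_union_left le_rfl)).1.comp_snd
    exact this.integral_prod_right'
  calc _ ≤ ∫⁻ y in T, (2 * ‖∫ x in S, f x * k x y‖ₑ ^ 2 + 2 * ‖∫ x in S', f x * k x y‖ₑ ^ 2) := by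
        refine setLIntegral_mono' hT fun y hy => ?_
        have hi : IntegrableOn (fun x => f x * k x y) (S ∪ S') :=
          MemLp.integrable_mul hf (hk y hy)
        rw [setIntegral_union hd hS' (hi.mono_set subset_union_left)
          (hi.mono_set subset_union_right)]
        exact enorm_add_sq_le _ _
    _ ≤ 2 * (K * ∫⁻ x in S, ‖f x‖ₑ ^ 2) + 2 * (K' * ∫⁻ x in S', ‖f x‖ₑ ^ 2) := by
        rw [lintegral_add_left' hm, lintegral_const_mul' _ _ (by simp),
          lintegral_const_mul' _ _ (by simp)]
        gcongr
    _ ≤ 2 * (K * ∫⁻ x in S ∪ S', ‖f x‖ₑ ^ 2) + 2 * (K' * ∫⁻ x in S ∪ S', ‖f x‖ₑ ^ 2) := by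
        gcongr
        · exact subset_union_left
        · exact subset_union_right
    _ = _ := by push_cast; ring

theorem IsL2Kernel.congr_ae {S S' T T' : Set ℝ} {k : ℝ → ℝ → ℂ} (h : IsL2Kernel S T k)
    (hS : S =ᵐ[volume] S') (hT : T =ᵐ[volume] T') : IsL2Kernel S' T' k := by
  obtain ⟨K, hK⟩ := h
  refine ⟨K, fun f hf => ?_⟩
  rw [← Measure.restrict_congr_set hS] at hf
  have := hK f hf
  rwa [Measure.restrict_congr_set hS, Measure.restrict_congr_set hT] at this

/-- The parametrization of the half of `[-1,1]` adjacent to `1` or `-1`. -/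
def halfMap (σ : ℝ) (x : ℝ) : ℝ := σ * (1 - x)

theorem measurePreserving_halfMap {σ : ℝ} (hσ : σ = 1 ∨ σ = -1) :
    MeasurePreserving (halfMap σ) volume volume := by
  rcases hσ with rfl | rfl
  · have : halfMap 1 = fun x => 1 - x := by ext x; simp [halfMap]
    rw [this]
    exact Measure.measurePreserving_sub_left volume (1 : ℝ)
  · have : halfMap (-1) = fun x => x - 1 := by ext x; simp [halfMap]
    rw [this]
    exact measurePreserving_sub_right volume (1 : ℝ)

theorem measurableEmbedding_halfMap {σ : ℝ} (hσ : σ = 1 ∨ σ = -1) :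
    MeasurableEmbedding (halfMap σ) := by
  refine Measurable.measurableEmbedding (by unfold halfMap; fun_prop) fun x y h => ?_
  rcases hσ with rfl | rfl <;> simpa [halfMap] using h

/-- The square is cut into four quarters. `halfMap` carries a half interval to `(0, 1)` with its
endpoint at `0`, so each quarter has one possibly singular corner, at the origin. -/
theorem isL2Kernel_square {A B C D : ℂ}
    (h : ∀ x ∈ Icc (-1 : ℝ) 1, ∀ y ∈ Icc (-1 : ℝ) 1, A * x * y + B * x + C * y + D = 0 →
      (x = -1 ∨ x = 1) ∧ (y = -1 ∨ y = 1)) :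
    IsL2Kernel (Icc (-1) 1) (Icc (-1) 1) fun x y => (A * x * y + B * x + C * y + D)⁻¹ := by
  set k : ℝ → ℝ → ℂ := fun x y => (A * x * y + B * x + C * y + D)⁻¹ with hk
  have hkm : Measurable (Function.uncurry k) := by
    simp only [hk, Function.uncurry_def]
    fun_prop
  have hq : ∀ σ σ' : ℝ, (σ = 1 ∨ σ = -1) → (σ' = 1 ∨ σ' = -1) →
      IsL2Kernel (Ioo 0 1) (Ioo 0 1) fun x y => k (halfMap σ x) (halfMap σ' y) := by
    intro σ σ' hσ hσ'
    have e : (fun x y => k (halfMap σ x) (halfMap σ' y)) = fun x y : ℝ =>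
        ((A * σ * σ') * x * y + (-(A * σ * σ' + B * σ)) * x + (-(A * σ * σ' + C * σ')) * y
          + (A * σ * σ' + B * σ + C * σ' + D))⁻¹ := by
      ext x y
      simp only [hk, halfMap]
      congr 1
      push_cast
      ring
    rw [e]
    refine isL2Kernel_bilinear fun x hx y hy hxy h0 => ?_
    have hmem : ∀ {σ x : ℝ}, (σ = 1 ∨ σ = -1) → x ∈ Icc (0 : ℝ) 1 → halfMap σ x ∈ Icc (-1 : ℝ) 1 := by
      rintro σ x (rfl | rfl) hx <;> constructor <;> simp only [halfMap] <;> linarith [hx.1, hx.2]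
    have hzero : ∀ {σ x : ℝ}, (σ = 1 ∨ σ = -1) → x ∈ Icc (0 : ℝ) 1 →
        (halfMap σ x = -1 ∨ halfMap σ x = 1) → x = 0 := by
      rintro σ x (rfl | rfl) hx (h | h) <;> simp only [halfMap] at h <;> linarith [hx.1, hx.2]
    have := h (halfMap σ x) (hmem hσ hx) (halfMap σ' y) (hmem hσ' hy) (by
      rw [← h0]
      simp only [halfMap]
      push_cast
      ring)
    exact hxy (by rw [hzero hσ hx this.1, hzero hσ' hy this.2])
  have hp1 : halfMap 1 ⁻¹' (Ioo 0 1) = Ioo 0 1 := by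
    ext x; simp only [halfMap, mem_preimage, mem_Ioo]; constructor <;> rintro ⟨a, b⟩ <;>
      constructor <;> linarith
  have hp2 : halfMap (-1) ⁻¹' (Ioo (-1) 0) = Ioo 0 1 := by
    ext x; simp only [halfMap, mem_preimage, mem_Ioo]; constructor <;> rintro ⟨a, b⟩ <;>
      constructor <;> linarith
  have m1 := measurePreserving_halfMap (σ := 1) (Or.inl rfl)
  have m2 := measurePreserving_halfMap (σ := -1) (Or.inr rfl)
  have b1 := measurableEmbedding_halfMap (σ := 1) (Or.inl rfl)
  have b2 := measurableEmbedding_halfMap (σ := -1) (Or.inr rfl)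
  have q11 := IsL2Kernel.of_comp m1 b1 hp1 measurableSet_Ioo m1 b1 hp1 (hq 1 1 (by simp) (by simp))
  have q12 := IsL2Kernel.of_comp m1 b1 hp1 measurableSet_Ioo m2 b2 hp2 (hq 1 (-1) (by simp) (by simp))
  have q21 := IsL2Kernel.of_comp m2 b2 hp2 measurableSet_Ioo m1 b1 hp1 (hq (-1) 1 (by simp) (by simp))
  have q22 := IsL2Kernel.of_comp m2 b2 hp2 measurableSet_Ioo m2 b2 hp2
    (hq (-1) (-1) (by simp) (by simp))
  have hae : (Ioo (-1 : ℝ) 0 ∪ Ioo 0 1 : Set ℝ) =ᵐ[volume] Icc (-1) 1 := by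
    have h1 : (Ioo (-1 : ℝ) 0 ∪ Ioo 0 1 : Set ℝ) =ᵐ[volume] (Ico (-1 : ℝ) 0 ∪ Icc 0 1 : Set ℝ) :=
      Ioo_ae_eq_Ico.union Ioo_ae_eq_Icc
    rwa [Ico_union_Icc_eq_Icc (by norm_num) (by norm_num)] at h1
  refine IsL2Kernel.congr_ae ?_ hae hae
  refine IsL2Kernel.union_left measurableSet_Ioo ?_ (measurableSet_Ioo.union measurableSet_Ioo) hkm
    (fun y hy => ?_) (q22.union_right q21) (q12.union_right q11)
  · rw [Set.disjoint_left]
    rintro x hx hx'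
    exact lt_asymm hx.2 hx'.1
  · have hy' : y ∈ Ioo (-1 : ℝ) 1 := by
      rcases hy with hy | hy
      · exact ⟨hy.1, hy.2.trans one_pos⟩
      · exact ⟨by linarith [hy.1], hy.2⟩
    have hc : ContinuousOn (fun x => k x y) (Icc (-1) 1) := by
      refine ContinuousOn.inv₀ (by apply Continuous.continuousOn; fun_prop) fun x hx h0 => ?_
      rcases (h x hx y (Ioo_subset_Icc_self hy') h0).2 with h1 | h1
      · linarith [hy'.1]
      · linarith [hy'.2]
    rw [Measure.restrict_congr_set hae]
    obtain ⟨K, hK⟩ := isCompact_Icc.exists_bound_of_continuousOn hc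
    exact MemLp.of_bound (hc.aestronglyMeasurable measurableSet_Icc) K
      ((ae_restrict_iff' measurableSet_Icc).2 (Eventually.of_forall hK))

/-! ### Primitives of square integrable functions and weak derivatives -/

/-- On `[-1,1]`, the function `f` is a primitive of the square integrable function `g`. -/
structure HasPrim (f g : ℝ → ℂ) : Prop where
  memLp : MemLp g 2 paramMeasure
  eq_add_integral : ∀ t ∈ Icc (-1 : ℝ) 1, f t = f (-1) + ∫ s in (-1 : ℝ)..t, g s

theorem intervalIntegrable_of_integrable {g : ℝ → ℂ} (hg : Integrable g paramMeasure) {a b : ℝ}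
    (ha : a ∈ Icc (-1 : ℝ) 1) (hb : b ∈ Icc (-1 : ℝ) 1) : IntervalIntegrable g volume a b := by
  have h : IntegrableOn g (uIcc (-1 : ℝ) 1) := by rwa [uIcc_of_le (by norm_num)]
  refine (h.mono_set ?_).intervalIntegrable
  rw [uIcc_of_le (show (-1 : ℝ) ≤ 1 by norm_num)]
  exact uIcc_subset_Icc ha hb

theorem left_mem : (-1 : ℝ) ∈ Icc (-1 : ℝ) 1 := by simp

theorem right_mem : (1 : ℝ) ∈ Icc (-1 : ℝ) 1 := by simp

theorem setIntegral_Icc_eq {E : Type*} [NormedAddCommGroup E] [NormedSpace ℝ E] (f : ℝ → E) :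
    ∫ t in Icc (-1 : ℝ) 1, f t = ∫ t in (-1 : ℝ)..1, f t := by
  rw [intervalIntegral.integral_of_le (by norm_num), integral_Icc_eq_integral_Ioc]

theorem memLp_param_of_continuousOn {f : ℝ → ℂ} (hf : ContinuousOn f (Icc (-1) 1)) (p : ℝ≥0∞) :
    MemLp f p paramMeasure := by
  obtain ⟨K, hK⟩ := isCompact_Icc.exists_bound_of_continuousOn hf
  exact MemLp.of_bound (hf.aestronglyMeasurable measurableSet_Icc) K
    ((ae_restrict_iff' measurableSet_Icc).2 (Eventually.of_forall hK))

theorem MemLp.continuousOn_mul_param {f g : ℝ → ℂ} {p : ℝ≥0∞} (hf : ContinuousOn f (Icc (-1) 1))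
    (hg : MemLp g p paramMeasure) : MemLp (fun t => f t * g t) p paramMeasure :=
  hg.mul' (memLp_param_of_continuousOn hf ⊤)

/-- The increments are dominated by those of the primitive of `‖g‖`, which is a real function. -/
theorem absolutelyContinuous_primitive {g : ℝ → ℂ} (hg : Integrable g paramMeasure) :
    AbsolutelyContinuousOnInterval (fun t => ∫ s in (-1 : ℝ)..t, g s) (-1) 1 := by
  have hn : IntervalIntegrable (fun s => ‖g s‖) volume (-1) 1 :=
    (intervalIntegrable_of_integrable hg left_mem right_mem).norm
  have h := hn.absolutelyContinuousOnInterval_intervalIntegral (c := -1) left_mem_uIcc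
  refine squeeze_zero' (Eventually.of_forall fun E => Finset.sum_nonneg fun i _ => dist_nonneg) ?_ h
  filter_upwards [mem_inf_of_right (mem_principal_self _)] with E hE
  refine Finset.sum_le_sum fun i hi => ?_
  have hmem : ∀ {x : ℝ}, x ∈ uIcc (-1 : ℝ) 1 → x ∈ Icc (-1 : ℝ) 1 := fun hx => by
    rwa [uIcc_of_le (by norm_num)] at hx
  have h1 := hmem (hE.1 i hi).1
  have h2 := hmem (hE.1 i hi).2
  have ii := fun {a b : ℝ} => intervalIntegrable_of_integrable hg (a := a) (b := b)
  rw [dist_eq_norm, dist_eq_norm,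
    intervalIntegral.integral_interval_sub_left (ii left_mem h1) (ii left_mem h2),
    intervalIntegral.integral_interval_sub_left (ii left_mem h1).norm (ii left_mem h2).norm]
  exact intervalIntegral.norm_integral_le_abs_integral_norm

namespace HasPrim

variable {f g f₁ g₁ : ℝ → ℂ}

theorem integrable (h : HasPrim f g) : Integrable g paramMeasure :=
  h.memLp.integrable (by norm_num)

theorem intervalIntegrable (h : HasPrim f g) {a b : ℝ} (ha : a ∈ Icc (-1 : ℝ) 1)
    (hb : b ∈ Icc (-1 : ℝ) 1) : IntervalIntegrable g volume a b :=
  intervalIntegrable_of_integrable h.integrable ha hb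

theorem sub_eq (h : HasPrim f g) {a b : ℝ} (ha : a ∈ Icc (-1 : ℝ) 1) (hb : b ∈ Icc (-1 : ℝ) 1) :
    f b - f a = ∫ s in a..b, g s := by
  rw [h.eq_add_integral a ha, h.eq_add_integral b hb, add_sub_add_left_eq_sub,
    intervalIntegral.integral_interval_sub_left (h.intervalIntegrable left_mem hb)
      (h.intervalIntegrable left_mem ha)]

theorem congr_ae (h : HasPrim f g) (hg : g =ᵐ[paramMeasure] g₁) : HasPrim f g₁ := by
  refine ⟨(memLp_congr_ae hg).1 h.memLp, fun t ht => ?_⟩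
  rw [h.eq_add_integral t ht]
  congr 1
  refine intervalIntegral.integral_congr_ae ?_
  rw [uIoc_of_le ht.1]
  have := (ae_restrict_iff' measurableSet_Icc).1 hg
  filter_upwards [this] with x hx hx'
  exact hx ⟨hx'.1.le, hx'.2.trans ht.2⟩

theorem absolutelyContinuous (h : HasPrim f g) : AbsolutelyContinuousOnInterval f (-1) 1 := by
  have h1 := absolutelyContinuous_primitive h.integrable
  refine squeeze_zero' (Eventually.of_forall fun E => Finset.sum_nonneg fun i _ => dist_nonneg) ?_ h1
  filter_upwards [mem_inf_of_right (mem_principal_self _)] with E hE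
  refine Finset.sum_le_sum fun i hi => ?_
  have hmem : ∀ {x : ℝ}, x ∈ uIcc (-1 : ℝ) 1 → x ∈ Icc (-1 : ℝ) 1 := fun hx => by
    rwa [uIcc_of_le (by norm_num)] at hx
  rw [h.eq_add_integral _ (hmem (hE.1 i hi).1), h.eq_add_integral _ (hmem (hE.1 i hi).2), dist_add_left]

theorem continuousOn (h : HasPrim f g) : ContinuousOn f (Icc (-1) 1) := by
  have := h.absolutelyContinuous.continuousOn
  rwa [uIcc_of_le (by norm_num)] at this

theorem ae_hasDerivAt (h : HasPrim f g) : ∀ᵐ x : ℝ, x ∈ uIcc (-1 : ℝ) 1 → HasDerivAt f (g x) x := by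
  have h1 := (h.intervalIntegrable left_mem right_mem).ae_hasDerivAt_integral
  have hne : ∀ᵐ x : ℝ, x ≠ -1 ∧ x ≠ 1 := by
    filter_upwards [compl_mem_ae_iff.2 (measure_singleton (-1 : ℝ)),
      compl_mem_ae_iff.2 (measure_singleton (1 : ℝ))] with x h1 h2
    exact ⟨h1, h2⟩
  filter_upwards [h1, hne] with x hx hx' hmem
  have := (hx hmem (-1) left_mem_uIcc).const_add (f (-1))
  rw [uIcc_of_le (by norm_num)] at hmem
  refine this.congr_of_eventuallyEq ?_
  have hmem' : x ∈ Ioo (-1 : ℝ) 1 :=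
    ⟨lt_of_le_of_ne hmem.1 hx'.1.symm, lt_of_le_of_ne hmem.2 hx'.2⟩
  filter_upwards [isOpen_Ioo.mem_nhds hmem'] with y hy
  exact h.eq_add_integral y (Ioo_subset_Icc_self hy)

/-- The product rule. -/
theorem mul (h : HasPrim f g) (h₁ : HasPrim f₁ g₁) :
    HasPrim (fun t => f t * f₁ t) (fun t => g t * f₁ t + f t * g₁ t) := by
  have hm : MemLp (fun t => g t * f₁ t + f t * g₁ t) 2 paramMeasure := by
    refine MemLp.add ?_ (MemLp.continuousOn_mul_param h.continuousOn h₁.memLp)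
    simpa only [mul_comm] using MemLp.continuousOn_mul_param h₁.continuousOn h.memLp
  have hp : HasPrim (fun t => ∫ s in (-1 : ℝ)..t, (g s * f₁ s + f s * g₁ s))
      (fun t => g t * f₁ t + f t * g₁ t) := ⟨hm, fun t _ => by simp⟩
  -- The product minus the expected primitive is absolutely continuous with derivative zero almost
  -- everywhere, hence constant.
  have hac : AbsolutelyContinuousOnInterval (fun t => f t * f₁ t -
      ∫ s in (-1 : ℝ)..t, (g s * f₁ s + f s * g₁ s)) (-1) 1 :=
    AbsolutelyContinuousOnInterval.sub (f := fun t => f t * f₁ t)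
      (h.absolutelyContinuous.smul h₁.absolutelyContinuous) hp.absolutelyContinuous
  obtain ⟨C, hC⟩ := hac.const_of_ae_hasDerivAt_zero (by
    filter_upwards [h.ae_hasDerivAt, h₁.ae_hasDerivAt, hp.ae_hasDerivAt] with x hx hx₁ hxp hmem
    have := ((hx hmem).mul (hx₁ hmem)).sub (hxp hmem)
    rwa [sub_self] at this)
  rw [uIcc_of_le (by norm_num)] at hC
  refine ⟨hm, fun t ht => ?_⟩
  have h1 := hC t ht
  have h2 := hC (-1) left_mem
  simp only [intervalIntegral.integral_same, sub_zero] at h1 h2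
  rw [h2, ← h1]
  ring

theorem of_hasDerivAt (hd : ∀ t ∈ Icc (-1 : ℝ) 1, HasDerivAt f (g t) t)
    (hc : ContinuousOn g (Icc (-1) 1)) : HasPrim f g := by
  refine ⟨memLp_param_of_continuousOn hc 2, fun t ht => ?_⟩
  have hsub : uIcc (-1) t ⊆ Icc (-1 : ℝ) 1 := uIcc_subset_Icc left_mem ht
  rw [intervalIntegral.integral_eq_sub_of_hasDerivAt (fun s hs => hd s (hsub hs))
    ((hc.mono hsub).intervalIntegrable)]
  ring

theorem add (h : HasPrim f g) (h₁ : HasPrim f₁ g₁) :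
    HasPrim (fun t => f t + f₁ t) (fun t => g t + g₁ t) := by
  refine ⟨h.memLp.add h₁.memLp, fun t ht => ?_⟩
  rw [intervalIntegral.integral_add (h.intervalIntegrable left_mem ht)
    (h₁.intervalIntegrable left_mem ht), h.eq_add_integral t ht, h₁.eq_add_integral t ht]
  ring

theorem const_mul (h : HasPrim f g) (c : ℂ) : HasPrim (fun t => c * f t) (fun t => c * g t) := by
  refine ⟨h.memLp.const_mul c, fun t ht => ?_⟩
  rw [intervalIntegral.integral_const_mul, h.eq_add_integral t ht]
  ring

theorem sub (h : HasPrim f g) (h₁ : HasPrim f₁ g₁) :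
    HasPrim (fun t => f t - f₁ t) (fun t => g t - g₁ t) := by
  have := h.add (h₁.const_mul (-1))
  simpa only [neg_one_mul, ← sub_eq_add_neg] using this

theorem sum {ι : Type*} {s : Finset ι} {F G : ι → ℝ → ℂ} (h : ∀ i ∈ s, HasPrim (F i) (G i)) :
    HasPrim (fun t => ∑ i ∈ s, F i t) (fun t => ∑ i ∈ s, G i t) := by
  refine ⟨memLp_finsetSum s fun i hi => (h i hi).memLp, fun t ht => ?_⟩
  rw [intervalIntegral.integral_finsetSum fun i hi => (h i hi).intervalIntegrable left_mem ht,
    ← Finset.sum_add_distrib]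
  exact Finset.sum_congr rfl fun i hi => (h i hi).eq_add_integral t ht

/-- A primitive has the weak derivative that one expects. -/
theorem integral_deriv_mul (h : HasPrim f g) {ψ : ℝ → ℝ} (hψ : ContDiff ℝ ∞ ψ)
    (hs : tsupport ψ ⊆ Ioo (-1 : ℝ) 1) :
    ∫ t in Icc (-1 : ℝ) 1, ((deriv ψ t : ℝ) : ℂ) * f t = -∫ t in Icc (-1 : ℝ) 1, ((ψ t : ℝ) : ℂ) * g t := by
  have hd : ∀ t, HasDerivAt (fun t => ((ψ t : ℝ) : ℂ)) ((deriv ψ t : ℝ) : ℂ) t := fun t =>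
    ((hψ.differentiable (by simp)).differentiableAt.hasDerivAt).ofReal_comp
  have hcont : Continuous fun t => ((deriv ψ t : ℝ) : ℂ) :=
    Complex.continuous_ofReal.comp (hψ.continuous_deriv (by simp))
  have hp : HasPrim (fun t => ((ψ t : ℝ) : ℂ)) (fun t => ((deriv ψ t : ℝ) : ℂ)) :=
    of_hasDerivAt (fun t _ => hd t) hcont.continuousOn
  have h1 := (hp.mul h).sub_eq left_mem right_mem
  have hz : ∀ t, t ∉ Ioo (-1 : ℝ) 1 → ψ t = 0 := fun t ht =>
    image_eq_zero_of_notMem_tsupport fun h => ht (hs h)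
  rw [hz 1 (by simp), hz (-1) (by simp), intervalIntegral.integral_add] at h1
  · rw [setIntegral_Icc_eq, setIntegral_Icc_eq]
    simp only [Complex.ofReal_zero, zero_mul, sub_zero] at h1
    exact eq_neg_of_add_eq_zero_left h1.symm
  · refine intervalIntegrable_of_integrable ?_ left_mem right_mem
    exact (memLp_param_of_continuousOn (hcont.continuousOn.mul h.continuousOn) 1).integrable le_rfl
  · refine intervalIntegrable_of_integrable ?_ left_mem right_mem
    exact (MemLp.continuousOn_mul_param (Complex.continuous_ofReal.comp hψ.continuous).continuousOn
      h.memLp).integrable (by norm_num)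

end HasPrim

/-! ### Matrix valued functions through their entries -/

theorem enorm_matrix_sq (A : Matrix (Fin 2) (Fin 2) ℂ) :
    ‖A‖ₑ ^ 2 = ∑ p, ∑ q, ‖A p q‖ₑ ^ 2 := by
  have h : ‖A‖₊ ^ 2 = ∑ p, ∑ q, ‖A p q‖₊ ^ 2 := by
    rw [Matrix.frobenius_nnnorm_def, ← NNReal.rpow_natCast, ← NNReal.rpow_mul]
    simp
  simp only [enorm_eq_nnnorm]
  exact_mod_cast h

theorem enorm_matrix_apply_le (A : Matrix (Fin 2) (Fin 2) ℂ) (p q : Fin 2) :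
    ‖A p q‖ₑ ≤ ‖A‖ₑ := by
  have h : ‖A p q‖ₑ ^ 2 ≤ ‖A‖ₑ ^ 2 := by
    rw [enorm_matrix_sq]
    exact (Finset.single_le_sum (f := fun q => ‖A p q‖ₑ ^ 2) (fun _ _ => zero_le) (Finset.mem_univ q)).trans
      (Finset.single_le_sum (f := fun p => ∑ q, ‖A p q‖ₑ ^ 2) (fun _ _ => zero_le) (Finset.mem_univ p))
  exact (ENNReal.pow_le_pow_left_iff two_ne_zero).1 h

theorem matrix_eq_sum_smul_single (A : Matrix (Fin 2) (Fin 2) ℂ) :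
    A = ∑ p, ∑ q, A p q • Matrix.single p q (1 : ℂ) := by
  conv_lhs => rw [Matrix.matrix_eq_sum_single A]
  simp

theorem integral_matrix_apply {μ : Measure ℝ} {f : ℝ → Matrix (Fin 2) (Fin 2) ℂ}
    (hf : ∀ p q, Integrable (fun t => f t p q) μ) (p q : Fin 2) :
    (∫ t, f t ∂μ) p q = ∫ t, f t p q ∂μ := by
  have h : (∫ t, f t ∂μ) = ∑ p, ∑ q, (∫ t, f t p q ∂μ) • Matrix.single p q (1 : ℂ) := by
    have hi := fun p q => (hf p q).smul_const (Matrix.single p q (1 : ℂ))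
    calc (∫ t, f t ∂μ) = ∫ t, ∑ p, ∑ q, f t p q • Matrix.single p q (1 : ℂ) ∂μ :=
          integral_congr_ae (Eventually.of_forall fun t => matrix_eq_sum_smul_single (f t))
      _ = _ := by
        rw [integral_finsetSum _ fun p _ => integrable_finsetSum _ fun q _ => hi p q]
        refine Finset.sum_congr rfl fun p _ => ?_
        rw [integral_finsetSum _ fun q _ => hi p q]
        exact Finset.sum_congr rfl fun q _ => integral_smul_const _ _
  have h2 := matrix_eq_sum_smul_single (Matrix.of fun p q => ∫ t, f t p q ∂μ)
  simp only [Matrix.of_apply] at h2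
  rw [h, ← h2, Matrix.of_apply]

theorem aestronglyMeasurable_matrix {μ : Measure ℝ} {f : ℝ → Matrix (Fin 2) (Fin 2) ℂ}
    (hf : ∀ p q, AEStronglyMeasurable (fun t => f t p q) μ) : AEStronglyMeasurable f μ := by
  have h : f = fun t => ∑ p, ∑ q, f t p q • Matrix.single p q (1 : ℂ) :=
    funext fun t => matrix_eq_sum_smul_single (f t)
  rw [h]
  exact Finset.aestronglyMeasurable_fun_sum _ fun p _ =>
    Finset.aestronglyMeasurable_fun_sum _ fun q _ => (hf p q).smul_const _

theorem MeasureTheory.AEStronglyMeasurable.matrix_apply {μ : Measure ℝ}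
    {f : ℝ → Matrix (Fin 2) (Fin 2) ℂ} (hf : AEStronglyMeasurable f μ) (p q : Fin 2) :
    AEStronglyMeasurable (fun t => f t p q) μ :=
  (continuous_id.matrix_elem p q).comp_aestronglyMeasurable hf

theorem continuousOn_matrix {s : Set ℝ} {f : ℝ → Matrix (Fin 2) (Fin 2) ℂ}
    (hf : ∀ p q, ContinuousOn (fun t => f t p q) s) : ContinuousOn f s :=
  continuousOn_pi.2 fun p => continuousOn_pi.2 fun q => hf p q

theorem ContinuousOn.matrix_apply {s : Set ℝ} {f : ℝ → Matrix (Fin 2) (Fin 2) ℂ}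
    (hf : ContinuousOn f s) (p q : Fin 2) : ContinuousOn (fun t => f t p q) s :=
  (continuous_id.matrix_elem p q).comp_continuousOn hf

/-! ### Weak derivatives are derivatives -/

/-- A smooth function with support in `(-1,1)` and vanishing integral is the derivative of such a
function. -/
theorem exists_deriv_eq_of_integral_eq_zero {η : ℝ → ℝ} (hη : ContDiff ℝ ∞ η)
    (hc : HasCompactSupport η) (hs : tsupport η ⊆ Ioo (-1 : ℝ) 1) (h0 : ∫ t, η t = 0) :
    ∃ ψ : ℝ → ℝ, ContDiff ℝ ∞ ψ ∧ HasCompactSupport ψ ∧ tsupport ψ ⊆ Ioo (-1 : ℝ) 1 ∧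
      deriv ψ = η := by
  have hz : ∀ t, t ∉ tsupport η → η t = 0 := fun t ht => image_eq_zero_of_notMem_tsupport ht
  obtain ⟨a, b, ha, hb, hab⟩ : ∃ a b : ℝ, -1 < a ∧ b < 1 ∧ tsupport η ⊆ Icc a b := by
    rcases (tsupport η).eq_empty_or_nonempty with he | hne
    · exact ⟨0, 0, by norm_num, by norm_num, by simp [he]⟩
    · obtain ⟨a, haK, ha⟩ := hc.isCompact.exists_isLeast hne
      obtain ⟨b, hbK, hb⟩ := hc.isCompact.exists_isGreatest hne
      exact ⟨a, b, (hs haK).1, (hs hbK).2, fun x hx => ⟨ha hx, hb hx⟩⟩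
  let ψ : ℝ → ℝ := fun t => ∫ s in (-1 : ℝ)..t, η s
  have hd : ∀ t, HasDerivAt ψ (η t) t := fun t =>
    intervalIntegral.integral_hasDerivAt_right (hη.continuous.intervalIntegrable _ _)
      (hη.continuous.stronglyMeasurableAtFilter _ _) hη.continuous.continuousAt
  have hder : deriv ψ = η := funext fun t => (hd t).deriv
  have hsm : ContDiff ℝ ∞ ψ :=
    contDiff_infty_iff_deriv.2 ⟨fun t => (hd t).differentiableAt, by rwa [hder]⟩
  have hint : ∀ t, ψ t = ∫ s in Iic t, η s := fun t => by
    have hi : Integrable η := hη.continuous.integrable_of_hasCompactSupport hc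
    have h1 : ∫ s in Iic (-1 : ℝ), η s = 0 := by
      refine setIntegral_eq_zero_of_forall_eq_zero fun x hx => hz x fun h => ?_
      exact absurd (hs h).1 (not_lt.2 hx)
    have := intervalIntegral.integral_Iic_sub_Iic (hi.integrableOn (s := Iic (-1)))
      (hi.integrableOn (s := Iic t))
    rw [h1, sub_zero] at this
    exact this.symm
  have hsup : Function.support ψ ⊆ Icc a b := by
    intro t ht
    by_contra hn
    refine ht ?_
    rw [hint]
    rcases not_and_or.1 hn with h | h
    · exact setIntegral_eq_zero_of_forall_eq_zero fun x hx => hz x fun hx' =>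
        h ((hab hx').1.trans hx)
    · rw [setIntegral_eq_integral_of_forall_compl_eq_zero, h0]
      exact fun x hx => hz x fun hx' => h ((le_of_not_ge hx).trans (hab hx').2)
  have hts : tsupport ψ ⊆ Icc a b := closure_minimal hsup isClosed_Icc
  exact ⟨ψ, hsm, isCompact_Icc.of_isClosed_subset (isClosed_tsupport ψ) hts,
    hts.trans fun x hx => ⟨ha.trans_le hx.1, hx.2.trans_lt hb⟩, hder⟩

/-- Du Bois-Reymond's lemma. With a fixed bump `ψ₀` of integral one, `φ - (∫ φ) ψ₀` has mean zero
and so is the derivative of a test function. Hence `h` minus its pairing `c` with `ψ₀` annihilates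
every test function `φ`. -/
theorem ae_eq_const_of_integral_deriv_mul_eq_zero {h : ℝ → ℂ} (hi : Integrable h paramMeasure)
    (h0 : ∀ ψ : ℝ → ℝ, ContDiff ℝ ∞ ψ → HasCompactSupport ψ → tsupport ψ ⊆ Ioo (-1 : ℝ) 1 →
      ∫ t in Icc (-1 : ℝ) 1, deriv ψ t • h t = 0) :
    ∃ c : ℂ, h =ᵐ[paramMeasure] fun _ => c := by
  let B : ContDiffBump (0 : ℝ) := ⟨1 / 4, 1 / 2, by norm_num, by norm_num⟩
  let ψ₀ : ℝ → ℝ := B.normed volume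
  have hψ₀ : ContDiff ℝ ∞ ψ₀ := B.contDiff_normed
  have hc₀ : HasCompactSupport ψ₀ := B.hasCompactSupport_normed
  have hs₀ : tsupport ψ₀ ⊆ Ioo (-1 : ℝ) 1 := by
    rw [ContDiffBump.tsupport_normed_eq, Real.closedBall_eq_Icc]
    intro x hx
    simp only [B] at hx
    constructor <;> linarith [hx.1, hx.2]
  have hi₀ : ∫ t, ψ₀ t = 1 := B.integral_normed
  have hmul : ∀ φ : ℝ → ℝ, Continuous φ → Integrable (fun t => φ t • h t) paramMeasure :=
    fun φ hφ => by
      have hb : MemLp (fun t => (φ t : ℂ)) ⊤ paramMeasure :=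
        memLp_param_of_continuousOn (Complex.continuous_ofReal.comp hφ).continuousOn ⊤
      have := (memLp_one_iff_integrable.2 hi).mul' (r := 1) hb
      simpa only [Complex.real_smul] using this.integrable le_rfl
  set c : ℂ := ∫ t in Icc (-1 : ℝ) 1, ψ₀ t • h t with hc
  refine ⟨c, ?_⟩
  have hsub : Integrable (fun t => h t - c) paramMeasure := hi.sub (integrable_const c)
  have key := IsOpen.ae_eq_zero_of_integral_contDiff_smul_eq_zero (μ := volume)
    (isOpen_Ioo (a := (-1 : ℝ)) (b := 1)) (f := fun t => h t - c)
    ((IntegrableOn.mono_set hsub Ioo_subset_Icc_self).locallyIntegrableOn) ?_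
  · have hne : ∀ᵐ x : ℝ, x ≠ -1 ∧ x ≠ 1 := by
      filter_upwards [compl_mem_ae_iff.2 (measure_singleton (-1 : ℝ)),
        compl_mem_ae_iff.2 (measure_singleton (1 : ℝ))] with x h1 h2
      exact ⟨h1, h2⟩
    refine (ae_restrict_iff' measurableSet_Icc).2 ?_
    filter_upwards [key, hne] with x hx hx' hmem
    exact sub_eq_zero.1 (hx ⟨lt_of_le_of_ne hmem.1 hx'.1.symm, lt_of_le_of_ne hmem.2 hx'.2⟩)
  intro φ hφ hφc hφs
  have hφ0 : ∀ t, t ∉ Icc (-1 : ℝ) 1 → φ t = 0 := fun t ht =>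
    image_eq_zero_of_notMem_tsupport fun h => ht (Ioo_subset_Icc_self (hφs h))
  set I : ℝ := ∫ t, φ t with hI
  have hφi : Integrable φ := hφ.continuous.integrable_of_hasCompactSupport hφc
  have hψi : Integrable ψ₀ := hψ₀.continuous.integrable_of_hasCompactSupport hc₀
  obtain ⟨ψ, h1, h2, h3, h4⟩ := exists_deriv_eq_of_integral_eq_zero
    (η := fun t => φ t - I * ψ₀ t) (hφ.sub (contDiff_const.mul hψ₀))
    (hφc.sub hc₀.mul_left)
    ((tsupport_sub φ _).trans (union_subset hφs ((tsupport_mul_subset_right).trans hs₀)))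
    (by rw [integral_sub hφi (hψi.const_mul I), integral_const_mul, hi₀, mul_one, sub_self])
  have h5 := h0 ψ h1 h2 h3
  rw [h4] at h5
  have h6 : ∫ t in Icc (-1 : ℝ) 1, φ t • h t = (I : ℂ) * c := by
    rw [← sub_eq_zero, ← h5, hc, ← integral_const_mul, ← integral_sub (hmul φ hφ.continuous)
      (((hmul ψ₀ hψ₀.continuous)).const_mul _)]
    refine integral_congr_ae (Eventually.of_forall fun t => ?_)
    simp only [Complex.real_smul]
    push_cast
    ring
  rw [← setIntegral_eq_integral_of_forall_compl_eq_zero (s := Icc (-1 : ℝ) 1)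
    (fun t ht => by rw [hφ0 t ht, zero_smul])]
  simp only [smul_sub]
  rw [integral_sub (hmul φ hφ.continuous) (hφi.integrableOn.smul_const c), h6, integral_smul_const,
    setIntegral_eq_integral_of_forall_compl_eq_zero hφ0, Complex.real_smul, sub_self]

/-- The difference of `f` and a primitive of `g` has weak derivative zero, so it is constant almost
everywhere. -/
theorem exists_hasPrim_of_weak {f g : ℝ → ℂ} (hf : Integrable f paramMeasure)
    (hg : MemLp g 2 paramMeasure)
    (h : ∀ ψ : ℝ → ℝ, ContDiff ℝ ∞ ψ → HasCompactSupport ψ → tsupport ψ ⊆ Ioo (-1 : ℝ) 1 →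
      ∫ t in Icc (-1 : ℝ) 1, deriv ψ t • f t = -∫ t in Icc (-1 : ℝ) 1, ψ t • g t) :
    ∃ F, HasPrim F g ∧ f =ᵐ[paramMeasure] F := by
  have hp : HasPrim (fun t => ∫ s in (-1 : ℝ)..t, g s) g := ⟨hg, fun t _ => by simp⟩
  have hFi := (memLp_param_of_continuousOn hp.continuousOn 1).integrable le_rfl
  obtain ⟨c, hc⟩ := ae_eq_const_of_integral_deriv_mul_eq_zero (hf.sub hFi) fun ψ h1 h2 h3 => by
    have e1 := h ψ h1 h2 h3
    have e2 := hp.integral_deriv_mul h1 h3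
    have hcont : Continuous fun t => ((deriv ψ t : ℝ) : ℂ) :=
      Complex.continuous_ofReal.comp (h1.continuous_deriv (by simp))
    have hmul : ∀ {φ : ℝ → ℂ}, Integrable φ paramMeasure →
        Integrable (fun t => ((deriv ψ t : ℝ) : ℂ) * φ t) paramMeasure := fun hφ =>
      (MemLp.continuousOn_mul_param hcont.continuousOn (memLp_one_iff_integrable.2 hφ)).integrable
        le_rfl
    simp only [Complex.real_smul, Pi.sub_apply, mul_sub] at e1 ⊢
    rw [integral_sub (hmul hf) (hmul hFi), e1, e2, sub_self]
  refine ⟨fun t => (∫ s in (-1 : ℝ)..t, g s) + c, ⟨hg, fun t _ => by simp [add_comm]⟩, ?_⟩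
  filter_upwards [hc] with t ht
  rw [← ht]
  simp

/-! ### Square integrals over the parameter interval -/

/-- The square of the norm in `L²(-1,1)`. -/
def paramSq (f : ℝ → ℂ) : ℝ≥0∞ := ∫⁻ t in Icc (-1 : ℝ) 1, ‖f t‖ₑ ^ 2

theorem paramSq_congr {f g : ℝ → ℂ} (h : f =ᵐ[paramMeasure] g) : paramSq f = paramSq g :=
  lintegral_congr_ae (h.mono fun t ht => by simp only [ht])

theorem paramSq_lt_top {f : ℝ → ℂ} (hf : MemLp f 2 paramMeasure) : paramSq f < ⊤ := by
  rw [paramSq, lintegral_enorm_sq_eq hf]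
  exact ENNReal.ofReal_lt_top

theorem paramSq_add_le {f g : ℝ → ℂ} (hf : AEStronglyMeasurable f paramMeasure) :
    paramSq (fun t => f t + g t) ≤ 2 * (paramSq f + paramSq g) := by
  unfold paramSq
  rw [← lintegral_add_left' (hf.enorm.pow_const 2), ← lintegral_const_mul' _ _ (by simp)]
  exact lintegral_mono fun t => (enorm_add_sq_le _ _).trans (mul_add _ _ _).ge

theorem paramSq_mul_le {w f : ℝ → ℂ} {K : ℝ≥0} (hw : ∀ t ∈ Icc (-1 : ℝ) 1, ‖w t‖₊ ≤ K) :
    paramSq (fun t => w t * f t) ≤ K ^ 2 * paramSq f := by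
  unfold paramSq
  rw [← lintegral_const_mul' _ _ (by simp)]
  refine setLIntegral_mono' measurableSet_Icc fun t ht => ?_
  rw [enorm_mul, mul_pow]
  gcongr
  exact_mod_cast hw t ht

theorem HasPrim.conj {f g : ℝ → ℂ} (h : HasPrim f g) :
    HasPrim (fun t => starRingEnd ℂ (f t)) (fun t => starRingEnd ℂ (g t)) := by
  refine ⟨h.memLp.star, fun t ht => ?_⟩
  rw [h.eq_add_integral t ht, map_add, intervalIntegral.intervalIntegral_eq_integral_uIoc,
    intervalIntegral.intervalIntegral_eq_integral_uIoc, integral_conj]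
  simp only [Complex.real_smul, map_mul, Complex.conj_ofReal]

/-- A multiplicative form of the Sobolev inequality in one dimension. -/
theorem HasPrim.enorm_sq_le {f g : ℝ → ℂ} (h : HasPrim f g) {c : ℝ≥0} (hc : c ≠ 0) {t : ℝ}
    (ht : t ∈ Icc (-1 : ℝ) 1) :
    ‖f t‖ₑ ^ 2 ≤ (1 + c) * paramSq f + c⁻¹ * paramSq g := by
  have hf : MemLp f 2 paramMeasure := memLp_param_of_continuousOn h.continuousOn 2
  have if2 : Integrable (fun s => ‖f s‖ ^ 2) paramMeasure := hf.integrable_norm_pow (by norm_num)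
  have ig2 : Integrable (fun s => ‖g s‖ ^ 2) paramMeasure :=
    h.memLp.integrable_norm_pow (by norm_num)
  set A := ∫ s in Icc (-1 : ℝ) 1, ‖f s‖ ^ 2
  set B := ∫ s in Icc (-1 : ℝ) 1, ‖g s‖ ^ 2
  have hc' : (0 : ℝ) < c := by positivity
  have hi : Integrable (fun x => (c : ℝ) * ‖f x‖ ^ 2 + (c : ℝ)⁻¹ * ‖g x‖ ^ 2) paramMeasure :=
    (if2.const_mul _).add (ig2.const_mul _)
  have hp := h.mul h.conj
  -- The product rule for `f * conj f` and `2 |f| |g| ≤ c |f|² + c⁻¹ |g|²`.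
  have key : ∀ s ∈ Icc (-1 : ℝ) 1, ‖f t‖ ^ 2 ≤ ‖f s‖ ^ 2 + (c * A + (c : ℝ)⁻¹ * B) := by
    intro s hs
    have h1 := hp.sub_eq hs ht
    have hn : ∀ x, f x * starRingEnd ℂ (f x) = ((‖f x‖ ^ 2 : ℝ) : ℂ) := fun x => by
      rw [Complex.mul_conj, Complex.normSq_eq_norm_sq]
    simp only [hn] at h1
    have h2 : ‖f t‖ ^ 2 - ‖f s‖ ^ 2 ≤ ‖((‖f t‖ ^ 2 : ℝ) : ℂ) - ((‖f s‖ ^ 2 : ℝ) : ℂ)‖ := by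
      rw [← Complex.ofReal_sub, Complex.norm_real]
      exact le_abs_self _
    rw [h1] at h2
    have h3 : ‖∫ x in s..t, (g x * starRingEnd ℂ (f x) + f x * starRingEnd ℂ (g x))‖ ≤
        c * A + (c : ℝ)⁻¹ * B := by
      refine intervalIntegral.norm_integral_le_integral_norm_uIoc.trans ?_
      have hsub : uIoc s t ⊆ Icc (-1 : ℝ) 1 := uIoc_subset_uIcc.trans (uIcc_subset_Icc hs ht)
      calc ∫ x in uIoc s t, ‖g x * starRingEnd ℂ (f x) + f x * starRingEnd ℂ (g x)‖
          ≤ ∫ x in uIoc s t, ((c : ℝ) * ‖f x‖ ^ 2 + (c : ℝ)⁻¹ * ‖g x‖ ^ 2) := by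
            refine integral_mono_of_nonneg (Eventually.of_forall fun x => norm_nonneg _)
              (IntegrableOn.mono_set hi hsub) (Eventually.of_forall fun x => ?_)
            refine (norm_add_le _ _).trans ?_
            simp only [norm_mul, RCLike.norm_conj]
            have e : (c : ℝ) * ‖f x‖ ^ 2 + (c : ℝ)⁻¹ * ‖g x‖ ^ 2 - (‖g x‖ * ‖f x‖ + ‖f x‖ * ‖g x‖)
                = (c : ℝ)⁻¹ * (c * ‖f x‖ - ‖g x‖) ^ 2 := by field_simp; ring
            have : 0 ≤ (c : ℝ)⁻¹ * (c * ‖f x‖ - ‖g x‖) ^ 2 := by positivity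
            linarith
        _ ≤ ∫ x in Icc (-1 : ℝ) 1, ((c : ℝ) * ‖f x‖ ^ 2 + (c : ℝ)⁻¹ * ‖g x‖ ^ 2) :=
            setIntegral_mono_set hi (Eventually.of_forall fun x => by positivity)
              hsub.eventuallyLE
        _ = c * A + (c : ℝ)⁻¹ * B := by
            rw [integral_add (if2.const_mul _) (ig2.const_mul _), integral_const_mul,
              integral_const_mul]
    linarith
  -- Integration over `s` in an interval of length `2` yields `‖f t‖² ≤ (1/2 + c) A + c⁻¹ B`; the
  -- stated constant rounds `1/2` up to `1`.
  have hmono := setIntegral_mono_on (μ := volume) (s := Icc (-1 : ℝ) 1) (integrable_const _)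
    (if2.add (integrable_const (c * A + (c : ℝ)⁻¹ * B))) measurableSet_Icc key
  simp only [Pi.add_apply] at hmono
  rw [integral_add if2 (integrable_const _), setIntegral_const, setIntegral_const] at hmono
  simp only [Real.volume_real_Icc, smul_eq_mul] at hmono
  have hA : 0 ≤ A := integral_nonneg fun _ => by positivity
  have hB : 0 ≤ B := integral_nonneg fun _ => by positivity
  norm_num at hmono
  have h4 : ‖f t‖ ^ 2 ≤ (1 + c) * A + (c : ℝ)⁻¹ * B := by
    change 2 * ‖f t‖ ^ 2 ≤ A + _ at hmono
    linarith
  unfold paramSq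
  rw [lintegral_enorm_sq_eq hf, lintegral_enorm_sq_eq h.memLp, ← ofReal_norm,
    ← ENNReal.ofReal_pow (norm_nonneg _)]
  refine (ENNReal.ofReal_le_ofReal h4).trans (le_of_eq ?_)
  rw [ENNReal.ofReal_add (by positivity) (by positivity), ENNReal.ofReal_mul (by positivity),
    ENNReal.ofReal_mul (by positivity), ENNReal.ofReal_add (by positivity) (by positivity),
    ENNReal.ofReal_inv_of_pos hc', ENNReal.coe_inv hc]
  simp [A, B]

/-! ### Functions on the contour through their entries -/

/-- The sum of the squares of the norms of the entries in the coordinates of the components. -/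
def entrySq {ℓ : ℕ} (f : ArcFun ℓ) : ℝ≥0∞ := ∑ i, ∑ p, ∑ q, paramSq fun t => f i t p q

theorem paramSq_le_entrySq {ℓ : ℕ} (f : ArcFun ℓ) (i : Fin ℓ) (p q : Fin 2) :
    paramSq (fun t => f i t p q) ≤ entrySq f :=
  ((Finset.single_le_sum (f := fun q => paramSq fun t => f i t p q) (fun _ _ => zero_le)
    (Finset.mem_univ q)).trans
    (Finset.single_le_sum (f := fun p => ∑ q, paramSq fun t => f i t p q) (fun _ _ => zero_le)
    (Finset.mem_univ p))).trans
    (Finset.single_le_sum (f := fun i => ∑ p, ∑ q, paramSq fun t => f i t p q) (fun _ _ => zero_le)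
    (Finset.mem_univ i))

theorem entrySq_le {ℓ : ℕ} {f g : ArcFun ℓ} {K : ℝ≥0∞}
    (h : ∀ i p q, paramSq (fun t => f i t p q) ≤ K * paramSq fun t => g i t p q) :
    entrySq f ≤ K * entrySq g := by
  unfold entrySq
  simp only [Finset.mul_sum]
  exact Finset.sum_le_sum fun i _ => Finset.sum_le_sum fun p _ => Finset.sum_le_sum fun q _ => h i p q

theorem lintegral_enorm_matrix_sq {f : ℝ → Matrix (Fin 2) (Fin 2) ℂ}
    (hf : ∀ p q, AEStronglyMeasurable (fun t => f t p q) paramMeasure) :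
    ∫⁻ t in Icc (-1 : ℝ) 1, ‖f t‖ₑ ^ 2 = ∑ p, ∑ q, paramSq fun t => f t p q := by
  simp only [enorm_matrix_sq]
  rw [lintegral_finsetSum' _ fun p _ => Finset.aemeasurable_fun_sum _ fun q _ => (hf p q).enorm.pow_const 2]
  exact Finset.sum_congr rfl fun p _ =>
    lintegral_finsetSum' _ fun q _ => (hf p q).enorm.pow_const 2

namespace MobiusContour

variable {ℓ : ℕ} (Γ : MobiusContour ℓ)

theorem continuousOn_der (i : Fin ℓ) :
    ContinuousOn (fun t : ℝ => (Γ.M i).der t) (Icc (-1) 1) := by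
  have h : ContinuousOn (fun t : ℝ => ((Γ.M i).c * t + (Γ.M i).d) ^ 2) (Icc (-1) 1) := by fun_prop
  exact continuousOn_const.div h fun t ht => pow_ne_zero 2 (Γ.no_pole i t ht)

theorem der_ne_zero (i : Fin ℓ) {t : ℝ} (ht : t ∈ Icc (-1 : ℝ) 1) : (Γ.M i).der t ≠ 0 :=
  div_ne_zero (Γ.M i).det_ne_zero (pow_ne_zero 2 (Γ.no_pole i t ht))

theorem exists_distortion : ∃ K : ℝ≥0, 1 ≤ K ∧ ∀ i, ∀ t ∈ Icc (-1 : ℝ) 1,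
    ‖(Γ.M i).der t‖₊ ≤ K ∧ ‖((Γ.M i).der t)⁻¹‖₊ ≤ K := by
  have h : ∀ i, ∃ K : ℝ≥0, ∀ t ∈ Icc (-1 : ℝ) 1,
      ‖(Γ.M i).der t‖₊ ≤ K ∧ ‖((Γ.M i).der t)⁻¹‖₊ ≤ K := fun i => by
    obtain ⟨a, ha⟩ := isCompact_Icc.exists_bound_of_continuousOn (Γ.continuousOn_der i)
    obtain ⟨b, hb⟩ := isCompact_Icc.exists_bound_of_continuousOn
      ((Γ.continuousOn_der i).inv₀ fun t ht => Γ.der_ne_zero i ht)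
    refine ⟨(max a b).toNNReal, fun t ht => ⟨?_, ?_⟩⟩
    · exact NNReal.le_toNNReal_of_coe_le ((ha t ht).trans (le_max_left _ _))
    · exact NNReal.le_toNNReal_of_coe_le ((hb t ht).trans (le_max_right _ _))
  choose K hK using h
  refine ⟨1 + ∑ i, K i, le_self_add, fun i t ht => ?_⟩
  have h1 : K i ≤ 1 + ∑ i, K i :=
    (Finset.single_le_sum (f := K) (fun _ _ => zero_le) (Finset.mem_univ i)).trans le_add_self
  exact ⟨(hK i t ht).1.trans h1, (hK i t ht).2.trans h1⟩

/-- A bound for the derivatives of the parametrizations and their inverses. -/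
def distortion : ℝ≥0 := Γ.exists_distortion.choose

theorem one_le_distortion : 1 ≤ Γ.distortion := Γ.exists_distortion.choose_spec.1

theorem der_le (i : Fin ℓ) {t : ℝ} (ht : t ∈ Icc (-1 : ℝ) 1) :
    ‖(Γ.M i).der t‖₊ ≤ Γ.distortion := (Γ.exists_distortion.choose_spec.2 i t ht).1

theorem inv_der_le (i : Fin ℓ) {t : ℝ} (ht : t ∈ Icc (-1 : ℝ) 1) :
    ‖((Γ.M i).der t)⁻¹‖₊ ≤ Γ.distortion := (Γ.exists_distortion.choose_spec.2 i t ht).2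

theorem l2Norm_sq (f : ArcFun ℓ) :
    Γ.l2Norm f ^ 2 = ∑ i, ∫⁻ t in Icc (-1 : ℝ) 1, ‖f i t‖ₑ ^ 2 * ‖(Γ.M i).der t‖ₑ := by
  rw [l2Norm, ← ENNReal.rpow_natCast, ← ENNReal.rpow_mul]
  norm_num

theorem l2Norm_sq_le {f : ArcFun ℓ}
    (hf : ∀ i p q, AEStronglyMeasurable (fun t => f i t p q) paramMeasure) :
    Γ.l2Norm f ^ 2 ≤ Γ.distortion * entrySq f := by
  rw [l2Norm_sq, entrySq, Finset.mul_sum]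
  refine Finset.sum_le_sum fun i _ => ?_
  rw [← lintegral_enorm_matrix_sq (hf i), ← lintegral_const_mul' _ _ (by simp)]
  refine setLIntegral_mono' measurableSet_Icc fun t ht => ?_
  rw [mul_comm]
  gcongr
  exact_mod_cast Γ.der_le i ht

theorem entrySq_le_l2Norm_sq {f : ArcFun ℓ}
    (hf : ∀ i p q, AEStronglyMeasurable (fun t => f i t p q) paramMeasure) :
    entrySq f ≤ Γ.distortion * Γ.l2Norm f ^ 2 := by
  rw [l2Norm_sq, entrySq, Finset.mul_sum]
  refine Finset.sum_le_sum fun i _ => ?_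
  rw [← lintegral_enorm_matrix_sq (hf i), ← lintegral_const_mul' _ _ (by simp)]
  refine setLIntegral_mono' measurableSet_Icc fun t ht => ?_
  have h := Γ.inv_der_le i ht
  have h1 : (1 : ℝ≥0∞) ≤ Γ.distortion * ‖(Γ.M i).der t‖ₑ := by
    have h2 : (1 : ℝ≥0) ≤ Γ.distortion * ‖(Γ.M i).der t‖₊ := by
      rw [nnnorm_inv] at h
      exact (inv_le_iff_one_le_mul₀ (nnnorm_pos.2 (Γ.der_ne_zero i ht))).1 h
    rw [enorm_eq_nnnorm]
    exact_mod_cast h2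
  calc ‖f i t‖ₑ ^ 2 = ‖f i t‖ₑ ^ 2 * 1 := (mul_one _).symm
    _ ≤ ‖f i t‖ₑ ^ 2 * (Γ.distortion * ‖(Γ.M i).der t‖ₑ) := by gcongr
    _ = _ := by ring

theorem memL2_iff {f : ArcFun ℓ} :
    Γ.MemL2 f ↔ ∀ i p q, MemLp (fun t => f i t p q) 2 paramMeasure := by
  constructor
  · rintro ⟨hm, hf⟩ i p q
    have hm' := fun i p q => (hm i).matrix_apply p q
    refine memLp_two_of_lintegral_lt_top (hm' i p q) ?_
    exact (paramSq_le_entrySq f i p q).trans_lt ((Γ.entrySq_le_l2Norm_sq hm').trans_lt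
      (ENNReal.mul_lt_top (by simp) (by finiteness)))
  · intro h
    have hm' := fun i p q => (h i p q).aestronglyMeasurable
    refine ⟨fun i => aestronglyMeasurable_matrix (hm' i), ?_⟩
    have h1 := Γ.l2Norm_sq_le hm'
    have h2 : entrySq f < ⊤ := ENNReal.sum_lt_top.2 fun i _ => ENNReal.sum_lt_top.2 fun p _ =>
      ENNReal.sum_lt_top.2 fun q _ => paramSq_lt_top (h i p q)
    by_contra hc
    rw [not_lt_top_iff.1 hc] at h1
    have := h1.trans_lt (ENNReal.mul_lt_top (by simp) h2)
    simp at this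

/-- `v` is the derivative of `u` with respect to arc length, in the sense that the entries of `u`
are primitives of those of `v`. -/
def HasArcDeriv (u v : ArcFun ℓ) : Prop :=
  ∀ i p q, HasPrim (fun t => u i t p q) (fun t => (Γ.M i).der t * v i t p q)

variable {Γ} {u v U : ArcFun ℓ}

namespace HasArcDeriv

theorem isContArc (h : Γ.HasArcDeriv u v) : IsContArc u :=
  fun i => continuousOn_matrix fun p q => (h i p q).continuousOn

theorem memL2_left (h : Γ.HasArcDeriv u v) : Γ.MemL2 u :=
  Γ.memL2_iff.2 fun i p q => memLp_param_of_continuousOn (h i p q).continuousOn 2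

theorem memL2_right (h : Γ.HasArcDeriv u v) : Γ.MemL2 v :=
  Γ.memL2_iff.2 fun i p q => by
    have h1 := MemLp.continuousOn_mul_param ((Γ.continuousOn_der i).inv₀ fun t ht =>
      Γ.der_ne_zero i ht) (h i p q).memLp
    refine (memLp_congr_ae ?_).1 h1
    refine (ae_restrict_iff' measurableSet_Icc).2 (Eventually.of_forall fun t ht => ?_)
    simp [Γ.der_ne_zero i ht]

theorem _root_.MeasureTheory.MemLp.integrable_ofReal_smul {w : ℝ → ℝ} (hw : Continuous w)
    {f : ℝ → ℂ} (hf : MemLp f 2 paramMeasure) : Integrable (fun t => w t • f t) paramMeasure := by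
  have hc : ContinuousOn (fun t => (w t : ℂ)) (Icc (-1) 1) :=
    (Complex.continuous_ofReal.comp hw).continuousOn
  have := (MemLp.continuousOn_mul_param hc hf).integrable (by norm_num)
  simpa only [Complex.real_smul] using this

theorem isWeakDeriv (h : Γ.HasArcDeriv U v) (hu : AEEqArc u U) : Γ.IsWeakDeriv u v := by
  intro i ψ h1 h2 h3
  have hd : Continuous (deriv ψ) := h1.continuous_deriv (by simp)
  have e : ∫ t in Icc (-1 : ℝ) 1, deriv ψ t • u i t = ∫ t in Icc (-1 : ℝ) 1, deriv ψ t • U i t :=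
    integral_congr_ae ((hu i).mono fun t ht => by simp only [ht])
  rw [e]
  have hU := Γ.memL2_iff.1 h.memL2_left
  ext p q
  rw [Matrix.neg_apply, integral_matrix_apply (f := fun t => deriv ψ t • U i t)
      (fun p q => (hU i p q).integrable_ofReal_smul hd),
    integral_matrix_apply (f := fun t => ψ t • (Γ.M i).der t • v i t) (fun p q => (h i p q).memLp.integrable_ofReal_smul h1.continuous)]
  simpa only [Matrix.smul_apply, Complex.real_smul, smul_eq_mul]
    using (h i p q).integral_deriv_mul h1 h3

theorem isDerivChain (h : Γ.HasArcDeriv U v) (hu : AEEqArc u U) :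
    Γ.IsDerivChain 1 u fun j => if j = 0 then u else v := by
  refine ⟨rfl, fun j hj => ?_, fun j hj => ?_⟩
  · have hU := Γ.memL2_iff.1 h.memL2_left
    rcases Nat.le_one_iff_eq_zero_or_eq_one.1 hj with rfl | rfl
    · exact Γ.memL2_iff.2 fun i p q =>
        (memLp_congr_ae ((hu i).mono fun t ht => by simp only [if_true, ht])).2 (hU i p q)
    · exact h.memL2_right
  · obtain rfl : j = 0 := by omega
    exact h.isWeakDeriv hu

theorem memH (h : Γ.HasArcDeriv U v) (hu : AEEqArc u U) : Γ.MemH 1 u := ⟨_, h.isDerivChain hu⟩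

theorem hNorm_sq_le (h : Γ.HasArcDeriv U v) (hu : AEEqArc u U) :
    Γ.hNorm 1 u ^ 2 ≤ Γ.l2Norm u ^ 2 + Γ.l2Norm v ^ 2 := by
  have h1 : Γ.hNorm 1 u ≤ (Γ.l2Norm u ^ 2 + Γ.l2Norm v ^ 2) ^ (1 / 2 : ℝ) := by
    refine (iInf₂_le _ (h.isDerivChain hu)).trans (le_of_eq ?_)
    simp [Finset.sum_range_succ]
  calc Γ.hNorm 1 u ^ 2 ≤ ((Γ.l2Norm u ^ 2 + Γ.l2Norm v ^ 2) ^ (1 / 2 : ℝ)) ^ 2 := by gcongr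
    _ = _ := by rw [← ENNReal.rpow_natCast, ← ENNReal.rpow_mul]; norm_num

theorem contRep_eqOn (h : Γ.HasArcDeriv U v) (hu : AEEqArc u U) (i : Fin ℓ) :
    EqOn (contRep u i) (U i) (Icc (-1) 1) := _root_.contRep_eqOn h.isContArc hu i

theorem congr_right {v' : ArcFun ℓ} (h : Γ.HasArcDeriv u v) (hv : AEEqArc v v') :
    Γ.HasArcDeriv u v' :=
  fun i p q => (h i p q).congr_ae ((hv i).mono fun t ht => by simp only [ht])

theorem sub {u' v' : ArcFun ℓ} (h : Γ.HasArcDeriv u v) (h' : Γ.HasArcDeriv u' v') :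
    Γ.HasArcDeriv (u - u') (v - v') := fun i p q => by
  have := (h i p q).sub (h' i p q)
  simp only [← mul_sub] at this
  exact this

end HasArcDeriv

/-- Entry by entry the weak derivative in the parameter is `der` times the arc length derivative.
From here on weak derivatives are replaced by primitives of continuous representatives. -/
theorem IsWeakDeriv.exists_hasArcDeriv (h : Γ.IsWeakDeriv u v) (hu : Γ.MemL2 u) (hv : Γ.MemL2 v) :
    ∃ U, Γ.HasArcDeriv U v ∧ AEEqArc u U := by
  rw [memL2_iff] at hu hv
  have hdv := fun i p q => MemLp.continuousOn_mul_param (Γ.continuousOn_der i) (hv i p q)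
  have key : ∀ i p q, ∃ F, HasPrim F (fun t => (Γ.M i).der t * v i t p q) ∧
      (fun t => u i t p q) =ᵐ[paramMeasure] F := fun i p q => by
    refine exists_hasPrim_of_weak ((hu i p q).integrable (by norm_num)) (hdv i p q)
      fun ψ h1 h2 h3 => ?_
    have hd : Continuous (deriv ψ) := h1.continuous_deriv (by simp)
    have := congrFun (congrFun (h i ψ h1 h2 h3) p) q
    rw [Matrix.neg_apply,
      integral_matrix_apply (f := fun t => deriv ψ t • u i t)
        (fun p q => (hu i p q).integrable_ofReal_smul hd),
      integral_matrix_apply (f := fun t => ψ t • (Γ.M i).der t • v i t) (fun p q => (hdv i p q).integrable_ofReal_smul h1.continuous)] at this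
    exact this
  choose F hF hFu using key
  refine ⟨fun i t => Matrix.of fun p q => F i p q t, fun i p q => hF i p q, fun i => ?_⟩
  have : ∀ᵐ t ∂paramMeasure, ∀ p q, u i t p q = F i p q t :=
    ae_all_iff.2 fun p => ae_all_iff.2 fun q => hFu i p q
  filter_upwards [this] with t ht
  ext p q
  exact ht p q

theorem IsDerivChain.exists_hasArcDeriv {k : ℕ} {g : ℕ → ArcFun ℓ} (h : Γ.IsDerivChain k u g)
    {j : ℕ} (hj : j < k) : ∃ U, Γ.HasArcDeriv U (g (j + 1)) ∧ AEEqArc (g j) U :=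
  (h.2.2 j hj).exists_hasArcDeriv (h.2.1 j hj.le) (h.2.1 (j + 1) hj)

theorem MemH.exists_hasArcDeriv (h : Γ.MemH 1 u) : ∃ U v, Γ.HasArcDeriv U v ∧ AEEqArc u U := by
  obtain ⟨g, hg⟩ := h
  obtain ⟨U, hU, hu⟩ := hg.exists_hasArcDeriv zero_lt_one
  exact ⟨U, _, hU, by rwa [hg.1] at hu⟩

end MobiusContour

/-! ### The Cauchy integral over one arc -/

theorem hasDerivAt_integral_div_sub {f m : ℝ → ℂ} (hf : Integrable f paramMeasure)
    (hm : ContinuousOn m (Icc (-1) 1)) {z : ℂ} (hz : ∀ t ∈ Icc (-1 : ℝ) 1, m t ≠ z) :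
    Integrable (fun t => f t / (m t - z)) paramMeasure ∧
    HasDerivAt (fun z => ∫ t in Icc (-1 : ℝ) 1, f t / (m t - z))
      (∫ t in Icc (-1 : ℝ) 1, f t / (m t - z) ^ 2) z := by
  obtain ⟨ε, hε, hεz⟩ : ∃ ε > 0, ∀ t ∈ Icc (-1 : ℝ) 1, ε ≤ ‖m t - z‖ := by
    obtain ⟨t₀, ht₀, hmin⟩ := isCompact_Icc.exists_isMinOn (nonempty_Icc.2 (by norm_num))
      ((hm.sub continuousOn_const).norm : ContinuousOn (fun t => ‖m t - z‖) (Icc (-1 : ℝ) 1))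
    exact ⟨‖m t₀ - z‖, norm_pos_iff.2 (sub_ne_zero.2 (hz t₀ ht₀)), fun t ht => hmin ht⟩
  have hball : ∀ w ∈ Metric.ball z (ε / 2), ∀ t ∈ Icc (-1 : ℝ) 1, ε / 2 ≤ ‖m t - w‖ := by
    intro w hw t ht
    have h1 := hεz t ht
    have h2 : ‖m t - z‖ ≤ ‖m t - w‖ + ‖w - z‖ := by
      simpa using norm_add_le (m t - w) (w - z)
    rw [Metric.mem_ball, dist_eq_norm] at hw
    linarith
  have hmeas : ∀ w, AEStronglyMeasurable (fun t => f t / (m t - w)) paramMeasure := fun w =>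
    (hf.aestronglyMeasurable.aemeasurable.div ((hm.sub continuousOn_const).aestronglyMeasurable
      measurableSet_Icc).aemeasurable).aestronglyMeasurable
  have hmeas2 : AEStronglyMeasurable (fun t => f t / (m t - z) ^ 2) paramMeasure :=
    (hf.aestronglyMeasurable.aemeasurable.div (((hm.sub continuousOn_const).pow 2).aestronglyMeasurable
      measurableSet_Icc).aemeasurable).aestronglyMeasurable
  have hae : ∀ {P : ℝ → Prop}, (∀ t ∈ Icc (-1 : ℝ) 1, P t) → ∀ᵐ t ∂paramMeasure, P t := fun h =>
    (ae_restrict_iff' measurableSet_Icc).2 (Eventually.of_forall h)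
  have hint : Integrable (fun t => f t / (m t - z)) paramMeasure := by
    refine Integrable.mono' (hf.norm.mul_const (ε / 2)⁻¹) (hmeas z) (hae fun t ht => ?_)
    rw [norm_div, div_eq_mul_inv]
    gcongr
    exact hball z (Metric.mem_ball_self (by positivity)) t ht
  refine ⟨hint, (hasDerivAt_integral_of_dominated_loc_of_deriv_le
    (F := fun w t => f t / (m t - w)) (F' := fun w t => f t / (m t - w) ^ 2)
    (bound := fun t => ‖f t‖ * ((ε / 2) ^ 2)⁻¹) (Metric.ball_mem_nhds z (by positivity : 0 < ε / 2))
    (Eventually.of_forall hmeas) hint hmeas2 (hae fun t ht w hw => ?_) (hf.norm.mul_const _)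
    (hae fun t ht w hw => ?_)).2⟩
  · rw [norm_div, norm_pow, div_eq_mul_inv]
    gcongr
    exact hball w hw t ht
  · have h0 : m t - w ≠ 0 := norm_pos_iff.1 ((by positivity : 0 < ε / 2).trans_le (hball w hw t ht))
    have := (((hasDerivAt_id w).const_sub (m t)).inv h0).const_mul (f t)
    simpa [div_eq_mul_inv] using this

namespace Mobius

theorem map_sub_map (M : Mobius) {z w : ℂ} (hz : M.c * z + M.d ≠ 0) (hw : M.c * w + M.d ≠ 0) :
    M.map z - M.map w =
      (M.a * M.d - M.b * M.c) * (z - w) / ((M.c * z + M.d) * (M.c * w + M.d)) := by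
  unfold map
  rw [div_sub_div _ _ hz hw]
  congr 1
  ring

/-- The integral `∫ v(s) / (s - z) ds` over the image of `[-1,1]`. -/
def arcCauchy (M : Mobius) (v : ℝ → ℂ) (z : ℂ) : ℂ :=
  ∫ t in Icc (-1 : ℝ) 1, M.der t / (M.map t - z) * v t

/-- The density on the real line that describes the Cauchy integral over the image of
`[-1,1]`. -/
def density (M : Mobius) (v : ℝ → ℂ) : ℝ → ℂ :=
  (Icc (-1 : ℝ) 1).indicator fun t => v t / (M.c * t + M.d)

/-- The arc `M([-1,1])` does not pass through infinity. -/
def NoPole (M : Mobius) : Prop := ∀ t ∈ Icc (-1 : ℝ) 1, M.c * (t : ℂ) + M.d ≠ 0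

variable {M M' : Mobius} {v : ℝ → ℂ}

theorem NoPole.continuousOn_inv (hM : M.NoPole) :
    ContinuousOn (fun t : ℝ => (M.c * (t : ℂ) + M.d)⁻¹) (Icc (-1) 1) :=
  ContinuousOn.inv₀ (by fun_prop) hM

theorem NoPole.continuousOn_map (hM : M.NoPole) :
    ContinuousOn (fun t : ℝ => M.map t) (Icc (-1) 1) :=
  ContinuousOn.div (by fun_prop) (by fun_prop) hM

theorem NoPole.continuousOn_der (hM : M.NoPole) :
    ContinuousOn (fun t : ℝ => M.der t) (Icc (-1) 1) :=
  ContinuousOn.div (by fun_prop) (by fun_prop) fun t ht => pow_ne_zero 2 (hM t ht)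

theorem NoPole.memLp_density (hM : M.NoPole) (hv : MemLp v 2 paramMeasure) :
    MemLp (M.density v) 2 volume := by
  refine (memLp_indicator_iff_restrict measurableSet_Icc).2 ?_
  have := MemLp.continuousOn_mul_param hM.continuousOn_inv hv
  simpa only [div_eq_inv_mul] using this

theorem NoPole.integrable_density (hM : M.NoPole) (hv : MemLp v 2 paramMeasure) :
    Integrable (M.density v) := by
  refine (integrable_indicator_iff measurableSet_Icc).2 ?_
  have := (MemLp.continuousOn_mul_param hM.continuousOn_inv hv).integrable (by norm_num)
  unfold IntegrableOn
  simpa only [div_eq_inv_mul] using this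

theorem NoPole.exists_integral_density_le (hM : M.NoPole) : ∃ K : ℝ≥0, ∀ v, MemLp v 2 paramMeasure →
    ENNReal.ofReal (∫ t, ‖M.density v t‖ ^ 2) ≤ K * paramSq v := by
  obtain ⟨K, hK⟩ := isCompact_Icc.exists_bound_of_continuousOn hM.continuousOn_inv
  refine ⟨K.toNNReal ^ 2, fun v hv => ?_⟩
  rw [← lintegral_enorm_sq_eq (hM.memLp_density hv)]
  have h1 : ∀ t, ‖M.density v t‖ₑ ^ 2 =
      (Icc (-1 : ℝ) 1).indicator (fun t => ‖(M.c * (t : ℂ) + M.d)⁻¹ * v t‖ₑ ^ 2) t := fun t => by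
    unfold density
    by_cases ht : t ∈ Icc (-1 : ℝ) 1
    · rw [indicator_of_mem ht, indicator_of_mem ht, div_eq_inv_mul]
    · rw [indicator_of_notMem ht, indicator_of_notMem ht]
      simp
  simp_rw [h1]
  rw [lintegral_indicator measurableSet_Icc]
  have := paramSq_mul_le (w := fun t => (M.c * (t : ℂ) + M.d)⁻¹) (f := v) (K := K.toNNReal)
    fun t ht => NNReal.le_toNNReal_of_coe_le (hK t ht)
  rw [ENNReal.coe_pow]
  exact this

/-- Since `M(t) - M(w) = det * (t - w) / ((c t + d) (c w + d))`, the Cauchy kernel of the arc is the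
Cauchy kernel of the line up to factors that depend on `t` or on `w` alone. -/
theorem NoPole.arcCauchy_map_self (hM : M.NoPole) {w : ℂ} (hw : M.c * w + M.d ≠ 0) :
    M.arcCauchy v (M.map w) = (M.c * w + M.d) * lineCauchy (M.density v) w := by
  unfold arcCauchy lineCauchy density
  have h1 : ∀ s : ℝ, (Icc (-1 : ℝ) 1).indicator (fun t : ℝ => v t / (M.c * t + M.d)) s * ((s : ℂ) - w)⁻¹ =
      (Icc (-1 : ℝ) 1).indicator (fun s : ℝ => v s / (M.c * s + M.d) * ((s : ℂ) - w)⁻¹) s :=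
    fun s => by
    by_cases hs : s ∈ Icc (-1 : ℝ) 1
    · rw [indicator_of_mem hs, indicator_of_mem hs]
    · rw [indicator_of_notMem hs, indicator_of_notMem hs, zero_mul]
  simp_rw [h1]
  rw [integral_indicator measurableSet_Icc, ← integral_const_mul]
  refine setIntegral_congr_fun measurableSet_Icc fun t ht => ?_
  have ht' := hM t ht
  rw [M.map_sub_map ht' hw, der]
  -- At a coincidence of the two points both sides are zero, by the convention for division by zero.
  by_cases h : (t : ℂ) - w = 0
  · simp [h]
  · have := M.det_ne_zero
    field_simp

/-- The numerator of `M(x) - M'(y)` is bilinear in `x` and `y`, which is the form of kernel treated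
in `isL2Kernel_square`. -/
theorem arcCauchy_map (hM : M.NoPole) {y : ℝ} (hy : M'.c * (y : ℂ) + M'.d ≠ 0) :
    M.arcCauchy v (M'.map y) = (M'.c * y + M'.d) * ∫ x in Icc (-1 : ℝ) 1,
      (((M.a * M.d - M.b * M.c) * (M.c * x + M.d)⁻¹) * v x) *
      ((M.a * M'.c - M'.a * M.c) * x * y + (M.a * M'.d - M'.b * M.c) * x
        + (M.b * M'.c - M'.a * M.d) * y + (M.b * M'.d - M'.b * M.d))⁻¹ := by
  unfold arcCauchy
  rw [← integral_const_mul]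
  refine setIntegral_congr_fun measurableSet_Icc fun t ht => ?_
  have ht' := hM t ht
  have h1 : M.map t - M'.map y = ((M.a * M'.c - M'.a * M.c) * t * y + (M.a * M'.d - M'.b * M.c) * t
        + (M.b * M'.c - M'.a * M.d) * y + (M.b * M'.d - M'.b * M.d)) /
        ((M.c * t + M.d) * (M'.c * y + M'.d)) := by
    unfold map
    rw [div_sub_div _ _ ht' hy]
    congr 1
    ring
  rw [h1, der]
  generalize (M.a * M'.c - M'.a * M.c) * (t : ℂ) * y + (M.a * M'.d - M'.b * M.c) * t
        + (M.b * M'.c - M'.a * M.d) * y + (M.b * M'.d - M'.b * M.d) = P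
  by_cases hP : P = 0
  · simp [hP]
  · field_simp

/-- The Cauchy integral over an arc defines a bounded operator into the square integrable functions
on another arc that meets the first one at most at endpoints. -/
theorem NoPole.exists_arcCauchy_map_le (hM : M.NoPole) (hM' : M'.NoPole)
    (hmeet : ∀ s ∈ Icc (-1 : ℝ) 1, ∀ t ∈ Icc (-1 : ℝ) 1, M.map s = M'.map t →
      (s = -1 ∨ s = 1) ∧ (t = -1 ∨ t = 1)) :
    ∃ K : ℝ≥0, ∀ v, MemLp v 2 paramMeasure →
      paramSq (fun t => M.arcCauchy v (M'.map t)) ≤ K * paramSq v := by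
  obtain ⟨K, hK⟩ := isL2Kernel_square (A := M.a * M'.c - M'.a * M.c) (B := M.a * M'.d - M'.b * M.c)
    (C := M.b * M'.c - M'.a * M.d) (D := M.b * M'.d - M'.b * M.d) fun x hx y hy h => by
      refine hmeet x hx y hy ?_
      unfold map
      rw [div_eq_div_iff (hM x hx) (hM' y hy)]
      linear_combination h
  have hw : ContinuousOn (fun t : ℝ => (M.a * M.d - M.b * M.c) * (M.c * (t : ℂ) + M.d)⁻¹)
      (Icc (-1) 1) := continuousOn_const.mul hM.continuousOn_inv
  obtain ⟨K₁, hK₁⟩ := isCompact_Icc.exists_bound_of_continuousOn hw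
  obtain ⟨K₂, hK₂⟩ := isCompact_Icc.exists_bound_of_continuousOn
    (show ContinuousOn (fun t : ℝ => M'.c * (t : ℂ) + M'.d) (Icc (-1) 1) by fun_prop)
  refine ⟨K₂.toNNReal ^ 2 * (K * K₁.toNNReal ^ 2), fun v hv => ?_⟩
  have h2 := hK _ (MemLp.continuousOn_mul_param hw hv)
  have h1 : paramSq (fun t => M.arcCauchy v (M'.map t)) = paramSq fun y => (M'.c * (y : ℂ) + M'.d) *
      ∫ x in Icc (-1 : ℝ) 1, (((M.a * M.d - M.b * M.c) * (M.c * x + M.d)⁻¹) * v x) *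
      ((M.a * M'.c - M'.a * M.c) * x * y + (M.a * M'.d - M'.b * M.c) * x
        + (M.b * M'.c - M'.a * M.d) * y + (M.b * M'.d - M'.b * M.d))⁻¹ :=
    paramSq_congr ((ae_restrict_iff' measurableSet_Icc).2 (Eventually.of_forall fun y hy =>
      arcCauchy_map hM (hM' y hy)))
  rw [h1]
  refine (paramSq_mul_le (K := K₂.toNNReal) fun t ht =>
    NNReal.le_toNNReal_of_coe_le (hK₂ t ht)).trans ?_
  push_cast
  rw [mul_assoc, mul_assoc]
  gcongr
  refine h2.trans ?_
  gcongr
  exact paramSq_mul_le (K := K₁.toNNReal) fun t ht => NNReal.le_toNNReal_of_coe_le (hK₁ t ht)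

theorem NoPole.integrable_kernel (hM : M.NoPole) (hv : MemLp v 2 paramMeasure) {z : ℂ}
    (hz : ∀ t ∈ Icc (-1 : ℝ) 1, M.map t ≠ z) :
    Integrable (fun t : ℝ => M.der t / (M.map t - z) * v t) paramMeasure := by
  have h := (hasDerivAt_integral_div_sub
    ((MemLp.continuousOn_mul_param hM.continuousOn_der hv).integrable (by norm_num))
    hM.continuousOn_map hz).1
  refine h.congr (Eventually.of_forall fun t => ?_)
  simp only
  ring

theorem NoPole.hasDerivAt_arcCauchy (hM : M.NoPole) (hv : MemLp v 2 paramMeasure) {z : ℂ}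
    (hz : ∀ t ∈ Icc (-1 : ℝ) 1, M.map t ≠ z) :
    HasDerivAt (M.arcCauchy v) (∫ t in Icc (-1 : ℝ) 1, M.der t / (M.map t - z) ^ 2 * v t) z := by
  have h := (hasDerivAt_integral_div_sub
    ((MemLp.continuousOn_mul_param hM.continuousOn_der hv).integrable (by norm_num))
    hM.continuousOn_map hz).2
  have e1 : M.arcCauchy v = fun z => ∫ t : ℝ in Icc (-1 : ℝ) 1, M.der t * v t / (M.map t - z) := by
    funext z
    exact integral_congr_ae (Eventually.of_forall fun t => by simp only; ring)
  rw [e1]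
  refine h.congr_deriv ?_
  exact integral_congr_ae (Eventually.of_forall fun t => by simp only; ring)

/-- Integration by parts for the derivative of the Cauchy integral. -/
theorem NoPole.hasDerivAt_arcCauchy_of_hasPrim (hM : M.NoPole) {f g : ℝ → ℂ}
    (hf : HasPrim f fun t => M.der t * g t) {z : ℂ} (hz : ∀ t ∈ Icc (-1 : ℝ) 1, M.map t ≠ z) :
    HasDerivAt (M.arcCauchy f)
      (M.arcCauchy g z - (f 1 / (M.map 1 - z) - f (-1) / (M.map (-1) - z))) z := by
  refine (hM.hasDerivAt_arcCauchy (memLp_param_of_continuousOn hf.continuousOn 2) hz).congr_deriv ?_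
  have hz' : ∀ t ∈ Icc (-1 : ℝ) 1, M.map t - z ≠ 0 := fun t ht => sub_ne_zero.2 (hz t ht)
  have hmap : ∀ t ∈ Icc (-1 : ℝ) 1, HasDerivAt (fun s : ℝ => M.map s) (M.der t) t := fun t ht =>
    (M.hasDerivAt_map t (hM t ht)).comp_ofReal
  have hinv : HasPrim (fun t : ℝ => (M.map t - z)⁻¹) (fun t : ℝ => -M.der t / (M.map t - z) ^ 2) :=
    HasPrim.of_hasDerivAt (fun t ht => ((hmap t ht).sub_const z).inv (hz' t ht))
      (hM.continuousOn_der.neg.div ((hM.continuousOn_map.sub continuousOn_const).pow 2)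
        fun t ht => pow_ne_zero 2 (hz' t ht))
  have h := (hinv.mul hf).sub_eq left_mem right_mem
  have i1 := (MemLp.continuousOn_mul_param hf.continuousOn hinv.memLp).integrable (by norm_num)
  have i2 := (MemLp.continuousOn_mul_param hinv.continuousOn hf.memLp).integrable (by norm_num)
  rw [← setIntegral_Icc_eq, integral_add (i1.congr (Eventually.of_forall fun t => mul_comm _ _)) i2] at h
  unfold arcCauchy
  have e1 : ∫ t in Icc (-1 : ℝ) 1, -M.der t / (M.map t - z) ^ 2 * f t =
      -∫ t in Icc (-1 : ℝ) 1, M.der t / (M.map t - z) ^ 2 * f t := by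
    rw [← integral_neg]
    exact integral_congr_ae (Eventually.of_forall fun t => by simp only; ring)
  have e2 : ∫ t in Icc (-1 : ℝ) 1, (M.map t - z)⁻¹ * (M.der t * g t) =
      ∫ t in Icc (-1 : ℝ) 1, M.der t / (M.map t - z) * g t :=
    integral_congr_ae (Eventually.of_forall fun t => by simp only; ring)
  rw [e1, e2] at h
  push_cast at h
  linear_combination h

end Mobius

/-! ### Approach from the right in the coordinate of the component -/

namespace Mobius

/-- The inverse transformation. -/
def symm (M : Mobius) : Mobius := ⟨M.d, -M.b, -M.c, M.a, by
  have := M.det_ne_zero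
  contrapose! this
  linear_combination this⟩

variable {M : Mobius}

theorem symm_denom_map {w : ℂ} (hw : M.c * w + M.d ≠ 0) :
    M.symm.c * M.map w + M.symm.d ≠ 0 := by
  have h : M.symm.c * M.map w + M.symm.d = (M.a * M.d - M.b * M.c) / (M.c * w + M.d) := by
    simp only [symm, map]
    rw [eq_div_iff hw]
    linear_combination -M.c * div_mul_cancel₀ (M.a * w + M.b) hw
  rw [h]
  exact div_ne_zero M.det_ne_zero hw

theorem denom_symm_map {z : ℂ} (hz : M.symm.c * z + M.symm.d ≠ 0) :
    M.c * M.symm.map z + M.d ≠ 0 := by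
  have h : M.c * M.symm.map z + M.d = (M.a * M.d - M.b * M.c) / (M.symm.c * z + M.symm.d) := by
    rw [eq_div_iff hz]
    simp only [map]
    have := div_mul_cancel₀ (M.symm.a * z + M.symm.b) hz
    simp only [symm] at this ⊢
    linear_combination M.c * this
  rw [h]
  exact div_ne_zero M.det_ne_zero hz

theorem map_symm_map {z : ℂ} (hz : M.symm.c * z + M.symm.d ≠ 0) : M.map (M.symm.map z) = z := by
  have h1 := denom_symm_map hz
  rw [map, div_eq_iff h1]
  have := div_mul_cancel₀ (M.symm.a * z + M.symm.b) hz
  have hd := M.det_ne_zero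
  simp only [symm, map] at this ⊢ hz
  generalize (M.d * z + -M.b) / (-M.c * z + M.a) = X at *
  linear_combination this

theorem symm_map_map {w : ℂ} (hw : M.c * w + M.d ≠ 0) : M.symm.map (M.map w) = w := by
  have h1 := symm_denom_map hw
  rw [map, div_eq_iff h1]
  have := div_mul_cancel₀ (M.a * w + M.b) hw
  simp only [symm, map] at this ⊢
  generalize (M.a * w + M.b) / (M.c * w + M.d) = X at *
  linear_combination this

/-- A non-tangential approach from the right of an arc corresponds to a non-tangential approach from
below of the parameter interval. -/
theorem tendsto_symm_map {t : ℝ} (ht : M.c * (t : ℂ) + M.d ≠ 0) (K : ℕ) :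
    Tendsto M.symm.map (𝓝[{z : ℂ | z ≠ M.map t ∧ ‖z - M.map t‖ ≤
      K * -((z - M.map t) / (M.der t / (‖M.der t‖ : ℂ))).im}] (M.map t))
      (𝓝[{w : ℂ | w.im < 0 ∧ ‖w - t‖ ≤ (4 * (K + 1) : ℝ) * -w.im}] (t : ℂ)) := by
  set z₀ := M.map t
  set τ := M.der t with hτ
  have hτ0 : τ ≠ 0 := div_ne_zero M.det_ne_zero (pow_ne_zero 2 ht)
  have hnτ : 0 < ‖τ‖ := norm_pos_iff.2 hτ0
  have hs0 : M.symm.map z₀ = t := symm_map_map ht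
  have hd : HasDerivAt M.symm.map τ⁻¹ z₀ := by
    refine (M.symm.hasDerivAt_map z₀ (symm_denom_map ht)).congr_deriv ?_
    have h : M.symm.c * M.map t + M.symm.d = (M.a * M.d - M.b * M.c) / (M.c * t + M.d) := by
      simp only [symm, map]
      rw [eq_div_iff ht]
      linear_combination -M.c * div_mul_cancel₀ (M.a * t + M.b) ht
    have hdet := M.det_ne_zero
    rw [der, h, hτ, der]
    have e : M.symm.a * M.symm.d - M.symm.b * M.symm.c = M.a * M.d - M.b * M.c := by
      simp only [symm]; ring
    rw [e]
    field_simp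
  -- With `s = ‖ζ‖ / ‖τ‖`, the linearized point lies at depth at least `s / (K + 1)`. This `ε` makes
  -- the linearization error at most half of that depth, so half of it survives, while `‖w - t‖ ≤ 2
  -- s`; the quotient is the constant `4 (K + 1)`.
  set ε : ℝ := (2 * (K + 1) * ‖τ‖)⁻¹ with hε
  have hε0 : 0 < ε := by positivity
  have ho : ∀ᶠ z in 𝓝 z₀, ‖M.symm.map z - t - (z - z₀) * τ⁻¹‖ ≤ ε * ‖z - z₀‖ := by
    have := (hasDerivAt_iff_isLittleO.1 hd).def hε0
    simpa only [hs0, smul_eq_mul] using this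
  refine tendsto_nhdsWithin_iff.2 ⟨?_, ?_⟩
  · have := hd.continuousAt.tendsto
    rw [hs0] at this
    exact this.mono_left nhdsWithin_le_nhds
  filter_upwards [mem_nhdsWithin_of_mem_nhds ho, self_mem_nhdsWithin] with z hz hmem
  obtain ⟨hne, hsec⟩ := hmem
  set ζ := z - z₀ with hζ
  have hζ0 : 0 < ‖ζ‖ := norm_pos_iff.2 (sub_ne_zero.2 hne)
  set w := M.symm.map z
  set r := w - t - ζ * τ⁻¹ with hr
  have hy : (ζ / (τ / (‖τ‖ : ℂ))).im = ‖τ‖ * (ζ * τ⁻¹).im := by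
    have : ζ / (τ / (‖τ‖ : ℂ)) = (‖τ‖ : ℂ) * (ζ * τ⁻¹) := by field_simp
    rw [this, Complex.im_ofReal_mul]
  rw [hy] at hsec
  have hwim : w.im = (ζ * τ⁻¹).im + r.im := by
    rw [← Complex.add_im, hr]
    simp
  have hrim : |r.im| ≤ ε * ‖ζ‖ := (Complex.abs_im_le_norm r).trans hz
  have h1 : ‖w - t‖ ≤ ‖τ‖⁻¹ * ‖ζ‖ + ε * ‖ζ‖ := by
    have : w - t = ζ * τ⁻¹ + r := by rw [hr]; ring
    rw [this]
    refine (norm_add_le _ _).trans (add_le_add (le_of_eq ?_) hz)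
    rw [norm_mul, norm_inv, mul_comm]
  set s := ‖τ‖⁻¹ * ‖ζ‖ with hsdef
  have hs : 0 < s := by positivity
  have hK : (0 : ℝ) < K + 1 := by positivity
  have h2 : ε * ‖ζ‖ = s / (2 * (K + 1)) := by rw [hε, hsdef]; field_simp
  have h3 : s ≤ (K + 1) * -(ζ * τ⁻¹).im := by
    have h4 : s ≤ K * -(ζ * τ⁻¹).im := by
      rw [hsdef, inv_mul_le_iff₀ hnτ]
      linarith
    have h5 : 0 ≤ -(ζ * τ⁻¹).im := by
      by_contra h
      push Not at h
      have : (K : ℝ) * -(ζ * τ⁻¹).im ≤ 0 := mul_nonpos_of_nonneg_of_nonpos (by positivity) h.le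
      linarith
    linarith
  have h4 : s / (K + 1) ≤ -(ζ * τ⁻¹).im := by rw [div_le_iff₀ hK]; linarith
  have h5 : s / (2 * (K + 1)) = s / (K + 1) / 2 := by field_simp
  have h6 : 0 < s / (K + 1) := by positivity
  have h7 : s / (K + 1) / 2 ≤ -w.im := by
    rw [hwim]
    have := le_abs_self r.im
    rw [h2, h5] at hrim
    linarith
  refine ⟨by linarith, ?_⟩
  have h8 : s / (K + 1) ≤ s := div_le_self hs.le (by linarith [(Nat.cast_nonneg K : (0 : ℝ) ≤ K)])
  calc ‖w - t‖ ≤ s + s / (K + 1) / 2 := by rw [h2, h5] at h1; exact h1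
    _ ≤ 2 * s := by linarith
    _ = 4 * (K + 1) * (s / (K + 1) / 2) := by field_simp; ring
    _ ≤ 4 * (K + 1) * -w.im := by gcongr

end Mobius

/-- The approach along the normal stays in the sector with `K = 1`. Nontriviality of the filter
makes the limit unique, hence equal to the value of `limUnder`. -/
theorem MobiusContour.neBot_rightApproach {ℓ : ℕ} (Γ : MobiusContour ℓ) (i : Fin ℓ) {t : ℝ}
    (ht : t ∈ Icc (-1 : ℝ) 1) : (Γ.rightApproach i t).NeBot := by
  set z₀ := (Γ.M i).map t
  set τ := (Γ.M i).der t with hτ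
  have hτ0 : τ ≠ 0 := Γ.der_ne_zero i ht
  have hn : (‖τ‖ : ℂ) ≠ 0 := by simpa using hτ0
  have hlim : Tendsto (fun n : ℕ => z₀ - ((n + 1 : ℝ)⁻¹ : ℝ) * Complex.I * (τ / (‖τ‖ : ℂ))) atTop (𝓝 z₀) := by
    have h1 : Tendsto (fun n : ℕ => ((n + 1 : ℝ)⁻¹ : ℝ)) atTop (𝓝 0) := by
      simpa using tendsto_one_div_add_atTop_nhds_zero_nat (𝕜 := ℝ)
    have h2 := (Complex.continuous_ofReal.tendsto 0).comp h1
    have h3 := tendsto_const_nhds (x := z₀) |>.sub ((h2.mul_const Complex.I).mul_const (τ / (‖τ‖ : ℂ)))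
    simpa using h3
  refine NeBot.mono ?_ (le_iSup _ 1)
  refine Tendsto.neBot (tendsto_nhdsWithin_iff.2 ⟨hlim, Eventually.of_forall fun n => ?_⟩)
  have hpos : (0 : ℝ) < (n + 1 : ℝ)⁻¹ := by positivity
  have h1 : ‖τ / (‖τ‖ : ℂ)‖ = 1 := by
    rw [norm_div, Complex.norm_real, norm_norm, div_self (norm_ne_zero_iff.2 hτ0)]
  refine ⟨?_, ?_⟩
  · rw [Ne, sub_eq_self]
    exact mul_ne_zero (mul_ne_zero (by exact_mod_cast hpos.ne') Complex.I_ne_zero) (div_ne_zero hτ0 hn)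
  · generalize (n + 1 : ℝ)⁻¹ = δ at hpos
    rw [sub_sub_cancel_left, neg_div, mul_div_assoc, div_self (div_ne_zero hτ0 hn), norm_neg,
      norm_mul, norm_mul, h1, Complex.norm_real, Complex.norm_I, Real.norm_of_nonneg hpos.le]
    simp

/-! ### Boundary values of the Cauchy integral -/

theorem paramSq_sum_le {ι : Type*} (s : Finset ι) {F : ι → ℝ → ℂ}
    (hF : ∀ i ∈ s, AEStronglyMeasurable (F i) paramMeasure) :
    paramSq (fun t => ∑ i ∈ s, F i t) ≤ 2 ^ s.card * ∑ i ∈ s, paramSq (F i) := by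
  classical
  induction s using Finset.induction_on with
  | empty => simp [paramSq]
  | insert a s ha ih =>
    simp only [Finset.sum_insert ha, Finset.card_insert_of_notMem ha]
    have h := ih fun i hi => hF i (Finset.mem_insert_of_mem hi)
    refine (paramSq_add_le (hF a (Finset.mem_insert_self a s))).trans ?_
    rw [pow_succ', mul_assoc]
    gcongr
    rw [mul_add]
    gcongr
    exact le_mul_of_one_le_left' (one_le_pow₀ (by norm_num))

/-- The difference `F n - g` is small in `L²` and is tested against bounded functions on a finite
measure; the remaining `g * A n` is handled by dominated convergence. -/
theorem tendsto_integral_mul_of_bounded {α : Type*} [MeasurableSpace α] {μ : Measure α}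
    [IsFiniteMeasure μ] {F A : ℕ → α → ℂ} {g a : α → ℂ} {B : ℝ} (hF : ∀ n, MemLp (F n) 2 μ)
    (hg : MemLp g 2 μ) (hA : ∀ᶠ n in atTop, AEStronglyMeasurable (A n) μ)
    (hB : ∀ᶠ n in atTop, ∀ᵐ x ∂μ, ‖A n x‖ ≤ B)
    (hlimA : ∀ᵐ x ∂μ, Tendsto (fun n => A n x) atTop (𝓝 (a x)))
    (hlim : Tendsto (fun n => eLpNorm (fun x => F n x - g x) 2 μ) atTop (𝓝 0)) :
    Tendsto (fun n => ∫ x, F n x * A n x ∂μ) atTop (𝓝 (∫ x, g x * a x ∂μ)) := by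
  have hgi : Integrable g μ := hg.integrable (by norm_num)
  have hsub : ∀ n, MemLp (fun x => F n x - g x) 2 μ := fun n => (hF n).sub hg
  have h1 : Tendsto (fun n => ∫ x, g x * A n x ∂μ) atTop (𝓝 (∫ x, g x * a x ∂μ)) := by
    refine tendsto_integral_filter_of_dominated_convergence (fun x => ‖g x‖ * B)
      (hA.mono fun n hn => hg.1.mul hn) ?_ (hgi.norm.mul_const B)
      (hlimA.mono fun x hx => hx.const_mul _)
    filter_upwards [hB] with n hn
    filter_upwards [hn] with x hx
    rw [norm_mul]
    gcongr
  have h2 : Tendsto (fun n => ∫ x, (F n x - g x) * A n x ∂μ) atTop (𝓝 0) := by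
    have hsq : Tendsto (fun n => (∫ x, ‖F n x - g x‖ ^ 2 ∂μ) * (μ.real univ * B ^ 2)) atTop (𝓝 0) := by
      have h3 : Tendsto (fun n => (eLpNorm (fun x => F n x - g x) 2 μ ^ 2).toReal) atTop (𝓝 0) := by
        have := (ENNReal.continuous_pow 2).tendsto 0 |>.comp hlim
        have h4 := (ENNReal.tendsto_toReal (by simp : (0 : ℝ≥0∞) ^ 2 ≠ ⊤)).comp this
        simpa [Function.comp_def] using h4
      have h4 := h3.mul_const (μ.real univ * B ^ 2)
      rw [zero_mul] at h4
      refine h4.congr fun n => ?_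
      rw [eLpNorm_two_sq_eq (hsub n), ENNReal.toReal_ofReal]
      exact integral_nonneg fun x => by positivity
    have hsq2 : Tendsto (fun n => ‖∫ x, (F n x - g x) * A n x ∂μ‖ ^ 2) atTop (𝓝 0) := by
      refine squeeze_zero' (Eventually.of_forall fun n => by positivity) ?_ hsq
      filter_upwards [hA, hB] with n hAn hBn
      have hAL : MemLp (A n) 2 μ := MemLp.of_bound hAn B hBn
      refine (sq_integral_norm_mul_le (hsub n) hAL).trans ?_
      gcongr
      calc ∫ x, ‖A n x‖ ^ 2 ∂μ ≤ ∫ _, B ^ 2 ∂μ := by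
            refine integral_mono_of_nonneg (Eventually.of_forall fun x => by positivity)
              (integrable_const _) (hBn.mono fun x hx => ?_)
            simp only
            gcongr
        _ = _ := by rw [integral_const, smul_eq_mul]
    rw [tendsto_zero_iff_norm_tendsto_zero]
    have := hsq2.sqrt
    simpa using this
  have h3 := h2.add h1
  rw [zero_add] at h3
  refine h3.congr' ?_
  filter_upwards [hA, hB] with n hAn hBn
  have hAL : MemLp (A n) 2 μ := MemLp.of_bound hAn B hBn
  have i1 : Integrable (fun x => (F n x - g x) * A n x) μ := MemLp.integrable_mul (hsub n) hAL
  have i2 : Integrable (fun x => g x * A n x) μ := MemLp.integrable_mul hg hAL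
  rw [← integral_add i1 i2]
  exact integral_congr_ae (Eventually.of_forall fun x => by simp only; ring)

open Classical in
/-- The boundary values from below of the Cauchy integral over the line. -/
def lineLimit (f : ℝ → ℂ) : ℝ → ℂ :=
  if h : Integrable f ∧ MemLp f 2 volume then (exists_tendsto_lineCauchy h.1 h.2).choose else 0

theorem lineLimit_spec {f : ℝ → ℂ} (hf : Integrable f) (hf2 : MemLp f 2 volume) :
    MemLp (lineLimit f) 2 volume ∧
      ∫ x, ‖lineLimit f x‖ ^ 2 ≤ 4 * Real.pi ^ 2 * ∫ s, ‖f s‖ ^ 2 ∧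
      Tendsto (fun n : ℕ => eLpNorm (fun x : ℝ =>
        lineCauchy f (x - ((n + 1 : ℝ)⁻¹ : ℝ) * Complex.I) - lineLimit f x) 2 volume) atTop (𝓝 0) := by
  have h : Integrable f ∧ MemLp f 2 volume := ⟨hf, hf2⟩
  have e : lineLimit f = (exists_tendsto_lineCauchy h.1 h.2).choose := dif_pos h
  rw [e]
  exact (exists_tendsto_lineCauchy h.1 h.2).choose_spec

theorem ae_param_of_Ioo {P : ℝ → Prop} (h : ∀ᵐ t : ℝ, t ∈ Ioo (-1 : ℝ) 1 → P t) :
    ∀ᵐ t ∂paramMeasure, P t := by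
  rw [paramMeasure, ← Measure.restrict_congr_set Ioo_ae_eq_Icc]
  exact (ae_restrict_iff' measurableSet_Ioo).2 h

theorem tendsto_inv_nat_succ : Tendsto (fun n : ℕ => ((n + 1 : ℝ)⁻¹ : ℝ)) atTop (𝓝 0) := by
  simpa using tendsto_one_div_add_atTop_nhds_zero_nat (𝕜 := ℝ)

theorem tendsto_sub_inv_nat_succ (t : ℝ) :
    Tendsto (fun n : ℕ => (t : ℂ) - ((n + 1 : ℝ)⁻¹ : ℝ) * Complex.I) atTop (𝓝 (t : ℂ)) := by
  have h := (Complex.continuous_ofReal.tendsto 0).comp tendsto_inv_nat_succ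
  simpa [Function.comp_def] using (h.mul_const Complex.I).const_sub (t : ℂ)

namespace MobiusContour

variable {ℓ : ℕ} (Γ : MobiusContour ℓ)

/-- The Cauchy integral of a scalar function without the factor `1 / 2πi`. -/
def sCauchy (v : Fin ℓ → ℝ → ℂ) (z : ℂ) : ℂ := ∑ j, (Γ.M j).arcCauchy (v j) z

/-- The boundary value from the right of `sCauchy`. -/
def boundary (v : Fin ℓ → ℝ → ℂ) (i : Fin ℓ) (t : ℝ) : ℂ :=
  ((Γ.M i).c * t + (Γ.M i).d) * lineLimit ((Γ.M i).density (v i)) t +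
    ∑ j ∈ Finset.univ.erase i, (Γ.M j).arcCauchy (v j) ((Γ.M i).map t)

theorem noPole (i : Fin ℓ) : (Γ.M i).NoPole := Γ.no_pole i

/-- The parameters that the `i`-th parametrization maps to the complement of the other
components. -/
def crossDomain (i : Fin ℓ) : Set ℂ :=
  {w | (Γ.M i).c * w + (Γ.M i).d ≠ 0 ∧
    ∀ j ≠ i, ∀ t ∈ Icc (-1 : ℝ) 1, (Γ.M j).map t ≠ (Γ.M i).map w}

theorem isOpen_crossDomain (i : Fin ℓ) : IsOpen (Γ.crossDomain i) := by
  have h1 : IsOpen {w : ℂ | (Γ.M i).c * w + (Γ.M i).d ≠ 0} :=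
    isOpen_ne_fun (by fun_prop) (by fun_prop)
  have hc : ContinuousOn (Γ.M i).map {w : ℂ | (Γ.M i).c * w + (Γ.M i).d ≠ 0} :=
    fun w hw => ((Γ.M i).hasDerivAt_map w hw).continuousAt.continuousWithinAt
  have h2 : IsOpen (⋂ j : {j // j ≠ i}, ((fun t : ℝ => (Γ.M j).map t) '' Icc (-1 : ℝ) 1)ᶜ) :=
    isOpen_iInter_of_finite fun j =>
      (isCompact_Icc.image_of_continuousOn (Γ.noPole j).continuousOn_map).isClosed.isOpen_compl
  convert hc.isOpen_inter_preimage h1 h2 using 1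
  ext w
  simp only [crossDomain, mem_ofPred_eq, mem_inter_iff, mem_preimage, mem_iInter, mem_compl_iff,
    mem_image, not_exists, not_and, Subtype.forall]

theorem mem_crossDomain (i : Fin ℓ) {t : ℝ} (ht : t ∈ Ioo (-1 : ℝ) 1) :
    (t : ℂ) ∈ Γ.crossDomain i := by
  refine ⟨Γ.no_pole i t (Ioo_subset_Icc_self ht), fun j hj s hs h => ?_⟩
  rcases (Γ.meet_at_endpoints j i hj s hs t (Ioo_subset_Icc_self ht) h).2 with rfl | rfl
  · exact lt_irrefl _ ht.1
  · exact lt_irrefl _ ht.2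

variable {Γ} {v : Fin ℓ → ℝ → ℂ}

theorem continuousOn_cross (hv : ∀ j, MemLp (v j) 2 paramMeasure) {i j : Fin ℓ} (hj : j ≠ i) :
    ContinuousOn (fun w => (Γ.M j).arcCauchy (v j) ((Γ.M i).map w)) (Γ.crossDomain i) := by
  intro w hw
  have h1 := ((Γ.noPole j).hasDerivAt_arcCauchy (hv j) (hw.2 j hj)).continuousAt
  have h2 := ((Γ.M i).hasDerivAt_map w hw.1).continuousAt
  exact (ContinuousAt.comp (g := (Γ.M j).arcCauchy (v j)) h1 h2).continuousWithinAt

theorem sCauchy_eq (v : Fin ℓ → ℝ → ℂ) (i : Fin ℓ) (z : ℂ) :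
    Γ.sCauchy v z = (Γ.M i).arcCauchy (v i) z +
      ∑ j ∈ Finset.univ.erase i, (Γ.M j).arcCauchy (v j) z :=
  (Finset.add_sum_erase _ _ (Finset.mem_univ i)).symm

theorem aestronglyMeasurable_cross (hv : ∀ j, MemLp (v j) 2 paramMeasure) {i j : Fin ℓ}
    (hj : j ≠ i) :
    AEStronglyMeasurable (fun t : ℝ => (Γ.M j).arcCauchy (v j) ((Γ.M i).map t)) paramMeasure := by
  rw [paramMeasure, ← Measure.restrict_congr_set Ioo_ae_eq_Icc]
  exact ((continuousOn_cross hv hj).comp Complex.continuous_ofReal.continuousOn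
    fun t ht => Γ.mem_crossDomain i ht).aestronglyMeasurable measurableSet_Ioo

theorem aestronglyMeasurable_boundary (hv : ∀ j, MemLp (v j) 2 paramMeasure) (i : Fin ℓ) :
    AEStronglyMeasurable (Γ.boundary v i) paramMeasure := by
  refine AEStronglyMeasurable.add (AEStronglyMeasurable.mul ?_ ?_)
    (Finset.aestronglyMeasurable_fun_sum _ fun j hj =>
      aestronglyMeasurable_cross hv (Finset.ne_of_mem_erase hj))
  · exact (show Continuous fun t : ℝ => (Γ.M i).c * (t : ℂ) + (Γ.M i).d by
      fun_prop).aestronglyMeasurable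
  · exact (lineLimit_spec ((Γ.noPole i).integrable_density (hv i))
      ((Γ.noPole i).memLp_density (hv i))).1.1.restrict

/-- The contribution of an arc to itself is bounded by the estimate on the line, the contributions
of the other arcs by the bilinear kernels. -/
theorem exists_paramSq_boundary_le (Γ : MobiusContour ℓ) : ∃ K : ℝ≥0, ∀ v : Fin ℓ → ℝ → ℂ,
    (∀ j, MemLp (v j) 2 paramMeasure) → ∀ i, paramSq (Γ.boundary v i) ≤ K * ∑ j, paramSq (v j) := by
  have hself : ∀ i, ∃ K : ℝ≥0, ∀ v, MemLp v 2 paramMeasure →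
      paramSq (fun t => ((Γ.M i).c * t + (Γ.M i).d) * lineLimit ((Γ.M i).density v) t) ≤
        K * paramSq v := by
    intro i
    obtain ⟨K₁, hK₁⟩ := isCompact_Icc.exists_bound_of_continuousOn
      (show ContinuousOn (fun t : ℝ => (Γ.M i).c * (t : ℂ) + (Γ.M i).d) (Icc (-1) 1) by fun_prop)
    obtain ⟨K₂, hK₂⟩ := (Γ.noPole i).exists_integral_density_le
    refine ⟨K₁.toNNReal ^ 2 * ((4 * Real.pi ^ 2).toNNReal * K₂), fun v hv => ?_⟩
    obtain ⟨h1, h2, -⟩ := lineLimit_spec ((Γ.noPole i).integrable_density hv)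
      ((Γ.noPole i).memLp_density hv)
    refine (paramSq_mul_le (K := K₁.toNNReal) fun t ht =>
      NNReal.le_toNNReal_of_coe_le (hK₁ t ht)).trans ?_
    push_cast
    rw [mul_assoc, mul_assoc]
    gcongr
    calc paramSq (lineLimit ((Γ.M i).density v))
        ≤ ∫⁻ t, ‖lineLimit ((Γ.M i).density v) t‖ₑ ^ 2 := setLIntegral_le_lintegral _ _
      _ = ENNReal.ofReal (∫ t, ‖lineLimit ((Γ.M i).density v) t‖ ^ 2) := lintegral_enorm_sq_eq h1
      _ ≤ ENNReal.ofReal (4 * Real.pi ^ 2 * ∫ s, ‖(Γ.M i).density v s‖ ^ 2) :=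
        ENNReal.ofReal_le_ofReal h2
      _ = ENNReal.ofReal (4 * Real.pi ^ 2) * ENNReal.ofReal (∫ s, ‖(Γ.M i).density v s‖ ^ 2) :=
        ENNReal.ofReal_mul (by positivity)
      _ ≤ ENNReal.ofReal (4 * Real.pi ^ 2) * (K₂ * paramSq v) := by
        gcongr
        exact hK₂ v hv
  have hcross : ∀ i j, ∃ K : ℝ≥0, j ≠ i → ∀ v, MemLp v 2 paramMeasure →
      paramSq (fun t => (Γ.M j).arcCauchy v ((Γ.M i).map t)) ≤ K * paramSq v := by
    intro i j
    by_cases hj : j = i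
    · exact ⟨0, fun h => absurd hj h⟩
    · obtain ⟨K, hK⟩ := (Γ.noPole j).exists_arcCauchy_map_le (Γ.noPole i) (Γ.meet_at_endpoints j i hj)
      exact ⟨K, fun _ => hK⟩
  choose K₁ hK₁ using hself
  choose K₂ hK₂ using hcross
  have hle : ∀ (f : Fin ℓ → ℝ≥0) i, f i ≤ ∑ i, f i := fun f i =>
    Finset.single_le_sum (fun _ _ => zero_le) (Finset.mem_univ i)
  set S₁ := ∑ i, K₁ i
  set S₂ := ∑ i, ∑ j, K₂ i j
  refine ⟨2 * (S₁ + 2 ^ ℓ * S₂), fun v hv i => ?_⟩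
  set T := ∑ j, paramSq (v j)
  have hT : ∀ j, paramSq (v j) ≤ T := fun j =>
    Finset.single_le_sum (f := fun j => paramSq (v j)) (fun _ _ => zero_le) (Finset.mem_univ j)
  unfold boundary
  have hm : AEStronglyMeasurable (fun t : ℝ => ((Γ.M i).c * t + (Γ.M i).d) *
      lineLimit ((Γ.M i).density (v i)) t) paramMeasure :=
    AEStronglyMeasurable.mul (show Continuous fun t : ℝ => (Γ.M i).c * (t : ℂ) + (Γ.M i).d by
      fun_prop).aestronglyMeasurable (lineLimit_spec ((Γ.noPole i).integrable_density (hv i))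
      ((Γ.noPole i).memLp_density (hv i))).1.1.restrict
  refine (paramSq_add_le hm).trans ?_
  push_cast
  rw [mul_assoc, add_mul]
  gcongr
  · refine (hK₁ i _ (hv i)).trans ?_
    gcongr
    · exact hle K₁ i
    · exact hT i
  · refine (paramSq_sum_le _ fun j hj =>
      aestronglyMeasurable_cross hv (Finset.ne_of_mem_erase hj)).trans ?_
    rw [mul_assoc]
    gcongr
    · norm_num
    · exact (Finset.card_le_univ _).trans (by simp)
    · calc ∑ j ∈ Finset.univ.erase i, paramSq (fun t => (Γ.M j).arcCauchy (v j) ((Γ.M i).map t))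
          ≤ ∑ j ∈ Finset.univ.erase i, (K₂ i j : ℝ≥0∞) * paramSq (v j) :=
            Finset.sum_le_sum fun j hj => hK₂ i j (Finset.ne_of_mem_erase hj) _ (hv j)
        _ ≤ ∑ j, (K₂ i j : ℝ≥0∞) * paramSq (v j) :=
            Finset.sum_le_sum_of_subset (Finset.erase_subset _ _)
        _ ≤ ∑ j, (K₂ i j : ℝ≥0∞) * T := by gcongr with j; exact hT j
        _ = ((∑ j, K₂ i j : ℝ≥0) : ℝ≥0∞) * T := by rw [← Finset.sum_mul]; push_cast; rfl
        _ ≤ S₂ * T := by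
            gcongr
            exact hle (fun i => ∑ j, K₂ i j) i

theorem memLp_boundary (hv : ∀ j, MemLp (v j) 2 paramMeasure) (i : Fin ℓ) :
    MemLp (Γ.boundary v i) 2 paramMeasure := by
  obtain ⟨K, hK⟩ := Γ.exists_paramSq_boundary_le
  refine memLp_two_of_lintegral_lt_top (aestronglyMeasurable_boundary hv i) ?_
  exact (hK v hv i).trans_lt (ENNReal.mul_lt_top (by simp)
    (ENNReal.sum_lt_top.2 fun j _ => paramSq_lt_top (hv j)))

/-- At an interior point of the arc the integrals over the other arcs are continuous. The own arc is
pulled back to the line, where the approach from the right becomes an approach from below. The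
second limit runs along verticals of the parameter plane, which suit integration along shifted
segments. -/
theorem ae_tendsto_sCauchy (hv : ∀ j, MemLp (v j) 2 paramMeasure) (i : Fin ℓ) :
    ∀ᵐ t ∂paramMeasure, Tendsto (Γ.sCauchy v) (Γ.rightApproach i t) (𝓝 (Γ.boundary v i t)) ∧
      Tendsto (fun n : ℕ => Γ.sCauchy v
        ((Γ.M i).map ((t : ℂ) - ((n + 1 : ℝ)⁻¹ : ℝ) * Complex.I))) atTop
        (𝓝 (Γ.boundary v i t)) := by
  have hd1 := (Γ.noPole i).integrable_density (hv i)
  have hd2 := (Γ.noPole i).memLp_density (hv i)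
  obtain ⟨hg, -, hlim⟩ := lineLimit_spec hd1 hd2
  refine ae_param_of_Ioo ?_
  filter_upwards [ae_tendsto_lineCauchy hd1 hg hlim] with t ht htm
  have htd := Γ.no_pole i t (Ioo_subset_Icc_self htm)
  have hlin : ContinuousAt (fun w : ℂ => (Γ.M i).c * w + (Γ.M i).d) t := by fun_prop
  have hcross : Tendsto (fun z => ∑ j ∈ Finset.univ.erase i, (Γ.M j).arcCauchy (v j) z)
      (𝓝 ((Γ.M i).map t))
      (𝓝 (∑ j ∈ Finset.univ.erase i, (Γ.M j).arcCauchy (v j) ((Γ.M i).map t))) :=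
    tendsto_finsetSum _ fun j hj => ((Γ.noPole j).hasDerivAt_arcCauchy (hv j)
      ((Γ.mem_crossDomain i htm).2 j (Finset.ne_of_mem_erase hj))).continuousAt
  constructor
  · refine tendsto_iSup.2 fun K => ?_
    have h1 := Mobius.tendsto_symm_map (M := Γ.M i) htd K
    have h2 := ((hlin.tendsto.mono_left nhdsWithin_le_nhds).comp h1).mul
      ((ht (4 * (K + 1)) (by positivity)).comp h1)
    refine (h2.add (hcross.mono_left nhdsWithin_le_nhds)).congr' ?_
    have hop : ∀ᶠ z in 𝓝 ((Γ.M i).map t), (Γ.M i).symm.c * z + (Γ.M i).symm.d ≠ 0 :=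
      (isOpen_ne_fun (by fun_prop) (by fun_prop)).mem_nhds (Mobius.symm_denom_map htd)
    filter_upwards [mem_nhdsWithin_of_mem_nhds hop] with z hz
    have := (Γ.noPole i).arcCauchy_map_self (v := v i) (Mobius.denom_symm_map hz)
    rw [Mobius.map_symm_map hz] at this
    rw [sCauchy_eq v i z, this]
    rfl
  · have hw := tendsto_sub_inv_nat_succ t
    have hsec : Tendsto (fun n : ℕ => (t : ℂ) - ((n + 1 : ℝ)⁻¹ : ℝ) * Complex.I) atTop
        (𝓝[{z : ℂ | z.im < 0 ∧ ‖z - t‖ ≤ 1 * -z.im}] (t : ℂ)) := by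
      refine tendsto_nhdsWithin_iff.2 ⟨hw, Eventually.of_forall fun n => ?_⟩
      have hpos : (0 : ℝ) < (n + 1 : ℝ)⁻¹ := by positivity
      generalize (n + 1 : ℝ)⁻¹ = δ at hpos
      refine ⟨by simpa using hpos, ?_⟩
      rw [sub_sub_cancel_left, norm_neg, norm_mul, Complex.norm_real, Complex.norm_I,
        Real.norm_of_nonneg hpos.le]
      simp
    have h2 := (hlin.tendsto.comp hw).mul ((ht 1 zero_le_one).comp hsec)
    have h3 := hcross.comp (((Γ.M i).hasDerivAt_map t htd).continuousAt.tendsto.comp hw)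
    refine (h2.add h3).congr' ?_
    have hop : ∀ᶠ w in 𝓝 (t : ℂ), (Γ.M i).c * w + (Γ.M i).d ≠ 0 :=
      (isOpen_ne_fun (by fun_prop) (by fun_prop)).mem_nhds htd
    filter_upwards [hw.eventually hop] with n hn
    rw [sCauchy_eq v i, (Γ.noPole i).arcCauchy_map_self (v := v i) hn]
    rfl

end MobiusContour

/-! ### Differentiability of the boundary values under the zero-sum condition -/

namespace MobiusContour

variable {ℓ : ℕ} {Γ : MobiusContour ℓ} {v : Fin ℓ → ℝ → ℂ}

/-- A closed segment inside `(-1, 1)` has a compact neighbourhood within the open set `crossDomain`;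
small shifts stay in it uniformly, and `A` is bounded there. -/
theorem exists_bound_below {i : Fin ℓ} {x₁ x₂ : ℝ} (h₁ : -1 < x₁) (h₂ : x₂ < 1) {A : ℂ → ℂ}
    (hA : ContinuousOn A (Γ.crossDomain i)) :
    ∃ B : ℝ, ∀ᶠ n : ℕ in atTop, ∀ t ∈ Icc x₁ x₂,
      (t : ℂ) - ((n + 1 : ℝ)⁻¹ : ℝ) * Complex.I ∈ Γ.crossDomain i ∧
      ‖A ((t : ℂ) - ((n + 1 : ℝ)⁻¹ : ℝ) * Complex.I)‖ ≤ B := by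
  have hK : IsCompact ((fun t : ℝ => (t : ℂ)) '' Icc x₁ x₂) :=
    isCompact_Icc.image Complex.continuous_ofReal
  have hsub : (fun t : ℝ => (t : ℂ)) '' Icc x₁ x₂ ⊆ Γ.crossDomain i := by
    rintro _ ⟨t, ht, rfl⟩
    exact Γ.mem_crossDomain i ⟨h₁.trans_le ht.1, ht.2.trans_lt h₂⟩
  obtain ⟨δ, hδ, hth⟩ := hK.exists_cthickening_subset_open (Γ.isOpen_crossDomain i) hsub
  obtain ⟨B, hB⟩ := hK.cthickening.exists_bound_of_continuousOn (hA.mono hth)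
  refine ⟨B, ?_⟩
  filter_upwards [tendsto_inv_nat_succ.eventually (ge_mem_nhds hδ)] with n hn t ht
  have hmem : (t : ℂ) - ((n + 1 : ℝ)⁻¹ : ℝ) * Complex.I ∈
      Metric.cthickening δ ((fun t : ℝ => (t : ℂ)) '' Icc x₁ x₂) := by
    refine Metric.mem_cthickening_of_dist_le _ (t : ℂ) _ _ ⟨t, ht, rfl⟩ ?_
    have hpos : (0 : ℝ) < (n + 1 : ℝ)⁻¹ := by positivity
    generalize (n + 1 : ℝ)⁻¹ = ε at hpos hn
    rw [dist_eq_norm, sub_sub_cancel_left, norm_neg, norm_mul, Complex.norm_real, Complex.norm_I,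
      Real.norm_of_nonneg hpos.le, mul_one]
    exact hn
  exact ⟨hth hmem, hB _ hmem⟩

theorem tendsto_integral_below {i : Fin ℓ} {x₁ x₂ : ℝ} (h₁ : -1 < x₁) (h₂ : x₂ < 1) {A : ℂ → ℂ}
    (hA : ContinuousOn A (Γ.crossDomain i)) {F : ℕ → ℝ → ℂ} {g : ℝ → ℂ}
    (hF : ∀ n, MemLp (F n) 2 (volume.restrict (Ioc x₁ x₂)))
    (hg : MemLp g 2 (volume.restrict (Ioc x₁ x₂)))
    (hlim : Tendsto (fun n => eLpNorm (fun x => F n x - g x) 2 (volume.restrict (Ioc x₁ x₂)))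
      atTop (𝓝 0)) :
    Tendsto (fun n : ℕ => ∫ t in Ioc x₁ x₂, F n t * A ((t : ℂ) - ((n + 1 : ℝ)⁻¹ : ℝ) * Complex.I))
      atTop (𝓝 (∫ t in Ioc x₁ x₂, g t * A t)) := by
  obtain ⟨B, hB⟩ := exists_bound_below h₁ h₂ hA
  refine tendsto_integral_mul_of_bounded (B := B) hF hg ?_ ?_ ?_ hlim
  · filter_upwards [hB] with n hn
    refine ContinuousOn.aestronglyMeasurable ?_ measurableSet_Ioc
    refine hA.comp (by fun_prop) fun t ht => (hn t (Ioc_subset_Icc_self ht)).1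
  · filter_upwards [hB] with n hn
    exact (ae_restrict_iff' measurableSet_Ioc).2 (Eventually.of_forall fun t ht =>
      (hn t (Ioc_subset_Icc_self ht)).2)
  · refine (ae_restrict_iff' measurableSet_Ioc).2 (Eventually.of_forall fun t ht => ?_)
    have hmem := Γ.mem_crossDomain i ⟨h₁.trans ht.1, ht.2.trans_lt h₂⟩
    exact ((hA.continuousAt ((Γ.isOpen_crossDomain i).mem_nhds hmem)).tendsto).comp
      (tendsto_sub_inv_nat_succ t)

theorem continuousOn_der_crossDomain (i : Fin ℓ) :
    ContinuousOn (Γ.M i).der (Γ.crossDomain i) :=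
  ContinuousOn.div (by fun_prop) (by fun_prop) fun w hw => pow_ne_zero 2 hw.1

/-- The own arc converges only in `L²`, the others converge boundedly on the segment; both are
instances of `tendsto_integral_below`. -/
theorem tendsto_integral_sCauchy (hv : ∀ j, MemLp (v j) 2 paramMeasure) (i : Fin ℓ) {x₁ x₂ : ℝ}
    (h₁ : -1 < x₁) (h₂ : x₂ < 1) :
    Tendsto (fun n : ℕ => ∫ t in Ioc x₁ x₂,
      Γ.sCauchy v ((Γ.M i).map ((t : ℂ) - ((n + 1 : ℝ)⁻¹ : ℝ) * Complex.I)) *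
        (Γ.M i).der ((t : ℂ) - ((n + 1 : ℝ)⁻¹ : ℝ) * Complex.I)) atTop
      (𝓝 (∫ t in Ioc x₁ x₂, Γ.boundary v i t * (Γ.M i).der t)) := by
  have hd1 := (Γ.noPole i).integrable_density (hv i)
  have hd2 := (Γ.noPole i).memLp_density (hv i)
  obtain ⟨hg, -, hlim⟩ := lineLimit_spec hd1 hd2
  set dens := (Γ.M i).density (v i)
  have hder := continuousOn_der_crossDomain (Γ := Γ) i
  have hA₁ : ContinuousOn (fun w => ((Γ.M i).c * w + (Γ.M i).d) * (Γ.M i).der w)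
      (Γ.crossDomain i) := ContinuousOn.mul (by fun_prop) hder
  have hA₂ : ContinuousOn (fun w => (∑ j ∈ Finset.univ.erase i,
      (Γ.M j).arcCauchy (v j) ((Γ.M i).map w)) * (Γ.M i).der w) (Γ.crossDomain i) :=
    (continuousOn_finsetSum _ fun j hj => continuousOn_cross hv (Finset.ne_of_mem_erase hj)).mul hder
  have hF : ∀ n : ℕ, MemLp (fun x : ℝ => lineCauchy dens (x - ((n + 1 : ℝ)⁻¹ : ℝ) * Complex.I)) 2
      volume := fun n => memLp_lineCauchy hd1 (by positivity)
  have t1 := tendsto_integral_below (F := fun (n : ℕ) (x : ℝ) =>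
    lineCauchy dens (x - ((n + 1 : ℝ)⁻¹ : ℝ) * Complex.I)) h₁ h₂ hA₁
    (fun n => (hF n).restrict _) (hg.restrict _)
    (tendsto_of_tendsto_of_tendsto_of_le_of_le tendsto_const_nhds hlim (fun n => zero_le)
      fun n => eLpNorm_mono_measure _ Measure.restrict_le_self)
  have t2 := tendsto_integral_below (F := fun _ _ => 1) (g := fun _ => 1) h₁ h₂ hA₂
    (fun n => memLp_const 1) (memLp_const 1) (by simp)
  obtain ⟨B₁, hB₁⟩ := exists_bound_below h₁ h₂ hA₁
  obtain ⟨B₂, hB₂⟩ := exists_bound_below h₁ h₂ hA₂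
  have hmeas : ∀ {A : ℂ → ℂ} (n : ℕ), ContinuousOn A (Γ.crossDomain i) →
      (∀ t ∈ Icc x₁ x₂, (t : ℂ) - ((n + 1 : ℝ)⁻¹ : ℝ) * Complex.I ∈ Γ.crossDomain i) →
      IntegrableOn (fun t : ℝ => A ((t : ℂ) - ((n + 1 : ℝ)⁻¹ : ℝ) * Complex.I)) (Ioc x₁ x₂) ∧
      MemLp (fun t : ℝ => A ((t : ℂ) - ((n + 1 : ℝ)⁻¹ : ℝ) * Complex.I)) 2
        (volume.restrict (Ioc x₁ x₂)) := by
    intro A n hA hn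
    have hc : ContinuousOn (fun t : ℝ => A ((t : ℂ) - ((n + 1 : ℝ)⁻¹ : ℝ) * Complex.I)) (Icc x₁ x₂) :=
      hA.comp (by fun_prop) hn
    obtain ⟨C, hC⟩ := isCompact_Icc.exists_bound_of_continuousOn hc
    refine ⟨(hc.integrableOn_Icc).mono_set Ioc_subset_Icc_self, ?_⟩
    exact MemLp.of_bound ((hc.mono Ioc_subset_Icc_self).aestronglyMeasurable measurableSet_Ioc) C
      ((ae_restrict_iff' measurableSet_Ioc).2 (Eventually.of_forall fun t ht =>
        hC t (Ioc_subset_Icc_self ht)))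
  have hsubI : Ioc x₁ x₂ ⊆ Icc (-1 : ℝ) 1 := fun t ht => ⟨(h₁.trans ht.1).le, (ht.2.trans_lt h₂).le⟩
  have hres : volume.restrict (Ioc x₁ x₂) ≤ paramMeasure := Measure.restrict_mono hsubI le_rfl
  have hRm : MemLp (fun t : ℝ => (∑ j ∈ Finset.univ.erase i,
      (Γ.M j).arcCauchy (v j) ((Γ.M i).map t)) * (Γ.M i).der t) 2 (volume.restrict (Ioc x₁ x₂)) := by
    have hc : ContinuousOn (fun t : ℝ => (∑ j ∈ Finset.univ.erase i,
      (Γ.M j).arcCauchy (v j) ((Γ.M i).map t)) * (Γ.M i).der t) (Icc x₁ x₂) :=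
      hA₂.comp Complex.continuous_ofReal.continuousOn fun t ht =>
        Γ.mem_crossDomain i ⟨h₁.trans_le ht.1, ht.2.trans_lt h₂⟩
    obtain ⟨C, hC⟩ := isCompact_Icc.exists_bound_of_continuousOn hc
    exact MemLp.of_bound ((hc.mono Ioc_subset_Icc_self).aestronglyMeasurable measurableSet_Ioc) C
      ((ae_restrict_iff' measurableSet_Ioc).2 (Eventually.of_forall fun t ht =>
        hC t (Ioc_subset_Icc_self ht)))
  have hlm : Integrable (fun t : ℝ => lineLimit dens t *
      (((Γ.M i).c * t + (Γ.M i).d) * (Γ.M i).der t)) (volume.restrict (Ioc x₁ x₂)) := by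
    have hc : ContinuousOn (fun t : ℝ => ((Γ.M i).c * t + (Γ.M i).d) * (Γ.M i).der t) (Icc (-1) 1) :=
      ContinuousOn.mul (by fun_prop) (Γ.continuousOn_der i)
    exact MemLp.integrable_mul (hg.restrict _)
      ((memLp_param_of_continuousOn hc 2).mono_measure hres)
  have hsum := t1.add t2
  have e : ∫ t in Ioc x₁ x₂, Γ.boundary v i t * (Γ.M i).der t =
      (∫ t in Ioc x₁ x₂, lineLimit dens t * (((Γ.M i).c * t + (Γ.M i).d) * (Γ.M i).der t)) +
      ∫ t in Ioc x₁ x₂, 1 * ((∑ j ∈ Finset.univ.erase i,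
        (Γ.M j).arcCauchy (v j) ((Γ.M i).map t)) * (Γ.M i).der t) := by
    simp only [one_mul]
    rw [← integral_add hlm (hRm.integrable (by norm_num))]
    refine integral_congr_ae (Eventually.of_forall fun t => ?_)
    simp only [boundary]
    ring
  rw [e]
  refine hsum.congr' ?_
  filter_upwards [hB₁, hB₂] with n hn hn'
  have m1 := (hmeas n hA₁ fun t ht => (hn t ht).1).2
  have m2 := (hmeas n hA₂ fun t ht => (hn t ht).1).1
  simp only [one_mul]
  have m3 : Integrable (fun t : ℝ => lineCauchy dens ((t : ℂ) - ((n + 1 : ℝ)⁻¹ : ℝ) * Complex.I) *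
      (((Γ.M i).c * ((t : ℂ) - ((n + 1 : ℝ)⁻¹ : ℝ) * Complex.I) + (Γ.M i).d) *
        (Γ.M i).der ((t : ℂ) - ((n + 1 : ℝ)⁻¹ : ℝ) * Complex.I))) (volume.restrict (Ioc x₁ x₂)) :=
    MemLp.integrable_mul ((hF n).restrict _) m1
  refine (integral_add m3 m2).symm.trans ?_
  refine setIntegral_congr_fun measurableSet_Ioc fun t ht => ?_
  have := (hn t (Ioc_subset_Icc_self ht)).1.1
  rw [sCauchy_eq v i, (Γ.noPole i).arcCauchy_map_self this]
  ring

/-- The complement of the contour. -/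
def OffContour (Γ : MobiusContour ℓ) (z : ℂ) : Prop :=
  ∀ j, ∀ s ∈ Icc (-1 : ℝ) 1, (Γ.M j).map s ≠ z

theorem offContour_map {i : Fin ℓ} {w : ℂ} (hw : w ∈ Γ.crossDomain i) (him : w.im ≠ 0) :
    Γ.OffContour ((Γ.M i).map w) := by
  intro j s hs h
  by_cases hj : j = i
  · subst hj
    have := congrArg (Γ.M j).symm.map h
    rw [Mobius.symm_map_map (Γ.no_pole j s hs), Mobius.symm_map_map hw.1] at this
    rw [← this] at him
    simp at him
  · exact hw.2 j hj s hs h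

theorem eventually_offContour (i : Fin ℓ) {t : ℝ} (ht : t ∈ Ioo (-1 : ℝ) 1) :
    ∀ᶠ z in Γ.rightApproach i t, Γ.OffContour z := by
  refine mem_iSup.2 fun K => ?_
  have htd := Γ.no_pole i t (Ioo_subset_Icc_self ht)
  have h1 := Mobius.tendsto_symm_map (M := Γ.M i) htd K
  have hop : ∀ᶠ z in 𝓝 ((Γ.M i).map t), (Γ.M i).symm.c * z + (Γ.M i).symm.d ≠ 0 :=
    (isOpen_ne_fun (by fun_prop) (by fun_prop)).mem_nhds (Mobius.symm_denom_map htd)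
  filter_upwards [h1.eventually self_mem_nhdsWithin, h1.eventually (mem_nhdsWithin_of_mem_nhds
    ((Γ.isOpen_crossDomain i).mem_nhds (Γ.mem_crossDomain i ht))),
    mem_nhdsWithin_of_mem_nhds hop] with z h2 h3 h4
  have := offContour_map h3 h2.1.ne
  rwa [Mobius.map_symm_map h4] at this

/-- The values at the endpoints cancel against each other, in the sense of the zeroth-order zero-sum
condition. -/
def ScalarZeroSum (Γ : MobiusContour ℓ) (f : Fin ℓ → ℝ → ℂ) : Prop :=
  ∀ a : ℂ, ∑ i, ((if (Γ.M i).map 1 = a then f i 1 else 0)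
    - (if (Γ.M i).map (-1) = a then f i (-1) else 0)) = 0

/-- The terms are grouped by endpoint, where the weight `φ a` factors out. With `φ a = 1 / (a - z)`
these are the endpoint terms that integration by parts leaves in the derivative of the Cauchy
integral. -/
theorem ScalarZeroSum.sum_eq_zero {f : Fin ℓ → ℝ → ℂ} (h : Γ.ScalarZeroSum f) (φ : ℂ → ℂ) :
    ∑ i, (f i 1 * φ ((Γ.M i).map 1) - f i (-1) * φ ((Γ.M i).map (-1))) = 0 := by
  classical
  set A : Finset ℂ := Finset.univ.image (fun i => (Γ.M i).map 1) ∪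
    Finset.univ.image fun i => (Γ.M i).map (-1)
  have h1 : ∑ a ∈ A, φ a * ∑ i, ((if (Γ.M i).map 1 = a then f i 1 else 0)
    - (if (Γ.M i).map (-1) = a then f i (-1) else 0)) = 0 :=
    Finset.sum_eq_zero fun a _ => by rw [h a, mul_zero]
  rw [← h1]
  simp only [Finset.mul_sum]
  rw [Finset.sum_comm]
  refine Finset.sum_congr rfl fun i _ => ?_
  simp only [mul_sub, mul_ite, mul_zero, Finset.sum_sub_distrib, Finset.sum_ite_eq]
  have hm1 : (Γ.M i).map 1 ∈ A := Finset.mem_union_left _ (Finset.mem_image_of_mem _ (Finset.mem_univ i))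
  have hm2 : (Γ.M i).map (-1) ∈ A :=
    Finset.mem_union_right _ (Finset.mem_image_of_mem (fun i => (Γ.M i).map (-1)) (Finset.mem_univ i))
  rw [if_pos hm1, if_pos hm2]
  ring

theorem hasDerivAt_sCauchy {f g : Fin ℓ → ℝ → ℂ}
    (hf : ∀ j, HasPrim (f j) fun t => (Γ.M j).der t * g j t) (hz : Γ.ScalarZeroSum f) {z : ℂ}
    (h : Γ.OffContour z) : HasDerivAt (Γ.sCauchy f) (Γ.sCauchy g z) z := by
  have h1 : HasDerivAt (fun z => ∑ j, (Γ.M j).arcCauchy (f j) z) _ z := HasDerivAt.fun_sum fun j _ =>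
    (Γ.noPole j).hasDerivAt_arcCauchy_of_hasPrim (hf j) (h j)
  refine h1.congr_deriv ?_
  rw [Finset.sum_sub_distrib]
  have := hz.sum_eq_zero fun a => (a - z)⁻¹
  simp only [← div_eq_mul_inv] at this
  rw [this, sub_zero, sCauchy]

theorem memLp_of_hasPrim {f g : Fin ℓ → ℝ → ℂ}
    (hf : ∀ j, HasPrim (f j) fun t => (Γ.M j).der t * g j t) (j : Fin ℓ) :
    MemLp (g j) 2 paramMeasure := by
  have h1 := MemLp.continuousOn_mul_param ((Γ.continuousOn_der j).inv₀ fun t ht =>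
    Γ.der_ne_zero j ht) (hf j).memLp
  refine (memLp_congr_ae ?_).1 h1
  refine (ae_restrict_iff' measurableSet_Icc).2 (Eventually.of_forall fun t ht => ?_)
  simp [Γ.der_ne_zero j ht]

/-- The boundary values of the Cauchy integral of a function that satisfies the zero-sum condition
are differentiable, with the derivative that one expects. -/
theorem exists_hasPrim_boundary {f g : Fin ℓ → ℝ → ℂ}
    (hf : ∀ j, HasPrim (f j) fun t => (Γ.M j).der t * g j t) (hz : Γ.ScalarZeroSum f) (i : Fin ℓ) :
    ∃ H, HasPrim H (fun t => (Γ.M i).der t * Γ.boundary g i t) ∧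
      Γ.boundary f i =ᵐ[paramMeasure] H := by
  have hfm : ∀ j, MemLp (f j) 2 paramMeasure := fun j =>
    memLp_param_of_continuousOn (hf j).continuousOn 2
  have hgm := memLp_of_hasPrim hf
  set k := fun t : ℝ => (Γ.M i).der t * Γ.boundary g i t
  have hk : MemLp k 2 paramMeasure :=
    MemLp.continuousOn_mul_param (Γ.continuousOn_der i) (memLp_boundary hgm i)
  have hgood : ∀ᵐ t ∂paramMeasure, t ∈ Ioo (-1 : ℝ) 1 ∧ Tendsto (fun n : ℕ => Γ.sCauchy f
      ((Γ.M i).map ((t : ℂ) - ((n + 1 : ℝ)⁻¹ : ℝ) * Complex.I))) atTop (𝓝 (Γ.boundary f i t)) := by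
    filter_upwards [ae_param_of_Ioo (Eventually.of_forall fun t ht => ht),
      ae_tendsto_sCauchy hfm i] with t h1 h2
    exact ⟨h1, h2.2⟩
  -- The fundamental theorem of calculus holds on the segment shifted below the real axis, where the
  -- Cauchy integral is differentiable. Letting the shift tend to zero transfers it to the boundary
  -- values at points of convergence.
  have key : ∀ x₁ x₂ : ℝ, x₁ ≤ x₂ → x₁ ∈ Ioo (-1 : ℝ) 1 → x₂ ∈ Ioo (-1 : ℝ) 1 →
      Tendsto (fun n : ℕ => Γ.sCauchy f
        ((Γ.M i).map ((x₁ : ℂ) - ((n + 1 : ℝ)⁻¹ : ℝ) * Complex.I))) atTop (𝓝 (Γ.boundary f i x₁)) →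
      Tendsto (fun n : ℕ => Γ.sCauchy f
        ((Γ.M i).map ((x₂ : ℂ) - ((n + 1 : ℝ)⁻¹ : ℝ) * Complex.I))) atTop (𝓝 (Γ.boundary f i x₂)) →
      Γ.boundary f i x₂ - Γ.boundary f i x₁ = ∫ t in x₁..x₂, k t := by
    intro x₁ x₂ hle hx₁ hx₂ l₁ l₂
    have hlim := tendsto_integral_sCauchy (Γ := Γ) hgm i hx₁.1 hx₂.2
    refine (tendsto_nhds_unique (l₂.sub l₁) ?_).trans ?_ (b := ∫ t in Ioc x₁ x₂, Γ.boundary g i t * (Γ.M i).der t)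
    · refine hlim.congr' ?_
      -- With the zero function only the membership of the shifted points in `crossDomain` is
      -- extracted.
      obtain ⟨B, hB⟩ := exists_bound_below (A := fun _ => 0) hx₁.1 hx₂.2 (continuousOn_const (s := Γ.crossDomain i))
      filter_upwards [hB] with n hn
      have hoff : ∀ t ∈ Icc x₁ x₂, Γ.OffContour ((Γ.M i).map ((t : ℂ) - ((n + 1 : ℝ)⁻¹ : ℝ) * Complex.I)) := by
        intro t ht
        refine offContour_map (hn t ht).1 ?_
        have hpos : (0 : ℝ) < (n + 1 : ℝ)⁻¹ := by positivity
        generalize (n + 1 : ℝ)⁻¹ = δ at hpos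
        simpa using hpos.ne'
      have hd : ∀ t ∈ Icc x₁ x₂, HasDerivAt (fun t : ℝ => Γ.sCauchy f
          ((Γ.M i).map ((t : ℂ) - ((n + 1 : ℝ)⁻¹ : ℝ) * Complex.I)))
          (Γ.sCauchy g ((Γ.M i).map ((t : ℂ) - ((n + 1 : ℝ)⁻¹ : ℝ) * Complex.I)) *
            (Γ.M i).der ((t : ℂ) - ((n + 1 : ℝ)⁻¹ : ℝ) * Complex.I)) t := by
        intro t ht
        have e1 := (hasDerivAt_sCauchy hf hz (hoff t ht)).comp
          ((t : ℂ) - ((n + 1 : ℝ)⁻¹ : ℝ) * Complex.I) ((Γ.M i).hasDerivAt_map _ (hn t ht).1.1)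
        have e2 := e1.comp_sub_const (t : ℂ) (((n + 1 : ℝ)⁻¹ : ℝ) * Complex.I)
        exact e2.comp_ofReal
      have hcont : ContinuousOn (fun t : ℝ =>
          Γ.sCauchy g ((Γ.M i).map ((t : ℂ) - ((n + 1 : ℝ)⁻¹ : ℝ) * Complex.I)) *
            (Γ.M i).der ((t : ℂ) - ((n + 1 : ℝ)⁻¹ : ℝ) * Complex.I)) (Icc x₁ x₂) := by
        refine ContinuousOn.mul ?_ ((continuousOn_der_crossDomain i).comp (by fun_prop)
          fun t ht => (hn t ht).1)
        refine continuousOn_finsetSum _ fun j _ t ht => ?_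
        have c1 := ((Γ.noPole j).hasDerivAt_arcCauchy (hgm j) (hoff t ht j)).continuousAt
        have c2 := ((Γ.M i).hasDerivAt_map _ (hn t ht).1.1).continuousAt
        have c3 : ContinuousAt (fun t : ℝ => (t : ℂ) - ((n + 1 : ℝ)⁻¹ : ℝ) * Complex.I) t := by fun_prop
        have c4 : ContinuousAt (fun t : ℝ => (Γ.M i).map ((t : ℂ) - ((n + 1 : ℝ)⁻¹ : ℝ) * Complex.I)) t :=
          ContinuousAt.comp (g := (Γ.M i).map) c2 c3
        have c5 : ContinuousAt (fun t : ℝ => (Γ.M j).arcCauchy (g j)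
            ((Γ.M i).map ((t : ℂ) - ((n + 1 : ℝ)⁻¹ : ℝ) * Complex.I))) t := c1.tendsto.comp c4.tendsto
        exact c5.continuousWithinAt
      rw [← intervalIntegral.integral_of_le hle]
      rw [← uIcc_of_le hle] at hd hcont
      exact intervalIntegral.integral_eq_sub_of_hasDerivAt hd hcont.intervalIntegrable
    · rw [intervalIntegral.integral_of_le hle]
      exact integral_congr_ae (Eventually.of_forall fun t => mul_comm _ _)
  have hne : (ae paramMeasure).NeBot := by
    rw [ae_neBot, Ne, Measure.restrict_eq_zero, Real.volume_Icc]
    norm_num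
  obtain ⟨x₀, hx₀, l₀⟩ := hgood.exists
  have hki := hk.integrable (by norm_num : (1 : ℝ≥0∞) ≤ 2)
  refine ⟨fun t => Γ.boundary f i x₀ - (∫ s in (-1 : ℝ)..x₀, k s) + ∫ s in (-1 : ℝ)..t, k s,
    ⟨hk, fun t _ => by simp⟩, ?_⟩
  filter_upwards [hgood] with t ⟨ht, lt⟩
  have hadd := intervalIntegral.integral_interval_sub_left
    (intervalIntegrable_of_integrable hki left_mem (Ioo_subset_Icc_self ht))
    (intervalIntegrable_of_integrable hki left_mem (Ioo_subset_Icc_self hx₀))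
  rcases le_total x₀ t with hle | hle
  · linear_combination key x₀ t hle hx₀ ht l₀ lt - hadd
  · have hsymm := intervalIntegral.integral_symm (f := k) (μ := volume) x₀ t
    linear_combination -key t x₀ hle ht hx₀ lt l₀ - hadd - hsymm

end MobiusContour

/-! ### Operator norms and the matrix-valued boundary operator -/

theorem le_opNorm_mul {ℓ : ℕ} {dom : Set (ArcFun ℓ)} {nd nc : ArcFun ℓ → ℝ≥0∞}
    {T : ArcFun ℓ → ArcFun ℓ} (h : opNorm dom nd nc T ≠ ⊤) {u : ArcFun ℓ} (hu : u ∈ dom)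
    (ht : nd u ≠ ⊤) :
    nc (T u) ≤ opNorm dom nd nc T * nd u := by
  have hne : {K : ℝ≥0∞ | ∀ u ∈ dom, nc (T u) ≤ K * nd u}.Nonempty := by
    by_contra hc
    rw [not_nonempty_iff_eq_empty] at hc
    rw [opNorm, hc, sInf_empty] at h
    exact h rfl
  -- The infimum is itself an admissible constant. Dividing by `nd u` shows this unless it vanishes,
  -- and then any admissible constant already forces the left side to vanish.
  by_cases h0 : nd u = 0
  · obtain ⟨K, hK⟩ := hne
    have := hK u hu
    rw [h0, mul_zero] at this ⊢
    exact this
  exact (ENNReal.div_le_iff h0 ht).1 (le_sInf fun K hK => ENNReal.div_le_of_le_mul (hK u hu))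

theorem opNorm_le {ℓ : ℕ} {dom : Set (ArcFun ℓ)} {nd nc : ArcFun ℓ → ℝ≥0∞}
    {T : ArcFun ℓ → ArcFun ℓ} {K : ℝ≥0∞} (h : ∀ u ∈ dom, nc (T u) ≤ K * nd u) :
    opNorm dom nd nc T ≤ K := sInf_le h

namespace MobiusContour

variable {ℓ : ℕ} {Γ : MobiusContour ℓ} {u v U : ArcFun ℓ}

theorem cauchyMinus_congr (h : AEEqArc u U) : Γ.cauchyMinus u = Γ.cauchyMinus U := by
  have : Γ.cauchy u = Γ.cauchy U := by
    funext z
    unfold cauchy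
    congr 1
    exact Finset.sum_congr rfl fun j _ => integral_congr_ae ((h j).mono fun t ht => by simp only [ht])
  funext i t
  unfold cauchyMinus
  rw [this]

theorem cauchy_apply (hu : Γ.MemL2 u) {z : ℂ} (hz : Γ.OffContour z) (p q : Fin 2) :
    Γ.cauchy u z p q = 1 / (2 * (Real.pi : ℂ) * Complex.I) * Γ.sCauchy (fun j t => u j t p q) z := by
  have h := Γ.memL2_iff.1 hu
  unfold cauchy sCauchy Mobius.arcCauchy
  rw [Matrix.smul_apply, smul_eq_mul, Matrix.sum_apply]
  congr 1
  refine Finset.sum_congr rfl fun j _ => ?_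
  exact integral_matrix_apply (f := fun t => ((Γ.M j).der t / ((Γ.M j).map t - z)) • u j t)
    (fun p q => (Γ.noPole j).integrable_kernel (h j p q) (hz j)) p q

/-- The matrix Cauchy integral is identified with its entries only off the contour, where the kernel
is integrable; the approach region lies there eventually, which is enough for the limit. -/
theorem cauchyMinus_ae (hu : Γ.MemL2 u) (i : Fin ℓ) : ∀ᵐ t ∂paramMeasure, ∀ p q,
    Γ.cauchyMinus u i t p q =
      1 / (2 * (Real.pi : ℂ) * Complex.I) * Γ.boundary (fun j t => u j t p q) i t := by
  have h := Γ.memL2_iff.1 hu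
  have hb : ∀ᵐ t ∂paramMeasure, ∀ p q, Tendsto (Γ.sCauchy fun j t => u j t p q)
      (Γ.rightApproach i t) (𝓝 (Γ.boundary (fun j t => u j t p q) i t)) :=
    ae_all_iff.2 fun p => ae_all_iff.2 fun q =>
      (ae_tendsto_sCauchy (fun j => h j p q) i).mono fun t ht => ht.1
  filter_upwards [hb, ae_param_of_Ioo (Eventually.of_forall fun t ht => ht)] with t ht htm p q
  have := Γ.neBot_rightApproach i (Ioo_subset_Icc_self htm)
  have hlim : Tendsto (Γ.cauchy u) (Γ.rightApproach i t) (𝓝 (Matrix.of fun p q =>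
      1 / (2 * (Real.pi : ℂ) * Complex.I) * Γ.boundary (fun j t => u j t p q) i t)) := by
    refine tendsto_pi_nhds.2 fun p => tendsto_pi_nhds.2 fun q => ?_
    refine ((ht p q).const_mul (1 / (2 * (Real.pi : ℂ) * Complex.I))).congr' ?_
    filter_upwards [eventually_offContour i htm] with z hz
    exact (cauchy_apply hu hz p q).symm
  rw [cauchyMinus, hlim.limUnder_eq, Matrix.of_apply]

theorem memL2_cauchyMinus (hu : Γ.MemL2 u) : Γ.MemL2 (Γ.cauchyMinus u) := by
  have h := Γ.memL2_iff.1 hu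
  refine Γ.memL2_iff.2 fun i p q => ?_
  refine (memLp_congr_ae ((cauchyMinus_ae hu i).mono fun t ht => ht p q)).2 ?_
  exact (memLp_boundary (fun j => h j p q) i).const_mul _

theorem exists_entrySq_cauchyMinus_le (Γ : MobiusContour ℓ) : ∃ K : ℝ≥0, ∀ u, Γ.MemL2 u →
    entrySq (Γ.cauchyMinus u) ≤ K * entrySq u := by
  obtain ⟨K, hK⟩ := Γ.exists_paramSq_boundary_le
  set c : ℂ := 1 / (2 * (Real.pi : ℂ) * Complex.I)
  refine ⟨ℓ * (‖c‖₊ ^ 2 * K), fun u hu => ?_⟩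
  have h := Γ.memL2_iff.1 hu
  have h1 : ∀ i p q, paramSq (fun t => Γ.cauchyMinus u i t p q) ≤
      (‖c‖₊ ^ 2 * K : ℝ≥0) * ∑ j, paramSq fun t => u j t p q := by
    intro i p q
    rw [paramSq_congr ((cauchyMinus_ae hu i).mono fun t ht => ht p q)]
    refine (paramSq_mul_le (w := fun _ => c) (K := ‖c‖₊) fun t _ => le_rfl).trans ?_
    push_cast
    rw [mul_assoc]
    gcongr
    exact hK _ (fun j => h j p q) i
  have h2 : entrySq u = ∑ p, ∑ q, ∑ j, paramSq fun t => u j t p q := by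
    unfold entrySq
    rw [Finset.sum_comm]
    refine Finset.sum_congr rfl fun p _ => ?_
    rw [Finset.sum_comm]
  calc entrySq (Γ.cauchyMinus u)
      ≤ ∑ _i : Fin ℓ, ∑ p, ∑ q, (‖c‖₊ ^ 2 * K : ℝ≥0) * ∑ j, paramSq fun t => u j t p q :=
        Finset.sum_le_sum fun i _ => Finset.sum_le_sum fun p _ => Finset.sum_le_sum fun q _ => h1 i p q
    _ = (ℓ * (‖c‖₊ ^ 2 * K) : ℝ≥0) * entrySq u := by
        rw [h2, Finset.sum_const, Finset.card_univ, Fintype.card_fin, nsmul_eq_mul]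
        simp only [← Finset.mul_sum]
        push_cast
        ring

theorem _root_.le_of_sq_le_sq_ennreal {a b : ℝ≥0∞} (h : a ^ 2 ≤ b ^ 2) : a ≤ b :=
  (ENNReal.pow_le_pow_left_iff two_ne_zero).1 h

/-- The operator `𝓒⁻` is bounded on `L²`. -/
theorem cauchyMinusNorm_lt_top (Γ : MobiusContour ℓ) : Γ.cauchyMinusNorm < ⊤ := by
  obtain ⟨K, hK⟩ := Γ.exists_entrySq_cauchyMinus_le
  have hK' : ∀ u ∈ {u | Γ.MemL2 u}, Γ.l2Norm (Γ.cauchyMinus u) ≤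
      ((1 + Γ.distortion * K * Γ.distortion : ℝ≥0) : ℝ≥0∞) * Γ.l2Norm u := by
    intro u hu
    refine le_of_sq_le_sq_ennreal ?_
    have m1 : ∀ i p q, AEStronglyMeasurable (fun t => Γ.cauchyMinus u i t p q) paramMeasure :=
      fun i p q => (Γ.memL2_iff.1 (memL2_cauchyMinus hu) i p q).1
    have m2 : ∀ i p q, AEStronglyMeasurable (fun t => u i t p q) paramMeasure :=
      fun i p q => (Γ.memL2_iff.1 hu i p q).1
    calc Γ.l2Norm (Γ.cauchyMinus u) ^ 2
        ≤ Γ.distortion * (K * (Γ.distortion * Γ.l2Norm u ^ 2)) := by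
          grw [Γ.l2Norm_sq_le m1, hK u hu, Γ.entrySq_le_l2Norm_sq m2]
      _ = ((Γ.distortion * K * Γ.distortion : ℝ≥0) : ℝ≥0∞) * Γ.l2Norm u ^ 2 := by
          push_cast; ring
      _ ≤ _ := by
          rw [mul_pow]
          gcongr
          norm_cast
          generalize Γ.distortion * K * Γ.distortion = x
          calc x ≤ 1 + x := le_add_self
            _ ≤ (1 + x) ^ 2 := le_self_pow₀ le_self_add two_ne_zero
  exact (opNorm_le hK').trans_lt ENNReal.coe_lt_top

theorem l2Norm_cauchyMinus_le (hu : Γ.MemL2 u) :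
    Γ.l2Norm (Γ.cauchyMinus u) ≤ Γ.cauchyMinusNorm * Γ.l2Norm u :=
  le_opNorm_mul Γ.cauchyMinusNorm_lt_top.ne hu hu.2.ne

theorem ZeroSum.scalarZeroSum (h : Γ.HasArcDeriv U v) (hu : AEEqArc u U) (hz : Γ.ZeroSum u)
    (p q : Fin 2) : Γ.ScalarZeroSum fun j t => U j t p q := by
  intro a
  have h1 := congrFun (congrFun (hz a) p) q
  rw [Matrix.sum_apply] at h1
  refine Eq.trans (Finset.sum_congr rfl fun i _ => ?_) h1
  rw [Matrix.sub_apply, h.contRep_eqOn hu i right_mem, h.contRep_eqOn hu i left_mem]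
  congr 1 <;> split_ifs <;> rfl

/-- On functions with the zero-sum condition `D` commutes with `𝓒⁻`. This is why the later bounds
involve only the norm of `𝓒⁻` on `L²` and no norm on `H¹`. -/
theorem exists_hasArcDeriv_cauchyMinus (h : Γ.HasArcDeriv U v) (hu : AEEqArc u U)
    (hz : Γ.ZeroSum u) :
    ∃ H, Γ.HasArcDeriv H (Γ.cauchyMinus v) ∧ AEEqArc (Γ.cauchyMinus u) H := by
  rw [cauchyMinus_congr hu]
  set c : ℂ := 1 / (2 * (Real.pi : ℂ) * Complex.I)
  have key := fun i p q => exists_hasPrim_boundary (fun j => h j p q)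
    (hz.scalarZeroSum h hu p q) i
  choose H hH hHe using key
  refine ⟨fun i t => Matrix.of fun p q => c * H i p q t, fun i p q => ?_, fun i => ?_⟩
  · refine ((hH i p q).const_mul c).congr_ae ?_
    filter_upwards [cauchyMinus_ae h.memL2_right i] with t ht
    rw [ht p q]
    ring
  · have hae : ∀ᵐ t ∂paramMeasure, ∀ p q, Γ.boundary (fun j t => U j t p q) i t = H i p q t :=
      ae_all_iff.2 fun p => ae_all_iff.2 fun q => hHe i p q
    filter_upwards [cauchyMinus_ae h.memL2_left i, hae] with t h1 h2
    ext p q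
    rw [h1 p q, h2 p q, Matrix.of_apply]

end MobiusContour

/-! ### Quadratic forms of trigonometric polynomials -/

theorem integral_sq_sum {α : Type*} [MeasurableSpace α] {μ : Measure α} (s : Finset ℕ) (a : ℕ → ℝ)
    (c : ℕ → α → ℝ) (hi : ∀ k ∈ s, ∀ l ∈ s, Integrable (fun x => c k x * c l x) μ)
    (ho : ∀ k ∈ s, ∀ l ∈ s, k ≠ l → ∫ x, c k x * c l x ∂μ = 0) :
    ∫ x, (∑ k ∈ s, a k * c k x) ^ 2 ∂μ = ∑ k ∈ s, a k ^ 2 * ∫ x, c k x ^ 2 ∂μ := by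
  have h1 : ∀ x, (∑ k ∈ s, a k * c k x) ^ 2 =
      ∑ k ∈ s, ∑ l ∈ s, a k * a l * (c k x * c l x) := fun x => by
    rw [sq, Finset.sum_mul_sum]
    exact Finset.sum_congr rfl fun k _ => Finset.sum_congr rfl fun l _ => by ring
  simp_rw [h1]
  rw [integral_finsetSum _ fun k hk => integrable_finsetSum _ fun l hl => (hi k hk l hl).const_mul _]
  refine Finset.sum_congr rfl fun k hk => ?_
  rw [integral_finsetSum _ fun l hl => (hi k hk l hl).const_mul _]
  rw [Finset.sum_eq_single_of_mem k hk fun l hl hlk => by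
    rw [integral_const_mul, ho k hk l hl (Ne.symm hlk), mul_zero]]
  rw [integral_const_mul]
  simp only [sq]

theorem integral_norm_sq_sum {α : Type*} [MeasurableSpace α] {μ : Measure α} (s : Finset ℕ)
    (a : ℕ → ℂ) (c : ℕ → α → ℝ) (hi : ∀ k ∈ s, ∀ l ∈ s, Integrable (fun x => c k x * c l x) μ)
    (ho : ∀ k ∈ s, ∀ l ∈ s, k ≠ l → ∫ x, c k x * c l x ∂μ = 0) :
    ∫ x, ‖∑ k ∈ s, a k * (c k x : ℂ)‖ ^ 2 ∂μ = ∑ k ∈ s, ‖a k‖ ^ 2 * ∫ x, c k x ^ 2 ∂μ := by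
  have hint : ∀ b : ℕ → ℝ, Integrable (fun x => (∑ k ∈ s, b k * c k x) ^ 2) μ := fun b => by
    have h1 : ∀ x, (∑ k ∈ s, b k * c k x) ^ 2 =
        ∑ k ∈ s, ∑ l ∈ s, b k * b l * (c k x * c l x) := fun x => by
      rw [sq, Finset.sum_mul_sum]
      exact Finset.sum_congr rfl fun k _ => Finset.sum_congr rfl fun l _ => by ring
    simp_rw [h1]
    exact integrable_finsetSum _ fun k hk => integrable_finsetSum _ fun l hl =>
      (hi k hk l hl).const_mul _
  have h2 : ∀ x, ‖∑ k ∈ s, a k * (c k x : ℂ)‖ ^ 2 =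
      (∑ k ∈ s, (a k).re * c k x) ^ 2 + (∑ k ∈ s, (a k).im * c k x) ^ 2 := fun x => by
    rw [← Complex.normSq_eq_norm_sq, Complex.normSq_apply, Complex.re_sum, Complex.im_sum]
    simp only [Complex.re_mul_ofReal, Complex.im_mul_ofReal]
    ring
  simp_rw [h2]
  rw [integral_add (hint _) (hint _), integral_sq_sum s _ c hi ho, integral_sq_sum s _ c hi ho,
    ← Finset.sum_add_distrib]
  refine Finset.sum_congr rfl fun k _ => ?_
  rw [← Complex.normSq_eq_norm_sq, Complex.normSq_apply]
  ring

theorem sum_norm_sq_sum (N : ℕ) (s : Finset ℕ) (a : ℕ → ℂ) (c : ℕ → ℕ → ℝ)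
    (ho : ∀ k ∈ s, ∀ l ∈ s, k ≠ l → ∑ j ∈ Finset.range N, c k j * c l j = 0) :
    ∑ j ∈ Finset.range N, ‖∑ k ∈ s, a k * (c k j : ℂ)‖ ^ 2 =
      ∑ k ∈ s, ‖a k‖ ^ 2 * ∑ j ∈ Finset.range N, c k j ^ 2 := by
  have h := integral_norm_sq_sum (μ := (Measure.count : Measure (Fin N))) s a (fun k j => c k j)
    (fun _ _ _ _ => .of_finite) fun k hk l hl hkl => by
      rw [integral_count, Fin.sum_univ_eq_sum_range (fun j => c k j * c l j)]
      exact ho k hk l hl hkl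
  simp only [integral_count] at h
  rw [Fin.sum_univ_eq_sum_range (fun j => ‖∑ k ∈ s, a k * (c k j : ℂ)‖ ^ 2)] at h
  rw [h]
  exact Finset.sum_congr rfl fun k _ => by rw [Fin.sum_univ_eq_sum_range (fun j => c k j ^ 2)]

/-- Multiplication by `2 sin (r π / (2 m))`, which is nonzero unless `2 m ∣ r`, makes the sum
telescope over a full period. -/
theorem sum_cos_equidistant {m : ℕ} (hm : 0 < m) (s : ℝ) {r : ℤ} (hr : ¬((2 * m : ℕ) : ℤ) ∣ r) :
    ∑ j ∈ Finset.range (2 * m), Real.cos (r * ((j + s) * (Real.pi / m))) = 0 := by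
  have hm' : (m : ℝ) ≠ 0 := by positivity
  have hsin : Real.sin (r * (Real.pi / m) / 2) ≠ 0 := by
    intro h
    obtain ⟨n, hn⟩ := Real.sin_eq_zero_iff.1 h
    refine hr ⟨n, ?_⟩
    have : (r : ℝ) = 2 * m * n := by
      field_simp at hn
      linarith
    have h2 : (r : ℤ) = 2 * m * n := by exact_mod_cast this
    rw [h2]; push_cast; ring
  have htel : ∀ j : ℕ, 2 * Real.sin (r * (Real.pi / m) / 2) *
      Real.cos (r * ((j + s) * (Real.pi / m))) =
      Real.sin (r * (((j + 1 : ℕ) + s - 1 / 2) * (Real.pi / m))) -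
        Real.sin (r * ((j + s - 1 / 2) * (Real.pi / m))) := fun j => by
    rw [Real.sin_sub_sin]
    push_cast
    congr 2
    · congr 1; ring_nf
    · ring_nf
  have hsum : 2 * Real.sin (r * (Real.pi / m) / 2) *
      ∑ j ∈ Finset.range (2 * m), Real.cos (r * ((j + s) * (Real.pi / m))) = 0 := by
    rw [Finset.mul_sum, Finset.sum_congr rfl fun j _ => htel j, Finset.sum_range_sub
      (fun j : ℕ => Real.sin (r * ((j + s - 1 / 2) * (Real.pi / m))))]
    have e : (r : ℝ) * (((2 * m : ℕ) + s - 1 / 2) * (Real.pi / m)) =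
        r * (((0 : ℕ) + s - 1 / 2) * (Real.pi / m)) + r * (2 * Real.pi) := by
      push_cast
      field_simp
      ring
    rw [e, Real.sin_add_int_mul_two_pi, sub_self]
  rcases mul_eq_zero.1 hsum with h | h
  · exact absurd h (mul_ne_zero two_ne_zero hsin)
  · exact h

theorem not_dvd_sub {m k l : ℕ} (hk : k ≤ m) (hl : l ≤ m) (hkl : k ≠ l) :
    ¬((2 * m : ℕ) : ℤ) ∣ (k : ℤ) - l := by
  intro h
  have := Int.eq_zero_of_abs_lt_dvd h (by rw [abs_lt]; constructor <;> omega)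
  omega

theorem not_dvd_add {m k l : ℕ} (hk : k ≤ m) (hl : l ≤ m) (hkl : k ≠ l) :
    ¬((2 * m : ℕ) : ℤ) ∣ (k : ℤ) + l := by
  intro h
  have := Int.eq_zero_of_abs_lt_dvd h (by rw [abs_lt]; constructor <;> omega)
  omega

theorem sum_cos_mul_cos {m k l : ℕ} (hm : 0 < m) (hk : k ≤ m) (hl : l ≤ m) (hkl : k ≠ l) (s : ℝ) :
    ∑ j ∈ Finset.range (2 * m), Real.cos (k * ((j + s) * (Real.pi / m))) *
      Real.cos (l * ((j + s) * (Real.pi / m))) = 0 := by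
  have h1 := sum_cos_equidistant hm s (not_dvd_sub hk hl hkl)
  have h2 := sum_cos_equidistant hm s (not_dvd_add hk hl hkl)
  have h3 : ∀ x : ℝ, Real.cos (k * x) * Real.cos (l * x) =
      (Real.cos (((k : ℤ) - l : ℤ) * x) + Real.cos (((k : ℤ) + l : ℤ) * x)) / 2 := fun x => by
    push_cast
    rw [sub_mul, add_mul, Real.cos_sub, Real.cos_add]
    ring
  simp_rw [h3]
  rw [← Finset.sum_div, Finset.sum_add_distrib, h1, h2]
  norm_num

theorem sum_sin_mul_sin {m k l : ℕ} (hm : 0 < m) (hk : k ≤ m) (hl : l ≤ m) (hkl : k ≠ l) (s : ℝ) :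
    ∑ j ∈ Finset.range (2 * m), Real.sin (k * ((j + s) * (Real.pi / m))) *
      Real.sin (l * ((j + s) * (Real.pi / m))) = 0 := by
  have h1 := sum_cos_equidistant hm s (not_dvd_sub hk hl hkl)
  have h2 := sum_cos_equidistant hm s (not_dvd_add hk hl hkl)
  have h3 : ∀ x : ℝ, Real.sin (k * x) * Real.sin (l * x) =
      (Real.cos (((k : ℤ) - l : ℤ) * x) - Real.cos (((k : ℤ) + l : ℤ) * x)) / 2 := fun x => by
    push_cast
    rw [sub_mul, add_mul, Real.cos_sub, Real.cos_add]
    ring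
  simp_rw [h3]
  rw [← Finset.sum_div, Finset.sum_sub_distrib, h1, h2]
  norm_num

theorem not_dvd_two_mul {m k : ℕ} (hk : k < m) (h0 : k ≠ 0) : ¬((2 * m : ℕ) : ℤ) ∣ ((2 * k : ℕ) : ℤ) := by
  intro h
  have := Int.eq_zero_of_abs_lt_dvd h (by rw [abs_lt]; constructor <;> omega)
  omega

theorem le_sum_cos_sq {m k : ℕ} (hm : 0 < m) (hk : k ≤ m) :
    (m : ℝ) ≤ ∑ j ∈ Finset.range (2 * m), Real.cos (k * ((j + 0) * (Real.pi / m))) ^ 2 := by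
  have hm' : (m : ℝ) ≠ 0 := by positivity
  have h3 : ∀ x : ℝ, Real.cos (k * x) ^ 2 = 1 / 2 + 1 / 2 * Real.cos (((2 * k : ℕ) : ℤ) * x) := fun x => by
    rw [Real.cos_sq]
    push_cast
    ring_nf
  by_cases h : k < m ∧ k ≠ 0
  · simp_rw [h3]
    rw [Finset.sum_add_distrib, ← Finset.mul_sum, sum_cos_equidistant hm 0 (not_dvd_two_mul h.1 h.2)]
    simp
    linarith
  · have h1 : ∀ j : ℕ, Real.cos (k * ((j + 0) * (Real.pi / m))) ^ 2 = 1 := fun j => by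
      rcases (by omega : k = 0 ∨ k = m) with rfl | rfl
      · simp
      · have : (k : ℝ) * ((j + 0) * (Real.pi / k)) = j * Real.pi := by field_simp; ring
        rw [this, Real.cos_nat_mul_pi, ← pow_mul, mul_comm, pow_mul]
        simp
    simp_rw [h1]
    simp
    linarith [(Nat.cast_nonneg m : (0 : ℝ) ≤ m)]

/-- The points are shifted by half a step because at the unshifted ones `sin (m θ)` vanishes; at the
shifted ones it is `±1`. -/
theorem le_sum_sin_sq {m k : ℕ} (hm : 0 < m) (hk : k ≤ m) (h0 : k ≠ 0) :
    (m : ℝ) ≤ ∑ j ∈ Finset.range (2 * m), Real.sin (k * ((j + 1 / 2) * (Real.pi / m))) ^ 2 := by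
  have hm' : (m : ℝ) ≠ 0 := by positivity
  have h3 : ∀ x : ℝ, Real.sin (k * x) ^ 2 = 1 / 2 - 1 / 2 * Real.cos (((2 * k : ℕ) : ℤ) * x) := fun x => by
    rw [Real.sin_sq, Real.cos_sq]
    push_cast
    ring_nf
  simp_rw [h3]
  rw [Finset.sum_sub_distrib, ← Finset.mul_sum]
  rcases hk.lt_or_eq with h | rfl
  · rw [sum_cos_equidistant hm _ (not_dvd_two_mul h h0)]
    simp
    linarith
  · have h1 : ∀ j : ℕ, Real.cos (((2 * k : ℕ) : ℤ) * ((j + 1 / 2) * (Real.pi / k))) = -1 := fun j => by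
      have : (((2 * k : ℕ) : ℤ) : ℝ) * ((j + 1 / 2) * (Real.pi / k)) = Real.pi + j * (2 * Real.pi) := by
        push_cast; field_simp; ring
      rw [this, Real.cos_add_nat_mul_two_pi, Real.cos_pi]
    simp_rw [h1]
    simp

/-- The trigonometric polynomial `∑_{k ≤ m} a_k cos (k θ)`. -/
def cosSum (m : ℕ) (a : ℕ → ℂ) (θ : ℝ) : ℂ := ∑ k ∈ Finset.range (m + 1), a k * (Real.cos (k * θ) : ℂ)

theorem cosSum_reflect {m : ℕ} (hm : 0 < m) (a : ℕ → ℂ) {i j : ℕ} (hij : i + j = 2 * m) :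
    cosSum m a (i * (Real.pi / m)) = cosSum m a (j * (Real.pi / m)) := by
  have hm' : (m : ℝ) ≠ 0 := by positivity
  unfold cosSum
  refine Finset.sum_congr rfl fun k _ => ?_
  have hi : (i : ℝ) = 2 * m - j := by rw [eq_sub_iff_add_eq]; exact_mod_cast hij
  have : (k : ℝ) * (i * (Real.pi / m)) = -(k * (j * (Real.pi / m))) + k * (2 * Real.pi) := by
    rw [hi]; field_simp; ring
  rw [this, Real.cos_add_nat_mul_two_pi, Real.cos_neg]

/-- The nodes are reflected to `2 m` equidistant angles on the circle, where the cosines of order up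
to `m` are orthogonal with squared norms at least `m`. The total of the nodal values is at most `2 m
B`. -/
theorem sum_sq_coeff_le {m : ℕ} (hm : 0 < m) (a : ℕ → ℂ) {B : ℝ}
    (hB : ∀ j ≤ m, ‖cosSum m a (j * (Real.pi / m))‖ ^ 2 ≤ B) :
    ∑ k ∈ Finset.range (m + 1), ‖a k‖ ^ 2 ≤ 2 * B := by
  have hm' : (0 : ℝ) < m := by positivity
  have h := sum_norm_sq_sum (2 * m) (Finset.range (m + 1)) a
    (fun k j => Real.cos (k * ((j + 0) * (Real.pi / m)))) fun k hk l hl hkl =>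
      sum_cos_mul_cos hm (Finset.mem_range_succ_iff.1 hk) (Finset.mem_range_succ_iff.1 hl) hkl 0
  have h1 : ∑ k ∈ Finset.range (m + 1), ‖a k‖ ^ 2 * m ≤ ∑ k ∈ Finset.range (m + 1), ‖a k‖ ^ 2 *
      ∑ j ∈ Finset.range (2 * m), Real.cos (k * ((j + 0) * (Real.pi / m))) ^ 2 := by
    refine Finset.sum_le_sum fun k hk => ?_
    gcongr
    exact le_sum_cos_sq hm (Finset.mem_range_succ_iff.1 hk)
  rw [← h, ← Finset.sum_mul] at h1
  have h2 : ∑ j ∈ Finset.range (2 * m), ‖∑ k ∈ Finset.range (m + 1),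
      a k * (Real.cos (k * ((j + 0) * (Real.pi / m))) : ℂ)‖ ^ 2 ≤ ∑ j ∈ Finset.range (2 * m), B := by
    refine Finset.sum_le_sum fun j hj => ?_
    have hj' := Finset.mem_range.1 hj
    have e : ∑ k ∈ Finset.range (m + 1), a k * (Real.cos (k * ((j + 0) * (Real.pi / m))) : ℂ) =
        cosSum m a (j * (Real.pi / m)) := by simp only [cosSum, add_zero]
    rw [e]
    by_cases hjm : j ≤ m
    · exact hB j hjm
    · rw [cosSum_reflect hm a (show j + (2 * m - j) = 2 * m by omega)]
      exact hB _ (by omega)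
  rw [Finset.sum_const, Finset.card_range, nsmul_eq_mul, Nat.cast_mul, Nat.cast_ofNat] at h2
  have h3 := h1.trans h2
  nlinarith

/-- Differences of neighbouring nodal values form a sine sum at the midpoints with coefficients `-2
a_k sin (k π / (2 m))`. Sines are orthogonal there, and Jordan's inequality gives `sin (k π / (2 m))
≥ k / m`. -/
theorem sum_sq_mul_coeff_le {m : ℕ} (hm : 0 < m) (a : ℕ → ℂ) :
    ∑ k ∈ Finset.range (m + 1), (k : ℝ) ^ 2 * ‖a k‖ ^ 2 ≤ m / 2 * ∑ j ∈ Finset.range m,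
      ‖cosSum m a ((j + 1 : ℕ) * (Real.pi / m)) - cosSum m a (j * (Real.pi / m))‖ ^ 2 := by
  have hm' : (0 : ℝ) < m := by positivity
  set d : ℕ → ℝ := fun j =>
    ‖cosSum m a ((j + 1 : ℕ) * (Real.pi / m)) - cosSum m a (j * (Real.pi / m))‖ ^ 2 with hd
  have hhalf : ∑ j ∈ Finset.range (2 * m), d j = 2 * ∑ j ∈ Finset.range m, d j := by
    rw [two_mul m, Finset.sum_range_add, two_mul]
    congr 1
    rw [← Finset.sum_range_reflect]
    refine Finset.sum_congr rfl fun j hj => ?_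
    have hj' := Finset.mem_range.1 hj
    simp only [hd]
    rw [cosSum_reflect hm a (show m + (m - 1 - j) + 1 + j = 2 * m by omega),
      cosSum_reflect hm a (show m + (m - 1 - j) + (j + 1) = 2 * m by omega), norm_sub_rev]
  have hdiff : ∀ j : ℕ, d j = ‖∑ k ∈ Finset.range (m + 1),
      (-2 * a k * (Real.sin (k * (Real.pi / m) / 2) : ℂ)) *
        (Real.sin (k * ((j + 1 / 2) * (Real.pi / m))) : ℂ)‖ ^ 2 := fun j => by
    simp only [hd, cosSum]
    rw [← Finset.sum_sub_distrib]
    congr 2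
    refine Finset.sum_congr rfl fun k _ => ?_
    rw [← mul_sub, ← Complex.ofReal_sub, Real.cos_sub_cos]
    push_cast
    ring_nf
  have h := sum_norm_sq_sum (2 * m) (Finset.range (m + 1))
    (fun k => -2 * a k * (Real.sin (k * (Real.pi / m) / 2) : ℂ))
    (fun k j => Real.sin (k * ((j + 1 / 2) * (Real.pi / m)))) fun k hk l hl hkl =>
      sum_sin_mul_sin hm (Finset.mem_range_succ_iff.1 hk) (Finset.mem_range_succ_iff.1 hl) hkl _
  simp_rw [← hdiff] at h
  rw [hhalf] at h
  have h1 : ∑ k ∈ Finset.range (m + 1), 4 / m * ((k : ℝ) ^ 2 * ‖a k‖ ^ 2) ≤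
      2 * ∑ j ∈ Finset.range m, d j := by
    rw [h]
    refine Finset.sum_le_sum fun k hk => ?_
    have hkm := Finset.mem_range_succ_iff.1 hk
    rcases eq_or_ne k 0 with rfl | h0
    · simp
    rw [norm_mul, norm_mul, norm_neg, Complex.norm_real, mul_pow, mul_pow]
    have hs : (k : ℝ) / m ≤ Real.sin (k * (Real.pi / m) / 2) := by
      have := Real.mul_le_sin (x := k * (Real.pi / m) / 2) (by positivity) (by
        have : (k : ℝ) / m ≤ 1 := (div_le_one hm').2 (by exact_mod_cast hkm)
        calc k * (Real.pi / m) / 2 = (k / m) * (Real.pi / 2) := by ring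
          _ ≤ 1 * (Real.pi / 2) := by gcongr
          _ = Real.pi / 2 := one_mul _)
      refine le_trans (le_of_eq ?_) this
      field_simp
    have hs2 : ((k : ℝ) / m) ^ 2 ≤ ‖Real.sin (k * (Real.pi / m) / 2)‖ ^ 2 := by
      rw [Real.norm_eq_abs, sq_abs]
      gcongr
    have hs3 := le_sum_sin_sq hm hkm h0
    calc 4 / m * ((k : ℝ) ^ 2 * ‖a k‖ ^ 2) = 4 * ‖a k‖ ^ 2 * ((k : ℝ) / m) ^ 2 * m := by
          field_simp
      _ ≤ 4 * ‖a k‖ ^ 2 * ‖Real.sin (k * (Real.pi / m) / 2)‖ ^ 2 *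
          ∑ j ∈ Finset.range (2 * m), Real.sin (k * ((j + 1 / 2) * (Real.pi / m))) ^ 2 := by
          gcongr
      _ = _ := by norm_num
  rw [← Finset.mul_sum] at h1
  calc ∑ k ∈ Finset.range (m + 1), (k : ℝ) ^ 2 * ‖a k‖ ^ 2
      = m / 4 * (4 / m * ∑ k ∈ Finset.range (m + 1), (k : ℝ) ^ 2 * ‖a k‖ ^ 2) := by field_simp
    _ ≤ m / 4 * (2 * ∑ j ∈ Finset.range m, d j) := by gcongr
    _ = _ := by ring

/-! ### Polynomials as cosine sums, and cosine sums on `[0, π]` -/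

open Polynomial in
theorem exists_eval_cos_eq_sum (n : ℕ) {P : ℂ[X]} (hP : P.degree < n) :
    ∃ a : ℕ → ℂ, ∀ θ : ℝ, P.eval (Real.cos θ : ℂ) =
      ∑ k ∈ Finset.range n, a k * (Real.cos (k * θ) : ℂ) := by
  induction n generalizing P with
  | zero =>
    have : P = 0 := by
      rw [← degree_eq_bot]
      simpa [Nat.WithBot.lt_zero_iff] using hP
    exact ⟨0, fun θ => by simp [this]⟩
  | succ n ih =>
    set T := Chebyshev.T ℂ n with hT
    have hnat : T.natDegree = n := by
      have := Chebyshev.degree_T (R := ℂ) (n : ℤ)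
      rw [Int.natAbs_natCast] at this
      exact natDegree_eq_of_degree_eq_some this
    have hlead : T.coeff n ≠ 0 := by
      have h0 : T ≠ 0 := by
        intro h
        have := Chebyshev.degree_T (R := ℂ) (n : ℤ)
        rw [← hT, h] at this
        simp at this
      have := leadingCoeff_ne_zero.2 h0
      rwa [leadingCoeff, hnat] at this
    set c := P.coeff n / T.coeff n
    obtain ⟨a, ha⟩ := ih (P := P - C c * T) (by
      refine (degree_lt_iff_coeff_zero _ _).2 fun k hk => ?_
      rw [coeff_sub, coeff_C_mul]
      rcases hk.eq_or_lt with rfl | hk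
      · rw [div_mul_cancel₀ _ hlead, sub_self]
      · rw [coeff_eq_zero_of_degree_lt (hP.trans_le (by exact_mod_cast hk)),
          coeff_eq_zero_of_natDegree_lt (by omega), mul_zero, sub_zero])
    refine ⟨fun k => if k = n then c else a k, fun θ => ?_⟩
    have h1 := ha θ
    have h2 : T.eval (Real.cos θ : ℂ) = (Real.cos (n * θ) : ℂ) := by
      have := Chebyshev.T_complex_cos (θ : ℂ) n
      push_cast at this ⊢
      exact this
    rw [eval_sub, eval_mul, eval_C, h2, sub_eq_iff_eq_add] at h1
    simp only
    rw [h1, Finset.sum_range_succ, if_pos rfl]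
    congr 1
    refine Finset.sum_congr rfl fun k hk => ?_
    rw [if_neg (Finset.mem_range.1 hk).ne]

theorem integral_cos_int {r : ℤ} (hr : r ≠ 0) : ∫ θ in (0 : ℝ)..Real.pi, Real.cos (r * θ) = 0 := by
  have hr' : (r : ℝ) ≠ 0 := by exact_mod_cast hr
  rw [intervalIntegral.integral_comp_mul_left (fun x => Real.cos x) hr', integral_cos]
  simp [Real.sin_int_mul_pi]

theorem intervalIntegrable_cos_mul (r : ℝ) (a b : ℝ) :
    IntervalIntegrable (fun θ => Real.cos (r * θ)) volume a b :=
  (by fun_prop : Continuous fun θ => Real.cos (r * θ)).intervalIntegrable _ _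

theorem integral_cos_mul_cos {k l : ℕ} (h : k ≠ l) :
    ∫ θ in (0 : ℝ)..Real.pi, Real.cos (k * θ) * Real.cos (l * θ) = 0 := by
  have h3 : ∀ x : ℝ, Real.cos (k * x) * Real.cos (l * x) =
      (1 / 2) * Real.cos (((k : ℤ) - l : ℤ) * x) + (1 / 2) * Real.cos (((k : ℤ) + l : ℤ) * x) :=
    fun x => by
    push_cast
    rw [sub_mul, add_mul, Real.cos_sub, Real.cos_add]
    ring
  simp_rw [h3]
  rw [intervalIntegral.integral_add ((intervalIntegrable_cos_mul _ _ _).const_mul _)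
    ((intervalIntegrable_cos_mul _ _ _).const_mul _), intervalIntegral.integral_const_mul,
    intervalIntegral.integral_const_mul, integral_cos_int (by omega), integral_cos_int (by omega)]
  norm_num

theorem integral_sin_mul_sin {k l : ℕ} (h : k ≠ l) :
    ∫ θ in (0 : ℝ)..Real.pi, Real.sin (k * θ) * Real.sin (l * θ) = 0 := by
  have h3 : ∀ x : ℝ, Real.sin (k * x) * Real.sin (l * x) =
      (1 / 2) * Real.cos (((k : ℤ) - l : ℤ) * x) - (1 / 2) * Real.cos (((k : ℤ) + l : ℤ) * x) :=
    fun x => by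
    push_cast
    rw [sub_mul, add_mul, Real.cos_sub, Real.cos_add]
    ring
  simp_rw [h3]
  rw [intervalIntegral.integral_sub ((intervalIntegrable_cos_mul _ _ _).const_mul _)
    ((intervalIntegrable_cos_mul _ _ _).const_mul _), intervalIntegral.integral_const_mul,
    intervalIntegral.integral_const_mul, integral_cos_int (by omega), integral_cos_int (by omega)]
  norm_num

theorem integral_le_pi {f : ℝ → ℝ} (hf : Continuous f) (h : ∀ x, f x ≤ 1) :
    ∫ θ in (0 : ℝ)..Real.pi, f θ ≤ Real.pi := by
  calc ∫ θ in (0 : ℝ)..Real.pi, f θ ≤ ∫ _ in (0 : ℝ)..Real.pi, (1 : ℝ) :=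
        intervalIntegral.integral_mono Real.pi_pos.le (hf.intervalIntegrable _ _)
          (continuous_const.intervalIntegrable _ _) h
    _ = Real.pi := by simp

theorem pi_div_two_le_integral_cos_sq (k : ℕ) :
    Real.pi / 2 ≤ ∫ θ in (0 : ℝ)..Real.pi, Real.cos (k * θ) ^ 2 := by
  have h3 : ∀ x : ℝ, Real.cos (k * x) ^ 2 = 1 / 2 + 1 / 2 * Real.cos (((2 * k : ℕ) : ℤ) * x) :=
    fun x => by
    rw [Real.cos_sq]
    push_cast
    ring_nf
  simp_rw [h3]
  rw [intervalIntegral.integral_add (continuous_const.intervalIntegrable _ _)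
    ((intervalIntegrable_cos_mul _ _ _).const_mul _), intervalIntegral.integral_const_mul]
  rcases eq_or_ne k 0 with rfl | h
  · simp
    linarith [Real.pi_pos]
  · rw [integral_cos_int (by exact_mod_cast (by omega : 2 * k ≠ 0))]
    simp
    linarith

theorem continuous_cosSum (m : ℕ) (a : ℕ → ℂ) : Continuous (cosSum m a) := by
  unfold cosSum; fun_prop

/-- The negative derivative of `cosSum`. -/
def sinSum (m : ℕ) (a : ℕ → ℂ) (θ : ℝ) : ℂ :=
  ∑ k ∈ Finset.range (m + 1), (k * a k) * (Real.sin (k * θ) : ℂ)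

theorem continuous_sinSum (m : ℕ) (a : ℕ → ℂ) : Continuous (sinSum m a) := by
  unfold sinSum; fun_prop

theorem hasDerivAt_cosSum (m : ℕ) (a : ℕ → ℂ) (θ : ℝ) :
    HasDerivAt (cosSum m a) (-sinSum m a θ) θ := by
  have h : ∀ k ∈ Finset.range (m + 1), HasDerivAt (fun θ : ℝ => a k * (Real.cos (k * θ) : ℂ))
      (a k * ((-Real.sin (k * θ) * k : ℝ) : ℂ)) θ := fun k _ => by
    have h1 : HasDerivAt (fun θ : ℝ => (k : ℝ) * θ) k θ := by
      simpa using (hasDerivAt_id θ).const_mul (k : ℝ)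
    exact (h1.cos.ofReal_comp).const_mul (a k)
  refine (HasDerivAt.fun_sum h).congr_deriv ?_
  rw [sinSum, ← Finset.sum_neg_distrib]
  refine Finset.sum_congr rfl fun k _ => ?_
  push_cast
  ring

theorem integral_norm_sq_cosSum (m : ℕ) (a : ℕ → ℂ) :
    ∫ θ in (0 : ℝ)..Real.pi, ‖cosSum m a θ‖ ^ 2 = ∑ k ∈ Finset.range (m + 1),
      ‖a k‖ ^ 2 * ∫ θ in (0 : ℝ)..Real.pi, Real.cos (k * θ) ^ 2 := by
  simp only [intervalIntegral.integral_of_le Real.pi_pos.le]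
  refine integral_norm_sq_sum _ a (fun k θ => Real.cos (k * θ)) (fun k _ l _ => ?_)
    fun k _ l _ hkl => ?_
  · exact (intervalIntegrable_iff_integrableOn_Ioc_of_le Real.pi_pos.le).1
      ((by fun_prop : Continuous fun θ : ℝ => Real.cos (k * θ) * Real.cos (l * θ)).intervalIntegrable _ _)
  · rw [← intervalIntegral.integral_of_le Real.pi_pos.le]
    exact integral_cos_mul_cos hkl

theorem integral_norm_sq_cosSum_le (m : ℕ) (a : ℕ → ℂ) :
    ∫ θ in (0 : ℝ)..Real.pi, ‖cosSum m a θ‖ ^ 2 ≤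
      Real.pi * ∑ k ∈ Finset.range (m + 1), ‖a k‖ ^ 2 := by
  rw [integral_norm_sq_cosSum, Finset.mul_sum]
  refine Finset.sum_le_sum fun k _ => ?_
  rw [mul_comm]
  gcongr
  exact integral_le_pi (by fun_prop) fun x => Real.cos_sq_le_one _

theorem le_integral_norm_sq_cosSum (m : ℕ) (a : ℕ → ℂ) :
    Real.pi / 2 * ∑ k ∈ Finset.range (m + 1), ‖a k‖ ^ 2 ≤
      ∫ θ in (0 : ℝ)..Real.pi, ‖cosSum m a θ‖ ^ 2 := by
  rw [integral_norm_sq_cosSum, Finset.mul_sum]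
  refine Finset.sum_le_sum fun k _ => ?_
  rw [mul_comm]
  gcongr
  exact pi_div_two_le_integral_cos_sq k

theorem integral_norm_sq_sinSum_le (m : ℕ) (a : ℕ → ℂ) :
    ∫ θ in (0 : ℝ)..Real.pi, ‖sinSum m a θ‖ ^ 2 ≤
      Real.pi * ∑ k ∈ Finset.range (m + 1), (k : ℝ) ^ 2 * ‖a k‖ ^ 2 := by
  have h : ∫ θ in (0 : ℝ)..Real.pi, ‖sinSum m a θ‖ ^ 2 = ∑ k ∈ Finset.range (m + 1),
      ‖k * a k‖ ^ 2 * ∫ θ in (0 : ℝ)..Real.pi, Real.sin (k * θ) ^ 2 := by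
    simp only [intervalIntegral.integral_of_le Real.pi_pos.le]
    refine integral_norm_sq_sum _ (fun k => k * a k) (fun k θ => Real.sin (k * θ))
      (fun k _ l _ => ?_) fun k _ l _ hkl => ?_
    · exact (intervalIntegrable_iff_integrableOn_Ioc_of_le Real.pi_pos.le).1
        ((by fun_prop : Continuous fun θ : ℝ =>
          Real.sin (k * θ) * Real.sin (l * θ)).intervalIntegrable _ _)
    · rw [← intervalIntegral.integral_of_le Real.pi_pos.le]
      exact integral_sin_mul_sin hkl
  rw [h, Finset.mul_sum]
  refine Finset.sum_le_sum fun k _ => ?_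
  rw [norm_mul, mul_pow, Complex.norm_natCast, mul_comm]
  gcongr
  exact integral_le_pi (by fun_prop) fun x => Real.sin_sq_le_one _

theorem abs_sin_nat_mul_le (k : ℕ) (θ : ℝ) : |Real.sin (k * θ)| ≤ k * |Real.sin θ| := by
  induction k with
  | zero => simp
  | succ k ih =>
    push_cast
    rw [add_mul, one_mul, Real.sin_add, add_mul, one_mul]
    refine (abs_add_le _ _).trans (add_le_add ?_ ?_)
    · rw [abs_mul]
      exact (mul_le_of_le_one_right (abs_nonneg _) (Real.abs_cos_le_one _)).trans ih
    · rw [abs_mul]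
      exact mul_le_of_le_one_left (abs_nonneg _) (Real.abs_cos_le_one _)

/-- The inequality `|sin (k θ)| ≤ k |sin θ|` keeps a factor `sin θ`. Cancelling it gives a bound for
the derivative of the polynomial up to the endpoints. -/
theorem norm_sinSum_le (m : ℕ) (a : ℕ → ℂ) (θ : ℝ) :
    ‖sinSum m a θ‖ ≤ (∑ k ∈ Finset.range (m + 1), (k : ℝ) ^ 2 * ‖a k‖) * |Real.sin θ| := by
  unfold sinSum
  refine (norm_sum_le _ _).trans ?_
  rw [Finset.sum_mul]
  refine Finset.sum_le_sum fun k _ => ?_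
  rw [norm_mul, norm_mul, Complex.norm_natCast, Complex.norm_real, Real.norm_eq_abs]
  calc (k : ℝ) * ‖a k‖ * |Real.sin (k * θ)| ≤ k * ‖a k‖ * (k * |Real.sin θ|) := by
        gcongr
        exact abs_sin_nat_mul_le k θ
    _ = _ := by ring

theorem norm_cosSum_sq_le (m : ℕ) (a : ℕ → ℂ) (θ : ℝ) :
    ‖cosSum m a θ‖ ^ 2 ≤ (m + 1) * ∑ k ∈ Finset.range (m + 1), ‖a k‖ ^ 2 := by
  have h1 : ‖cosSum m a θ‖ ≤ ∑ k ∈ Finset.range (m + 1), ‖a k‖ := by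
    refine (norm_sum_le _ _).trans (Finset.sum_le_sum fun k _ => ?_)
    rw [norm_mul, Complex.norm_real, Real.norm_eq_abs]
    exact mul_le_of_le_one_right (norm_nonneg _) (Real.abs_cos_le_one _)
  have h2 := sq_sum_le_card_mul_sum_sq (s := Finset.range (m + 1)) (f := fun k => ‖a k‖)
  rw [Finset.card_range] at h2
  push_cast at h2
  calc ‖cosSum m a θ‖ ^ 2 ≤ (∑ k ∈ Finset.range (m + 1), ‖a k‖) ^ 2 := by gcongr
    _ ≤ _ := h2

theorem sq_sum_sq_mul_le (m : ℕ) (a : ℕ → ℂ) :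
    (∑ k ∈ Finset.range (m + 1), (k : ℝ) ^ 2 * ‖a k‖) ^ 2 ≤
      (m + 1) ^ 3 * ∑ k ∈ Finset.range (m + 1), (k : ℝ) ^ 2 * ‖a k‖ ^ 2 := by
  have h2 := sq_sum_le_card_mul_sum_sq (s := Finset.range (m + 1))
    (f := fun k => (k : ℝ) ^ 2 * ‖a k‖)
  rw [Finset.card_range] at h2
  push_cast at h2
  refine h2.trans ?_
  rw [pow_succ', mul_assoc]
  gcongr
  rw [Finset.mul_sum]
  refine Finset.sum_le_sum fun k hk => ?_
  have hk' : (k : ℝ) ≤ m + 1 := by exact_mod_cast (Finset.mem_range.1 hk).le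
  calc ((k : ℝ) ^ 2 * ‖a k‖) ^ 2 = (k : ℝ) ^ 2 * ((k : ℝ) ^ 2 * ‖a k‖ ^ 2) := by ring
    _ ≤ (m + 1) ^ 2 * ((k : ℝ) ^ 2 * ‖a k‖ ^ 2) := by gcongr

theorem sum_sq_mul_coeff_le_crude (m : ℕ) (a : ℕ → ℂ) :
    ∑ k ∈ Finset.range (m + 1), (k : ℝ) ^ 2 * ‖a k‖ ^ 2 ≤
      (m + 1) ^ 2 * ∑ k ∈ Finset.range (m + 1), ‖a k‖ ^ 2 := by
  rw [Finset.mul_sum]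
  refine Finset.sum_le_sum fun k hk => ?_
  have hk' : (k : ℝ) ≤ m + 1 := by exact_mod_cast (Finset.mem_range.1 hk).le
  gcongr

/-! ### The substitution `t = cos θ` -/

theorem integral_comp_cos {F : ℝ → ℝ} (hF : Continuous F) (α β : ℝ) :
    ∫ t in Real.cos β..Real.cos α, F t = ∫ θ in α..β, F (Real.cos θ) * Real.sin θ := by
  have h := intervalIntegral.integral_comp_mul_deriv (a := α) (b := β) (f := Real.cos)
    (f' := fun θ => -Real.sin θ) (g := F) (fun x _ => Real.hasDerivAt_cos x)
    (by fun_prop) hF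
  rw [intervalIntegral.integral_symm, ← h, ← intervalIntegral.integral_neg]
  refine intervalIntegral.integral_congr fun θ _ => ?_
  simp

theorem integral_comp_cos_pi {F : ℝ → ℝ} (hF : Continuous F) :
    ∫ t in (-1 : ℝ)..1, F t = ∫ θ in (0 : ℝ)..Real.pi, F (Real.cos θ) * Real.sin θ := by
  have := integral_comp_cos hF 0 Real.pi
  rwa [Real.cos_pi, Real.cos_zero] at this

theorem integral_mul_sin_le {F : ℝ → ℝ} (hF : Continuous F) (h0 : ∀ θ, 0 ≤ F θ) {α β : ℝ}
    (hαβ : α ≤ β) : ∫ θ in α..β, F θ * Real.sin θ ≤ ∫ θ in α..β, F θ :=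
  intervalIntegral.integral_mono hαβ ((by fun_prop : Continuous _).intervalIntegrable _ _)
    (hF.intervalIntegrable _ _) fun θ => mul_le_of_le_one_right (h0 θ) (Real.sin_le_one θ)

/-! ### Polynomials on the unit interval -/

section PolynomialBounds

open Polynomial

theorem continuous_eval_ofReal (P : ℂ[X]) : Continuous fun t : ℝ => P.eval (t : ℂ) :=
  P.continuous.comp Complex.continuous_ofReal

theorem continuous_norm_sq_eval_ofReal (P : ℂ[X]) : Continuous fun t : ℝ => ‖P.eval (t : ℂ)‖ ^ 2 :=
  (continuous_eval_ofReal P).norm.pow 2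

theorem hasDerivAt_eval_ofReal (P : ℂ[X]) (t : ℝ) :
    HasDerivAt (fun t : ℝ => P.eval (t : ℂ)) (P.derivative.eval (t : ℂ)) t :=
  (P.hasDerivAt (t : ℂ)).comp_ofReal

theorem hasPrim_eval (P : ℂ[X]) :
    HasPrim (fun t => P.eval (t : ℂ)) fun t => P.derivative.eval (t : ℂ) :=
  .of_hasDerivAt (fun t _ => hasDerivAt_eval_ofReal P t) (continuous_eval_ofReal _).continuousOn

variable {m : ℕ} {P : ℂ[X]} {a : ℕ → ℂ}

theorem sin_mul_eval_derivative (ha : ∀ θ : ℝ, P.eval (Real.cos θ : ℂ) = cosSum m a θ) (θ : ℝ) :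
    P.derivative.eval (Real.cos θ : ℂ) * (Real.sin θ : ℂ) = sinSum m a θ := by
  have h1 : HasDerivAt (fun θ : ℝ => P.eval (Real.cos θ : ℂ))
      ((-Real.sin θ) • P.derivative.eval (Real.cos θ : ℂ)) θ :=
    HasDerivAt.scomp θ (hasDerivAt_eval_ofReal P (Real.cos θ)) (Real.hasDerivAt_cos θ)
  have h2 := hasDerivAt_cosSum m a θ
  rw [show cosSum m a = fun θ : ℝ => P.eval (Real.cos θ : ℂ) from (funext ha).symm] at h2
  have h3 := h1.unique h2
  rw [Complex.real_smul] at h3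
  push_cast at h3 ⊢
  linear_combination -h3

theorem integral_norm_sq_le_integral_cosSum (ha : ∀ θ : ℝ, P.eval (Real.cos θ : ℂ) = cosSum m a θ) :
    ∫ t in (-1 : ℝ)..1, ‖P.eval (t : ℂ)‖ ^ 2 ≤ ∫ θ in (0 : ℝ)..Real.pi, ‖cosSum m a θ‖ ^ 2 := by
  rw [integral_comp_cos_pi (continuous_norm_sq_eval_ofReal P)]
  simp only [ha]
  exact integral_mul_sin_le (F := fun θ => ‖cosSum m a θ‖ ^ 2) ((continuous_cosSum m a).norm.pow 2)
    (fun θ => by positivity) Real.pi_pos.le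

/-- In the variable `θ` the integrand is `|p'| * |p' sin θ|`. The second factor is the modulus of
`sinSum`, the first is bounded uniformly by `D = ∑ k² |a_k|`. The inequality `D |S| ≤ D² / (2 (m +
1)) + (m + 1) |S|² / 2` balances them, as `D² ≤ (m + 1)³ A`. -/
theorem integral_norm_sq_derivative_le
    (ha : ∀ θ : ℝ, P.eval (Real.cos θ : ℂ) = cosSum m a θ) :
    ∫ t in (-1 : ℝ)..1, ‖P.derivative.eval (t : ℂ)‖ ^ 2 ≤
      Real.pi * (m + 1) ^ 2 * ∑ k ∈ Finset.range (m + 1), (k : ℝ) ^ 2 * ‖a k‖ ^ 2 := by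
  set A := ∑ k ∈ Finset.range (m + 1), (k : ℝ) ^ 2 * ‖a k‖ ^ 2
  set D := ∑ k ∈ Finset.range (m + 1), (k : ℝ) ^ 2 * ‖a k‖
  have hA : 0 ≤ A := Finset.sum_nonneg fun k _ => by positivity
  have hD : 0 ≤ D := Finset.sum_nonneg fun k _ => by positivity
  have hDA : D ^ 2 ≤ (m + 1) ^ 3 * A := sq_sum_sq_mul_le m a
  have hc : Continuous fun θ => ‖sinSum m a θ‖ ^ 2 := (continuous_sinSum m a).norm.pow 2
  rw [integral_comp_cos_pi (continuous_norm_sq_eval_ofReal P.derivative)]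
  have hm : (0 : ℝ) < m + 1 := by positivity
  have hpt : ∀ θ ∈ Icc (0 : ℝ) Real.pi,
      ‖P.derivative.eval (Real.cos θ : ℂ)‖ ^ 2 * Real.sin θ ≤
        (m + 1 : ℝ)⁻¹ / 2 * D ^ 2 + (m + 1) / 2 * ‖sinSum m a θ‖ ^ 2 := by
    intro θ hθ
    have hs0 := Real.sin_nonneg_of_mem_Icc hθ
    rcases hs0.eq_or_lt with h0 | hs
    · rw [← h0]
      have : 0 ≤ (m + 1 : ℝ)⁻¹ / 2 * D ^ 2 + (m + 1) / 2 * ‖sinSum m a θ‖ ^ 2 := by positivity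
      simpa using this
    have h1 : ‖P.derivative.eval (Real.cos θ : ℂ)‖ * Real.sin θ = ‖sinSum m a θ‖ := by
      rw [← sin_mul_eval_derivative ha, norm_mul, Complex.norm_real, Real.norm_of_nonneg hs0]
    have h2 := norm_sinSum_le m a θ
    rw [← h1, abs_of_nonneg hs0] at h2
    have h3 : ‖P.derivative.eval (Real.cos θ : ℂ)‖ ≤ D := le_of_mul_le_mul_right h2 hs
    have h4 : (m + 1 : ℝ)⁻¹ / 2 * D ^ 2 + (m + 1) / 2 * ‖sinSum m a θ‖ ^ 2 - D * ‖sinSum m a θ‖ =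
        (m + 1 : ℝ)⁻¹ / 2 * (D - (m + 1) * ‖sinSum m a θ‖) ^ 2 := by
      field_simp
      ring
    have h5 : 0 ≤ (m + 1 : ℝ)⁻¹ / 2 * (D - (m + 1) * ‖sinSum m a θ‖) ^ 2 := by positivity
    calc ‖P.derivative.eval (Real.cos θ : ℂ)‖ ^ 2 * Real.sin θ
        = ‖P.derivative.eval (Real.cos θ : ℂ)‖ * ‖sinSum m a θ‖ := by rw [← h1]; ring
      _ ≤ D * ‖sinSum m a θ‖ := by gcongr
      _ ≤ _ := by linarith
  calc ∫ θ in (0 : ℝ)..Real.pi, ‖P.derivative.eval (Real.cos θ : ℂ)‖ ^ 2 * Real.sin θ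
      ≤ ∫ θ in (0 : ℝ)..Real.pi, ((m + 1 : ℝ)⁻¹ / 2 * D ^ 2 + (m + 1) / 2 * ‖sinSum m a θ‖ ^ 2) := by
        refine intervalIntegral.integral_mono_on Real.pi_pos.le (Continuous.intervalIntegrable ?_ _ _)
          (Continuous.intervalIntegrable (by fun_prop) _ _) hpt
        exact (((continuous_eval_ofReal _).comp Real.continuous_cos).norm.pow 2).mul Real.continuous_sin
    _ = Real.pi * ((m + 1 : ℝ)⁻¹ / 2 * D ^ 2) +
          (m + 1) / 2 * ∫ θ in (0 : ℝ)..Real.pi, ‖sinSum m a θ‖ ^ 2 := by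
        rw [intervalIntegral.integral_add (continuous_const.intervalIntegrable _ _)
          ((hc.intervalIntegrable _ _).const_mul _),
          intervalIntegral.integral_const_mul, intervalIntegral.integral_const_mul]
        simp
        ring
    _ ≤ Real.pi * ((m + 1 : ℝ)⁻¹ / 2 * ((m + 1) ^ 3 * A)) + (m + 1) / 2 * (Real.pi * A) := by
        gcongr
        exact integral_norm_sq_sinSum_le m a
    _ = Real.pi * A * ((m + 1) ^ 2 / 2 + (m + 1) / 2) := by field_simp
    _ ≤ Real.pi * A * (m + 1) ^ 2 := by
        gcongr
        nlinarith [(Nat.cast_nonneg m : (0 : ℝ) ≤ m)]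
    _ = _ := by ring

/-- The weight `sin θ` degenerates only at the ends. On end intervals of length `δ = π / (8 (m +
1))` the pointwise bound `(m + 1) S` allows a mass of `π S / 8` each, together half of the lower
bound `π S / 2`. In between `sin θ ≥ 1 / (4 (m + 1))`. -/
theorem sum_sq_coeff_le_integral (ha : ∀ θ : ℝ, P.eval (Real.cos θ : ℂ) = cosSum m a θ) :
    ∑ k ∈ Finset.range (m + 1), ‖a k‖ ^ 2 ≤
      16 / Real.pi * (m + 1) * ∫ t in (-1 : ℝ)..1, ‖P.eval (t : ℂ)‖ ^ 2 := by
  set S := ∑ k ∈ Finset.range (m + 1), ‖a k‖ ^ 2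
  have hm : (0 : ℝ) < m + 1 := by positivity
  have hpi := Real.pi_pos
  set δ : ℝ := Real.pi / (8 * (m + 1)) with hδ
  have hδ0 : 0 < δ := by positivity
  have hδ1 : δ ≤ Real.pi / 8 := by
    rw [hδ]
    gcongr
    linarith [(Nat.cast_nonneg m : (0 : ℝ) ≤ m)]
  rw [integral_comp_cos_pi (continuous_norm_sq_eval_ofReal P)]
  simp only [ha]
  have hc : Continuous fun θ => ‖cosSum m a θ‖ ^ 2 := (continuous_cosSum m a).norm.pow 2
  have hcs : Continuous fun θ => ‖cosSum m a θ‖ ^ 2 * Real.sin θ := hc.mul Real.continuous_sin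
  have hi := fun α β => hc.intervalIntegrable (μ := volume) α β
  have his := fun α β => hcs.intervalIntegrable (μ := volume) α β
  have hend : ∀ α β : ℝ, α ≤ β → β - α = δ → ∫ θ in α..β, ‖cosSum m a θ‖ ^ 2 ≤ δ * ((m + 1) * S) := by
    intro α β hαβ he
    calc ∫ θ in α..β, ‖cosSum m a θ‖ ^ 2 ≤ ∫ _ in α..β, (m + 1) * S :=
          intervalIntegral.integral_mono hαβ (hi _ _) (continuous_const.intervalIntegrable _ _)
            fun θ => norm_cosSum_sq_le m a θ
      _ = δ * ((m + 1) * S) := by rw [intervalIntegral.integral_const, he, smul_eq_mul]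
  have h1 := hend 0 δ hδ0.le (by ring)
  have h3 := hend (Real.pi - δ) Real.pi (by linarith) (by ring)
  have h2 : ∫ θ in δ..(Real.pi - δ), ‖cosSum m a θ‖ ^ 2 ≤
      4 * (m + 1) * ∫ θ in (0 : ℝ)..Real.pi, ‖cosSum m a θ‖ ^ 2 * Real.sin θ := by
    have hsin : ∀ θ ∈ Icc δ (Real.pi - δ), 1 ≤ 4 * (m + 1) * Real.sin θ := by
      intro θ hθ
      have key : ∀ x, δ ≤ x → x ≤ Real.pi / 2 → 1 ≤ 4 * (m + 1) * Real.sin x := fun x hx hx' => by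
        have := Real.mul_le_sin (hδ0.le.trans hx) hx'
        have h4 : 2 / Real.pi * δ ≤ Real.sin x := le_trans (by gcongr) this
        calc (1 : ℝ) = 4 * (m + 1) * (2 / Real.pi * δ) := by rw [hδ]; field_simp; norm_num
          _ ≤ _ := by gcongr
      rcases le_total θ (Real.pi / 2) with h | h
      · exact key θ hθ.1 h
      · rw [← Real.sin_pi_sub]
        exact key _ (by linarith [hθ.2]) (by linarith)
    calc ∫ θ in δ..(Real.pi - δ), ‖cosSum m a θ‖ ^ 2
        ≤ ∫ θ in δ..(Real.pi - δ), 4 * (m + 1) * (‖cosSum m a θ‖ ^ 2 * Real.sin θ) := by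
          refine intervalIntegral.integral_mono_on (by linarith) (hi _ _) ((his _ _).const_mul _)
            fun θ hθ => ?_
          calc ‖cosSum m a θ‖ ^ 2 = ‖cosSum m a θ‖ ^ 2 * 1 := (mul_one _).symm
            _ ≤ ‖cosSum m a θ‖ ^ 2 * (4 * (m + 1) * Real.sin θ) := by
              gcongr
              exact hsin θ hθ
            _ = _ := by ring
      _ = 4 * (m + 1) * ∫ θ in δ..(Real.pi - δ), ‖cosSum m a θ‖ ^ 2 * Real.sin θ :=
          intervalIntegral.integral_const_mul _ _
      _ ≤ _ := by
          gcongr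
          refine intervalIntegral.integral_mono_interval hδ0.le (by linarith) (by linarith) ?_ (his _ _)
          refine (ae_restrict_iff' measurableSet_Ioc).2 (Eventually.of_forall fun θ hθ => ?_)
          exact mul_nonneg (by positivity) (Real.sin_nonneg_of_mem_Icc (Ioc_subset_Icc_self hθ))
  have h4 := le_integral_norm_sq_cosSum m a
  rw [← intervalIntegral.integral_add_adjacent_intervals (hi 0 δ) (hi δ Real.pi),
    ← intervalIntegral.integral_add_adjacent_intervals (hi δ (Real.pi - δ)) (hi _ Real.pi)] at h4
  have h5 : δ * ((m + 1) * S) = Real.pi / 8 * S := by rw [hδ]; field_simp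
  rw [h5] at h1 h3
  set J := ∫ θ in (0 : ℝ)..Real.pi, ‖cosSum m a θ‖ ^ 2 * Real.sin θ
  have h6 : Real.pi / 4 * S ≤ 4 * (m + 1) * J := by
    change Real.pi / 2 * S ≤ _ at h4
    linarith
  calc S = 4 / Real.pi * (Real.pi / 4 * S) := by field_simp
    _ ≤ 4 / Real.pi * (4 * (m + 1) * J) := by gcongr
    _ = _ := by ring

/-- An inequality of Markov type. -/
theorem integral_norm_sq_derivative_le_integral {n : ℕ} (hn : 0 < n) (hP : P.degree < n) :
    ∫ t in (-1 : ℝ)..1, ‖P.derivative.eval (t : ℂ)‖ ^ 2 ≤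
      16 * (n : ℝ) ^ 8 * ∫ t in (-1 : ℝ)..1, ‖P.eval (t : ℂ)‖ ^ 2 := by
  obtain ⟨m, rfl⟩ : ∃ m, n = m + 1 := ⟨n - 1, by omega⟩
  obtain ⟨a, ha⟩ := exists_eval_cos_eq_sum (m + 1) hP
  set J := ∫ t in (-1 : ℝ)..1, ‖P.eval (t : ℂ)‖ ^ 2
  have hJ : 0 ≤ J := intervalIntegral.integral_nonneg (by norm_num) fun t _ => by positivity
  have h1 := integral_norm_sq_derivative_le (m := m) ha
  have h2 := sum_sq_coeff_le_integral (m := m) ha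
  have h3 := sum_sq_mul_coeff_le_crude m a
  have hm : (1 : ℝ) ≤ m + 1 := by linarith [(Nat.cast_nonneg m : (0 : ℝ) ≤ m)]
  have hpi := Real.pi_pos
  push_cast
  calc _ ≤ Real.pi * (m + 1) ^ 2 * ((m + 1) ^ 2 * (16 / Real.pi * (m + 1) * J)) := by
        refine h1.trans ?_
        gcongr
        refine h3.trans ?_
        gcongr
    _ = 16 * (m + 1) ^ 5 * J := by field_simp; try ring
    -- The fifth power is relaxed to the eighth: balanced against `c = n⁴` in the Sobolev
    -- inequality, this is what the factor `n²` for `𝓣ₙ` needs.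
    _ ≤ 16 * (m + 1) ^ 8 * J := by
        gcongr
        norm_num

/-- Stability of polynomial interpolation at the Chebyshev points. -/
theorem integral_norm_sq_le_of_nodes (hm : 0 < m) (hP : P.degree < (m + 1 : ℕ)) {B : ℝ}
    (hB : ∀ j ≤ m, ‖P.eval (Real.cos (j * (Real.pi / m)) : ℂ)‖ ^ 2 ≤ B) :
    ∫ t in (-1 : ℝ)..1, ‖P.eval (t : ℂ)‖ ^ 2 ≤ 8 * B := by
  obtain ⟨a, ha⟩ := exists_eval_cos_eq_sum (m + 1) hP
  have hB0 : 0 ≤ B := le_trans (by positivity) (hB 0 (Nat.zero_le _))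
  have h1 : ∑ k ∈ Finset.range (m + 1), ‖a k‖ ^ 2 ≤ 2 * B := sum_sq_coeff_le hm a fun j hj => by
    have := hB j hj
    rw [ha] at this
    exact this
  calc _ ≤ _ := integral_norm_sq_le_integral_cosSum (m := m) ha
    _ ≤ Real.pi * ∑ k ∈ Finset.range (m + 1), ‖a k‖ ^ 2 := integral_norm_sq_cosSum_le m a
    _ ≤ 4 * (2 * B) := by
        gcongr
        exact Real.pi_le_four
    _ = 8 * B := by ring

theorem norm_sq_intervalIntegral_le {g : ℝ → ℂ} {α β : ℝ} (h : α ≤ β)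
    (hg : MemLp g 2 (volume.restrict (Ioc α β))) :
    ‖∫ t in α..β, g t‖ ^ 2 ≤ (β - α) * ∫ t in α..β, ‖g t‖ ^ 2 := by
  have h1 := sq_integral_norm_mul_le (μ := volume.restrict (Ioc α β)) (u := fun _ => 1)
    (memLp_const 1) hg
  simp only [one_mul, norm_one, one_pow] at h1
  rw [intervalIntegral.integral_of_le h, intervalIntegral.integral_of_le h]
  refine h1.trans (le_of_eq ?_)
  rw [integral_const]
  simp [h]

/-- The Poincaré inequality on an interval, for functions that vanish at an endpoint. -/
theorem integral_norm_sq_sub_le {F G : ℝ → ℂ} {α β γ : ℝ} (h : α ≤ β) (hγ : γ = α ∨ γ = β)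
    (hG : MemLp G 2 (volume.restrict (Ioc α β)))
    (hF : ∀ s ∈ Icc α β, ∀ t ∈ Icc α β, F t - F s = ∫ x in s..t, G x)
    (hFc : ContinuousOn F (Icc α β)) :
    ∫ t in α..β, ‖F t - F γ‖ ^ 2 ≤ (β - α) ^ 2 * ∫ t in α..β, ‖G t‖ ^ 2 := by
  have hi : IntegrableOn (fun t => ‖G t‖ ^ 2) (Ioc α β) := hG.integrable_norm_pow (by norm_num)
  have hγm : γ ∈ Icc α β := by rcases hγ with rfl | rfl <;> simp [h]
  have hpt : ∀ t ∈ Icc α β, ‖F t - F γ‖ ^ 2 ≤ (β - α) * ∫ t in α..β, ‖G t‖ ^ 2 := by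
    have key : ∀ s ∈ Icc α β, ∀ t ∈ Icc α β, s ≤ t →
        ‖F t - F s‖ ^ 2 ≤ (β - α) * ∫ t in α..β, ‖G t‖ ^ 2 := by
      intro s hs t ht hst
      rw [hF s hs t ht]
      have hsub : Ioc s t ⊆ Ioc α β := Ioc_subset_Ioc hs.1 ht.2
      refine (norm_sq_intervalIntegral_le hst (hG.mono_measure (Measure.restrict_mono hsub le_rfl))).trans ?_
      have h1 : ∫ t in s..t, ‖G t‖ ^ 2 ≤ ∫ t in α..β, ‖G t‖ ^ 2 := by
        rw [intervalIntegral.integral_of_le hst, intervalIntegral.integral_of_le h]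
        exact setIntegral_mono_set hi (Eventually.of_forall fun x => by positivity) hsub.eventuallyLE
      have h2 : 0 ≤ ∫ t in s..t, ‖G t‖ ^ 2 :=
        intervalIntegral.integral_nonneg hst fun x _ => by positivity
      exact mul_le_mul (by linarith [hs.1, ht.2]) h1 h2 (by linarith)
    intro t ht
    rcases le_total γ t with hle | hle
    · exact key γ hγm t ht hle
    · rw [norm_sub_rev]
      exact key t ht γ hγm hle
  have hcont : ContinuousOn (fun t => ‖F t - F γ‖ ^ 2) (Icc α β) :=
    (hFc.sub continuousOn_const).norm.pow 2
  rw [← uIcc_of_le h] at hcont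
  calc ∫ t in α..β, ‖F t - F γ‖ ^ 2 ≤ ∫ _ in α..β, (β - α) * ∫ t in α..β, ‖G t‖ ^ 2 :=
        intervalIntegral.integral_mono_on h hcont.intervalIntegrable
          (continuous_const.intervalIntegrable _ _) hpt
    _ = _ := by rw [intervalIntegral.integral_const, smul_eq_mul]; ring

end PolynomialBounds

/-! ### The error of interpolation at the Chebyshev points -/

section InterpolationError

open Polynomial

theorem cos_node_mem (x : ℝ) : Real.cos x ∈ Icc (-1 : ℝ) 1 := Real.cos_mem_Icc x

theorem node_le {m j : ℕ} (hj : j < m) :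
    Real.cos ((j + 1 : ℕ) * (Real.pi / m)) ≤ Real.cos (j * (Real.pi / m)) := by
  have hm : (0 : ℝ) < m := by exact_mod_cast (Nat.zero_le j).trans_lt hj
  have hpi := Real.pi_pos
  refine Real.cos_le_cos_of_nonneg_of_le_pi (by positivity) ?_ (by gcongr; omega)
  calc ((j + 1 : ℕ) : ℝ) * (Real.pi / m) ≤ m * (Real.pi / m) := by
        gcongr
        exact_mod_cast hj
    _ = Real.pi := by field_simp

theorem node_sub_le (m j : ℕ) :
    Real.cos (j * (Real.pi / m)) - Real.cos ((j + 1 : ℕ) * (Real.pi / m)) ≤ Real.pi / m := by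
  have h := Real.abs_cos_sub_cos_le (j * (Real.pi / m)) ((j + 1 : ℕ) * (Real.pi / m))
  refine (le_abs_self _).trans (h.trans (le_of_eq ?_))
  push_cast
  rw [add_mul, one_mul, sub_add_cancel_left, abs_neg, abs_of_nonneg (by positivity)]

theorem sum_integral_nodes {m : ℕ} (hm : 0 < m) {F : ℝ → ℝ}
    (hF : IntegrableOn F (Icc (-1) 1)) :
    ∑ j ∈ Finset.range m, ∫ t in Real.cos ((j + 1 : ℕ) * (Real.pi / m))..Real.cos (j * (Real.pi / m)), F t =
      ∫ t in (-1 : ℝ)..1, F t := by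
  have hm' : (m : ℝ) ≠ 0 := by positivity
  have h := intervalIntegral.sum_integral_adjacent_intervals (f := F) (μ := volume)
    (a := fun j : ℕ => Real.cos (j * (Real.pi / m))) (n := m) fun j _ => by
      have h1 : IntegrableOn F (uIcc (Real.cos (j * (Real.pi / m)))
          (Real.cos ((j + 1 : ℕ) * (Real.pi / m)))) :=
        hF.mono_set (uIcc_subset_Icc (cos_node_mem _) (cos_node_mem _))
      exact h1.intervalIntegrable
  simp only [Nat.cast_zero, zero_mul, Real.cos_zero, mul_div_cancel₀ Real.pi hm', Real.cos_pi] at h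
  rw [intervalIntegral.integral_symm, ← h, ← Finset.sum_neg_distrib]
  exact Finset.sum_congr rfl fun j _ => intervalIntegral.integral_symm _ _

theorem HasPrim.memLp_Ioc {f g : ℝ → ℂ} (h : HasPrim f g) {α β : ℝ} (hα : α ∈ Icc (-1 : ℝ) 1)
    (hβ : β ∈ Icc (-1 : ℝ) 1) : MemLp g 2 (volume.restrict (Ioc α β)) :=
  h.memLp.mono_measure (Measure.restrict_mono (Ioc_subset_Icc_self.trans (Icc_subset_Icc hα.1 hβ.2)) le_rfl)

theorem continuous_memLp_Ioc {F : ℝ → ℂ} (hF : Continuous F) (α β : ℝ) :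
    MemLp F 2 (volume.restrict (Ioc α β)) := by
  obtain ⟨K, hK⟩ := isCompact_Icc.exists_bound_of_continuousOn (hF.continuousOn (s := Icc α β))
  exact MemLp.of_bound hF.aestronglyMeasurable K ((ae_restrict_iff' measurableSet_Ioc).2
    (Eventually.of_forall fun t ht => hK t (Ioc_subset_Icc_self ht)))

variable {m : ℕ} {P : ℂ[X]} {a : ℕ → ℂ} {f g : ℝ → ℂ}

/-- The differences of nodal values are integrals of `g` between neighbouring nodes. Cauchy-Schwarz
and the gap bound `π / m` turn them into `‖g‖²`, cancelling the factor `m`. -/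
theorem sum_sq_mul_coeff_le_of_nodes (hm : 0 < m) (hfg : HasPrim f g)
    (ha : ∀ θ : ℝ, P.eval (Real.cos θ : ℂ) = cosSum m a θ)
    (hP : ∀ j ≤ m, P.eval (Real.cos (j * (Real.pi / m)) : ℂ) = f (Real.cos (j * (Real.pi / m)))) :
    ∑ k ∈ Finset.range (m + 1), (k : ℝ) ^ 2 * ‖a k‖ ^ 2 ≤
      Real.pi / 2 * ∫ t in (-1 : ℝ)..1, ‖g t‖ ^ 2 := by
  have hm' : (0 : ℝ) < m := by positivity
  have hg : IntegrableOn (fun t => ‖g t‖ ^ 2) (Icc (-1) 1) := hfg.memLp.integrable_norm_pow (by norm_num)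
  refine (sum_sq_mul_coeff_le hm a).trans ?_
  rw [← sum_integral_nodes hm hg, Finset.mul_sum, Finset.mul_sum]
  refine Finset.sum_le_sum fun j hj => ?_
  have hj' : j < m := Finset.mem_range.1 hj
  rw [← ha, ← ha, hP _ hj', hP _ hj'.le, norm_sub_rev, hfg.sub_eq (cos_node_mem _) (cos_node_mem _)]
  have h1 := norm_sq_intervalIntegral_le (node_le hj')
    (hfg.memLp_Ioc (cos_node_mem ((j + 1 : ℕ) * (Real.pi / m))) (cos_node_mem (j * (Real.pi / m))))
  have h2 : 0 ≤ ∫ t in Real.cos ((j + 1 : ℕ) * (Real.pi / m))..Real.cos (j * (Real.pi / m)), ‖g t‖ ^ 2 :=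
    intervalIntegral.integral_nonneg (node_le hj') fun t _ => by positivity
  calc _ ≤ (m / 2 : ℝ) * (Real.pi / m * ∫ t in Real.cos ((j + 1 : ℕ) * (Real.pi / m))..Real.cos
          (j * (Real.pi / m)), ‖g t‖ ^ 2) := by
        gcongr
        refine h1.trans ?_
        gcongr
        exact node_sub_le m j
    _ = _ := by field_simp

/-- Between neighbouring nodes both `P` and `f` are compared with their common value at the right
node. Poincaré's inequality is applied to `f` in the variable `t` and to `P` in the variable `θ`,
where its derivative `sinSum` is controlled without loss in `m`. The constant is `2 π² (1 + π² / 2)`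
with `π ≤ 4`. -/
theorem integral_norm_sq_sub_le_of_nodes (hm : 0 < m) (hfg : HasPrim f g) (hd : P.degree < (m + 1 : ℕ))
    (hP : ∀ j ≤ m, P.eval (Real.cos (j * (Real.pi / m)) : ℂ) = f (Real.cos (j * (Real.pi / m)))) :
    ∫ t in (-1 : ℝ)..1, ‖P.eval (t : ℂ) - f t‖ ^ 2 ≤
        288 / (m : ℝ) ^ 2 * ∫ t in (-1 : ℝ)..1, ‖g t‖ ^ 2 := by
  obtain ⟨a, ha⟩ := exists_eval_cos_eq_sum (m + 1) hd
  replace ha : ∀ θ : ℝ, P.eval (Real.cos θ : ℂ) = cosSum m a θ := ha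
  have hm' : (0 : ℝ) < m := by positivity
  have hpi := Real.pi_pos
  set h : ℝ := Real.pi / m with hh
  have h0 : 0 ≤ h := by positivity
  set G := ∫ t in (-1 : ℝ)..1, ‖g t‖ ^ 2
  have hG0 : 0 ≤ G := intervalIntegral.integral_nonneg (by norm_num) fun t _ => by positivity
  set A := ∑ k ∈ Finset.range (m + 1), (k : ℝ) ^ 2 * ‖a k‖ ^ 2
  have hA : A ≤ Real.pi / 2 * G := sum_sq_mul_coeff_le_of_nodes hm hfg ha hP
  have hg : IntegrableOn (fun t => ‖g t‖ ^ 2) (Icc (-1) 1) := hfg.memLp.integrable_norm_pow (by norm_num)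
  have hPc := continuous_eval_ofReal P
  have hcont : ContinuousOn (fun t : ℝ => ‖P.eval (t : ℂ) - f t‖ ^ 2) (Icc (-1) 1) :=
    (hPc.continuousOn.sub hfg.continuousOn).norm.pow 2
  have hsc : Continuous fun θ => ‖sinSum m a θ‖ ^ 2 := (continuous_sinSum m a).norm.pow 2
  have hpiece : ∀ j ∈ Finset.range m,
      ∫ t in Real.cos ((j + 1 : ℕ) * h)..Real.cos (j * h), ‖P.eval (t : ℂ) - f t‖ ^ 2 ≤
        2 * h ^ 2 * (∫ t in Real.cos ((j + 1 : ℕ) * h)..Real.cos (j * h), ‖g t‖ ^ 2) +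
          2 * h ^ 2 * ∫ θ in (j * h)..((j + 1 : ℕ) * h), ‖sinSum m a θ‖ ^ 2 := by
    intro j hj
    have hj' : j < m := Finset.mem_range.1 hj
    set α := Real.cos ((j + 1 : ℕ) * h)
    set β := Real.cos (j * h) with hβ
    have hαβ : α ≤ β := node_le hj'
    have hαm : α ∈ Icc (-1 : ℝ) 1 := cos_node_mem _
    have hβm : β ∈ Icc (-1 : ℝ) 1 := cos_node_mem _
    have hsub : Icc α β ⊆ Icc (-1 : ℝ) 1 := Icc_subset_Icc hαm.1 hβm.2
    have hpβ : P.eval (β : ℂ) = f β := hP j hj'.le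
    have hint : ∀ {F : ℝ → ℝ}, ContinuousOn F (Icc (-1) 1) → IntervalIntegrable F volume α β :=
      fun hF => (hF.mono (uIcc_subset_Icc hαm hβm)).intervalIntegrable
    have c1 : Continuous fun t : ℝ => ‖P.eval (t : ℂ) - P.eval (β : ℂ)‖ ^ 2 :=
      (hPc.sub continuous_const).norm.pow 2
    have c2 : ContinuousOn (fun t : ℝ => ‖f t - f β‖ ^ 2) (Icc (-1) 1) :=
      (hfg.continuousOn.sub continuousOn_const).norm.pow 2
    have e1 : ∫ t in α..β, ‖f t - f β‖ ^ 2 ≤ h ^ 2 * ∫ t in α..β, ‖g t‖ ^ 2 := by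
      refine (integral_norm_sq_sub_le hαβ (Or.inr rfl) (hfg.memLp_Ioc hαm hβm)
        (fun s hs t ht => hfg.sub_eq (hsub hs) (hsub ht)) (hfg.continuousOn.mono hsub)).trans ?_
      have h2 : 0 ≤ ∫ t in α..β, ‖g t‖ ^ 2 :=
        intervalIntegral.integral_nonneg hαβ fun t _ => by positivity
      gcongr
      exact node_sub_le m j
    have e2 : ∫ t in α..β, ‖P.eval (t : ℂ) - P.eval (β : ℂ)‖ ^ 2 ≤
        h ^ 2 * ∫ θ in (j * h)..((j + 1 : ℕ) * h), ‖sinSum m a θ‖ ^ 2 := by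
      have hle : (j : ℝ) * h ≤ (j + 1 : ℕ) * h := by gcongr; omega
      rw [integral_comp_cos c1]
      have c3 : Continuous fun θ : ℝ => ‖P.eval (Real.cos θ : ℂ) - P.eval (β : ℂ)‖ ^ 2 :=
        c1.comp Real.continuous_cos
      refine (integral_mul_sin_le c3 (fun θ => by positivity) hle).trans ?_
      simp only [hβ, ha]
      have hlen : ((j + 1 : ℕ) : ℝ) * h - j * h = h := by push_cast; ring
      have := integral_norm_sq_sub_le (F := cosSum m a) (G := fun θ => -sinSum m a θ) hle
        (Or.inl rfl) ?_ (fun s _ t _ => ?_) (continuous_cosSum m a).continuousOn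
      · simpa only [norm_neg, hlen] using this
      · exact continuous_memLp_Ioc (continuous_sinSum m a).neg _ _
      · rw [intervalIntegral.integral_eq_sub_of_hasDerivAt (fun x _ => hasDerivAt_cosSum m a x)
          ((continuous_sinSum m a).neg.intervalIntegrable _ _)]
    calc ∫ t in α..β, ‖P.eval (t : ℂ) - f t‖ ^ 2
        ≤ ∫ t in α..β, (2 * ‖f t - f β‖ ^ 2 + 2 * ‖P.eval (t : ℂ) - P.eval (β : ℂ)‖ ^ 2) := by
          refine intervalIntegral.integral_mono_on hαβ (hint hcont)
            (((hint c2).const_mul 2).add ((c1.intervalIntegrable _ _).const_mul 2)) fun t _ => ?_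
          have e : P.eval (t : ℂ) - f t = (P.eval (t : ℂ) - P.eval (β : ℂ)) - (f t - f β) := by
            rw [hpβ]; ring
          rw [e]
          have := norm_sub_le (P.eval (t : ℂ) - P.eval (β : ℂ)) (f t - f β)
          nlinarith [norm_nonneg (P.eval (t : ℂ) - P.eval (β : ℂ) - (f t - f β)),
            sq_nonneg (‖P.eval (t : ℂ) - P.eval (β : ℂ)‖ - ‖f t - f β‖)]
      _ = 2 * (∫ t in α..β, ‖f t - f β‖ ^ 2) + 2 * ∫ t in α..β, ‖P.eval (t : ℂ) - P.eval (β : ℂ)‖ ^ 2 := by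
          rw [intervalIntegral.integral_add ((hint c2).const_mul 2)
            ((c1.intervalIntegrable _ _).const_mul 2), intervalIntegral.integral_const_mul,
            intervalIntegral.integral_const_mul]
      _ ≤ _ := by linarith
  have hsum := Finset.sum_le_sum hpiece
  have hsin : ∑ j ∈ Finset.range m, ∫ θ in (j * h)..((j + 1 : ℕ) * h), ‖sinSum m a θ‖ ^ 2 =
      ∫ θ in (0 : ℝ)..Real.pi, ‖sinSum m a θ‖ ^ 2 := by
    have := intervalIntegral.sum_integral_adjacent_intervals (f := fun θ => ‖sinSum m a θ‖ ^ 2)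
      (μ := volume) (a := fun j : ℕ => (j : ℝ) * h) (n := m) fun j _ => hsc.intervalIntegrable _ _
    rw [this, Nat.cast_zero, zero_mul, hh, mul_div_cancel₀ _ hm'.ne']
  rw [sum_integral_nodes hm (hcont.integrableOn_compact isCompact_Icc), Finset.sum_add_distrib,
    ← Finset.mul_sum, ← Finset.mul_sum, sum_integral_nodes hm hg, hsin] at hsum
  have hS := integral_norm_sq_sinSum_le m a
  have hpi4 := Real.pi_le_four
  calc _ ≤ 2 * h ^ 2 * G + 2 * h ^ 2 * (Real.pi * (Real.pi / 2 * G)) := by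
        refine hsum.trans ?_
        gcongr
        refine hS.trans ?_
        gcongr
    _ = 2 * Real.pi ^ 2 * (1 + Real.pi ^ 2 / 2) / m ^ 2 * G := by rw [hh]; field_simp
    _ ≤ 2 * 4 ^ 2 * (1 + 4 ^ 2 / 2) / m ^ 2 * G := by gcongr
    _ = _ := by norm_num

theorem integral_norm_sq_derivative_le_of_nodes (hm : 0 < m) (hfg : HasPrim f g)
    (hd : P.degree < (m + 1 : ℕ))
    (hP : ∀ j ≤ m, P.eval (Real.cos (j * (Real.pi / m)) : ℂ) = f (Real.cos (j * (Real.pi / m)))) :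
    ∫ t in (-1 : ℝ)..1, ‖P.derivative.eval (t : ℂ)‖ ^ 2 ≤
        8 * (m + 1 : ℝ) ^ 2 * ∫ t in (-1 : ℝ)..1, ‖g t‖ ^ 2 := by
  obtain ⟨a, ha⟩ := exists_eval_cos_eq_sum (m + 1) hd
  replace ha : ∀ θ : ℝ, P.eval (Real.cos θ : ℂ) = cosSum m a θ := ha
  have hG0 : 0 ≤ ∫ t in (-1 : ℝ)..1, ‖g t‖ ^ 2 :=
    intervalIntegral.integral_nonneg (by norm_num) fun t _ => by positivity
  have hpi := Real.pi_pos
  have hpi4 := Real.pi_le_four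
  calc _ ≤ Real.pi * (m + 1) ^ 2 * (Real.pi / 2 * ∫ t in (-1 : ℝ)..1, ‖g t‖ ^ 2) := by
        refine (integral_norm_sq_derivative_le ha).trans ?_
        gcongr
        exact sum_sq_mul_coeff_le_of_nodes hm hfg ha hP
    _ = Real.pi ^ 2 / 2 * (m + 1) ^ 2 * ∫ t in (-1 : ℝ)..1, ‖g t‖ ^ 2 := by ring
    _ ≤ 4 ^ 2 / 2 * (m + 1) ^ 2 * ∫ t in (-1 : ℝ)..1, ‖g t‖ ^ 2 := by gcongr
    _ = _ := by norm_num

end InterpolationError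

/-! ### The interpolating polynomial -/

section Interpolation

open Polynomial

/-- For `n = m + 1` the points are the cosines of the multiples of `π / m`, numbered in increasing
order of `t`, that is, of decreasing angle. -/
theorem chebPoint_succ {m : ℕ} (hm : 0 < m) (j : Fin (m + 1)) :
    chebPoint (m + 1) j = Real.cos ((m - j : ℕ) * (Real.pi / m)) := by
  have hm' : (m : ℝ) ≠ 0 := by positivity
  rw [chebPoint, Nat.cast_sub (Nat.lt_succ_iff.1 j.2)]
  congr 1
  push_cast
  rw [add_sub_cancel_right]
  field_simp

theorem chebPoint_mem (n : ℕ) (j : Fin n) : chebPoint n j ∈ Icc (-1 : ℝ) 1 := Real.cos_mem_Icc _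

theorem chebPoint_injective {n : ℕ} (hn : 2 ≤ n) : Function.Injective (chebPoint n) := by
  obtain ⟨m, rfl⟩ : ∃ m, n = m + 1 := ⟨n - 1, by omega⟩
  have hm : 0 < m := by omega
  have hm' : (0 : ℝ) < m := by positivity
  have hpi := Real.pi_pos
  have hmem : ∀ k : ℕ, k ≤ m → (k : ℝ) * (Real.pi / m) ∈ Icc 0 Real.pi := fun k hk => by
    refine ⟨by positivity, ?_⟩
    calc (k : ℝ) * (Real.pi / m) ≤ m * (Real.pi / m) := by gcongr
      _ = Real.pi := by field_simp
  intro j k h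
  rw [chebPoint_succ hm, chebPoint_succ hm] at h
  have h1 := Real.injOn_cos (hmem _ (Nat.sub_le _ _)) (hmem _ (Nat.sub_le _ _)) h
  have h2 := mul_right_cancel₀ (by positivity : Real.pi / m ≠ 0) h1
  have h3 : m - (j : ℕ) = m - k := by exact_mod_cast h2
  have := j.2
  have := k.2
  exact Fin.ext (by omega)

/-- The polynomial of degree less than `n` that interpolates `f` at the Chebyshev points. -/
def interp (n : ℕ) (f : ℝ → ℂ) : ℂ[X] :=
  Lagrange.interpolate Finset.univ (fun j => (chebPoint n j : ℂ)) fun j => f (chebPoint n j)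

variable {n : ℕ} {f g : ℝ → ℂ}

theorem injOn_chebPoint (hn : 2 ≤ n) :
    InjOn (fun j => (chebPoint n j : ℂ)) (Finset.univ : Finset (Fin n)) :=
  (Complex.ofReal_injective.comp (chebPoint_injective hn)).injOn

theorem degree_interp_lt (hn : 2 ≤ n) (f : ℝ → ℂ) : (interp n f).degree < n := by
  simpa [interp] using Lagrange.degree_interpolate_lt (fun j => f (chebPoint n j)) (injOn_chebPoint hn)

theorem eval_interp_chebPoint (hn : 2 ≤ n) (f : ℝ → ℂ) (j : Fin n) :
    (interp n f).eval (chebPoint n j : ℂ) = f (chebPoint n j) :=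
  Lagrange.eval_interpolate_at_node (fun j => f (chebPoint n j)) (injOn_chebPoint hn) (Finset.mem_univ j)

theorem eval_interp_node {m : ℕ} (hm : 0 < m) (f : ℝ → ℂ) {j : ℕ} (hj : j ≤ m) :
    (interp (m + 1) f).eval (Real.cos (j * (Real.pi / m)) : ℂ) = f (Real.cos (j * (Real.pi / m))) := by
  have h := eval_interp_chebPoint (n := m + 1) (by omega) f ⟨m - j, by omega⟩
  rw [chebPoint_succ hm] at h
  simpa only [Nat.sub_sub_self hj] using h

theorem interp_eval (hn : 2 ≤ n) {P : ℂ[X]} (hP : P.degree < n) :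
    interp n (fun t => P.eval (t : ℂ)) = P :=
  (Lagrange.eq_interpolate (injOn_chebPoint hn) (by simpa using hP)).symm

theorem interp_congr (h : EqOn f g (Icc (-1) 1)) : interp n f = interp n g := by
  unfold interp
  congr 1
  funext j
  exact h (chebPoint_mem n j)

theorem interp_sub : interp n (fun t => f t - g t) = interp n f - interp n g :=
  map_sub (Lagrange.interpolate Finset.univ fun j => (chebPoint n j : ℂ)) (fun j => f (chebPoint n j))
    fun j => g (chebPoint n j)

theorem eval_interp (n : ℕ) (f : ℝ → ℂ) (t : ℝ) : (interp n f).eval (t : ℂ) =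
    ∑ j : Fin n, (((Lagrange.basis Finset.univ (chebPoint n) j).eval t : ℝ) : ℂ) * f (chebPoint n j) := by
  rw [interp, Lagrange.interpolate_apply, eval_finsetSum]
  refine Finset.sum_congr rfl fun j _ => ?_
  rw [eval_mul, eval_C, mul_comm]
  congr 1
  simp only [Lagrange.basis, eval_prod, Complex.ofReal_prod]
  refine Finset.prod_congr rfl fun k _ => ?_
  simp [Lagrange.basisDivisor]

theorem chebInterp_apply {ℓ : ℕ} (n : ℕ) (f : ArcFun ℓ) (i : Fin ℓ) (t : ℝ) (p q : Fin 2) :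
    chebInterp n f i t p q = (interp n fun t => contRep f i t p q).eval (t : ℂ) := by
  rw [eval_interp, chebInterp, Matrix.sum_apply]
  exact Finset.sum_congr rfl fun j _ => by rw [Matrix.smul_apply, Complex.real_smul]

theorem exists_derivative_eq {m : ℕ} {q : ℂ[X]} (hq : q.degree < m) :
    ∃ Q : ℂ[X], Q.degree < (m + 1 : ℕ) ∧ derivative Q = q := by
  rcases eq_or_ne q 0 with rfl | h0
  · exact ⟨0, by simp [bot_lt_iff_ne_bot], by simp⟩
  have hq' : q.natDegree < m := (natDegree_lt_iff_degree_lt h0).2 hq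
  refine ⟨∑ k ∈ Finset.range m, C (q.coeff k / (k + 1)) * X ^ (k + 1), ?_, ?_⟩
  · refine (degree_sum_le _ _).trans_lt ((Finset.sup_lt_iff (WithBot.bot_lt_coe _)).2 fun k hk => ?_)
    refine (degree_C_mul_X_pow_le _ _).trans_lt ?_
    exact_mod_cast Nat.succ_lt_succ (Finset.mem_range.1 hk)
  · conv_rhs => rw [q.as_sum_range' m hq']
    rw [derivative_sum]
    refine Finset.sum_congr rfl fun k _ => ?_
    rw [derivative_C_mul_X_pow, ← C_mul_X_pow_eq_monomial]
    congr 2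
    push_cast
    field_simp

end Interpolation

/-! ### The squared norm on the parameter interval -/

/-- The square of the norm of `L²(-1,1)`. -/
def normSq (f : ℝ → ℂ) : ℝ := ∫ t in (-1 : ℝ)..1, ‖f t‖ ^ 2

section NormSq

variable {f g w : ℝ → ℂ}

theorem normSq_nonneg (f : ℝ → ℂ) : 0 ≤ normSq f :=
  intervalIntegral.integral_nonneg (by norm_num) fun t _ => by positivity

theorem paramSq_eq_ofReal (hf : MemLp f 2 paramMeasure) : paramSq f = ENNReal.ofReal (normSq f) := by
  rw [paramSq, lintegral_enorm_sq_eq hf, normSq, setIntegral_Icc_eq]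

theorem normSq_mono_of_le {K : ℝ} (hf : MemLp f 2 paramMeasure) (hg : MemLp g 2 paramMeasure)
    (h : ∀ t ∈ Icc (-1 : ℝ) 1, ‖f t‖ ^ 2 ≤ K * ‖g t‖ ^ 2) : normSq f ≤ K * normSq g := by
  have hi : ∀ {f : ℝ → ℂ}, MemLp f 2 paramMeasure → Integrable (fun t => ‖f t‖ ^ 2) paramMeasure :=
    fun hf => hf.integrable_norm_pow (by norm_num)
  unfold normSq
  rw [← setIntegral_Icc_eq, ← setIntegral_Icc_eq, ← integral_const_mul]
  exact setIntegral_mono_on (hi hf) ((hi hg).const_mul K) measurableSet_Icc h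

theorem normSq_add_le (hf : MemLp f 2 paramMeasure) (hg : MemLp g 2 paramMeasure) :
    normSq (fun t => f t + g t) ≤ 2 * normSq f + 2 * normSq g := by
  have hi : ∀ {f : ℝ → ℂ}, MemLp f 2 paramMeasure → Integrable (fun t => ‖f t‖ ^ 2) paramMeasure :=
    fun hf => hf.integrable_norm_pow (by norm_num)
  unfold normSq
  rw [← setIntegral_Icc_eq, ← setIntegral_Icc_eq, ← setIntegral_Icc_eq, ← integral_const_mul,
    ← integral_const_mul, ← integral_add ((hi hf).const_mul 2) ((hi hg).const_mul 2)]
  refine setIntegral_mono_on (hi (hf.add hg)) (((hi hf).const_mul 2).add ((hi hg).const_mul 2))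
    measurableSet_Icc fun t _ => ?_
  have := norm_add_le (f t) (g t)
  nlinarith [norm_nonneg (f t + g t), sq_nonneg (‖f t‖ - ‖g t‖)]

theorem normSq_const_mul (c : ℂ) (f : ℝ → ℂ) : normSq (fun t => c * f t) = ‖c‖ ^ 2 * normSq f := by
  simp only [normSq, norm_mul, mul_pow, intervalIntegral.integral_const_mul]

theorem normSq_sub_comm (f g : ℝ → ℂ) : normSq (fun t => f t - g t) = normSq fun t => g t - f t := by
  simp only [normSq, norm_sub_rev]

theorem exists_normSq_mul_le (hw : ContinuousOn w (Icc (-1) 1)) : ∃ K : ℝ, 0 ≤ K ∧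
    ∀ f : ℝ → ℂ, MemLp f 2 paramMeasure → normSq (fun t => w t * f t) ≤ K * normSq f := by
  obtain ⟨K, hK⟩ := isCompact_Icc.exists_bound_of_continuousOn hw
  refine ⟨K ^ 2, by positivity, fun f hf => normSq_mono_of_le (MemLp.continuousOn_mul_param hw hf) hf
    fun t ht => ?_⟩
  rw [norm_mul, mul_pow]
  gcongr
  exact hK t ht

end NormSq

/-! ### Approximation by polynomials -/

/-- A chain of derivatives along an arc. -/
structure Mobius.IsChain (M : Mobius) (r : ℕ) (U : ℕ → ℝ → ℂ) : Prop where
  memLp : ∀ j ≤ r, MemLp (U j) 2 paramMeasure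
  hasPrim : ∀ j < r, HasPrim (U j) fun t => M.der t * U (j + 1) t

section Approximation

open Polynomial

variable {M : Mobius} {r : ℕ} {U : ℕ → ℝ → ℂ} {f g : ℝ → ℂ}

theorem Mobius.IsChain.shift (h : M.IsChain (r + 1) U) : M.IsChain r fun j => U (j + 1) :=
  ⟨fun j hj => h.memLp (j + 1) (by omega), fun j hj => h.hasPrim (j + 1) (by omega)⟩

theorem Mobius.IsChain.pred (h : M.IsChain (r + 1) U) : M.IsChain r U :=
  ⟨fun j hj => h.memLp j (by omega), fun j hj => h.hasPrim j (by omega)⟩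

/-- The square of the norm of a chain of derivatives. -/
def chainSq (r : ℕ) (U : ℕ → ℝ → ℂ) : ℝ := ∑ j ∈ Finset.range (r + 1), normSq (U j)

theorem chainSq_nonneg (r : ℕ) (U : ℕ → ℝ → ℂ) : 0 ≤ chainSq r U :=
  Finset.sum_nonneg fun j _ => normSq_nonneg (U j)

theorem chainSq_pred_le (r : ℕ) (U : ℕ → ℝ → ℂ) : chainSq r U ≤ chainSq (r + 1) U := by
  rw [chainSq, chainSq, Finset.sum_range_succ _ (r + 1)]
  exact le_add_of_nonneg_right (normSq_nonneg _)

theorem chainSq_shift_le (r : ℕ) (U : ℕ → ℝ → ℂ) :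
    chainSq r (fun j => U (j + 1)) ≤ chainSq (r + 1) U := by
  rw [chainSq, chainSq, Finset.sum_range_succ' _ (r + 1)]
  exact le_add_of_nonneg_right (normSq_nonneg _)

theorem normSq_zero_le_chainSq (r : ℕ) (U : ℕ → ℝ → ℂ) : normSq (U 0) ≤ chainSq r U :=
  Finset.single_le_sum (f := fun j => normSq (U j)) (fun j _ => normSq_nonneg _) (by simp)

theorem HasPrim.memLp_left (h : HasPrim f g) : MemLp f 2 paramMeasure :=
  memLp_param_of_continuousOn h.continuousOn 2

theorem normSq_interp_sub_le {m : ℕ} (hm : 0 < m) (h : HasPrim f g) :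
    normSq (fun t => (interp (m + 1) f).eval (t : ℂ) - f t) ≤ 288 / (m : ℝ) ^ 2 * normSq g :=
  integral_norm_sq_sub_le_of_nodes hm h (degree_interp_lt (by omega) f)
    fun _ hj => eval_interp_node hm f hj

theorem normSq_derivative_interp_le {m : ℕ} (hm : 0 < m) (h : HasPrim f g) :
    normSq (fun t => (derivative (interp (m + 1) f)).eval (t : ℂ)) ≤ 8 * (m + 1 : ℝ) ^ 2 * normSq g :=
  integral_norm_sq_derivative_le_of_nodes hm h (degree_interp_lt (by omega) f)
    fun _ hj => eval_interp_node hm f hj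

/-- The weight `(c t + d)⁻ᵏ`. -/
def Mobius.weight (M : Mobius) (k : ℕ) (t : ℝ) : ℂ := ((M.c * t + M.d) ^ k)⁻¹

theorem Mobius.NoPole.continuousOn_weight (hM : M.NoPole) (k : ℕ) :
    ContinuousOn (M.weight k) (Icc (-1) 1) :=
  ContinuousOn.inv₀ (by fun_prop) fun t ht => pow_ne_zero k (hM t ht)

theorem Mobius.der_eq_weight (M : Mobius) (t : ℝ) :
    M.der t = (M.a * M.d - M.b * M.c) * M.weight 2 t := rfl

theorem Mobius.NoPole.hasPrim_weight (hM : M.NoPole) (k : ℕ) :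
    HasPrim (M.weight k) fun t => -(k * M.c) * M.weight (k + 1) t := by
  refine .of_hasDerivAt (fun t ht => ?_) (continuousOn_const.mul (hM.continuousOn_weight (k + 1)))
  have h0 := hM t ht
  have h1 : HasDerivAt (fun z : ℂ => M.c * z + M.d) M.c (t : ℂ) := by
    simpa using ((hasDerivAt_id (t : ℂ)).const_mul M.c).add_const M.d
  have h2 := ((h1.pow k).inv (pow_ne_zero k h0)).comp_ofReal
  refine h2.congr_deriv ?_
  rw [Mobius.weight]
  rcases k with - | k
  · simp
  · simp only [Nat.add_sub_cancel, Pi.pow_apply]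
    field_simp
    ring

/-- Since `M.der` is a multiple of the weight with `k = 2`, the products of weights and arc length
derivatives are closed under `d/dt`. An induction over all `k` at once can therefore trade arc
length derivatives for parameter derivatives. -/
theorem Mobius.IsChain.hasPrim_weight_mul (h : M.IsChain (r + 1) U) (hM : M.NoPole) (k : ℕ) :
    HasPrim (fun t => M.weight k t * U 0 t) fun t =>
      -(k * M.c) * (M.weight (k + 1) t * U 0 t) +
        (M.a * M.d - M.b * M.c) * (M.weight (k + 2) t * U 1 t) := by
  refine ((hM.hasPrim_weight k).mul (h.hasPrim 0 (by omega))).congr_ae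
    ((ae_restrict_iff' measurableSet_Icc).2 (Eventually.of_forall fun t ht => ?_))
  have h0 := hM t ht
  simp only [Mobius.der_eq_weight, Mobius.weight, zero_add]
  field_simp
  ring

theorem inv_pow_le_of_succ {m : ℕ} (hm : 0 < m) (r : ℕ) :
    1 / (m : ℝ) ^ (2 * r) ≤ 4 ^ r / ((m + 1 : ℕ) : ℝ) ^ (2 * r) := by
  have hm' : (1 : ℝ) ≤ m := by exact_mod_cast hm
  rw [div_le_div_iff₀ (by positivity) (by positivity), one_mul, pow_mul, pow_mul, ← mul_pow]
  gcongr
  push_cast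
  nlinarith

/-- Approximation of weighted functions by polynomials, of the order of their smoothness. -/
theorem Mobius.NoPole.exists_polynomial_approx (hM : M.NoPole) (r : ℕ) : ∀ k : ℕ, ∃ C : ℝ, 0 ≤ C ∧
    ∀ U : ℕ → ℝ → ℂ, M.IsChain r U → ∀ n : ℕ, 0 < n → ∃ p : ℂ[X], p.degree < n ∧
      normSq (fun t => M.weight k t * U 0 t - p.eval (t : ℂ)) ≤
        C / (n : ℝ) ^ (2 * r) * chainSq r U := by
  induction r with
  | zero =>
    intro k
    obtain ⟨K, hK0, hK⟩ := exists_normSq_mul_le (hM.continuousOn_weight k)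
    refine ⟨K, hK0, fun U hU n hn => ⟨0, by simp [bot_lt_iff_ne_bot], ?_⟩⟩
    simp only [eval_zero, sub_zero, mul_zero, pow_zero, div_one]
    refine (hK _ (hU.memLp 0 le_rfl)).trans ?_
    gcongr
    exact normSq_zero_le_chainSq 0 U
  | succ r ih =>
    intro k
    obtain ⟨C₁, h₁, H₁⟩ := ih (k + 1)
    obtain ⟨C₂, h₂, H₂⟩ := ih (k + 2)
    obtain ⟨K, hK0, hK⟩ := exists_normSq_mul_le (hM.continuousOn_weight k)
    set α : ℂ := -(k * M.c)
    set β : ℂ := M.a * M.d - M.b * M.c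
    set C := 2 * ‖α‖ ^ 2 * C₁ + 2 * ‖β‖ ^ 2 * C₂ with hC
    have hC0 : 0 ≤ C := by positivity
    refine ⟨K + 4 ^ (r + 1) * (288 * C), by positivity, fun U hU n hn => ?_⟩
    have hS := chainSq_nonneg (r + 1) U
    -- Polynomials of degree below `m` integrate to degree below `n = m + 1`. For `m = 0` there is
    -- nothing to integrate and the zero polynomial is good enough.
    obtain ⟨m, rfl⟩ : ∃ m, n = m + 1 := ⟨n - 1, by omega⟩
    rcases m.eq_zero_or_pos with rfl | hm
    · refine ⟨0, by simp [bot_lt_iff_ne_bot], ?_⟩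
      simp only [eval_zero, sub_zero, zero_add, Nat.cast_one, one_pow, div_one]
      refine (hK _ (hU.memLp 0 (by omega))).trans ?_
      have h4 : 0 ≤ 4 ^ (r + 1) * (288 * C) := by positivity
      have h5 := normSq_nonneg (U 0)
      gcongr
      · linarith
      · exact normSq_zero_le_chainSq _ U
    have hm' : (0 : ℝ) < m := by positivity
    obtain ⟨q₁, hd₁, hq₁⟩ := H₁ U hU.pred m hm
    obtain ⟨q₂, hd₂, hq₂⟩ := H₂ _ hU.shift m hm
    obtain ⟨Q, hQ, hQd⟩ : ∃ Q : ℂ[X], Q.degree < (m + 1 : ℕ) ∧ derivative Q = α • q₁ + β • q₂ := by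
      refine exists_derivative_eq ((degree_add_le _ _).trans_lt (max_lt ?_ ?_))
      · exact (degree_smul_le _ _).trans_lt hd₁
      · exact (degree_smul_le _ _).trans_lt hd₂
    have hw := hU.hasPrim_weight_mul hM k
    have hv := hw.sub (hasPrim_eval Q)
    set w : ℝ → ℂ := fun t => M.weight k t * U 0 t with hwdef
    have hm₁ : MemLp (fun t => M.weight (k + 1) t * U 0 t - q₁.eval (t : ℂ)) 2 paramMeasure :=
      (MemLp.continuousOn_mul_param (hM.continuousOn_weight _) (hU.memLp 0 (by omega))).sub
        (hasPrim_eval q₁).memLp_left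
    have hm₂ : MemLp (fun t => M.weight (k + 2) t * U 1 t - q₂.eval (t : ℂ)) 2 paramMeasure :=
      (MemLp.continuousOn_mul_param (hM.continuousOn_weight _) (hU.memLp 1 (by omega))).sub
        (hasPrim_eval q₂).memLp_left
    have hg : normSq (fun t => α * (M.weight (k + 1) t * U 0 t) + β * (M.weight (k + 2) t * U 1 t) -
        (derivative Q).eval (t : ℂ)) ≤ C * (1 / (m : ℝ) ^ (2 * r)) * chainSq (r + 1) U := by
      have e : (fun t : ℝ => α * (M.weight (k + 1) t * U 0 t) + β * (M.weight (k + 2) t * U 1 t) -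
          (derivative Q).eval (t : ℂ)) = fun t : ℝ =>
          α * (M.weight (k + 1) t * U 0 t - q₁.eval (t : ℂ)) +
            β * (M.weight (k + 2) t * U 1 t - q₂.eval (t : ℂ)) := by
        funext t
        rw [hQd]
        simp only [eval_add, eval_smul, smul_eq_mul]
        ring
      rw [e]
      refine (normSq_add_le (hm₁.const_mul α) (hm₂.const_mul β)).trans ?_
      rw [normSq_const_mul, normSq_const_mul]
      have b₁ : normSq (fun t => M.weight (k + 1) t * U 0 t - q₁.eval (t : ℂ)) ≤
          C₁ / (m : ℝ) ^ (2 * r) * chainSq (r + 1) U :=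
        hq₁.trans (by gcongr; exact chainSq_pred_le r U)
      have b₂ : normSq (fun t => M.weight (k + 2) t * U 1 t - q₂.eval (t : ℂ)) ≤
          C₂ / (m : ℝ) ^ (2 * r) * chainSq (r + 1) U :=
        hq₂.trans (by gcongr; exact chainSq_shift_le r U)
      calc _ ≤ 2 * (‖α‖ ^ 2 * (C₁ / (m : ℝ) ^ (2 * r) * chainSq (r + 1) U)) +
            2 * (‖β‖ ^ 2 * (C₂ / (m : ℝ) ^ (2 * r) * chainSq (r + 1) U)) := by gcongr
        _ = _ := by rw [hC]; ring
    -- `Q` makes the derivative of the remainder small of order `r`; interpolating the remainder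
    -- gains the further factor `1 / m`.
    refine ⟨Q + interp (m + 1) (fun t => w t - Q.eval (t : ℂ)),
      (degree_add_le _ _).trans_lt (max_lt hQ (degree_interp_lt (by omega) _)), ?_⟩
    have e : (fun t : ℝ => M.weight k t * U 0 t -
        (Q + interp (m + 1) (fun t => w t - Q.eval (t : ℂ))).eval (t : ℂ)) = fun t : ℝ =>
        (w t - Q.eval (t : ℂ)) - (interp (m + 1) (fun t => w t - Q.eval (t : ℂ))).eval (t : ℂ) := by
      funext t
      rw [eval_add, hwdef]
      ring
    rw [e, normSq_sub_comm]
    have hpow := inv_pow_le_of_succ hm (r + 1)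
    calc _ ≤ 288 / (m : ℝ) ^ 2 * (C * (1 / (m : ℝ) ^ (2 * r)) * chainSq (r + 1) U) :=
          (normSq_interp_sub_le hm hv).trans (by gcongr)
      _ = 288 * C * (1 / (m : ℝ) ^ (2 * (r + 1))) * chainSq (r + 1) U := by
          rw [show 2 * (r + 1) = 2 * r + 2 by ring, pow_add]
          field_simp
      _ ≤ 288 * C * (4 ^ (r + 1) / ((m + 1 : ℕ) : ℝ) ^ (2 * (r + 1))) * chainSq (r + 1) U := by gcongr
      _ = 4 ^ (r + 1) * (288 * C) / ((m + 1 : ℕ) : ℝ) ^ (2 * (r + 1)) * chainSq (r + 1) U := by ring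
      _ ≤ _ := by
          gcongr
          linarith

/-- The interpolation error in the norm of `H¹`, for functions on an arc. -/
theorem Mobius.NoPole.exists_interp_error (hM : M.NoPole) (r : ℕ) : ∃ C : ℝ, 0 ≤ C ∧
    ∀ U : ℕ → ℝ → ℂ, M.IsChain (r + 1) U → ∀ n : ℕ, 2 ≤ n →
      normSq (fun t => (interp n (U 0)).eval (t : ℂ) - U 0 t) ≤
        C * ((n : ℝ) ^ 2 / (n : ℝ) ^ (2 * r)) * chainSq (r + 1) U ∧
      normSq (fun t => (derivative (interp n (U 0))).eval (t : ℂ) - M.der t * U 1 t) ≤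
        C * ((n : ℝ) ^ 2 / (n : ℝ) ^ (2 * r)) * chainSq (r + 1) U := by
  obtain ⟨C, hC, H⟩ := hM.exists_polynomial_approx r 2
  set β : ℂ := M.a * M.d - M.b * M.c with hβ
  refine ⟨288 * (‖β‖ ^ 2 * C * 4 ^ r), by positivity, fun U hU n hn => ?_⟩
  obtain ⟨m, rfl⟩ : ∃ m, n = m + 1 := ⟨n - 1, by omega⟩
  have hm : 0 < m := by omega
  have hm' : (1 : ℝ) ≤ m := by exact_mod_cast hm
  obtain ⟨q, hd, hq⟩ := H _ hU.shift m hm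
  -- The parameter derivative of `U 0` is `β` times the weighted `U 1`, so `Q'` approximates it to
  -- order `r`.
  obtain ⟨Q, hQ, hQd⟩ : ∃ Q : ℂ[X], Q.degree < (m + 1 : ℕ) ∧ derivative Q = β • q :=
    exists_derivative_eq ((degree_smul_le _ _).trans_lt hd)
  have hv := (hU.hasPrim 0 (by omega)).sub (hasPrim_eval Q)
  have hS := chainSq_nonneg (r + 1) U
  set g : ℝ → ℂ := fun t => M.der t * U (0 + 1) t - (derivative Q).eval (t : ℂ) with hgdef
  set T := ‖β‖ ^ 2 * C * 4 ^ r / ((m + 1 : ℕ) : ℝ) ^ (2 * r) * chainSq (r + 1) U with hT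
  have hT0 : 0 ≤ T := by positivity
  have hg : normSq g ≤ T := by
    have e : g = fun t : ℝ => β * (M.weight 2 t * U (0 + 1) t - q.eval (t : ℂ)) := by
      funext t
      rw [hgdef, hQd]
      simp only [eval_smul, smul_eq_mul, Mobius.der_eq_weight, ← hβ]
      ring
    rw [e, normSq_const_mul]
    have hpow := inv_pow_le_of_succ hm r
    have hsh := chainSq_shift_le r U
    calc _ ≤ ‖β‖ ^ 2 * (C / (m : ℝ) ^ (2 * r) * chainSq (r + 1) U) := by
          gcongr
          exact hq.trans (by gcongr)
      _ = ‖β‖ ^ 2 * C * (1 / (m : ℝ) ^ (2 * r)) * chainSq (r + 1) U := by ring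
      _ ≤ ‖β‖ ^ 2 * C * (4 ^ r / ((m + 1 : ℕ) : ℝ) ^ (2 * r)) * chainSq (r + 1) U := by gcongr
      _ = T := by rw [hT]; ring
  -- Polynomials of degree below `n` are reproduced, so the interpolation error of `U 0` is that of
  -- `U 0 - Q`.
  have hI : interp (m + 1) (U 0) = Q + interp (m + 1) fun t => U 0 t - Q.eval (t : ℂ) := by
    rw [interp_sub, interp_eval hn hQ]
    ring
  have hTn : 288 * (‖β‖ ^ 2 * C * 4 ^ r) * (((m + 1 : ℕ) : ℝ) ^ 2 / ((m + 1 : ℕ) : ℝ) ^ (2 * r)) *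
      chainSq (r + 1) U = 288 * ((m + 1 : ℕ) : ℝ) ^ 2 * T := by rw [hT]; ring
  rw [hTn, hI]
  have hn1 : (1 : ℝ) ≤ ((m + 1 : ℕ) : ℝ) ^ 2 := one_le_pow₀ (by push_cast; linarith)
  constructor
  · have e : (fun t : ℝ => (Q + interp (m + 1) fun t => U 0 t - Q.eval (t : ℂ)).eval (t : ℂ) - U 0 t) =
        fun t : ℝ => (interp (m + 1) fun t => U 0 t - Q.eval (t : ℂ)).eval (t : ℂ) -
          (U 0 t - Q.eval (t : ℂ)) := by
      funext t
      rw [eval_add]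
      ring
    rw [e]
    calc _ ≤ 288 / (m : ℝ) ^ 2 * normSq g := normSq_interp_sub_le hm hv
      _ ≤ 288 / 1 ^ 2 * T := by gcongr; exact normSq_nonneg g
      _ = 288 * 1 * T := by ring
      _ ≤ _ := by gcongr
  · have e : (fun t : ℝ => (derivative (Q + interp (m + 1) fun t => U 0 t - Q.eval (t : ℂ))).eval (t : ℂ) -
        M.der t * U 1 t) = fun t : ℝ =>
        (derivative (interp (m + 1) fun t => U 0 t - Q.eval (t : ℂ))).eval (t : ℂ) + -1 * g t := by
      funext t
      rw [derivative_add, eval_add, hgdef]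
      simp only [zero_add]
      ring
    rw [e]
    -- Differentiating the interpolant costs a factor `n²` in the squared norm; this is the loss in
    -- the final rate.
    have h1 := normSq_derivative_interp_le hm hv
    have h2 := normSq_nonneg g
    calc _ ≤ 2 * (8 * (m + 1 : ℝ) ^ 2 * normSq g) + 2 * (‖(-1 : ℂ)‖ ^ 2 * normSq g) := by
          refine (normSq_add_le (hasPrim_eval _).memLp_left (hv.memLp.const_mul (-1))).trans ?_
          rw [normSq_const_mul]
          gcongr
      _ = (16 * ((m + 1 : ℕ) : ℝ) ^ 2 + 2 * 1) * normSq g := by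
          rw [norm_neg, norm_one]
          push_cast
          ring
      _ ≤ (16 * ((m + 1 : ℕ) : ℝ) ^ 2 + 2 * ((m + 1 : ℕ) : ℝ) ^ 2) * T := by gcongr
      _ = 18 * ((m + 1 : ℕ) : ℝ) ^ 2 * T := by ring
      _ ≤ _ := by gcongr; norm_num

end Approximation

/-! ### Interpolation on the contour -/

theorem entrySq_le_of_forall_le {ℓ : ℕ} {f : ArcFun ℓ} {B : ℝ≥0∞}
    (h : ∀ i p q, paramSq (fun t => f i t p q) ≤ B) : entrySq f ≤ ℓ * 4 * B := by
  calc entrySq f ≤ ∑ _i : Fin ℓ, ∑ _p : Fin 2, ∑ _q : Fin 2, B :=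
        Finset.sum_le_sum fun i _ => Finset.sum_le_sum fun p _ => Finset.sum_le_sum fun q _ => h i p q
    _ = _ := by
        simp only [Finset.sum_const, Finset.card_univ, Fintype.card_fin, nsmul_eq_mul]
        push_cast
        ring

theorem AEEqArc.sub {ℓ : ℕ} {f g f' g' : ArcFun ℓ} (h : AEEqArc f g) (h' : AEEqArc f' g') :
    AEEqArc (f - f') (g - g') := fun i => (h i).sub (h' i)

theorem paramSq_interp_le {n : ℕ} (hn : 2 ≤ n) {f : ℝ → ℂ} {B : ℝ≥0∞}
    (h : ∀ t ∈ Icc (-1 : ℝ) 1, ‖f t‖ₑ ^ 2 ≤ B) :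
    paramSq (fun t => (interp n f).eval (t : ℂ)) ≤ 8 * B := by
  rcases eq_or_ne B ⊤ with rfl | hB
  · simp
  obtain ⟨m, rfl⟩ : ∃ m, n = m + 1 := ⟨n - 1, by omega⟩
  have hm : 0 < m := by omega
  lift B to ℝ≥0 using hB
  rw [paramSq_eq_ofReal (hasPrim_eval _).memLp_left]
  refine ENNReal.ofReal_le_of_le_toReal ?_
  rw [ENNReal.toReal_mul]
  refine integral_norm_sq_le_of_nodes hm (degree_interp_lt hn f) fun j hj => ?_
  rw [eval_interp_node hm f hj]
  have := h _ (cos_node_mem (j * (Real.pi / m)))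
  rw [← ofReal_norm, ← ENNReal.ofReal_pow (norm_nonneg _)] at this
  exact (ENNReal.ofReal_le_iff_le_toReal (by simp)).1 this

namespace MobiusContour

variable {ℓ : ℕ} {Γ : MobiusContour ℓ} {u v U f g : ArcFun ℓ} {n : ℕ}

theorem l2Norm_congr (h : AEEqArc f g) : Γ.l2Norm f = Γ.l2Norm g := by
  unfold l2Norm
  congr 1
  exact Finset.sum_congr rfl fun i _ => lintegral_congr_ae ((h i).mono fun t ht => by simp only [ht])

theorem l2Norm_chebInterp_sq_le (Γ : MobiusContour ℓ) (hn : 2 ≤ n) {B : ℝ≥0∞}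
    (h : ∀ i p q, ∀ t ∈ Icc (-1 : ℝ) 1, ‖contRep f i t p q‖ₑ ^ 2 ≤ B) :
    Γ.l2Norm (chebInterp n f) ^ 2 ≤ Γ.distortion * (ℓ * 4 * (8 * B)) := by
  refine (Γ.l2Norm_sq_le fun i p q => ?_).trans ?_
  · simp only [chebInterp_apply]
    exact (continuous_eval_ofReal _).aestronglyMeasurable
  · gcongr
    refine entrySq_le_of_forall_le fun i p q => ?_
    simp only [chebInterp_apply]
    exact paramSq_interp_le hn (h i p q)

/-- The arc length derivative of the interpolant. -/
def interpDeriv (Γ : MobiusContour ℓ) (n : ℕ) (f : ArcFun ℓ) : ArcFun ℓ := fun i t =>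
  Matrix.of fun p q => ((Γ.M i).der t)⁻¹ *
    (Polynomial.derivative (interp n fun t => contRep f i t p q)).eval (t : ℂ)

theorem hasArcDeriv_chebInterp (Γ : MobiusContour ℓ) (n : ℕ) (f : ArcFun ℓ) :
    Γ.HasArcDeriv (chebInterp n f) (Γ.interpDeriv n f) := fun i p q => by
  simp only [chebInterp_apply]
  refine (hasPrim_eval _).congr_ae ((ae_restrict_iff' measurableSet_Icc).2
    (Eventually.of_forall fun t ht => ?_))
  simp only [interpDeriv, Matrix.of_apply]
  rw [mul_inv_cancel_left₀ (Γ.der_ne_zero i ht)]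

theorem HasArcDeriv.contRep_self (h : Γ.HasArcDeriv u v) (i : Fin ℓ) :
    EqOn (contRep u i) (u i) (Icc (-1) 1) := h.contRep_eqOn (fun _ => EventuallyEq.rfl) i

theorem interp_eval_right (hn : 2 ≤ n) (f : ℝ → ℂ) : (interp n f).eval ((1 : ℝ) : ℂ) = f 1 := by
  obtain ⟨m, rfl⟩ : ∃ m, n = m + 1 := ⟨n - 1, by omega⟩
  simpa using eval_interp_node (m := m) (by omega) f (Nat.zero_le m)

theorem interp_eval_left (hn : 2 ≤ n) (f : ℝ → ℂ) : (interp n f).eval ((-1 : ℝ) : ℂ) = f (-1) := by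
  obtain ⟨m, rfl⟩ : ∃ m, n = m + 1 := ⟨n - 1, by omega⟩
  have hm : (m : ℝ) ≠ 0 := by
    have : m ≠ 0 := by omega
    exact_mod_cast this
  have h := eval_interp_node (m := m) (by omega) f le_rfl
  rwa [mul_div_cancel₀ _ hm, Real.cos_pi] at h

/-- The Chebyshev points include both endpoints, so interpolation preserves the endpoint values and
with them the zero-sum condition. -/
theorem Xn_chebInterp_subset (Γ : MobiusContour ℓ) (hn : 2 ≤ n) : Γ.Xn chebInterp n ⊆ Γ.Hz := by
  rintro _ ⟨w, hw, rfl⟩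
  have h := Γ.hasArcDeriv_chebInterp n w
  refine ⟨h.memH fun _ => EventuallyEq.rfl, fun a => ?_⟩
  refine Eq.trans (Finset.sum_congr rfl fun i _ => ?_) (hw.2 a)
  have e1 : contRep (chebInterp n w) i 1 = contRep w i 1 := by
    rw [h.contRep_self i right_mem]
    ext p q
    rw [chebInterp_apply, interp_eval_right hn]
  have e2 : contRep (chebInterp n w) i (-1) = contRep w i (-1) := by
    rw [h.contRep_self i left_mem]
    ext p q
    rw [chebInterp_apply, interp_eval_left hn]
  rw [e1, e2]

theorem exists_l2Norm_interpDeriv_le (Γ : MobiusContour ℓ) : ∃ K : ℝ≥0, ∀ n : ℕ, 2 ≤ n → ∀ f : ArcFun ℓ,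
    Γ.l2Norm (Γ.interpDeriv n f) ^ 2 ≤ K * (n : ℝ≥0∞) ^ 8 * Γ.l2Norm (chebInterp n f) ^ 2 := by
  refine ⟨Γ.distortion * (Γ.distortion ^ 2 * 16) * Γ.distortion, fun n hn f => ?_⟩
  have h := Γ.hasArcDeriv_chebInterp n f
  have h1 : entrySq (Γ.interpDeriv n f) ≤
      (Γ.distortion ^ 2 * (16 * (n : ℝ≥0∞) ^ 8)) * entrySq (chebInterp n f) := by
    refine entrySq_le fun i p q => ?_
    simp only [chebInterp_apply, interpDeriv, Matrix.of_apply]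
    set P := interp n fun t => contRep f i t p q
    refine (paramSq_mul_le fun t ht => Γ.inv_der_le i ht).trans ?_
    rw [mul_assoc]
    gcongr
    rw [paramSq_eq_ofReal (hasPrim_eval P).memLp_left,
      paramSq_eq_ofReal (hasPrim_eval (Polynomial.derivative P)).memLp_left]
    refine (ENNReal.ofReal_le_ofReal (integral_norm_sq_derivative_le_integral (by omega)
      (degree_interp_lt hn _))).trans (le_of_eq ?_)
    change ENNReal.ofReal (16 * (n : ℝ) ^ 8 * normSq _) = _
    rw [ENNReal.ofReal_mul (by positivity), ENNReal.ofReal_mul (by positivity),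
      ENNReal.ofReal_pow (by positivity), ENNReal.ofReal_natCast]
    norm_num
    rfl
  calc _ ≤ Γ.distortion * entrySq (Γ.interpDeriv n f) := by
        refine Γ.l2Norm_sq_le fun i p q => ?_
        exact (Γ.memL2_iff.1 h.memL2_right i p q).aestronglyMeasurable
    _ ≤ Γ.distortion * ((Γ.distortion ^ 2 * (16 * (n : ℝ≥0∞) ^ 8)) *
          (Γ.distortion * Γ.l2Norm (chebInterp n f) ^ 2)) := by
        gcongr
        refine h1.trans ?_
        gcongr
        exact Γ.entrySq_le_l2Norm_sq fun i p q =>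
          (Γ.memL2_iff.1 h.memL2_left i p q).aestronglyMeasurable
    _ = _ := by
        push_cast
        ring

theorem exists_opNorm_chebInterp_le (Γ : MobiusContour ℓ) : ∃ C : ℝ≥0, ∀ n : ℕ, 2 ≤ n →
    opNorm {f : ArcFun ℓ | IsContArc f} supNorm Γ.l2Norm (chebInterp n) ≤ C := by
  refine ⟨Γ.distortion * (ℓ * 4 * 8) + 1, fun n hn => opNorm_le fun f hf => le_of_sq_le_sq_ennreal ?_⟩
  have hb : ∀ i p q, ∀ t ∈ Icc (-1 : ℝ) 1, ‖contRep f i t p q‖ₑ ^ 2 ≤ supNorm f ^ 2 := by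
    intro i p q t ht
    rw [contRep_eqOn hf (fun _ => EventuallyEq.rfl) i ht]
    gcongr
    refine (enorm_matrix_apply_le _ p q).trans ?_
    exact le_iSup_of_le i (le_iSup₂_of_le t ht le_rfl)
  refine (Γ.l2Norm_chebInterp_sq_le hn hb).trans ?_
  rw [mul_pow]
  have h1 : (Γ.distortion * (ℓ * 4 * 8) : ℝ≥0∞) ≤ ((Γ.distortion * (ℓ * 4 * 8) + 1 : ℝ≥0) : ℝ≥0∞) ^ 2 := by
    have : Γ.distortion * (ℓ * 4 * 8) ≤ (Γ.distortion * (ℓ * 4 * 8) + 1) ^ 2 := by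
      have h0 : 0 ≤ Γ.distortion * (ℓ * 4 * 8) := zero_le
      nlinarith
    exact_mod_cast this
  calc _ = (Γ.distortion * (ℓ * 4 * 8) : ℝ≥0∞) * supNorm f ^ 2 := by ring
    _ ≤ _ := by gcongr

theorem sq_rpow_half (x : ℝ≥0∞) : (x ^ (1 / 2 : ℝ)) ^ 2 = x := by
  rw [← ENNReal.rpow_natCast, ← ENNReal.rpow_mul]
  norm_num

/-- `hNorm` is an infimum over chains, so it suffices to argue for each chain. If there is none, the
right side is infinite, because `K ≠ 0`. -/
theorem le_mul_hNorm {k : ℕ} {x K : ℝ≥0∞} (h0 : K ≠ 0) (ht : K ≠ ⊤)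
    (h : ∀ g, Γ.IsDerivChain k u g → x ^ 2 ≤ K ^ 2 * ∑ j ∈ Finset.range (k + 1), Γ.l2Norm (g j) ^ 2) :
    x ≤ K * Γ.hNorm k u := by
  rw [mul_comm, ← ENNReal.div_le_iff_le_mul (Or.inl h0) (Or.inl ht)]
  refine le_iInf₂ fun g hg => ?_
  rw [ENNReal.div_le_iff_le_mul (Or.inl h0) (Or.inl ht), mul_comm]
  refine le_of_sq_le_sq_ennreal ?_
  rw [mul_pow, sq_rpow_half]
  exact h g hg

/-- All derivatives below the top one have continuous representatives; the top one is only square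
integrable and is kept as it is. -/
theorem IsDerivChain.exists_continuous {r : ℕ} {g : ℕ → ArcFun ℓ} (h : Γ.IsDerivChain (r + 1) u g) :
    ∃ W : ℕ → ArcFun ℓ, (∀ j, AEEqArc (g j) (W j)) ∧ (∀ j < r + 1, Γ.HasArcDeriv (W j) (W (j + 1))) ∧
      ∀ j ≤ r + 1, Γ.MemL2 (W j) := by
  have hex : ∀ j, ∃ V, AEEqArc (g j) V ∧ (j < r + 1 → Γ.HasArcDeriv V (g (j + 1))) ∧
      (j ≤ r + 1 → Γ.MemL2 V) := fun j => by
    by_cases hj : j < r + 1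
    · obtain ⟨V, h1, h2⟩ := h.exists_hasArcDeriv hj
      exact ⟨V, h2, fun _ => h1, fun _ => h1.memL2_left⟩
    · exact ⟨g j, fun _ => EventuallyEq.rfl, fun h => absurd h hj, fun hj' => h.2.1 j hj'⟩
  choose W h1 h2 h3 using hex
  exact ⟨W, h1, fun j hj => (h2 j hj).congr_right (h1 (j + 1)), h3⟩

end MobiusContour

namespace MobiusContour

variable {ℓ : ℕ} {Γ : MobiusContour ℓ} {u v U f g : ArcFun ℓ} {n : ℕ}

/-! ### The interpolation error on the contour -/

theorem ofReal_chainSq {M : Mobius} {r : ℕ} {W : ℕ → ℝ → ℂ} (hW : M.IsChain r W) :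
    ENNReal.ofReal (chainSq r W) = ∑ j ∈ Finset.range (r + 1), paramSq (W j) := by
  rw [chainSq, ENNReal.ofReal_sum_of_nonneg fun j _ => normSq_nonneg _]
  exact Finset.sum_congr rfl fun j hj =>
    (paramSq_eq_ofReal (hW.memLp j (by simpa [Nat.lt_succ_iff] using hj))).symm

theorem exists_chebInterp_sub_sq_le (Γ : MobiusContour ℓ) (r : ℕ) : ∃ C : ℝ≥0, ∀ n : ℕ, 2 ≤ n →
    ∀ u g, Γ.IsDerivChain (r + 1) u g → Γ.hNorm 1 (chebInterp n u - u) ^ 2 ≤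
      C * ENNReal.ofReal ((n : ℝ) ^ 2 / (n : ℝ) ^ (2 * r)) *
        ∑ j ∈ Finset.range (r + 2), Γ.l2Norm (g j) ^ 2 := by
  choose C hC H using fun i => (Γ.noPole i).exists_interp_error r
  set K : ℝ≥0 := ∑ i, (C i).toNNReal with hK
  refine ⟨Γ.distortion * K * Γ.distortion + Γ.distortion * (Γ.distortion ^ 2 * K) * Γ.distortion,
    fun n hn u g hg => ?_⟩
  obtain ⟨W, h1, h2, h3⟩ := hg.exists_continuous
  set E := ENNReal.ofReal ((n : ℝ) ^ 2 / (n : ℝ) ^ (2 * r))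
  have hchain : ∀ i p q, (Γ.M i).IsChain (r + 1) fun j t => W j i t p q := fun i p q =>
    ⟨fun j hj => Γ.memL2_iff.1 (h3 j hj) i p q, fun j hj => h2 j hj i p q⟩
  have hu : AEEqArc u (W 0) := by
    have := h1 0
    rwa [hg.1] at this
  have hW0 := h2 0 (by omega)
  have hrep : ∀ i p q, (interp n fun t => contRep u i t p q) = interp n fun t => W 0 i t p q :=
    fun i p q => interp_congr fun t ht => by simp only [hW0.contRep_eqOn hu i ht]
  have hV := (Γ.hasArcDeriv_chebInterp n u).sub hW0
  have hsum : ∀ i p q, ENNReal.ofReal (C i * ((n : ℝ) ^ 2 / (n : ℝ) ^ (2 * r)) *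
      chainSq (r + 1) fun j t => W j i t p q) ≤
      K * E * ∑ j ∈ Finset.range (r + 2), paramSq fun t => W j i t p q := fun i p q => by
    rw [ENNReal.ofReal_mul (mul_nonneg (hC i) (by positivity)), ENNReal.ofReal_mul (hC i),
      ofReal_chainSq (hchain i p q)]
    gcongr
    rw [ENNReal.ofReal, hK]
    exact_mod_cast Finset.single_le_sum (f := fun i => (C i).toNNReal) (fun _ _ => zero_le)
      (Finset.mem_univ i)
  have hS : ∑ j ∈ Finset.range (r + 2), entrySq (W j) ≤
      Γ.distortion * ∑ j ∈ Finset.range (r + 2), Γ.l2Norm (g j) ^ 2 := by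
    rw [Finset.mul_sum]
    refine Finset.sum_le_sum fun j hj => ?_
    rw [l2Norm_congr (h1 j)]
    refine Γ.entrySq_le_l2Norm_sq fun i p q => ?_
    exact (hchain i p q).memLp j (by have := Finset.mem_range.1 hj; omega) |>.aestronglyMeasurable
  have hcomm : ∑ j ∈ Finset.range (r + 2), entrySq (W j) =
      ∑ i, ∑ p, ∑ q, ∑ j ∈ Finset.range (r + 2), paramSq fun t => W j i t p q := by
    unfold entrySq
    rw [Finset.sum_comm]
    refine Finset.sum_congr rfl fun i _ => ?_
    rw [Finset.sum_comm]
    exact Finset.sum_congr rfl fun p _ => Finset.sum_comm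
  have hb0 : entrySq (chebInterp n u - W 0) ≤ K * E * ∑ j ∈ Finset.range (r + 2), entrySq (W j) := by
    rw [hcomm]
    simp only [entrySq, Finset.mul_sum (Finset.univ : Finset (Fin ℓ)),
      Finset.mul_sum (Finset.univ : Finset (Fin 2))]
    refine Finset.sum_le_sum fun i _ => Finset.sum_le_sum fun p _ => Finset.sum_le_sum fun q _ => ?_
    refine le_trans ?_ (hsum i p q)
    simp only [Pi.sub_apply, Matrix.sub_apply, chebInterp_apply]
    have hm : MemLp (fun t : ℝ => (interp n fun t => contRep u i t p q).eval (t : ℂ) - W 0 i t p q) 2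
        paramMeasure := (hasPrim_eval _).memLp_left.sub ((hchain i p q).memLp 0 (by omega))
    rw [paramSq_eq_ofReal hm, hrep]
    exact ENNReal.ofReal_le_ofReal (H i _ (hchain i p q) n hn).1
  have hb1 : entrySq (Γ.interpDeriv n u - W (0 + 1)) ≤
      Γ.distortion ^ 2 * K * E * ∑ j ∈ Finset.range (r + 2), entrySq (W j) := by
    rw [hcomm]
    simp only [entrySq, Finset.mul_sum (Finset.univ : Finset (Fin ℓ)),
      Finset.mul_sum (Finset.univ : Finset (Fin 2))]
    refine Finset.sum_le_sum fun i _ => Finset.sum_le_sum fun p _ => Finset.sum_le_sum fun q _ => ?_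
    set P := interp n fun t => contRep u i t p q with hP
    have e : paramSq (fun t => (Γ.interpDeriv n u - W (0 + 1)) i t p q) =
        paramSq fun t : ℝ => ((Γ.M i).der t)⁻¹ *
          ((Polynomial.derivative P).eval (t : ℂ) - (Γ.M i).der t * W 1 i t p q) := by
      refine paramSq_congr ((ae_restrict_iff' measurableSet_Icc).2 (Eventually.of_forall fun t ht => ?_))
      simp only [Pi.sub_apply, Matrix.sub_apply, interpDeriv, Matrix.of_apply, zero_add, mul_sub]
      rw [inv_mul_cancel_left₀ (Γ.der_ne_zero i ht)]
    rw [e, mul_assoc _ (K : ℝ≥0∞), mul_assoc]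
    refine (paramSq_mul_le fun t ht => Γ.inv_der_le i ht).trans ?_
    gcongr
    refine le_trans ?_ (hsum i p q)
    have hm : MemLp (fun t : ℝ => (Polynomial.derivative P).eval (t : ℂ) -
        (Γ.M i).der t * W 1 i t p q) 2 paramMeasure :=
      (hasPrim_eval _).memLp_left.sub ((hchain i p q).hasPrim 0 (by omega)).memLp
    rw [paramSq_eq_ofReal hm, hP, hrep]
    exact ENNReal.ofReal_le_ofReal (H i _ (hchain i p q) n hn).2
  set S := ∑ j ∈ Finset.range (r + 2), Γ.l2Norm (g j) ^ 2
  have hae : AEEqArc (chebInterp n u - u) (chebInterp n u - W 0) :=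
    AEEqArc.sub (fun _ => EventuallyEq.rfl) hu
  calc _ ≤ Γ.l2Norm (chebInterp n u - u) ^ 2 + Γ.l2Norm (Γ.interpDeriv n u - W (0 + 1)) ^ 2 :=
        hV.hNorm_sq_le hae
    _ ≤ Γ.distortion * entrySq (chebInterp n u - W 0) +
          Γ.distortion * entrySq (Γ.interpDeriv n u - W (0 + 1)) := by
        rw [l2Norm_congr hae]
        gcongr
        · exact Γ.l2Norm_sq_le fun i p q => (Γ.memL2_iff.1 hV.memL2_left i p q).aestronglyMeasurable
        · exact Γ.l2Norm_sq_le fun i p q => (Γ.memL2_iff.1 hV.memL2_right i p q).aestronglyMeasurable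
    _ ≤ Γ.distortion * (K * E * (Γ.distortion * S)) +
          Γ.distortion * (Γ.distortion ^ 2 * K * E * (Γ.distortion * S)) := by
        gcongr
        · exact hb0.trans (by gcongr)
        · exact hb1.trans (by gcongr)
    _ = _ := by
        push_cast
        ring

/-- With `r = s - 1` the squared rate `n² / n^(2r)` is the square of `n^(2-s)`. -/
theorem exists_chebInterp_sub_le (Γ : MobiusContour ℓ) {s : ℕ} (hs : 1 ≤ s) : ∃ C : ℝ≥0, ∀ n : ℕ, 2 ≤ n →
    ∀ u, Γ.hNorm 1 (chebInterp n u - u) ≤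
      C * ENNReal.ofReal ((n : ℝ) ^ (2 - (s : ℝ))) * Γ.hNorm s u := by
  obtain ⟨r, rfl⟩ : ∃ r, s = r + 1 := ⟨s - 1, by omega⟩
  obtain ⟨C, hC⟩ := Γ.exists_chebInterp_sub_sq_le r
  -- `C + 1` stands in for the square root of `C`: its square is at least `C`, and it is nonzero, as
  -- `le_mul_hNorm` requires.
  refine ⟨C + 1, fun n hn u => ?_⟩
  have hn0 : (0 : ℝ) < n := by positivity
  have hx : 0 < (n : ℝ) ^ (2 - ((r + 1 : ℕ) : ℝ)) := Real.rpow_pos_of_pos hn0 _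
  have hsq : ENNReal.ofReal ((n : ℝ) ^ 2 / (n : ℝ) ^ (2 * r)) =
      ENNReal.ofReal ((n : ℝ) ^ (2 - ((r + 1 : ℕ) : ℝ))) ^ 2 := by
    rw [← ENNReal.ofReal_pow hx.le, ← Real.rpow_natCast (_ ^ _) 2, ← Real.rpow_mul hn0.le,
      ← Real.rpow_natCast (n : ℝ) 2, ← Real.rpow_natCast (n : ℝ) (2 * r), ← Real.rpow_sub hn0]
    congr 2
    push_cast
    ring
  refine le_mul_hNorm (mul_ne_zero (by simp) (by simpa using hx)) (by finiteness) fun g hg => ?_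
  refine (hC n hn u g hg).trans ?_
  rw [hsq, mul_pow]
  gcongr
  have : C ≤ (C + 1) ^ 2 := by
    have h0 : 0 ≤ C := zero_le
    nlinarith
  exact_mod_cast this

end MobiusContour

/-! ### Pointwise bounds -/

/-- The function `max (‖F‖²) B` is continuous and equal to `B` almost everywhere, hence everywhere.
Interpolation needs the bound at the nodes themselves. -/
theorem enorm_sq_le_of_ae {F : ℝ → ℂ} (hF : ContinuousOn F (Icc (-1) 1)) {B : ℝ≥0∞}
    (h : ∀ᵐ t ∂paramMeasure, ‖F t‖ₑ ^ 2 ≤ B) {t : ℝ} (ht : t ∈ Icc (-1 : ℝ) 1) : ‖F t‖ₑ ^ 2 ≤ B := by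
  have hc : ContinuousOn (fun t => max (‖F t‖ₑ ^ 2) B) (Icc (-1) 1) :=
    ((ENNReal.continuous_pow 2).comp_continuousOn (continuous_enorm.comp_continuousOn hF)).sup
      continuousOn_const
  have he : (fun t => max (‖F t‖ₑ ^ 2) B) =ᵐ[paramMeasure] fun _ => B := h.mono fun t ht => max_eq_right ht
  exact max_eq_right_iff.1 (Measure.eqOn_Icc_of_ae_eq volume (by norm_num) he hc continuousOn_const ht)

theorem enorm_matrix_sq_le {A : Matrix (Fin 2) (Fin 2) ℂ} {B : ℝ≥0∞} (h : ∀ p q, ‖A p q‖ₑ ^ 2 ≤ B) :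
    ‖A‖ₑ ^ 2 ≤ 4 * B := by
  rw [enorm_matrix_sq]
  calc _ ≤ ∑ _p : Fin 2, ∑ _q : Fin 2, B :=
        Finset.sum_le_sum fun p _ => Finset.sum_le_sum fun q _ => h p q
    _ = 4 * B := by
        simp only [Finset.sum_const, Finset.card_univ, Fintype.card_fin, nsmul_eq_mul]
        push_cast
        ring

theorem ae_enorm_le_linfNorm {ℓ : ℕ} (f : ArcFun ℓ) (i : Fin ℓ) :
    ∀ᵐ t ∂paramMeasure, ‖f i t‖ₑ ≤ linfNorm f := by
  have h : eLpNorm (f i) ⊤ paramMeasure ≤ linfNorm f := le_iSup (fun i => eLpNorm (f i) ⊤ paramMeasure) i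
  rw [eLpNorm_exponent_top] at h
  exact (enorm_ae_le_eLpNormEssSup (f i) paramMeasure).mono fun t ht => ht.trans h

namespace MobiusContour

variable {ℓ : ℕ} {Γ : MobiusContour ℓ} {u v U f g G H W : ArcFun ℓ} {n : ℕ}

theorem memL2_of_memLinf (h : MemLinf f) : Γ.MemL2 f := by
  refine Γ.memL2_iff.2 fun i p q => ?_
  have h1 : MemLp (fun t => f i t p q) ⊤ paramMeasure := by
    refine ⟨(h i).1.matrix_apply p q, lt_of_le_of_lt ?_ (h i).2⟩
    exact eLpNorm_mono_enorm_ae (Eventually.of_forall fun t => enorm_matrix_apply_le (f i t) p q)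
  exact h1.mono_exponent le_top

theorem exists_hasArcDeriv_of_memW1inf (hG : Γ.MemW1inf G) :
    ∃ V v, Γ.HasArcDeriv V v ∧ AEEqArc G V := by
  obtain ⟨h1, v, hv, h2⟩ := hG
  obtain ⟨V, h3, h4⟩ := h2.exists_hasArcDeriv (memL2_of_memLinf h1) (memL2_of_memLinf hv)
  exact ⟨V, v, h3, h4⟩

/-- The product rule, for a product with `V - 1`. -/
theorem HasArcDeriv.mul_sub_one {h' V v' : ArcFun ℓ} (hH : Γ.HasArcDeriv H h') (hV : Γ.HasArcDeriv V v') :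
    Γ.HasArcDeriv (fun i t => H i t * (V i t - 1)) fun i t => h' i t * (V i t - 1) + H i t * v' i t := by
  intro i p q
  have h1 : ∀ r, HasPrim (fun t => V i t r q - (1 : Matrix (Fin 2) (Fin 2) ℂ) r q)
      fun t => (Γ.M i).der t * v' i t r q := fun r => by
    have h2 := hV i r q
    refine ⟨h2.memLp, fun t ht => ?_⟩
    rw [h2.eq_add_integral t ht]
    ring
  have h2 := HasPrim.sum (s := Finset.univ) fun r (_ : r ∈ (Finset.univ : Finset (Fin 2))) =>
    (hH i p r).mul (h1 r)
  have e1 : (fun t => (H i t * (V i t - 1)) p q) = fun t => ∑ r, H i t p r *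
      (V i t r q - (1 : Matrix (Fin 2) (Fin 2) ℂ) r q) := by
    funext t
    simp only [Matrix.mul_apply, Matrix.sub_apply]
  have e2 : (fun t : ℝ => (Γ.M i).der t * (h' i t * (V i t - 1) + H i t * v' i t) p q) = fun t : ℝ =>
      ∑ r, ((Γ.M i).der t * h' i t p r * (V i t r q - (1 : Matrix (Fin 2) (Fin 2) ℂ) r q) +
        H i t p r * ((Γ.M i).der t * v' i t r q)) := by
    funext t
    simp only [Matrix.add_apply, Matrix.mul_apply, Matrix.sub_apply]
    rw [Finset.sum_add_distrib, mul_add, Finset.mul_sum, Finset.mul_sum]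
    congr 1 <;> exact Finset.sum_congr rfl fun r _ => by ring
  rw [e1, e2]
  exact h2

/-- The continuous representative of `𝓣[G;Γ] u`, with its bound. -/
theorem exists_hasArcDeriv_opT (hG : Γ.MemW1inf G) (hH : Γ.HasArcDeriv H v)
    (hu : AEEqArc (Γ.cauchyMinus u) H) : ∃ W w, Γ.HasArcDeriv W w ∧ AEEqArc (Γ.opT G u) W ∧
      ∀ B : ℝ≥0∞, (∀ i p q, ∀ t ∈ Icc (-1 : ℝ) 1, ‖H i t p q‖ₑ ^ 2 ≤ B) → ∀ i p q, ∀ t ∈ Icc (-1 : ℝ) 1,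
        ‖W i t p q‖ₑ ^ 2 ≤ 4 * B * linfNorm (fun i t => G i t - 1) ^ 2 := by
  obtain ⟨V, v', hV, hGV⟩ := exists_hasArcDeriv_of_memW1inf hG
  have hW := hH.mul_sub_one hV
  refine ⟨_, _, hW, fun i => ?_, fun B hB i p q t ht => ?_⟩
  · filter_upwards [hu i, hGV i] with t h1 h2
    simp only [opT, h1, h2]
  -- The bound on `G - I` holds only almost everywhere; continuity of the product extends the
  -- resulting bound to all points. The factor `4` counts the entries of a matrix.
  · refine enorm_sq_le_of_ae (hW.isContArc i |>.matrix_apply p q) ?_ ht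
    filter_upwards [hGV i, ae_enorm_le_linfNorm (fun i t => G i t - 1) i,
      ae_restrict_mem measurableSet_Icc] with t h1 h2 h3
    rw [← h1]
    calc _ ≤ ‖H i t * (G i t - 1)‖ₑ ^ 2 := by gcongr; exact enorm_matrix_apply_le _ p q
      _ ≤ (‖H i t‖ₑ * ‖G i t - 1‖ₑ) ^ 2 := by
          gcongr
          have h4 := ENNReal.coe_le_coe.2 (Matrix.frobenius_nnnorm_mul (H i t) (G i t - 1))
          rwa [ENNReal.coe_mul] at h4
      _ = ‖H i t‖ₑ ^ 2 * ‖G i t - 1‖ₑ ^ 2 := mul_pow _ _ _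
      _ ≤ _ := by
          gcongr
          exact enorm_matrix_sq_le fun p q => hB i p q t h3

theorem memH_opT_opC (hG : Γ.MemW1inf G) (hu : u ∈ Γ.Hz) :
    Γ.MemH 1 (Γ.opT G u) ∧ Γ.MemH 1 (Γ.opC G u) := by
  obtain ⟨U, v, hU, huU⟩ := hu.1.exists_hasArcDeriv
  obtain ⟨H, hH, huH⟩ := exists_hasArcDeriv_cauchyMinus hU huU hu.2
  obtain ⟨W, w, hW, huW, -⟩ := exists_hasArcDeriv_opT hG hH huH
  exact ⟨hW.memH huW, (hU.sub hW).memH (huU.sub huW)⟩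

/-- A pointwise bound by the norms of a function and its derivative. -/
theorem HasArcDeriv.enorm_sq_le (hU : Γ.HasArcDeriv U v) {c : ℝ≥0} (hc : c ≠ 0) (i : Fin ℓ) (p q : Fin 2)
    {t : ℝ} (ht : t ∈ Icc (-1 : ℝ) 1) : ‖U i t p q‖ₑ ^ 2 ≤ (1 + c) * (Γ.distortion * Γ.l2Norm U ^ 2) +
      c⁻¹ * (Γ.distortion ^ 2 * (Γ.distortion * Γ.l2Norm v ^ 2)) := by
  refine ((hU i p q).enorm_sq_le hc ht).trans ?_
  gcongr
  · refine (paramSq_le_entrySq U i p q).trans (Γ.entrySq_le_l2Norm_sq fun i p q => ?_)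
    exact (Γ.memL2_iff.1 hU.memL2_left i p q).aestronglyMeasurable
  · refine (paramSq_mul_le fun t ht => Γ.der_le i ht).trans ?_
    gcongr
    refine (paramSq_le_entrySq v i p q).trans (Γ.entrySq_le_l2Norm_sq fun i p q => ?_)
    exact (Γ.memL2_iff.1 hU.memL2_right i p q).aestronglyMeasurable

/-- The derivative of `𝓒⁻u` is `𝓒⁻` of the derivative, so both terms of the Sobolev inequality are
bounded with the same factor `‖𝓒⁻‖²`. -/
theorem enorm_sq_cauchyMinus_le (hU : Γ.HasArcDeriv U v) (hu : AEEqArc u U)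
    (hH : Γ.HasArcDeriv H (Γ.cauchyMinus v)) (hH' : AEEqArc (Γ.cauchyMinus u) H)
    {c : ℝ≥0} (hc : c ≠ 0) (i : Fin ℓ) (p q : Fin 2) {t : ℝ} (ht : t ∈ Icc (-1 : ℝ) 1) :
    ‖H i t p q‖ₑ ^ 2 ≤ Γ.cauchyMinusNorm ^ 2 * ((1 + c) * (Γ.distortion * Γ.l2Norm u ^ 2) +
      c⁻¹ * (Γ.distortion ^ 2 * (Γ.distortion * Γ.l2Norm v ^ 2))) := by
  have h1 : Γ.l2Norm H ≤ Γ.cauchyMinusNorm * Γ.l2Norm u := by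
    rw [← l2Norm_congr hH', cauchyMinus_congr hu, l2Norm_congr hu]
    exact l2Norm_cauchyMinus_le hU.memL2_left
  have h2 := l2Norm_cauchyMinus_le hU.memL2_right
  refine (hH.enorm_sq_le hc i p q ht).trans ?_
  calc _ ≤ (1 + c) * (Γ.distortion * (Γ.cauchyMinusNorm * Γ.l2Norm u) ^ 2) +
        c⁻¹ * (Γ.distortion ^ 2 * (Γ.distortion * (Γ.cauchyMinusNorm * Γ.l2Norm v) ^ 2)) := by gcongr
    _ = _ := by ring

/-! ### The bounds for the discrete operators -/

theorem enorm_sub_sq_le (a b : ℂ) : ‖a - b‖ₑ ^ 2 ≤ 2 * (‖a‖ₑ ^ 2 + ‖b‖ₑ ^ 2) := by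
  have := enorm_add_sq_le a (-b)
  rwa [enorm_neg, ← sub_eq_add_neg, ← mul_add] at this

theorem linfNorm_sub_one_lt_top (hG : Γ.MemW1inf G) : linfNorm (fun i t => G i t - 1) < ⊤ := by
  have h : ∀ i, MemLp (fun t => G i t - 1) ⊤ paramMeasure := fun i => (hG.1 i).sub (memLp_const 1)
  refine lt_of_le_of_lt (iSup_le fun i => ?_)
    (ENNReal.sum_lt_top.2 fun i (_ : i ∈ (Finset.univ : Finset (Fin ℓ))) => (h i).2)
  exact Finset.single_le_sum (f := fun i => eLpNorm (fun t => G i t - 1) ⊤ paramMeasure)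
    (fun _ _ => zero_le) (Finset.mem_univ i)

/-- The continuous representative of `u - 𝓣u` is bounded uniformly by the `H¹` norm of `u`, by the
Sobolev inequality with `c = 1` for `u` and for `𝓒⁻u`; stability of interpolation does the rest. -/
theorem exists_opCn_le (Γ : MobiusContour ℓ) : ∃ C : ℝ≥0, ∀ G : ArcFun ℓ, Γ.MemW1inf G → ∀ n : ℕ, 2 ≤ n →
    opNorm Γ.Hz (Γ.hNorm 1) Γ.l2Norm (Γ.opCn chebInterp G n) ≤ C * (1 + Γ.gc G) := by
  set d := Γ.distortion with hd
  have hd1 : (1 : ℝ≥0∞) ≤ d := by exact_mod_cast Γ.one_le_distortion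
  set K : ℝ≥0 := d * (ℓ * 4 * 8) * (20 * d ^ 3) with hK
  refine ⟨K + 1, fun G hG n hn => opNorm_le fun u hu => ?_⟩
  have hgc : Γ.gc G < ⊤ := ENNReal.mul_lt_top (linfNorm_sub_one_lt_top hG) Γ.cauchyMinusNorm_lt_top
  refine le_mul_hNorm (mul_ne_zero (by simp) (by simp)) (by finiteness) fun g hg => ?_
  obtain ⟨U, hU, huU⟩ := hg.exists_hasArcDeriv zero_lt_one
  rw [hg.1] at huU
  obtain ⟨H, hH, huH⟩ := exists_hasArcDeriv_cauchyMinus hU huU hu.2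
  obtain ⟨W, w, hW, huW, hWB⟩ := exists_hasArcDeriv_opT hG hH huH
  set E := ∑ j ∈ Finset.range (1 + 1), Γ.l2Norm (g j) ^ 2 with hE
  have hE' : E = Γ.l2Norm u ^ 2 + Γ.l2Norm (g (0 + 1)) ^ 2 := by
    rw [hE, Finset.sum_range_succ, Finset.sum_range_one, hg.1]
  have hcomb : ∀ a b : ℝ≥0∞, (1 + ((1 : ℝ≥0) : ℝ≥0∞)) * (d * a) +
      (((1 : ℝ≥0)⁻¹ : ℝ≥0) : ℝ≥0∞) * (d ^ 2 * (d * b)) ≤ 2 * d ^ 3 * (a + b) := fun a b => by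
    have h1 : (d : ℝ≥0∞) ≤ d ^ 3 := le_self_pow₀ hd1 (by norm_num)
    calc _ = 2 * d * a + d ^ 3 * b := by
          rw [inv_one, ENNReal.coe_one]
          ring
      _ ≤ 2 * d ^ 3 * a + 2 * d ^ 3 * b := by
          gcongr
          exact le_mul_of_one_le_left zero_le one_le_two
      _ = _ := by ring
  have hUb : ∀ i p q, ∀ t ∈ Icc (-1 : ℝ) 1, ‖U i t p q‖ₑ ^ 2 ≤ 2 * d ^ 3 * E := fun i p q t ht => by
    rw [hE', l2Norm_congr huU]
    exact (hU.enorm_sq_le one_ne_zero i p q ht).trans (hcomb _ _)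
  have hHb : ∀ i p q, ∀ t ∈ Icc (-1 : ℝ) 1, ‖H i t p q‖ₑ ^ 2 ≤
      Γ.cauchyMinusNorm ^ 2 * (2 * d ^ 3 * E) := fun i p q t ht => by
    refine (enorm_sq_cauchyMinus_le hU huU hH huH one_ne_zero i p q ht).trans ?_
    rw [hE']
    gcongr
    exact hcomb _ _
  have hWb := hWB _ hHb
  -- The constant is `20 = 2 * 2 + 2 * 4 * 2`, from the terms `u` and `𝓣u`, each with the Sobolev
  -- constant `2 d³`.
  have hrep : ∀ i p q, ∀ t ∈ Icc (-1 : ℝ) 1, ‖contRep (Γ.opC G u) i t p q‖ₑ ^ 2 ≤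
      20 * d ^ 3 * E * (1 + Γ.gc G) ^ 2 := fun i p q t ht => by
    rw [opC, (hU.sub hW).contRep_eqOn (huU.sub huW) i ht, Pi.sub_apply, Pi.sub_apply, Matrix.sub_apply]
    refine (enorm_sub_sq_le _ _).trans ?_
    calc _ ≤ 2 * (2 * d ^ 3 * E + 4 * (Γ.cauchyMinusNorm ^ 2 * (2 * d ^ 3 * E)) *
            linfNorm (fun i t => G i t - 1) ^ 2) := by
          gcongr
          · exact hUb i p q t ht
          · exact hWb i p q t ht
      _ = 4 * d ^ 3 * E * 1 + 16 * d ^ 3 * E * Γ.gc G ^ 2 := by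
          rw [gc]
          ring
      _ ≤ 4 * d ^ 3 * E * (1 + Γ.gc G) ^ 2 + 16 * d ^ 3 * E * (1 + Γ.gc G) ^ 2 := by
          gcongr
          · exact one_le_pow₀ le_self_add
          · exact le_add_self
      _ = _ := by ring
  refine (Γ.l2Norm_chebInterp_sq_le hn hrep).trans ?_
  rw [mul_pow]
  have hKK : (K : ℝ≥0∞) ≤ ((K + 1 : ℝ≥0) : ℝ≥0∞) ^ 2 := by
    have : K ≤ (K + 1) ^ 2 := by
      have h0 : 0 ≤ K := zero_le
      nlinarith
    exact_mod_cast this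
  calc _ = K * (1 + Γ.gc G) ^ 2 * E := by
        rw [hK]
        push_cast
        ring
    _ ≤ _ := by gcongr

/-- On `Xₙ` the derivative of `u` is controlled by `u` itself through the Markov inequality, so the
Sobolev inequality bounds `𝓒⁻u` uniformly by the `L²` norm of `u`. The zero-sum condition needed for
this holds by `Xn_chebInterp_subset`. -/
theorem exists_opTn_le (Γ : MobiusContour ℓ) : ∃ C : ℝ≥0, ∀ G : ArcFun ℓ, Γ.MemW1inf G → ∀ n : ℕ, 2 ≤ n →
    opNorm (Γ.Xn chebInterp n) Γ.l2Norm Γ.l2Norm (Γ.opTn chebInterp G n) ≤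
      C * (n : ℝ≥0∞) ^ 2 * Γ.gc G := by
  obtain ⟨A, hA⟩ := Γ.exists_l2Norm_interpDeriv_le
  set d := Γ.distortion with hd
  set K : ℝ≥0 := d * (ℓ * 4 * 8) * (4 * (2 * d + d ^ 3 * A)) with hK
  refine ⟨K + 1, fun G hG n hn => opNorm_le fun u hu => le_of_sq_le_sq_ennreal ?_⟩
  have hz := Γ.Xn_chebInterp_subset hn hu
  obtain ⟨f, -, rfl⟩ := hu
  set u := chebInterp n f
  have hU : Γ.HasArcDeriv u (Γ.interpDeriv n f) := Γ.hasArcDeriv_chebInterp n f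
  have hu : AEEqArc u u := fun _ => EventuallyEq.rfl
  obtain ⟨H, hH, huH⟩ := exists_hasArcDeriv_cauchyMinus hU hu hz.2
  obtain ⟨W, w, hW, huW, hWB⟩ := exists_hasArcDeriv_opT hG hH huH
  have hn0 : ((n : ℝ≥0) ^ 4) ≠ 0 := pow_ne_zero _ (by exact_mod_cast (by omega : n ≠ 0))
  have hn1 : (1 : ℝ≥0∞) ≤ (n : ℝ≥0∞) ^ 4 := one_le_pow₀ (by exact_mod_cast (by omega : 1 ≤ n))
  have hnt : ((n : ℝ≥0∞) ^ 4) ≠ ⊤ := by finiteness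
  have hnz : ((n : ℝ≥0∞) ^ 4) ≠ 0 := by positivity
  have hHb : ∀ i p q, ∀ t ∈ Icc (-1 : ℝ) 1, ‖H i t p q‖ₑ ^ 2 ≤
      Γ.cauchyMinusNorm ^ 2 * ((2 * d + d ^ 3 * A) * (n : ℝ≥0∞) ^ 4 * Γ.l2Norm u ^ 2) := fun i p q t ht => by
    -- The choice `c = n⁴` balances `c ‖u‖²` against `c⁻¹ n⁸ ‖u‖²`; the square root of `n⁴` is the
    -- factor `n²`.
    refine (enorm_sq_cauchyMinus_le hU hu hH huH hn0 i p q ht).trans ?_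
    gcongr
    have e : (((n : ℝ≥0) ^ 4 : ℝ≥0) : ℝ≥0∞) = (n : ℝ≥0∞) ^ 4 := by push_cast; rfl
    rw [ENNReal.coe_inv hn0, e]
    calc _ ≤ ((n : ℝ≥0∞) ^ 4 + (n : ℝ≥0∞) ^ 4) * (d * Γ.l2Norm u ^ 2) +
          ((n : ℝ≥0∞) ^ 4)⁻¹ * (d ^ 2 * (d * (A * (n : ℝ≥0∞) ^ 8 * Γ.l2Norm u ^ 2))) := by
          gcongr
          exact hA n hn f
      _ = 2 * d * (n : ℝ≥0∞) ^ 4 * Γ.l2Norm u ^ 2 + (((n : ℝ≥0∞) ^ 4)⁻¹ * (n : ℝ≥0∞) ^ 4) *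
          (d ^ 3 * A * (n : ℝ≥0∞) ^ 4 * Γ.l2Norm u ^ 2) := by ring
      _ = _ := by
          rw [ENNReal.inv_mul_cancel hnz hnt]
          ring
  have hrep : ∀ i p q, ∀ t ∈ Icc (-1 : ℝ) 1, ‖contRep (Γ.opT G u) i t p q‖ₑ ^ 2 ≤
      4 * (Γ.cauchyMinusNorm ^ 2 * ((2 * d + d ^ 3 * A) * (n : ℝ≥0∞) ^ 4 * Γ.l2Norm u ^ 2)) *
        linfNorm (fun i t => G i t - 1) ^ 2 := fun i p q t ht => by
      rw [hW.contRep_eqOn huW i ht]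
      exact hWB _ hHb i p q t ht
  refine (Γ.l2Norm_chebInterp_sq_le hn hrep).trans ?_
  have hKK : (K : ℝ≥0∞) ≤ ((K + 1 : ℝ≥0) : ℝ≥0∞) ^ 2 := by
    have : K ≤ (K + 1) ^ 2 := by
      have h0 : 0 ≤ K := zero_le
      nlinarith
    exact_mod_cast this
  calc _ = K * (n : ℝ≥0∞) ^ 4 * Γ.gc G ^ 2 * Γ.l2Norm u ^ 2 := by
        rw [hK, gc]
        push_cast
        ring
    _ ≤ ((K + 1 : ℝ≥0) : ℝ≥0∞) ^ 2 * (n : ℝ≥0∞) ^ 4 * Γ.gc G ^ 2 * Γ.l2Norm u ^ 2 := by gcongr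
    _ = _ := by ring

end MobiusContour

/-! ### The type of the method -/

theorem MobiusContour.isOfType_of_hasInverseBound {ℓ : ℕ} (Γ : MobiusContour ℓ) {𝒢 : Set (ArcFun ℓ)}
    (h𝒢 : ∀ G ∈ 𝒢, Γ.MemW1inf G) {β : ℝ} (h : Γ.HasInverseBound chebInterp chebInterp 𝒢 β) :
    Γ.IsOfType chebInterp chebInterp 𝒢 0 β 2 := by
  obtain ⟨C₁, h₁⟩ := Γ.exists_opCn_le
  obtain ⟨C₂, h₂⟩ := h
  obtain ⟨C₃, h₃⟩ := Γ.exists_opTn_le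
  refine ⟨C₁, C₂, C₃, fun G hG hinv => ?_⟩
  obtain ⟨N, hN⟩ := h₂ G hG hinv
  -- The threshold is at least `1`, so that `n ≥ 2`, as the bounds for interpolation require.
  refine ⟨max N 1, fun n hn => ?_⟩
  have hn2 : 2 ≤ n := (le_max_right N 1).trans_lt hn
  refine ⟨?_, hN n ((le_max_left N 1).trans_lt hn), ?_⟩
  · simpa using h₁ G (h𝒢 G hG) n hn2
  · have e : ENNReal.ofReal ((n : ℝ) ^ (2 : ℝ)) = (n : ℝ≥0∞) ^ 2 := by
      rw [Real.rpow_two, ENNReal.ofReal_pow (Nat.cast_nonneg n), ENNReal.ofReal_natCast]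
    rw [e]
    exact h₃ G (h𝒢 G hG) n hn2

end

theorem mainTheorem12 {ℓ : ℕ} (Γ : MobiusContour ℓ) :
    -- the operators are well defined
    Γ.cauchyMinusNorm < ⊤ ∧
    (∀ n : ℕ, 2 ≤ n → Γ.Xn chebInterp n ⊆ Γ.Hz) ∧
    (∀ G : ArcFun ℓ, Γ.MemW1inf G → ∀ u ∈ Γ.Hz, Γ.MemH 1 (Γ.opT G u) ∧ Γ.MemH 1 (Γ.opC G u)) ∧
    -- uniform boundedness of the interpolation from `C(Γ)` to `L²(Γ)`
    (∃ C : ℝ≥0, ∀ n : ℕ, 2 ≤ n →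
      opNorm {f : ArcFun ℓ | IsContArc f} supNorm Γ.l2Norm (chebInterp n) ≤ C) ∧
    -- the bound for `𝓒ₙ[G;Γ]`
    (∃ C : ℝ≥0, ∀ G : ArcFun ℓ, Γ.MemW1inf G → ∀ n : ℕ, 2 ≤ n →
      opNorm Γ.Hz (Γ.hNorm 1) Γ.l2Norm (Γ.opCn chebInterp G n)
        ≤ C * (1 + linfNorm (fun i t => G i t - 1) * Γ.cauchyMinusNorm)) ∧
    -- the bound for `𝓣ₙ[G;Γ]`
    (∃ C : ℝ≥0, ∀ G : ArcFun ℓ, Γ.MemW1inf G → ∀ n : ℕ, 2 ≤ n →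
      opNorm (Γ.Xn chebInterp n) Γ.l2Norm Γ.l2Norm (Γ.opTn chebInterp G n)
        ≤ C * (n : ℝ≥0∞) ^ 2 * (linfNorm (fun i t => G i t - 1) * Γ.cauchyMinusNorm)) ∧
    -- the interpolation error
    (∀ s : ℕ, 1 ≤ s → ∃ C : ℝ≥0, ∀ n : ℕ, 2 ≤ n → ∀ u : ArcFun ℓ, Γ.MemH s u →
      Γ.hNorm 1 (chebInterp n u - u)
        ≤ C * ENNReal.ofReal ((n : ℝ) ^ (2 - (s : ℝ))) * Γ.hNorm s u) ∧
    -- with a bound on the inverses, the method is of type `(0, β, 2)`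
    (∀ 𝒢 : Set (ArcFun ℓ), (∀ G ∈ 𝒢, Γ.MemW1inf G) → ∀ β : ℝ,
      Γ.HasInverseBound chebInterp chebInterp 𝒢 β →
        Γ.IsOfType chebInterp chebInterp 𝒢 0 β 2) := by
  refine ⟨Γ.cauchyMinusNorm_lt_top, fun n hn => Γ.Xn_chebInterp_subset hn,
    fun G hG u hu => MobiusContour.memH_opT_opC hG hu, Γ.exists_opNorm_chebInterp_le, Γ.exists_opCn_le,
    Γ.exists_opTn_le, fun s hs => ?_, fun 𝒢 h𝒢 β h => Γ.isOfType_of_hasInverseBound h𝒢 h⟩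
  obtain ⟨C, hC⟩ := Γ.exists_chebInterp_sub_le hs
  exact ⟨C, fun n hn u _ => hC n hn u⟩
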